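/- Let $c_1,c_2$ be real numbers with $0<c_1<c_2\le 2$ and $c_1^{-1}-c_2^{-1}\le 1$, and put $m_1:=c_1^{-1}$. Let $c:\mathbb{R}\to\mathbb{R}$ be $(c_1,c_2)$-admissible, that is, $c_1<\inf_{\mathbb R} c\le\sup_{\mathbb R} c<c_2$ and at least one of the following holds: (C2) $c\in W^{N,\infty}(\mathbb{R})$ for some $N\in\mathbb{N}$ with $N>\tfrac32+c_1^{-1}$ and $N\ge 1+\lceil c_1^{-1}\rceil$; (C2') there are $c_0\in(c_1,c_2)$ and a real $s$ with $s>\tfrac32+c_1^{-1}$ and $s\ge 1+\lceil c_1^{-1}\rceil$ such that $c-c_0\in H^s(\mathbb{R})$ and $c^{-1}-c_0^{-1}\in H^s(\mathbb{R})$. With $\widehat f(\xi)=\int_{\mathbb R} e^{-2\pi i x\xi}f(x)\,dx$ and for a symbol $a(x,\xi)$, let $a(x,tD)f(x)=\int_{\mathbb{R}}e^{2\pi i x\xi}a(x,t\xi)\widehat f(\xi)\,d\xi$. Let $p(x,\xi)=(1+c(x)|\xi|)^{1/c(x)}$, let $p^{-1}(x,\xi)=1/p(x,\xi)$, and define, for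 Schwartz functions $f$, $$\mathfrak{C}_t(p,p^{-1})f:=p(x,tD)\,p^{-1}(x,tD)f-(p\,p^{-1})(x,tD)f=p(x,tD)\,p^{-1}(x,tD)f-f .$$ For $\sigma\in\mathbb{R}$ and $t\in(0,1]$ let $H^{\sigma}_t(\mathbb{R})$ be the space of tempered distributions $f$ with $(1+it\xi)^{\sigma}\widehat f(\xi)\in L^2(\mathbb{R})$, with norm $\|f\|_{H^\sigma_t}=\|(1+it\xi)^{\sigma}\widehat f\|_{L^2}$; $H^\sigma=H^\sigma_1$. Then there is a constant $C_1>0$ such that for every real $m$ with $0\le m\le\lceil m_1\rceil$ and every $t\in(0,1]$: all the integrals in $p(x,tD)\,p^{-1}(x,tD)f$ converge absolutely for every Schwartz function $f$, and $\mathfrak{C}_t(p,p^{-1})$ extends uniquely from the Schwartz functions to a bounded linear operator on $H^{-m}_t(\mathbb{R})$, with $$\|\mathfrak{C}_t(p,p^{-1})\|_{\mathcal{L}(H^{-m}_t,H^{-m}_t)}\le t\,C_1 .$$ -/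

import Mathlib

open MeasureTheory FourierTransform Complex
open scoped SchwartzMap ContDiff

noncomputable section

/-! ### Admissible opening speeds -/

/-- The conditions on the pair `(c₁, c₂)`: `0 < c₁ < c₂ ≤ 2` and `1 / c₁ - 1 / c₂ ≤ 1`. -/
def AdmissiblePair (c₁ c₂ : ℝ) : Prop :=
  0 < c₁ ∧ c₁ < c₂ ∧ c₂ ≤ 2 ∧ c₁⁻¹ - c₂⁻¹ ≤ 1

/-- `g'` is the weak (distributional) derivative of `g` on the real line. Only used for locally
integrable `g` and `g'`. -/
def IsWeakDeriv (g g' : ℝ → ℝ) : Prop :=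
  ∀ φ : ℝ → ℝ, ContDiff ℝ ∞ φ → HasCompactSupport φ →
    ∫ x, g x * deriv φ x = -∫ x, g' x * φ x

/-- The Sobolev space `W^{N,∞}(ℝ)`: the weak derivatives up to order `N` are bounded. -/
def MemSobolevInfty (N : ℕ) (c : ℝ → ℝ) : Prop :=
  ∃ g : ℕ → ℝ → ℝ, g 0 = c ∧ (∀ k ≤ N, MemLp (g k) ⊤ volume) ∧
    ∀ k < N, IsWeakDeriv (g k) (g (k + 1))

/-- The tempered distribution `u` is (integration against) the function `h`. -/
def IsRepresentedBy (u : 𝓢'(ℝ, ℂ)) (h : ℝ → ℂ) : Prop :=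
  (∀ φ : 𝓢(ℝ, ℂ), Integrable fun x ↦ φ x * h x) ∧ ∀ φ : 𝓢(ℝ, ℂ), u φ = ∫ x, φ x * h x

/-- The weight `(1 + i t ξ)^s`. -/
def scWeight (t s ξ : ℝ) : ℂ := (1 + I * (t * ξ : ℝ)) ^ (s : ℂ)

/-- `f` belongs to `H^s_t(ℝ)`, that is `(1 + i t ξ)^s f̂(ξ) ∈ L²(ℝ)`. -/
def MemScSobolev (t s : ℝ) (f : 𝓢'(ℝ, ℂ)) : Prop :=
  ∃ F : ℝ → ℂ, IsRepresentedBy (𝓕 f) F ∧ MemLp (fun ξ ↦ scWeight t s ξ * F ξ) 2 volume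

/-- A real function belongs to `H^s(ℝ) = H^s_1(ℝ)`. -/
def MemSobolevTwo (s : ℝ) (v : ℝ → ℝ) : Prop :=
  ∃ u : 𝓢'(ℝ, ℂ), IsRepresentedBy u (fun x ↦ (v x : ℂ)) ∧ MemScSobolev 1 s u

/-- Condition (C1): `c₁ < inf c ≤ sup c < c₂`. -/
def ConditionC1 (c₁ c₂ : ℝ) (c : ℝ → ℝ) : Prop :=
  BddBelow (Set.range c) ∧ BddAbove (Set.range c) ∧ c₁ < ⨅ x, c x ∧ ⨆ x, c x < c₂

/-- Condition (C2). -/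
def ConditionC2 (c₁ : ℝ) (c : ℝ → ℝ) : Prop :=
  ∃ N : ℕ, 3 / 2 + c₁⁻¹ < (N : ℝ) ∧ 1 + ⌈c₁⁻¹⌉₊ ≤ N ∧ MemSobolevInfty N c

/-- Condition (C2'). -/
def ConditionC2' (c₁ c₂ : ℝ) (c : ℝ → ℝ) : Prop :=
  ∃ c₀ s : ℝ, c₁ < c₀ ∧ c₀ < c₂ ∧ 3 / 2 + c₁⁻¹ < s ∧ 1 + (⌈c₁⁻¹⌉₊ : ℝ) ≤ s ∧
    MemSobolevTwo s (fun x ↦ c x - c₀) ∧ MemSobolevTwo s (fun x ↦ (c x)⁻¹ - c₀⁻¹)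

/-- `c` is `(c₁, c₂)`-admissible. -/
def Admissible (c₁ c₂ : ℝ) (c : ℝ → ℝ) : Prop :=
  ConditionC1 c₁ c₂ c ∧ (ConditionC2 c₁ c ∨ ConditionC2' c₁ c₂ c)

/-! ### Symbols and semiclassical quantization -/

/-- The symbol `p(x, ξ) = (1 + c(x) |ξ|)^{1 / c(x)}`. -/
def symbolP (c : ℝ → ℝ) (x ξ : ℝ) : ℂ := (((1 + c x * |ξ|) ^ (1 / c x) : ℝ) : ℂ)

/-- The symbol `p^{-1}(x, ξ) = 1 / p(x, ξ)`. -/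
def symbolPInv (c : ℝ → ℝ) (x ξ : ℝ) : ℂ := (symbolP c x ξ)⁻¹

/-- The integrand `e^{2π i x ξ} a(x, t ξ) f̂(ξ)` of the semiclassical quantization. -/
def scQuantIntegrand (a : ℝ → ℝ → ℂ) (t : ℝ) (f : ℝ → ℂ) (x ξ : ℝ) : ℂ :=
  exp (2 * Real.pi * I * x * ξ) * a x (t * ξ) * 𝓕 f ξ

/-- The semiclassical quantization `a(x, tD) f (x) = ∫ e^{2π i x ξ} a(x, t ξ) f̂(ξ) dξ`. -/
def scQuant (a : ℝ → ℝ → ℂ) (t : ℝ) (f : ℝ → ℂ) (x : ℝ) : ℂ :=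
  ∫ ξ, scQuantIntegrand a t f x ξ

/-- All integrals in the definition of `a(x, tD) f` (the Fourier transform of `f` included)
converge absolutely. -/
def ScQuantConverges (a : ℝ → ℝ → ℂ) (t : ℝ) (f : ℝ → ℂ) : Prop :=
  Integrable f ∧ ∀ x, Integrable (scQuantIntegrand a t f x)

/-- The composition remainder `p₁(x, tD) p₂(x, tD) - (p₁ p₂)(x, tD)`. -/
def compRemainder (t : ℝ) (p₁ p₂ : ℝ → ℝ → ℂ) (f : ℝ → ℂ) (x : ℝ) : ℂ :=
  scQuant p₁ t (scQuant p₂ t f) x - scQuant (fun y ξ ↦ p₁ y ξ * p₂ y ξ) t f x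

/-- The symbol `1` is quantized as the identity. -/
theorem scQuant_one (t : ℝ) (f : 𝓢(ℝ, ℂ)) (x : ℝ) :
    scQuant (fun _ _ ↦ 1) t f x = f x := by
  have h : 𝓕⁻ (𝓕 (f : ℝ → ℂ)) x = f x := by
    rw [← SchwartzMap.fourier_coe, ← SchwartzMap.fourierInv_coe, fourierInv_fourier_eq]
  rw [← h, Real.fourierInv_eq']
  refine integral_congr_ae (Filter.Eventually.of_forall fun ξ ↦ ?_)
  simp only [scQuantIntegrand, smul_eq_mul, mul_one]
  congr 2
  simp
  ring

/-- For `p = p(x, ξ)` the remainder is `p(x, tD) p^{-1}(x, tD) - I`. -/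
theorem compRemainder_symbolP {c₁ c₂ : ℝ} {c : ℝ → ℝ} (h₁ : 0 < c₁) (hc : ConditionC1 c₁ c₂ c)
    (t : ℝ) (f : 𝓢(ℝ, ℂ)) (x : ℝ) :
    compRemainder t (symbolP c) (symbolPInv c) f x =
      scQuant (symbolP c) t (scQuant (symbolPInv c) t f) x - f x := by
  have h : (fun y ξ ↦ symbolP c y ξ * symbolPInv c y ξ) = fun _ _ ↦ 1 := by
    funext y ξ
    refine mul_inv_cancel₀ ?_
    have hy : 0 < c y := h₁.trans (hc.2.2.1.trans_le (ciInf_le hc.1 y))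
    unfold symbolP
    exact_mod_cast (Real.rpow_pos_of_pos (by positivity) _).ne'
  rw [compRemainder, h, scQuant_one]

/-! ### The semiclassical Sobolev spaces `H^s_t(ℝ)` as normed spaces -/

theorem scWeight_base_ne_zero (t ξ : ℝ) : (1 + I * (t * ξ : ℝ) : ℂ) ≠ 0 := by
  intro h
  simpa using congrArg Complex.re h

theorem scWeight_ne_zero (t s ξ : ℝ) : scWeight t s ξ ≠ 0 := by
  rw [scWeight, Ne, cpow_eq_zero_iff]
  exact fun h ↦ scWeight_base_ne_zero t ξ h.1

theorem norm_scWeight (t s ξ : ℝ) : ‖scWeight t s ξ‖ = (1 + ‖t * ξ‖ ^ 2) ^ (s / 2) := by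
  have h : ‖(1 + I * (t * ξ : ℝ) : ℂ)‖ = (1 + ‖t * ξ‖ ^ 2) ^ (1 / 2 : ℝ) := by
    rw [← Real.sqrt_eq_rpow, Complex.norm_eq_sqrt_sq_add_sq]
    simp [mul_pow]
  rw [scWeight, norm_cpow_of_ne_zero (scWeight_base_ne_zero t ξ), h]
  simp only [ofReal_re, ofReal_im, mul_zero, Real.exp_zero, div_one]
  rw [← Real.rpow_mul (by positivity)]
  congr 1
  ring

theorem measurable_scWeight (t s : ℝ) : Measurable (scWeight t s) := by
  unfold scWeight
  fun_prop

theorem IsRepresentedBy.add {u v : 𝓢'(ℝ, ℂ)} {g h : ℝ → ℂ} (hu : IsRepresentedBy u g)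
    (hv : IsRepresentedBy v h) : IsRepresentedBy (u + v) (g + h) := by
  refine ⟨fun φ ↦ ?_, fun φ ↦ ?_⟩
  · have e : (fun x ↦ φ x * (g + h) x) = (fun x ↦ φ x * g x) + fun x ↦ φ x * h x := by
      funext x
      simp [mul_add]
    rw [e]
    exact (hu.1 φ).add (hv.1 φ)
  · have : (u + v) φ = u φ + v φ := rfl
    rw [this, hu.2 φ, hv.2 φ, ← integral_add (hu.1 φ) (hv.1 φ)]
    simp [mul_add]

theorem IsRepresentedBy.smul {u : 𝓢'(ℝ, ℂ)} {g : ℝ → ℂ} (a : ℂ) (hu : IsRepresentedBy u g) :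
    IsRepresentedBy (a • u) (a • g) := by
  refine ⟨fun φ ↦ ?_, fun φ ↦ ?_⟩
  · simpa [mul_left_comm] using (hu.1 φ).const_mul a
  · have : (a • u) φ = a * u φ := rfl
    rw [this, hu.2 φ, ← integral_const_mul]
    simp [mul_left_comm]

theorem IsRepresentedBy.zero : IsRepresentedBy (0 : 𝓢'(ℝ, ℂ)) 0 := by
  refine ⟨fun φ ↦ by simp, fun φ ↦ ?_⟩
  have : (0 : 𝓢'(ℝ, ℂ)) φ = 0 := rfl
  simp [this]

/-- The space `H^s_t(ℝ)` as a linear subspace of the tempered distributions. -/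
def scSobolevSubmodule (t s : ℝ) : Submodule ℂ 𝓢'(ℝ, ℂ) where
  carrier := {f | MemScSobolev t s f}
  add_mem' := by
    rintro f g ⟨F, hF, hF'⟩ ⟨G, hG, hG'⟩
    refine ⟨F + G, ?_, ?_⟩
    · rw [FourierAdd.fourier_add]
      exact hF.add hG
    · have e : (fun ξ ↦ scWeight t s ξ * (F + G) ξ) =
          (fun ξ ↦ scWeight t s ξ * F ξ) + fun ξ ↦ scWeight t s ξ * G ξ := by
        funext ξ
        simp [mul_add]
      rw [e]
      exact hF'.add hG'
  zero_mem' := by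
    refine ⟨0, ?_, by simp⟩
    rw [← fourierCLM_apply (R := ℂ), map_zero]
    exact IsRepresentedBy.zero
  smul_mem' := by
    rintro a f ⟨F, hF, hF'⟩
    refine ⟨a • F, ?_, ?_⟩
    · rw [fourier_smul]
      exact hF.smul a
    · simpa [mul_left_comm] using hF'.const_mul a

/-- The space `H^s_t(ℝ)`, with the norm `‖f‖ = ‖(1 + i t ξ)^s f̂‖_{L²}` defined below. -/
def ScSobolev (t s : ℝ) : Type := scSobolevSubmodule t s

instance (t s : ℝ) : AddCommGroup (ScSobolev t s) :=
  inferInstanceAs (AddCommGroup (scSobolevSubmodule t s))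

instance (t s : ℝ) : Module ℂ (ScSobolev t s) :=
  inferInstanceAs (Module ℂ (scSobolevSubmodule t s))

/-- The distribution underlying an element of `H^s_t(ℝ)`. -/
def ScSobolev.toDistribution {t s : ℝ} (f : ScSobolev t s) : 𝓢'(ℝ, ℂ) := Subtype.val f

/-- The function `f̂`. -/
def ScSobolev.hat {t s : ℝ} (f : ScSobolev t s) : ℝ → ℂ := Classical.choose (Subtype.prop f)

theorem ScSobolev.hat_spec {t s : ℝ} (f : ScSobolev t s) :
    IsRepresentedBy (𝓕 f.toDistribution) f.hat ∧
      MemLp (fun ξ ↦ scWeight t s ξ * f.hat ξ) 2 volume :=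
  Classical.choose_spec (Subtype.prop f)

theorem IsRepresentedBy.ae_unique {u : 𝓢'(ℝ, ℂ)} {g h : ℝ → ℂ} (hg : IsRepresentedBy u g)
    (hh : IsRepresentedBy u h) : g =ᵐ[volume] h := by
  have key : ∀ k : ℝ → ℂ, IsRepresentedBy u k → LocallyIntegrable k volume := by
    intro k hk
    rw [locallyIntegrable_iff]
    intro K hK
    obtain ⟨φ, hφ1, hφ0, hφs, hφd, -⟩ :
        ∃ φ : ℝ → ℝ, (∀ x ∈ K, φ x = 1) ∧ True ∧ HasCompactSupport φ ∧ ContDiff ℝ ∞ φ ∧ True := by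
      obtain ⟨R, hR⟩ := hK.isBounded.subset_closedBall 0
      let b : ContDiffBump (0 : ℝ) := ⟨max R 1, max R 1 + 1, by positivity, by linarith⟩
      exact ⟨b, fun x hx ↦ b.one_of_mem_closedBall
        (Metric.closedBall_subset_closedBall (le_max_left _ _) (hR hx)), trivial,
        b.hasCompactSupport, b.contDiff, trivial⟩
    have hc : HasCompactSupport (Complex.ofRealCLM ∘ φ) := hφs.comp_left rfl
    have hd : ContDiff ℝ ∞ (Complex.ofRealCLM ∘ φ) := by fun_prop
    refine ((hk.1 (hc.toSchwartzMap hd)).integrableOn (s := K)).congr_fun ?_ hK.measurableSet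
    intro x hx
    simp [hφ1 x hx]
  have hl : LocallyIntegrable (g - h) volume := (key g hg).sub (key h hh)
  have h0 : ∀ᵐ x ∂volume, (g - h) x = 0 := by
    refine ae_eq_zero_of_integral_contDiff_smul_eq_zero hl fun φ hφ hφc ↦ ?_
    have hc : HasCompactSupport (Complex.ofRealCLM ∘ φ) := hφc.comp_left rfl
    have hd : ContDiff ℝ ∞ (Complex.ofRealCLM ∘ φ) := by fun_prop
    have e := (hg.2 (hc.toSchwartzMap hd)).symm.trans (hh.2 (hc.toSchwartzMap hd))
    rw [← sub_eq_zero, ← integral_sub (hg.1 _) (hh.1 _)] at e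
    rw [← e]
    congr 1
    funext x
    simp [mul_sub]
  filter_upwards [h0] with x hx
  simpa [sub_eq_zero] using hx

/-- The linear injection `f ↦ (1 + i t ξ)^s f̂` of `H^s_t(ℝ)` into `L²(ℝ)`. -/
def ScSobolev.toL2 (t s : ℝ) : ScSobolev t s →ₗ[ℂ] Lp ℂ 2 (volume : Measure ℝ) where
  toFun f := f.hat_spec.2.toLp _
  map_add' f g := by
    rw [← MemLp.toLp_add, MemLp.toLp_eq_toLp_iff]
    have h := (f + g).hat_spec.1
    have e : 𝓕 (f + g).toDistribution = 𝓕 f.toDistribution + 𝓕 g.toDistribution :=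
      FourierAdd.fourier_add _ _
    rw [e] at h
    filter_upwards [h.ae_unique (f.hat_spec.1.add g.hat_spec.1)] with ξ hξ
    simp [hξ, mul_add]
  map_smul' a f := by
    rw [RingHom.id_apply, ← MemLp.toLp_const_smul, MemLp.toLp_eq_toLp_iff]
    have h := (a • f).hat_spec.1
    have e : 𝓕 (a • f).toDistribution = a • 𝓕 f.toDistribution := fourier_smul _ _
    rw [e] at h
    filter_upwards [h.ae_unique (f.hat_spec.1.smul a)] with ξ hξ
    simp [hξ, mul_left_comm]

theorem ScSobolev.toL2_injective (t s : ℝ) : Function.Injective (ScSobolev.toL2 t s) := by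
  rw [injective_iff_map_eq_zero]
  intro f hf
  have h0 : f.hat =ᵐ[volume] 0 := by
    have h : (ScSobolev.toL2 t s f : ℝ → ℂ) =ᵐ[volume] 0 := Lp.eq_zero_iff_ae_eq_zero.1 hf
    have h' : (ScSobolev.toL2 t s f : ℝ → ℂ) =ᵐ[volume] fun ξ ↦ scWeight t s ξ * f.hat ξ :=
      f.hat_spec.2.coeFn_toLp
    filter_upwards [h, h'] with ξ h₁ h₂
    rw [h₁] at h₂
    simpa [scWeight_ne_zero] using h₂.symm
  have h1 : 𝓕 f.toDistribution = 0 := by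
    ext φ
    rw [f.hat_spec.1.2 φ]
    have : (0 : 𝓢'(ℝ, ℂ)) φ = 0 := rfl
    rw [this]
    refine integral_eq_zero_of_ae ?_
    filter_upwards [h0] with x hx
    simp [hx]
  have h2 : f.toDistribution = 0 := by
    rw [← fourierInv_fourier_eq (F := 𝓢'(ℝ, ℂ)) f.toDistribution, h1,
      ← fourierInvCLM_apply (R := ℂ), map_zero]
  exact Subtype.ext h2

instance (t s : ℝ) : NormedAddCommGroup (ScSobolev t s) :=
  NormedAddCommGroup.induced _ _ (ScSobolev.toL2 t s) (ScSobolev.toL2_injective t s)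

instance (t s : ℝ) : NormedSpace ℂ (ScSobolev t s) :=
  NormedSpace.induced ℂ _ _ (ScSobolev.toL2 t s)

/-- Schwartz functions belong to `H^s_t(ℝ)`. -/
theorem SchwartzMap.memScSobolev (t s : ℝ) (f : 𝓢(ℝ, ℂ)) : MemScSobolev t s (f : 𝓢'(ℝ, ℂ)) := by
  have hw : Function.HasTemperateGrowth fun ξ : ℝ ↦ (((1 + ‖t * ξ‖ ^ 2) ^ (s / 2) : ℝ) : ℂ) := by
    have h₁ : Function.HasTemperateGrowth fun ξ : ℝ ↦ (1 + ‖ξ‖ ^ 2) ^ (s / 2) :=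
      Function.hasTemperateGrowth_one_add_norm_sq_rpow ℝ (s / 2)
    have h₂ : Function.HasTemperateGrowth fun ξ : ℝ ↦ t * ξ := by fun_prop
    have h₃ : Function.HasTemperateGrowth fun ξ : ℝ ↦ (1 + ‖t * ξ‖ ^ 2) ^ (s / 2) := h₁.comp h₂
    fun_prop
  refine ⟨fun ξ ↦ (𝓕 f) ξ, ⟨fun φ ↦ ?_, fun φ ↦ ?_⟩, ?_⟩
  · exact (SchwartzMap.pairing (ContinuousLinearMap.mul ℂ ℂ) φ (𝓕 f)).integrable
  · rw [TemperedDistribution.fourier_toTemperedDistributionCLM_eq, SchwartzMap.coe_apply]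
    rfl
  · refine (SchwartzMap.memLp (SchwartzMap.smulLeftCLM ℂ
      (fun ξ : ℝ ↦ (((1 + ‖t * ξ‖ ^ 2) ^ (s / 2) : ℝ) : ℂ)) (𝓕 f)) 2 volume).of_le
      ((measurable_scWeight t s).mul (𝓕 f).continuous.measurable).aestronglyMeasurable
      (Filter.Eventually.of_forall fun ξ ↦ ?_)
    rw [SchwartzMap.smulLeftCLM_apply_apply hw, norm_mul, norm_smul, norm_scWeight, norm_real,
      Real.norm_of_nonneg (Real.rpow_nonneg (by positivity) _)]

/-- The inclusion of the Schwartz functions in `H^s_t(ℝ)`. -/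
def ScSobolev.ofSchwartz (t s : ℝ) (f : 𝓢(ℝ, ℂ)) : ScSobolev t s :=
  ⟨(f : 𝓢'(ℝ, ℂ)), f.memScSobolev t s⟩

end

/-! Separation of variables. Let `z₀` be the midpoint of `(c₁, c₂)` and `u = c - z₀`, so that `|u| ≤
ρ < κ < R < (c₂ - c₁) / 2`. For fixed `λ` the functions `(1 + zλ)^{±1/z}` are holomorphic in `z` on
the disc of radius `R` about `z₀`. Hence `p = ∑ u(x)^k a_k(|ξ|)` and `p⁻¹ = ∑ u(x)^l b_l(|ξ|)`,
where `a_k` and `b_l` are `R^{-k}` and `R^{-l}` times symbols of order `α` and `-β`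
(`exists_symbolExpansion`). If `T` denotes multiplication by `u` seen on the frequency side, the
remainder becomes `∑ T^k [a_k(t|ξ|), T^l] b_l(t|ξ|) f̂`, and it suffices to bound each commutator by
`t κ^l R^{-k}`, up to a fixed constant, in the weighted norms: the double series is then geometric
with ratio `κ / R`.

Powers of `T`. A submultiplicative norm built from finite differences, `diffNorm`, is at most `κ` at
`u`. So `T^l` has, with constant `K κ^l`, three properties: it is bounded, its commutator with
`e^{2πihξ}` is `O(h)`, and between non-adjacent dyadic shells `i`, `k` it decays like `2^{min i k}
2^{-(M+1) max i k}`, where `M = ⌈c₁⁻¹⌉` (`exists_regOp_pow`). This consumes `M + 1` derivatives of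
`c`.

The commutator. Between neighbouring shells at frequency `2^q` a Taylor expansion of the holomorphic
symbol about the centre of the shells reduces to the commutator with `ξ`, which is bounded; this
gains `2^{-q}` over the size of the symbol (`norm_commBlock_shell_le`). Between distant shells the
decay of `T^l` is used. Since `a_k(z) - a_k(0) = O(|z| (1 + |z|)^{α-1})` and `z = t|ξ|`, both cases
produce the factor `t`. A Schur test with weights `(1 + t 2^i)^{-m}` adds the blocks
(`dyadSq_comm_le`): the off-diagonal decay pays for weights of order `m ≤ M`, and `α - β < 1`, which
comes from `c₁⁻¹ - c₂⁻¹ ≤ 1`, leaves a geometric factor (`theta_weight_far`).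

Finally the iterated integrals are shown to converge and to be given by this series
(`SpeedExpansion.scQuant_symbolPInv`, `SpeedExpansion.compRemainder_ae`), and the operator is
extended by density (`existsUnique_extension`). -/

noncomputable section

namespace ScComm

/-! ### Multiplication operators on both sides of the Fourier transform, and dyadic shells. -/

section

open scoped ENNReal

/-- The Hilbert space `L²(ℝ)`. -/
abbrev L2 : Type := Lp ℂ 2 (volume : Measure ℝ)

/-- Essentially bounded measurable functions on the line. -/
abbrev Bdd (a : ℝ → ℂ) : Prop := MemLp a ⊤ (volume : Measure ℝ)

open Classical in
/-- Multiplication by a bounded function, as an operator on `L²(ℝ)` (zero for other functions). -/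
def mulL (a : ℝ → ℂ) : L2 →L[ℂ] L2 :=
  if h : Bdd a then (ContinuousLinearMap.mul ℂ ℂ).holderL volume ⊤ 2 2 (h.toLp a) else 0

theorem coeFn_mulL {a : ℝ → ℂ} (ha : Bdd a) (f : L2) :
    (mulL a f : ℝ → ℂ) =ᵐ[volume] fun x ↦ a x * f x := by
  rw [mulL, dif_pos ha]
  have h := (ContinuousLinearMap.mul ℂ ℂ).coeFn_holder (r := 2) (ha.toLp a) f
  filter_upwards [h, ha.coeFn_toLp] with x h1 h2
  rw [← h2]
  exact h1

theorem bdd_of_bound {a : ℝ → ℂ} (ha : AEStronglyMeasurable a volume) {K : ℝ}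
    (h : ∀ᵐ x, ‖a x‖ ≤ K) : Bdd a := memLp_top_of_bound ha K h

theorem mulL_eq_of_ae {a : ℝ → ℂ} (ha : Bdd a) {f g : L2}
    (h : (g : ℝ → ℂ) =ᵐ[volume] fun x ↦ a x * f x) : mulL a f = g :=
  Lp.ext ((coeFn_mulL ha f).trans h.symm)

theorem norm_le_of_ae_le {f g : L2} {K : ℝ}
    (h : ∀ᵐ x, ‖(f : ℝ → ℂ) x‖ ≤ K * ‖(g : ℝ → ℂ) x‖) : ‖f‖ ≤ K * ‖g‖ :=
  Lp.norm_le_mul_norm_of_ae_le_mul h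

theorem norm_mulL_le {a : ℝ → ℂ} {K : ℝ} (hK : 0 ≤ K) (h : ∀ᵐ x, ‖a x‖ ≤ K) :
    ‖mulL a‖ ≤ K := by
  by_cases ha : Bdd a
  · refine ContinuousLinearMap.opNorm_le_bound _ hK fun f ↦ norm_le_of_ae_le ?_
    filter_upwards [coeFn_mulL ha f, h] with x h1 h2
    rw [h1, norm_mul]
    gcongr
  · rw [mulL, dif_neg ha]
    simpa using hK

theorem Bdd.mul {a b : ℝ → ℂ} (ha : Bdd a) (hb : Bdd b) : Bdd (fun x ↦ a x * b x) := by
  have := MemLp.mul (p := ⊤) (q := ⊤) (r := ⊤) hb ha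
  exact this

theorem Bdd.sub {a b : ℝ → ℂ} (ha : Bdd a) (hb : Bdd b) : Bdd (fun x ↦ a x - b x) := MemLp.sub ha hb

theorem Bdd.add {a b : ℝ → ℂ} (ha : Bdd a) (hb : Bdd b) : Bdd (fun x ↦ a x + b x) := MemLp.add ha hb

theorem bdd_const (k : ℂ) : Bdd (fun _ ↦ k) :=
  bdd_of_bound aestronglyMeasurable_const (K := ‖k‖) (by simp)

theorem Bdd.pow {a : ℝ → ℂ} (ha : Bdd a) (n : ℕ) : Bdd (fun x ↦ a x ^ n) := by
  induction n with
  | zero => simpa using bdd_const 1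
  | succ n ih => simpa only [pow_succ] using ih.mul ha

theorem mulL_mul {a b : ℝ → ℂ} (ha : Bdd a) (hb : Bdd b) :
    mulL (fun x ↦ a x * b x) = mulL a * mulL b := by
  ext1 f
  refine mulL_eq_of_ae (ha.mul hb) ?_
  filter_upwards [coeFn_mulL ha (mulL b f), coeFn_mulL hb f] with x h1 h2
  rw [mul_apply_eq_comp, h1, h2, mul_assoc]

theorem mulL_sub {a b : ℝ → ℂ} (ha : Bdd a) (hb : Bdd b) :
    mulL (fun x ↦ a x - b x) = mulL a - mulL b := by
  ext1 f
  refine mulL_eq_of_ae (ha.sub hb) ?_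
  rw [sub_apply]
  filter_upwards [coeFn_mulL ha f, coeFn_mulL hb f, Lp.coeFn_sub (mulL a f) (mulL b f)]
    with x h1 h2 h3
  rw [h3, Pi.sub_apply, h1, h2, sub_mul]

theorem mulL_add {a b : ℝ → ℂ} (ha : Bdd a) (hb : Bdd b) :
    mulL (fun x ↦ a x + b x) = mulL a + mulL b := by
  ext1 f
  refine mulL_eq_of_ae (ha.add hb) ?_
  rw [add_apply]
  filter_upwards [coeFn_mulL ha f, coeFn_mulL hb f, Lp.coeFn_add (mulL a f) (mulL b f)]
    with x h1 h2 h3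
  rw [h3, Pi.add_apply, h1, h2, add_mul]

theorem mulL_const (k : ℂ) : mulL (fun _ ↦ k) = k • (1 : L2 →L[ℂ] L2) := by
  ext1 f
  refine mulL_eq_of_ae (bdd_const k) ?_
  exact Lp.coeFn_smul k f

theorem mulL_one : mulL (fun _ ↦ 1) = 1 := by rw [mulL_const, one_smul]

theorem mulL_comm (a b : ℝ → ℂ) : mulL a * mulL b = mulL b * mulL a := by
  by_cases ha : Bdd a
  · by_cases hb : Bdd b
    · rw [← mulL_mul ha hb, ← mulL_mul hb ha]
      simp_rw [mul_comm]
    · simp [show mulL b = 0 from dif_neg hb]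
  · simp [show mulL a = 0 from dif_neg ha]

/-- The operator of multiplication by `w`, seen on the frequency side. -/
def conjF (w : ℝ → ℂ) : L2 →L[ℂ] L2 :=
  ((Lp.fourierTransformₗᵢ ℝ ℂ : L2 ≃ₗᵢ[ℂ] L2) : L2 →L[ℂ] L2) ∘L mulL w ∘L
    ((Lp.fourierTransformₗᵢ ℝ ℂ : L2 ≃ₗᵢ[ℂ] L2).symm : L2 →L[ℂ] L2)

theorem conjF_apply (w : ℝ → ℂ) (f : L2) : conjF w f = 𝓕 (mulL w (𝓕⁻ f : L2)) := rfl

theorem norm_fourierInv (f : L2) : ‖(𝓕⁻ f : L2)‖ = ‖f‖ :=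
  (Lp.fourierTransformₗᵢ ℝ ℂ : L2 ≃ₗᵢ[ℂ] L2).symm.norm_map f

theorem fourierInv_conjF (w : ℝ → ℂ) (f : L2) : (𝓕⁻ (conjF w f) : L2) = mulL w (𝓕⁻ f : L2) := by
  rw [conjF_apply, fourierInv_fourier_eq]

theorem norm_conjF_le {w : ℝ → ℂ} {K : ℝ} (hK : 0 ≤ K) (h : ∀ᵐ x, ‖w x‖ ≤ K) : ‖conjF w‖ ≤ K := by
  refine ContinuousLinearMap.opNorm_le_bound _ hK fun f ↦ ?_
  rw [conjF_apply, Lp.norm_fourier_eq, ← norm_fourierInv f]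
  exact (mulL w).le_of_opNorm_le (norm_mulL_le hK h) _

theorem conjF_mul {a b : ℝ → ℂ} (ha : Bdd a) (hb : Bdd b) :
    conjF (fun x ↦ a x * b x) = conjF a * conjF b := by
  ext1 f
  rw [mul_apply_eq_comp, conjF_apply a, fourierInv_conjF, conjF_apply, mulL_mul ha hb]
  rfl

theorem conjF_sub {a b : ℝ → ℂ} (ha : Bdd a) (hb : Bdd b) :
    conjF (fun x ↦ a x - b x) = conjF a - conjF b := by
  rw [conjF, mulL_sub ha hb]
  ext1 f
  simp [conjF]

theorem conjF_add {a b : ℝ → ℂ} (ha : Bdd a) (hb : Bdd b) :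
    conjF (fun x ↦ a x + b x) = conjF a + conjF b := by
  rw [conjF, mulL_add ha hb]
  ext1 f
  simp [conjF]

theorem conjF_one : conjF (fun _ ↦ 1) = 1 := by
  ext1 f
  rw [conjF_apply, mulL_one, one_apply_eq_self, fourier_fourierInv_eq]
  rfl

theorem conjF_pow {w : ℝ → ℂ} (hw : Bdd w) (n : ℕ) : conjF (fun x ↦ w x ^ n) = conjF w ^ n := by
  induction n with
  | zero => simpa using conjF_one
  | succ n ih => rw [pow_succ, ← ih, ← conjF_mul (hw.pow n) hw]; simp_rw [pow_succ]

theorem conjF_comm (a b : ℝ → ℂ) : conjF a * conjF b = conjF b * conjF a := by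
  ext1 f
  simp only [mul_apply_eq_comp]
  rw [conjF_apply a, fourierInv_conjF, conjF_apply b, fourierInv_conjF]
  exact congrArg _ (DFunLike.congr_fun (mulL_comm a b) _)

/-! ### The Fourier transform on `L¹ ∩ L²` -/

/-- The `L²` transform and the integral are compared as distributions: paired with a smooth
compactly supported function, each moves the transform onto the test function. -/
theorem fourier_toLp {f : ℝ → ℂ} (h1 : Integrable f) (h2 : MemLp f 2) :
    ((𝓕 (h2.toLp f) : L2) : ℝ → ℂ) =ᵐ[volume] 𝓕 f := by
  have hl : LocallyIntegrable (𝓕 f) volume :=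
    (VectorFourier.fourierIntegral_continuous Real.continuous_fourierChar
      (by fun_prop : Continuous fun p : ℝ × ℝ ↦ (innerₗ ℝ) p.1 p.2) h1).locallyIntegrable
  have hl2 : LocallyIntegrable ((𝓕 (h2.toLp f) : L2) : ℝ → ℂ) volume :=
    (Lp.memLp _).locallyIntegrable (by norm_num)
  have h0 : ∀ᵐ x ∂volume, (((𝓕 (h2.toLp f) : L2) : ℝ → ℂ) - 𝓕 f) x = 0 := by
    refine ae_eq_zero_of_integral_contDiff_smul_eq_zero (hl2.sub hl) fun φ hφ hφc ↦ ?_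
    have hc : HasCompactSupport (Complex.ofRealCLM ∘ φ) := hφc.comp_left rfl
    have hd : ContDiff ℝ ∞ (Complex.ofRealCLM ∘ φ) := by fun_prop
    set ψ : 𝓢(ℝ, ℂ) := hc.toSchwartzMap hd with hψ
    have hψφ : ∀ x, ψ x = φ x := fun x ↦ rfl
    have e1 := DFunLike.congr_fun (Lp.fourier_toTemperedDistribution_eq (h2.toLp f)) ψ
    rw [TemperedDistribution.fourier_apply, Lp.toTemperedDistribution_apply,
      Lp.toTemperedDistribution_apply] at e1
    have e2 : ∫ x, (𝓕 ψ) x • (h2.toLp f : ℝ → ℂ) x = ∫ x, (𝓕 ψ) x • f x := by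
      refine integral_congr_ae ?_
      filter_upwards [h2.coeFn_toLp] with x hx
      rw [hx]
    have e3 : ∫ x, (𝓕 (ψ : ℝ → ℂ)) x • f x = ∫ x, ψ x • (𝓕 f) x := by
      have := VectorFourier.integral_fourierIntegral_smul_eq_flip (L := innerₗ ℝ) (μ := volume)
        (ν := volume) (f := ψ) (g := f) Real.continuous_fourierChar
        (by fun_prop : Continuous fun p : ℝ × ℝ ↦ (innerₗ ℝ) p.1 p.2) ψ.integrable h1
      rw [flip_innerₗ] at this
      exact this
    rw [e2, SchwartzMap.fourier_coe, e3] at e1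
    have i1 : Integrable fun x ↦ φ x • ((𝓕 (h2.toLp f) : L2) : ℝ → ℂ) x :=
      hl2.integrable_smul_left_of_hasCompactSupport hφ.continuous hφc
    have i2 : Integrable fun x ↦ φ x • 𝓕 f x :=
      hl.integrable_smul_left_of_hasCompactSupport hφ.continuous hφc
    have : (fun x ↦ φ x • (((𝓕 (h2.toLp f) : L2) : ℝ → ℂ) - 𝓕 f) x) =
        fun x ↦ φ x • ((𝓕 (h2.toLp f) : L2) : ℝ → ℂ) x - φ x • 𝓕 f x := by
      funext x; simp [mul_sub]
    rw [this, integral_sub i1 i2, sub_eq_zero]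
    simpa [hψφ] using e1.symm
  filter_upwards [h0] with x hx
  simpa [sub_eq_zero] using hx

theorem fourierInv_toLp {f : ℝ → ℂ} (h1 : Integrable f) (h2 : MemLp f 2) :
    ((𝓕⁻ (h2.toLp f) : L2) : ℝ → ℂ) =ᵐ[volume] 𝓕⁻ f := by
  have hl : LocallyIntegrable (𝓕⁻ f) volume := by
    have e : (𝓕⁻ f) = 𝓕 (fun x ↦ f (-x)) := by
      rw [Real.fourierInv_eq_fourier_comp_neg]
    rw [e]
    exact (VectorFourier.fourierIntegral_continuous Real.continuous_fourierChar
      (by fun_prop : Continuous fun p : ℝ × ℝ ↦ (innerₗ ℝ) p.1 p.2) h1.comp_neg).locallyIntegrable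
  have hl2 : LocallyIntegrable ((𝓕⁻ (h2.toLp f) : L2) : ℝ → ℂ) volume :=
    (Lp.memLp _).locallyIntegrable (by norm_num)
  have h0 : ∀ᵐ x ∂volume, (((𝓕⁻ (h2.toLp f) : L2) : ℝ → ℂ) - 𝓕⁻ f) x = 0 := by
    refine ae_eq_zero_of_integral_contDiff_smul_eq_zero (hl2.sub hl) fun φ hφ hφc ↦ ?_
    have hc : HasCompactSupport (Complex.ofRealCLM ∘ φ) := hφc.comp_left rfl
    have hd : ContDiff ℝ ∞ (Complex.ofRealCLM ∘ φ) := by fun_prop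
    set ψ : 𝓢(ℝ, ℂ) := hc.toSchwartzMap hd with hψ
    have hψφ : ∀ x, ψ x = φ x := fun x ↦ rfl
    have e1 := DFunLike.congr_fun (Lp.fourierInv_toTemperedDistribution_eq (h2.toLp f)) ψ
    rw [TemperedDistribution.fourierInv_apply, Lp.toTemperedDistribution_apply,
      Lp.toTemperedDistribution_apply] at e1
    have e2 : ∫ x, (𝓕⁻ ψ) x • (h2.toLp f : ℝ → ℂ) x = ∫ x, (𝓕⁻ ψ) x • f x := by
      refine integral_congr_ae ?_
      filter_upwards [h2.coeFn_toLp] with x hx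
      rw [hx]
    have e3 : ∫ x, (𝓕⁻ (ψ : ℝ → ℂ)) x • f x = ∫ x, ψ x • (𝓕⁻ f) x := by
      have := VectorFourier.integral_fourierIntegral_smul_eq_flip (L := -innerₗ ℝ) (μ := volume)
        (ν := volume) (f := ψ) (g := f) Real.continuous_fourierChar
        (by
          have : Continuous fun p : ℝ × ℝ ↦ (innerₗ ℝ) p.1 p.2 := by fun_prop
          exact this.neg) ψ.integrable h1
      have hf : (-innerₗ ℝ : ℝ →ₗ[ℝ] ℝ →ₗ[ℝ] ℝ).flip = -innerₗ ℝ := by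
        ext; simp
      rw [hf] at this
      exact this
    rw [e2, SchwartzMap.fourierInv_coe, e3] at e1
    have i1 : Integrable fun x ↦ φ x • ((𝓕⁻ (h2.toLp f) : L2) : ℝ → ℂ) x :=
      hl2.integrable_smul_left_of_hasCompactSupport hφ.continuous hφc
    have i2 : Integrable fun x ↦ φ x • 𝓕⁻ f x :=
      hl.integrable_smul_left_of_hasCompactSupport hφ.continuous hφc
    have : (fun x ↦ φ x • (((𝓕⁻ (h2.toLp f) : L2) : ℝ → ℂ) - 𝓕⁻ f) x) =
        fun x ↦ φ x • ((𝓕⁻ (h2.toLp f) : L2) : ℝ → ℂ) x - φ x • 𝓕⁻ f x := by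
      funext x; simp [mul_sub]
    rw [this, integral_sub i1 i2, sub_eq_zero]
    simpa [hψφ] using e1.symm
  filter_upwards [h0] with x hx
  simpa [sub_eq_zero] using hx

/-! ### Modulations and translations -/

/-- The character `ξ ↦ e^{2π i h ξ}`. -/
def modE (h ξ : ℝ) : ℂ := exp (2 * Real.pi * I * h * ξ)

theorem norm_modE (h ξ : ℝ) : ‖modE h ξ‖ = 1 := by
  rw [modE, norm_exp]
  simp

theorem continuous_modE (h : ℝ) : Continuous (modE h) := by unfold modE; fun_prop

theorem modE_add (h k ξ : ℝ) : modE (h + k) ξ = modE h ξ * modE k ξ := by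
  rw [modE, modE, modE, ← Complex.exp_add]
  push_cast
  ring_nf

theorem modE_zero (ξ : ℝ) : modE 0 ξ = 1 := by simp [modE]

theorem modE_add_right (h ξ η : ℝ) : modE h (ξ + η) = modE h ξ * modE h η := by
  rw [modE, modE, modE, ← Complex.exp_add]
  push_cast
  ring_nf

theorem bdd_modE (h : ℝ) : Bdd (modE h) :=
  bdd_of_bound (continuous_modE h).aestronglyMeasurable (K := 1)
    (Filter.Eventually.of_forall fun ξ ↦ (norm_modE h ξ).le)

/-- Multiplication by `e^{2π i h ξ}` on `L²(ℝ)`. -/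
def modU (h : ℝ) : L2 →L[ℂ] L2 := mulL (modE h)

theorem norm_modU_le (h : ℝ) : ‖modU h‖ ≤ 1 :=
  norm_mulL_le zero_le_one (Filter.Eventually.of_forall fun ξ ↦ (norm_modE h ξ).le)

theorem modU_mul (h k : ℝ) : modU h * modU k = modU (h + k) := by
  rw [modU, modU, modU, ← mulL_mul (bdd_modE h) (bdd_modE k)]
  congr 1
  funext ξ
  rw [modE_add]

theorem modU_zero : modU 0 = 1 := by
  rw [modU, ← mulL_one]
  congr 1
  funext ξ
  exact modE_zero ξ

theorem modU_mul_neg (h : ℝ) : modU h * modU (-h) = 1 := by rw [modU_mul, add_neg_cancel, modU_zero]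

/-- Translation by `h` on `L²(ℝ)`. -/
def transL (h : ℝ) : L2 →ₗᵢ[ℂ] L2 :=
  Lp.compMeasurePreservingₗᵢ ℂ (fun x : ℝ ↦ x + h) (measurePreserving_add_right volume h)

theorem coeFn_transL (h : ℝ) (f : L2) :
    (transL h f : ℝ → ℂ) =ᵐ[volume] fun x ↦ (f : ℝ → ℂ) (x + h) :=
  Lp.coeFn_compMeasurePreserving f (measurePreserving_add_right volume h)

theorem ae_comp_add {p : ℝ → Prop} (hp : ∀ᵐ x, p x) (h : ℝ) : ∀ᵐ x, p (x + h) :=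
  (measurePreserving_add_right volume h).quasiMeasurePreserving.ae hp

theorem Bdd.comp_add {a : ℝ → ℂ} (ha : Bdd a) (h : ℝ) : Bdd (fun x ↦ a (x + h)) :=
  ha.comp_measurePreserving (measurePreserving_add_right volume h)

theorem fourierInv_modE_mul (h : ℝ) (f : ℝ → ℂ) (x : ℝ) :
    𝓕⁻ (fun ξ ↦ modE h ξ * f ξ) x = 𝓕⁻ f (x + h) := by
  rw [Real.fourierInv_eq', Real.fourierInv_eq']
  refine integral_congr_ae (Filter.Eventually.of_forall fun ξ ↦ ?_)
  simp only [smul_eq_mul, modE]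
  rw [← mul_assoc, ← Complex.exp_add]
  congr 2
  simp
  ring

theorem fourierInv_modU (h : ℝ) (f : L2) :
    (𝓕⁻ (modU h f : L2) : L2) = transL h (𝓕⁻ f : L2) := by
  refine DenseRange.induction_on
    (p := fun f : L2 ↦ (𝓕⁻ (modU h f : L2) : L2) = transL h (𝓕⁻ f : L2))
    (SchwartzMap.denseRange_toLpCLM (p := 2) (F := ℂ) (E := ℝ) (μ := volume)
      ENNReal.ofNat_ne_top) f ?_ ?_
  · refine isClosed_eq ?_ ?_
    · exact (Lp.fourierTransformₗᵢ ℝ ℂ : L2 ≃ₗᵢ[ℂ] L2).symm.continuous.comp (modU h).continuous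
    · exact (transL h).continuous.comp
        (Lp.fourierTransformₗᵢ ℝ ℂ : L2 ≃ₗᵢ[ℂ] L2).symm.continuous
  · intro φ
    have h1 : Integrable (fun ξ ↦ modE h ξ * φ ξ) :=
      φ.integrable.bdd_mul (continuous_modE h).aestronglyMeasurable (c := 1)
        (Filter.Eventually.of_forall fun ξ ↦ (norm_modE h ξ).le)
    have h2 : MemLp (fun ξ ↦ modE h ξ * φ ξ) 2 := by
      refine (φ.memLp 2 volume).of_le
        ((continuous_modE h).aestronglyMeasurable.mul φ.continuous.aestronglyMeasurable)
        (Filter.Eventually.of_forall fun ξ ↦ ?_)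
      rw [norm_mul, norm_modE, one_mul]
    have e : modU h (φ.toLp 2) = h2.toLp _ := by
      refine mulL_eq_of_ae (bdd_modE h) ?_
      filter_upwards [h2.coeFn_toLp, φ.coeFn_toLp 2 volume] with ξ h3 h4
      rw [h3, h4]
    have e' : (φ.toLp 2 : L2) = (φ.memLp 2 volume).toLp _ := rfl
    refine Lp.ext ?_
    rw [SchwartzMap.toLpCLM_apply, e]
    refine (fourierInv_toLp h1 h2).trans ?_
    refine Filter.EventuallyEq.trans ?_ (coeFn_transL h _).symm
    rw [e']
    filter_upwards [ae_comp_add (fourierInv_toLp φ.integrable (φ.memLp 2 volume)) h] with x hx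
    rw [fourierInv_modE_mul, hx]

/-- A modulation in frequency is a translation in space, so passing it across multiplication by `w`
translates `w`. The commutator of the two is thus multiplication by a finite difference of `w`; this
is how regularity of the speed becomes a property of operators. -/
theorem modU_conjF (h : ℝ) {w : ℝ → ℂ} (hw : Bdd w) :
    modU h * conjF w = conjF (fun x ↦ w (x + h)) * modU h := by
  ext1 f
  rw [mul_apply_eq_comp, mul_apply_eq_comp]
  rw [← fourier_fourierInv_eq (F := L2) (modU h (conjF w f)), conjF_apply (fun x ↦ w (x + h)),
    fourierInv_modU, fourierInv_modU, fourierInv_conjF]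
  congr 1
  refine (mulL_eq_of_ae (hw.comp_add h) ?_).symm
  filter_upwards [coeFn_transL h (mulL w (𝓕⁻ f : L2)), coeFn_transL h (𝓕⁻ f : L2),
    ae_comp_add (coeFn_mulL hw (𝓕⁻ f : L2)) h] with x h1 h2 h3
  rw [h1, h3, h2]

/-! ### Dyadic frequency shells -/

/-- The dyadic shells `{|ξ| < 1}` and `{2 ^ (i - 1) ≤ |ξ| < 2 ^ i}`. -/
def shell (i : ℕ) : Set ℝ := {ξ | |ξ| < 2 ^ i ∧ (i = 0 ∨ 2 ^ i ≤ 2 * |ξ|)}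

theorem measurableSet_shell (i : ℕ) : MeasurableSet (shell i) := by
  have h1 : MeasurableSet {ξ : ℝ | |ξ| < 2 ^ i} := measurableSet_lt (by fun_prop) (by fun_prop)
  have h2 : MeasurableSet {ξ : ℝ | (2 : ℝ) ^ i ≤ 2 * |ξ|} :=
    measurableSet_le (by fun_prop) (by fun_prop)
  exact h1.inter ((MeasurableSet.const _).union h2)

theorem shell_disjoint {i j : ℕ} (h : i ≠ j) : Disjoint (shell i) (shell j) := by
  have key : ∀ i j : ℕ, i < j → Disjoint (shell i) (shell j) := by
    intro i j hij
    rw [Set.disjoint_left]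
    rintro ξ ⟨h1, -⟩ ⟨-, h2⟩
    have h3 := h2.resolve_left (by omega)
    have h4 : (2 : ℝ) ^ (i + 1) ≤ 2 ^ j := pow_le_pow_right₀ (by norm_num) hij
    rw [pow_succ] at h4
    linarith
  rcases lt_or_gt_of_ne h with h | h
  · exact key i j h
  · exact (key j i h).symm

theorem exists_mem_shell (ξ : ℝ) : ∃ i, ξ ∈ shell i := by
  have hex : ∃ n : ℕ, |ξ| < 2 ^ n := pow_unbounded_of_one_lt _ (by norm_num)
  classical
  refine ⟨Nat.find hex, Nat.find_spec hex, ?_⟩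
  rcases Nat.eq_zero_or_pos (Nat.find hex) with h | h
  · exact Or.inl h
  · right
    have h1 := Nat.find_min hex (m := Nat.find hex - 1) (by omega)
    have h2 : (2 : ℝ) ^ Nat.find hex = 2 * 2 ^ (Nat.find hex - 1) := by
      rw [← pow_succ']
      congr 1
      omega
    push Not at h1
    rw [h2]
    linarith

theorem iUnion_shell : (⋃ i, shell i) = Set.univ := by
  ext ξ
  simpa using exists_mem_shell ξ

/-- The function `a` cut off to the set `s`. -/
abbrev cut (s : Set ℝ) (a : ℝ → ℂ) : ℝ → ℂ := s.indicator a

theorem bdd_cut {s : Set ℝ} (hs : MeasurableSet s) {a : ℝ → ℂ}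
    (ha : AEStronglyMeasurable a volume) {K : ℝ} (hK : ∀ ξ ∈ s, ‖a ξ‖ ≤ K) : Bdd (cut s a) := by
  refine bdd_of_bound (ha.indicator hs) (K := max K 0) (Filter.Eventually.of_forall fun ξ ↦ ?_)
  by_cases h : ξ ∈ s
  · rw [cut, Set.indicator_of_mem h]; exact (hK ξ h).trans (le_max_left _ _)
  · rw [cut, Set.indicator_of_notMem h]; simp

theorem norm_mulL_cut_le {s : Set ℝ} {a : ℝ → ℂ} {K : ℝ} (hK0 : 0 ≤ K)
    (hK : ∀ ξ ∈ s, ‖a ξ‖ ≤ K) : ‖mulL (cut s a)‖ ≤ K := by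
  refine norm_mulL_le hK0 (Filter.Eventually.of_forall fun ξ ↦ ?_)
  by_cases h : ξ ∈ s
  · rw [cut, Set.indicator_of_mem h]; exact hK ξ h
  · rw [cut, Set.indicator_of_notMem h]; simpa using hK0

/-- The frequency projection to a set. -/
def proj (s : Set ℝ) : L2 →L[ℂ] L2 := mulL (cut s fun _ ↦ 1)

theorem bdd_cut_one {s : Set ℝ} (hs : MeasurableSet s) : Bdd (cut s fun _ ↦ 1) :=
  bdd_cut hs aestronglyMeasurable_const (K := 1) (by simp)

theorem norm_proj_le (s : Set ℝ) : ‖proj s‖ ≤ 1 := norm_mulL_cut_le zero_le_one (by simp)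

theorem mulL_cut_mul_proj {s : Set ℝ} (hs : MeasurableSet s) {a : ℝ → ℂ} (ha : Bdd (cut s a)) :
    mulL (cut s a) * proj s = mulL (cut s a) := by
  rw [proj, ← mulL_mul ha (bdd_cut_one hs)]
  congr 1
  funext ξ
  by_cases h : ξ ∈ s <;> simp [cut, h]

theorem proj_mul_mulL_cut {s : Set ℝ} (hs : MeasurableSet s) {a : ℝ → ℂ} (ha : Bdd (cut s a)) :
    proj s * mulL (cut s a) = mulL (cut s a) := by
  rw [proj, mulL_comm, ← proj, mulL_cut_mul_proj hs ha]

theorem proj_mul_proj {s : Set ℝ} (hs : MeasurableSet s) : proj s * proj s = proj s :=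
  mulL_cut_mul_proj hs (bdd_cut_one hs)

theorem mulL_cut_eq {s : Set ℝ} (hs : MeasurableSet s) {a : ℝ → ℂ} (ha : Bdd a) :
    mulL (cut s a) = proj s * mulL a := by
  rw [proj, ← mulL_mul (bdd_cut_one hs) ha]
  congr 1
  funext ξ
  by_cases h : ξ ∈ s <;> simp [cut, h]

/-- The projection to the `i`-th shell. -/
def shellP (i : ℕ) : L2 →L[ℂ] L2 := proj (shell i)

theorem norm_shellP_le (i : ℕ) : ‖shellP i‖ ≤ 1 := norm_proj_le _

theorem enorm_shellP_sq {i : ℕ} (f : L2) {g : ℝ → ℂ} (h : (f : ℝ → ℂ) =ᵐ[volume] g) :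
    ‖shellP i f‖ₑ ^ 2 = ∫⁻ ξ in shell i, ‖g ξ‖ₑ ^ 2 := by
  rw [Lp.enorm_def, eLpNorm_eq_lintegral_rpow_enorm_toReal (by norm_num) (by norm_num)]
  simp only [ENNReal.toReal_ofNat, one_div]
  rw [← ENNReal.rpow_natCast, ← ENNReal.rpow_mul]
  norm_num
  rw [← lintegral_indicator (measurableSet_shell i)]
  refine lintegral_congr_ae ?_
  filter_upwards [coeFn_mulL (bdd_cut_one (measurableSet_shell i)) f, h] with ξ h1 h2
  rw [shellP, proj, h1]
  by_cases hξ : ξ ∈ shell i <;> simp [cut, hξ, h2]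

theorem lintegral_eq_tsum_shell (g : ℝ → ℝ≥0∞) :
    ∫⁻ ξ, g ξ = ∑' i, ∫⁻ ξ in shell i, g ξ := by
  rw [← lintegral_iUnion measurableSet_shell (fun i j h ↦ shell_disjoint h), iUnion_shell,
    setLIntegral_univ]

theorem enorm_sq_eq_lintegral (f : L2) {g : ℝ → ℂ} (h : (f : ℝ → ℂ) =ᵐ[volume] g) :
    ‖f‖ₑ ^ 2 = ∫⁻ ξ, ‖g ξ‖ₑ ^ 2 := by
  rw [Lp.enorm_def, eLpNorm_eq_lintegral_rpow_enorm_toReal (by norm_num) (by norm_num)]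
  simp only [ENNReal.toReal_ofNat, one_div]
  rw [← ENNReal.rpow_natCast, ← ENNReal.rpow_mul]
  norm_num
  refine lintegral_congr_ae ?_
  filter_upwards [h] with ξ h1
  rw [h1]

theorem enorm_sq_eq_tsum_shellP (f : L2) : ‖f‖ₑ ^ 2 = ∑' i, ‖shellP i f‖ₑ ^ 2 := by
  rw [enorm_sq_eq_lintegral f (Filter.EventuallyEq.refl _ _), lintegral_eq_tsum_shell]
  congr 1
  funext i
  rw [enorm_shellP_sq f (Filter.EventuallyEq.refl _ _)]

theorem shellP_mul_shellP_of_ne {i j : ℕ} (h : i ≠ j) : shellP i * shellP j = 0 := by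
  rw [shellP, shellP, proj, proj, ← mulL_mul (bdd_cut_one (measurableSet_shell i))
    (bdd_cut_one (measurableSet_shell j))]
  have : (fun ξ ↦ cut (shell i) (fun _ ↦ 1) ξ * cut (shell j) (fun _ ↦ 1) ξ) = fun _ ↦ (0 : ℂ) := by
    funext ξ
    by_cases h1 : ξ ∈ shell i
    · have h2 : ξ ∉ shell j := Set.disjoint_left.1 (shell_disjoint h) h1
      simp [cut, h2]
    · simp [cut, h1]
  rw [this, mulL_const, zero_smul]

theorem shellP_mul_shellP (i : ℕ) : shellP i * shellP i = shellP i :=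
  proj_mul_proj (measurableSet_shell i)

/-- The squared norm of what a finite set of shells leaves out is a tail of the convergent series `∑
‖shellP i f‖²`. -/
theorem hasSum_shellP (f : L2) : HasSum (fun i ↦ shellP i f) f := by
  classical
  have hsum : ∑' i, ‖shellP i f‖ₑ ^ 2 ≠ ⊤ := by
    rw [← enorm_sq_eq_tsum_shellP]
    simp
  have h0 := ENNReal.tendsto_tsum_compl_atTop_zero hsum
  have hq : ∀ (s : Finset ℕ) (j : ℕ), shellP j (f - ∑ i ∈ s, shellP i f) =
      if j ∈ s then 0 else shellP j f := by
    intro s j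
    have e : ∀ i, shellP j (shellP i f) = if i = j then shellP j f else 0 := by
      intro i
      rw [← mul_apply_eq_comp]
      by_cases h : i = j
      · rw [if_pos h, h, shellP_mul_shellP]
      · rw [if_neg h, shellP_mul_shellP_of_ne (Ne.symm h)]; rfl
    rw [map_sub, map_sum, Finset.sum_congr rfl (fun i _ ↦ e i), Finset.sum_ite_eq']
    by_cases h : j ∈ s <;> simp [h]
  have h1 : ∀ s : Finset ℕ, ‖f - ∑ i ∈ s, shellP i f‖ₑ ^ 2 =
      ∑' i : { x // x ∉ s }, ‖shellP i f‖ₑ ^ 2 := by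
    intro s
    rw [enorm_sq_eq_tsum_shellP]
    rw [show (∑' i : { x // x ∉ s }, ‖shellP i f‖ₑ ^ 2) =
      ∑' i : ((s : Set ℕ)ᶜ : Set ℕ), ‖shellP (i : ℕ) f‖ₑ ^ 2 from rfl,
      tsum_subtype ((s : Set ℕ)ᶜ) (fun i ↦ ‖shellP i f‖ₑ ^ 2)]
    congr 1
    funext j
    rw [hq]
    by_cases h : j ∈ s <;> simp [h]
  have h2 : Filter.Tendsto (fun s : Finset ℕ ↦ ‖f - ∑ i ∈ s, shellP i f‖ₑ) Filter.atTop (nhds 0) := by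
    have h3 : Filter.Tendsto (fun s : Finset ℕ ↦ ‖f - ∑ i ∈ s, shellP i f‖ₑ ^ 2) Filter.atTop
        (nhds 0) := by simpa only [h1] using h0
    have h4 := h3.ennrpow_const (1 / 2)
    simp only [← ENNReal.rpow_natCast, ← ENNReal.rpow_mul] at h4
    norm_num at h4
    exact h4
  rw [HasSum, tendsto_iff_edist_tendsto_0]
  refine h2.congr fun s ↦ ?_
  rw [edist_comm, edist_eq_enorm_sub]

end

/-! ### Off-diagonal decay of multiplication operators, uniform over powers. -/

section

open scoped ENNReal

/-! ### Finite differences and off-diagonal decay -/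

/-- Translation of a function. -/
def trans (h : ℝ) (w : ℝ → ℂ) : ℝ → ℂ := fun x ↦ w (x + h)

/-- Forward difference of a function. -/
def diff (h : ℝ) (w : ℝ → ℂ) : ℝ → ℂ := fun x ↦ w (x + h) - w x

theorem bdd_trans {w : ℝ → ℂ} (hw : Bdd w) (h : ℝ) : Bdd (trans h w) := hw.comp_add h

theorem bdd_diff {w : ℝ → ℂ} (hw : Bdd w) (h : ℝ) : Bdd (diff h w) := (hw.comp_add h).sub hw

theorem bdd_diff_iterate {w : ℝ → ℂ} (hw : Bdd w) (h : ℝ) (j : ℕ) : Bdd ((diff h)^[j] w) := by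
  induction j with
  | zero => exact hw
  | succ j ih => rw [Function.iterate_succ_apply']; exact bdd_diff ih h

theorem conjF_trans {w : ℝ → ℂ} (hw : Bdd w) (h : ℝ) :
    conjF (trans h w) = modU h * conjF w * modU (-h) := by
  rw [modU_conjF h hw, mul_assoc, modU_mul_neg, mul_one]
  rfl

theorem conjF_diff {w : ℝ → ℂ} (hw : Bdd w) (h : ℝ) :
    conjF (diff h w) = conjF (trans h w) - conjF w := conjF_sub (hw.comp_add h) hw

theorem modU_shellP (h : ℝ) (i : ℕ) : modU h * shellP i = shellP i * modU h := mulL_comm _ _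

theorem norm_conj_le (h : ℝ) (T : L2 →L[ℂ] L2) : ‖modU h * T * modU (-h)‖ ≤ ‖T‖ := by
  refine (norm_mul_le _ _).trans ?_
  have h1 := (norm_mul_le (modU h) T).trans
    (mul_le_mul_of_nonneg_right (norm_modU_le h) (norm_nonneg T))
  rw [one_mul] at h1
  exact (mul_le_mul h1 (norm_modU_le (-h)) (norm_nonneg _) (norm_nonneg _)).trans (mul_one _).le

theorem norm_conjF_trans_le {w : ℝ → ℂ} (hw : Bdd w) (h : ℝ) : ‖conjF (trans h w)‖ ≤ ‖conjF w‖ := by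
  rw [conjF_trans hw]
  exact norm_conj_le h _

/-- The normalized size of the multiplication by `w` from and to the `i`-th shell. -/
def shellSize (i : ℕ) (w : ℝ → ℂ) : ℝ :=
  (1 / 2) ^ i * (‖conjF w * shellP i‖ + ‖shellP i * conjF w‖)

theorem shellSize_nonneg (i : ℕ) (w : ℝ → ℂ) : 0 ≤ shellSize i w := by
  unfold shellSize; positivity

theorem norm_mul_shellP_le (T : L2 →L[ℂ] L2) (i : ℕ) : ‖T * shellP i‖ ≤ ‖T‖ :=
  (norm_mul_le _ _).trans ((mul_le_mul_of_nonneg_left (norm_shellP_le i) (norm_nonneg _)).trans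
    (mul_one _).le)

theorem norm_shellP_mul_le (T : L2 →L[ℂ] L2) (i : ℕ) : ‖shellP i * T‖ ≤ ‖T‖ :=
  (norm_mul_le _ _).trans ((mul_le_mul_of_nonneg_right (norm_shellP_le i) (norm_nonneg _)).trans
    (one_mul _).le)

theorem shellSize_le (i : ℕ) (w : ℝ → ℂ) : shellSize i w ≤ 2 * ‖conjF w‖ := by
  have h1 := norm_mul_shellP_le (conjF w) i
  have h2 := norm_shellP_mul_le (conjF w) i
  have h3 : ((1 : ℝ) / 2) ^ i ≤ 1 := pow_le_one₀ (by norm_num) (by norm_num)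
  unfold shellSize
  nlinarith [norm_nonneg (conjF w * shellP i), norm_nonneg (shellP i * conjF w),
    pow_nonneg (show (0 : ℝ) ≤ 1 / 2 by norm_num) i]

theorem shellSize_trans_le {w : ℝ → ℂ} (hw : Bdd w) (h : ℝ) (i : ℕ) :
    shellSize i (trans h w) ≤ shellSize i w := by
  unfold shellSize
  rw [conjF_trans hw]
  have e1 : modU h * conjF w * modU (-h) * shellP i = modU h * (conjF w * shellP i) * modU (-h) := by
    rw [mul_assoc, modU_shellP]; simp only [mul_assoc]
  have e2 : shellP i * (modU h * conjF w * modU (-h)) =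
      modU h * (shellP i * conjF w) * modU (-h) := by
    rw [← mul_assoc, ← mul_assoc, ← modU_shellP]; simp only [mul_assoc]
  rw [e1, e2]
  gcongr
  · exact norm_conj_le _ _
  · exact norm_conj_le _ _

/-- Multiplications commute, so the factor `a` can always be moved to the side away from the
projection. -/
theorem shellSize_mul_le {a b : ℝ → ℂ} (ha : Bdd a) (hb : Bdd b) (i : ℕ) :
    shellSize i (fun x ↦ a x * b x) ≤ ‖conjF a‖ * shellSize i b := by
  unfold shellSize
  rw [conjF_mul ha hb, ← mul_assoc (shellP i)]
  have h1 : ‖conjF a * conjF b * shellP i‖ ≤ ‖conjF a‖ * ‖conjF b * shellP i‖ := by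
    rw [mul_assoc]; exact norm_mul_le _ _
  have h2 : ‖shellP i * conjF a * conjF b‖ ≤ ‖conjF a‖ * ‖shellP i * conjF b‖ := by
    rw [mul_assoc, conjF_comm, ← mul_assoc, mul_comm]; exact norm_mul_le _ _
  calc _ ≤ (1 / 2) ^ i * (‖conjF a‖ * ‖conjF b * shellP i‖ + ‖conjF a‖ * ‖shellP i * conjF b‖) := by
        gcongr
    _ = _ := by ring

theorem shellSize_add_le {a b : ℝ → ℂ} (ha : Bdd a) (hb : Bdd b) (i : ℕ) :
    shellSize i (fun x ↦ a x + b x) ≤ shellSize i a + shellSize i b := by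
  unfold shellSize
  rw [conjF_add ha hb, add_mul, mul_add (shellP i)]
  have h1 := norm_add_le (conjF a * shellP i) (conjF b * shellP i)
  have h2 := norm_add_le (shellP i * conjF a) (shellP i * conjF b)
  have h3 := mul_le_mul_of_nonneg_left (add_le_add h1 h2)
    (show (0 : ℝ) ≤ (1 / 2) ^ i by positivity)
  linarith

/-- A submultiplicative norm controlling the differences of order at most `j + 1`; the difference
of order `j + 1` is measured by `shellSize`. -/
def diffNorm (i : ℕ) (h σ : ℝ) : ℕ → (ℝ → ℂ) → ℝ
  | 0, w => ‖conjF w‖ + σ * shellSize i (diff h w)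
  | j + 1, w => diffNorm i h σ j w + σ * diffNorm i h σ j (diff h w)

section diffNorm

variable {i : ℕ} {h σ : ℝ}

theorem diffNorm_nonneg (hσ : 0 ≤ σ) (j : ℕ) (w : ℝ → ℂ) : 0 ≤ diffNorm i h σ j w := by
  induction j generalizing w with
  | zero => exact add_nonneg (norm_nonneg _) (mul_nonneg hσ (shellSize_nonneg _ _))
  | succ j ih => exact add_nonneg (ih _) (mul_nonneg hσ (ih _))

theorem diff_trans (k : ℝ) (w : ℝ → ℂ) : diff h (trans k w) = trans k (diff h w) := by
  funext x; simp only [diff, trans]; ring_nf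

theorem diffNorm_trans_le (hσ : 0 ≤ σ) (j : ℕ) {w : ℝ → ℂ} (hw : Bdd w) (k : ℝ) :
    diffNorm i h σ j (trans k w) ≤ diffNorm i h σ j w := by
  induction j generalizing w with
  | zero =>
    simp only [diffNorm, diff_trans]
    gcongr
    · exact norm_conjF_trans_le hw k
    · exact shellSize_trans_le (bdd_diff hw h) k i
  | succ j ih =>
    simp only [diffNorm, diff_trans]
    gcongr
    · exact ih hw
    · exact ih (bdd_diff hw h)

theorem diffNorm_add_le (hσ : 0 ≤ σ) (j : ℕ) {a b : ℝ → ℂ} (ha : Bdd a) (hb : Bdd b) :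
    diffNorm i h σ j (fun x ↦ a x + b x) ≤ diffNorm i h σ j a + diffNorm i h σ j b := by
  have e : ∀ a b : ℝ → ℂ, diff h (fun x ↦ a x + b x) = fun x ↦ diff h a x + diff h b x := by
    intro a b; funext x; simp only [diff]; ring
  induction j generalizing a b with
  | zero =>
    simp only [diffNorm, e, conjF_add ha hb]
    have h1 := norm_add_le (conjF a) (conjF b)
    have h2 := mul_le_mul_of_nonneg_left
      (shellSize_add_le (bdd_diff ha h) (bdd_diff hb h) i) hσ
    linarith
  | succ j ih =>
    simp only [diffNorm, e]
    have h1 := ih ha hb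
    have h2 := mul_le_mul_of_nonneg_left (ih (bdd_diff ha h) (bdd_diff hb h)) hσ
    linarith

theorem diff_mul (a b : ℝ → ℂ) : diff h (fun x ↦ a x * b x) =
    fun x ↦ (b x * diff h a x) + (trans h a x * diff h b x) := by
  funext x; simp only [diff, trans]; ring

/-- Leibniz: the difference of `a b` is `b Δa + (τa) Δb`, and the translation `τ` does not increase
the norm. The product of the two norms contains these terms and a further nonnegative one, of order
`σ²`. Submultiplicativity is what makes an `l`-th power cost `κ ^ l` with no extra factor growing in
`l`. -/
theorem diffNorm_mul_le (hσ : 0 ≤ σ) (j : ℕ) {a b : ℝ → ℂ} (ha : Bdd a) (hb : Bdd b) :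
    diffNorm i h σ j (fun x ↦ a x * b x) ≤ diffNorm i h σ j a * diffNorm i h σ j b := by
  induction j generalizing a b with
  | zero =>
    simp only [diffNorm, diff_mul, conjF_mul ha hb]
    have h1 := norm_mul_le (conjF a) (conjF b)
    have h2 := shellSize_add_le (hb.mul (bdd_diff ha h)) ((bdd_trans ha h).mul (bdd_diff hb h)) i
    have h3 := shellSize_mul_le hb (bdd_diff ha h) i
    have h4 := shellSize_mul_le (bdd_trans ha h) (bdd_diff hb h) i
    have h5 := mul_le_mul_of_nonneg_right (norm_conjF_trans_le ha h)
      (shellSize_nonneg i (diff h b))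
    have h6 := mul_le_mul_of_nonneg_left (h2.trans (add_le_add h3 (h4.trans h5))) hσ
    have h7 : 0 ≤ σ * σ * (shellSize i (diff h a) * shellSize i (diff h b)) :=
      mul_nonneg (mul_nonneg hσ hσ) (mul_nonneg (shellSize_nonneg _ _) (shellSize_nonneg _ _))
    nlinarith
  | succ j ih =>
    simp only [diffNorm, diff_mul]
    have h1 := ih ha hb
    have h2 := diffNorm_add_le (i := i) (h := h) hσ j (hb.mul (bdd_diff ha h))
      ((bdd_trans ha h).mul (bdd_diff hb h))
    have h3 := ih hb (bdd_diff ha h)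
    have h4 := ih (bdd_trans ha h) (bdd_diff hb h)
    have h5 := mul_le_mul_of_nonneg_right (diffNorm_trans_le (i := i) (h := h) hσ j ha h)
      (diffNorm_nonneg (i := i) (h := h) hσ j (diff h b))
    have h6 := mul_le_mul_of_nonneg_left (h2.trans (add_le_add h3 (h4.trans h5))) hσ
    have h7 : 0 ≤ σ * σ * (diffNorm i h σ j (diff h a) * diffNorm i h σ j (diff h b)) :=
      mul_nonneg (mul_nonneg hσ hσ) (mul_nonneg (diffNorm_nonneg hσ _ _) (diffNorm_nonneg hσ _ _))
    nlinarith

theorem conjF_zero_fun : conjF (fun _ ↦ 0) = 0 := by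
  have := conjF_sub (bdd_const 1) (bdd_const 1)
  simpa using this

theorem diffNorm_zero_fun (j : ℕ) : diffNorm i h σ j (fun _ ↦ 0) = 0 := by
  have e : diff h (fun _ ↦ (0 : ℂ)) = fun _ ↦ 0 := by funext x; simp [diff]
  induction j with
  | zero => simp [diffNorm, e, conjF_zero_fun, shellSize]
  | succ j ih => simp [diffNorm, e, ih]

theorem diffNorm_one_le (j : ℕ) : diffNorm i h σ j (fun _ ↦ 1) ≤ 1 := by
  have e : diff h (fun _ ↦ (1 : ℂ)) = fun _ ↦ 0 := by funext x; simp [diff]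
  induction j with
  | zero =>
    have h1 : ‖(1 : L2 →L[ℂ] L2)‖ ≤ 1 := ContinuousLinearMap.norm_id_le
    simpa [diffNorm, e, shellSize, conjF_zero_fun, conjF_one] using h1
  | succ j ih => simpa [diffNorm, e, diffNorm_zero_fun] using ih

theorem diffNorm_pow_le (hσ : 0 ≤ σ) (j : ℕ) {w : ℝ → ℂ} (hw : Bdd w) {κ : ℝ}
    (hκ : diffNorm i h σ j w ≤ κ) (l : ℕ) : diffNorm i h σ j (fun x ↦ w x ^ l) ≤ κ ^ l := by
  induction l with
  | zero => simpa using diffNorm_one_le j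
  | succ l ih =>
    simp_rw [pow_succ]
    exact (diffNorm_mul_le hσ j (hw.pow l) hw).trans
      (mul_le_mul ih hκ (diffNorm_nonneg hσ _ _) ((diffNorm_nonneg hσ _ _).trans ih))

theorem norm_conjF_le_diffNorm (hσ : 0 ≤ σ) (j : ℕ) (w : ℝ → ℂ) :
    ‖conjF w‖ ≤ diffNorm i h σ j w := by
  induction j with
  | zero => exact le_add_of_nonneg_right (mul_nonneg hσ (shellSize_nonneg _ _))
  | succ j ih => exact ih.trans (le_add_of_nonneg_right (mul_nonneg hσ (diffNorm_nonneg hσ _ _)))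

theorem norm_conjF_diff_le_diffNorm (hσ : 0 ≤ σ) (j : ℕ) (w : ℝ → ℂ) :
    σ * ‖conjF (diff h w)‖ ≤ diffNorm i h σ (j + 1) w := by
  have h1 := mul_le_mul_of_nonneg_left
    (norm_conjF_le_diffNorm (i := i) (h := h) hσ j (diff h w)) hσ
  exact h1.trans (le_add_of_nonneg_left (diffNorm_nonneg hσ _ _))

theorem shellSize_le_diffNorm (hσ : 0 ≤ σ) (j : ℕ) (w : ℝ → ℂ) :
    σ ^ (j + 1) * shellSize i ((diff h)^[j + 1] w) ≤ diffNorm i h σ j w := by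
  induction j generalizing w with
  | zero => simp [diffNorm]
  | succ j ih =>
    have h1 := mul_le_mul_of_nonneg_left (ih (diff h w)) hσ
    rw [← Function.iterate_succ_apply, ← mul_assoc, ← pow_succ'] at h1
    exact h1.trans (le_add_of_nonneg_left (diffNorm_nonneg hσ _ _))

end diffNorm

/-- A difference of order `j ≥ 1` is `O(h ^ j)` and carries the weight `(s / h) ^ j`, so it
contributes only `O(s)`. The bound is uniform in `h` and in the shell, and tends to `ρ` as `s` tends
to `0`. -/
theorem diffNorm_le_of_bounds {i M : ℕ} {h s D ρ : ℝ} (hh : 0 < h) (hs : 0 ≤ s) (hs1 : s ≤ 1)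
    (hD : 0 ≤ D) {u : ℝ → ℂ} (h0 : ‖conjF u‖ ≤ ρ)
    (h1 : ∀ j, 1 ≤ j → j ≤ M → ‖conjF ((diff h)^[j] u)‖ ≤ D * h ^ j)
    (h2 : ∀ j, 1 ≤ j → j ≤ M + 1 → shellSize i ((diff h)^[j] u) ≤ D * h ^ j) :
    diffNorm i h (s / h) M u ≤ ρ + s * D * ∑ j ∈ Finset.range (M + 1), 2 ^ j := by
  have hσ : 0 ≤ s / h := by positivity
  -- Unfolded `J` times, the recursion at an already differenced function has `2 ^ (J + 1)` terms,
  -- each at most `D * h ^ a` because `s ≤ 1`.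
  have key : ∀ J a, 1 ≤ a → a + J ≤ M →
      diffNorm i h (s / h) J ((diff h)^[a] u) ≤ D * h ^ a * 2 ^ (J + 1) := by
    intro J
    induction J with
    | zero =>
      intro a ha haM
      have e1 := h1 a ha (by omega)
      have e2 := h2 (a + 1) (by omega) (by omega)
      rw [Function.iterate_succ_apply'] at e2
      have e3 := mul_le_mul_of_nonneg_left e2 hσ
      have e4 : s / h * (D * h ^ (a + 1)) = s * (D * h ^ a) := by
        field_simp
        ring
      have e5 : s * (D * h ^ a) ≤ D * h ^ a := by
        have : 0 ≤ D * h ^ a := by positivity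
        nlinarith
      simp only [diffNorm]
      rw [e4] at e3
      linarith
    | succ J ih =>
      intro a ha haM
      have e1 := ih a ha (by omega)
      have e2 := ih (a + 1) (by omega) (by omega)
      rw [Function.iterate_succ_apply'] at e2
      have e3 := mul_le_mul_of_nonneg_left e2 hσ
      have e4 : s / h * (D * h ^ (a + 1) * 2 ^ (J + 1)) = s * (D * h ^ a * 2 ^ (J + 1)) := by
        field_simp
        ring
      have e5 : s * (D * h ^ a * 2 ^ (J + 1)) ≤ D * h ^ a * 2 ^ (J + 1) := by
        have : 0 ≤ D * h ^ a * 2 ^ (J + 1) := by positivity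
        nlinarith
      simp only [diffNorm]
      rw [e4] at e3
      rw [pow_succ 2 (J + 1)]
      linarith
  have main : ∀ J, J ≤ M →
      diffNorm i h (s / h) J u ≤ ρ + s * D * ∑ j ∈ Finset.range (J + 1), 2 ^ j := by
    intro J
    induction J with
    | zero =>
      intro _
      have e2 := mul_le_mul_of_nonneg_left (h2 1 le_rfl (by omega)) hσ
      have e4 : s / h * (D * h ^ 1) = s * D := by field_simp
      rw [e4] at e2
      simp only [diffNorm]
      simp only [Function.iterate_one] at e2
      simpa using add_le_add h0 e2
    | succ J ih =>
      intro hJ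
      have e1 := ih (by omega)
      have e2 := mul_le_mul_of_nonneg_left (key J 1 le_rfl (by omega)) hσ
      have e4 : s / h * (D * h ^ 1 * 2 ^ (J + 1)) = s * D * 2 ^ (J + 1) := by field_simp
      rw [e4] at e2
      simp only [Function.iterate_one] at e2
      rw [Finset.sum_range_succ]
      simp only [diffNorm]
      linarith
  exact main M le_rfl

theorem norm_modE_sub_one_le (h ξ : ℝ) : ‖modE h ξ - 1‖ ≤ 2 * Real.pi * |h * ξ| := by
  have h1 := Real.norm_exp_I_mul_ofReal_sub_one_le (x := 2 * Real.pi * (h * ξ))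
  have e : modE h ξ = cexp (I * ((2 * Real.pi * (h * ξ) : ℝ) : ℂ)) := by
    rw [modE]; push_cast; ring_nf
  rw [e]
  refine h1.trans ?_
  rw [Real.norm_eq_abs, abs_mul, abs_of_pos (by positivity : (0 : ℝ) < 2 * Real.pi)]

/-- In this range of `h * ξ` the character lies in the closed left half plane. -/
theorem one_le_norm_modE_sub_one {h ξ : ℝ} (h1 : 1 / 4 ≤ |h * ξ|) (h2 : |h * ξ| ≤ 1 / 2) :
    1 ≤ ‖modE h ξ - 1‖ := by
  have e : (modE h ξ).re = Real.cos (2 * Real.pi * |h * ξ|) := by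
    have : modE h ξ = cexp (((2 * Real.pi * (h * ξ) : ℝ) : ℂ) * I) := by
      rw [modE]; push_cast; ring_nf
    rw [this, Complex.exp_ofReal_mul_I_re]
    rw [← Real.cos_abs, abs_mul, abs_of_pos (by positivity : (0 : ℝ) < 2 * Real.pi)]
  have h3 : Real.cos (2 * Real.pi * |h * ξ|) ≤ 0 := by
    apply Real.cos_nonpos_of_pi_div_two_le_of_le <;> nlinarith [Real.pi_pos]
  have h4 := Complex.abs_re_le_norm (modE h ξ - 1)
  rw [sub_re, one_re, e] at h4
  refine le_trans ?_ h4
  rw [abs_of_nonpos (by linarith)]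
  linarith

section separation

variable {w : ℝ → ℂ} {i k : ℕ} {h : ℝ}

theorem shell_comm_identity (hw : Bdd w) :
    shellP i * conjF w * shellP k * modU h =
      modU h * (shellP i * conjF w * shellP k) -
        shellP i * conjF (diff h w) * shellP k * modU h := by
  have h1 := modU_conjF h hw
  have h2 : conjF (fun x ↦ w (x + h)) = conjF w + conjF (diff h w) := by
    rw [conjF_diff hw]; exact (add_sub_cancel _ _).symm
  rw [h2, add_mul] at h1
  calc shellP i * conjF w * shellP k * modU h
      = shellP i * (conjF w * modU h) * shellP k := by
        rw [mul_assoc, ← modU_shellP]; simp only [mul_assoc]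
    _ = shellP i * (modU h * conjF w - conjF (diff h w) * modU h) * shellP k := by
        rw [h1, add_sub_cancel_right]
    _ = (shellP i * modU h) * conjF w * shellP k -
          shellP i * conjF (diff h w) * (modU h * shellP k) := by
        rw [mul_sub, sub_mul]; simp only [mul_assoc]
    _ = _ := by rw [← modU_shellP, modU_shellP h k]; simp only [mul_assoc]

theorem modU_sub_one (h : ℝ) : modU h - 1 = mulL (fun ξ ↦ modE h ξ - 1) := by
  rw [mulL_sub (bdd_modE h) (bdd_const 1), mulL_one]; rfl

/-- Two shells below `q` the phase `2πhξ` is at most `π / 4`, and `π / 4 < 4 / 5 < 1`. The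
separation by two shells is needed exactly for this strict inequality. -/
theorem norm_modU_sub_one_mul_shellP_le {q : ℕ} (hi : i + 2 ≤ q) :
    ‖(modU (1 / 2 ^ (q + 1)) - 1) * shellP i‖ ≤ 4 / 5 := by
  rw [modU_sub_one, shellP, proj, mulL_comm, ← proj,
    ← mulL_cut_eq (measurableSet_shell i) ((bdd_modE _).sub (bdd_const 1))]
  refine norm_mulL_cut_le (by norm_num) fun ξ hξ ↦ (norm_modE_sub_one_le _ _).trans ?_
  have h1 : |ξ| ≤ 2 ^ i := hξ.1.le
  have h2 : (2 : ℝ) ^ (i + 2) ≤ 2 ^ q := pow_le_pow_right₀ (by norm_num) hi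
  have h3 : |1 / 2 ^ (q + 1) * ξ| ≤ 1 / 8 := by
    rw [abs_mul, abs_of_pos (by positivity : (0 : ℝ) < 1 / 2 ^ (q + 1)), one_div_mul_eq_div,
      div_le_iff₀ (by positivity)]
    rw [pow_add] at h2 ⊢
    linarith
  have := Real.pi_lt_d2
  nlinarith [Real.pi_pos]

/-- On the shell `q` this step gives `1/4 ≤ |hξ| ≤ 1/2`, where the multiplier `e^{2πihξ} - 1` has
modulus at least `1` and can be inverted. -/
theorem exists_inverse_modU_sub_one {q : ℕ} (hq : 2 ≤ q) :
    ∃ N : L2 →L[ℂ] L2, ‖N‖ ≤ 1 ∧ (modU (1 / 2 ^ (q + 1)) - 1) * N = shellP q ∧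
      N * (modU (1 / 2 ^ (q + 1)) - 1) = shellP q := by
  set h : ℝ := 1 / 2 ^ (q + 1) with hh
  have hlow : ∀ ξ ∈ shell q, 1 ≤ ‖modE h ξ - 1‖ := by
    intro ξ hξ
    have h1 : |ξ| < 2 ^ q := hξ.1
    have h2 : (2 : ℝ) ^ q ≤ 2 * |ξ| := hξ.2.resolve_left (by omega)
    have e : |h * ξ| = |ξ| / 2 ^ (q + 1) := by
      rw [abs_mul, abs_of_pos (by positivity : (0 : ℝ) < h), hh, one_div_mul_eq_div]
    apply one_le_norm_modE_sub_one
    · rw [e, le_div_iff₀ (by positivity), pow_succ]; linarith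
    · rw [e, div_le_iff₀ (by positivity), pow_succ]; linarith
  have hm : AEStronglyMeasurable (fun ξ ↦ (modE h ξ - 1)⁻¹) volume :=
    ((continuous_modE h).sub continuous_const).measurable.inv.aestronglyMeasurable
  have hb1 : ∀ ξ ∈ shell q, ‖(modE h ξ - 1)⁻¹‖ ≤ 1 := by
    intro ξ hξ
    rw [norm_inv]
    exact inv_le_one_of_one_le₀ (hlow ξ hξ)
  have hb : Bdd (cut (shell q) fun ξ ↦ (modE h ξ - 1)⁻¹) := bdd_cut (measurableSet_shell q) hm hb1
  refine ⟨mulL (cut (shell q) fun ξ ↦ (modE h ξ - 1)⁻¹), norm_mulL_cut_le zero_le_one hb1, ?_, ?_⟩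
  swap
  · rw [modU_sub_one, mulL_comm, ← modU_sub_one]
    rw [modU_sub_one, ← mulL_mul ((bdd_modE _).sub (bdd_const 1)) hb, shellP, proj]
    congr 1
    funext ξ
    by_cases hξ : ξ ∈ shell q
    · have : modE h ξ - 1 ≠ 0 := norm_pos_iff.1 (lt_of_lt_of_le one_pos (hlow ξ hξ))
      simp [cut, hξ, this]
    · simp [cut, hξ]
  · rw [modU_sub_one, ← mulL_mul ((bdd_modE _).sub (bdd_const 1)) hb, shellP, proj]
    congr 1
    funext ξ
    by_cases hξ : ξ ∈ shell q
    · have : modE h ξ - 1 ≠ 0 := norm_pos_iff.1 (lt_of_lt_of_le one_pos (hlow ξ hξ))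
      simp [cut, hξ, this]
    · simp [cut, hξ]

/-- Let `X` and `Y` be the blocks of `w` and of its difference, and `U = modU h`; then `U X - X U =
Y U`. On the higher shell `U - 1` has an inverse of norm at most `1`, on the lower one its norm is
at most `4/5`. Hence `‖X‖ ≤ 4/5 ‖X‖ + ‖Y‖`, and the first term is absorbed. -/
theorem norm_block_le_diff (hw : Bdd w) (hik : i + 2 ≤ k ∨ k + 2 ≤ i) :
    ‖shellP i * conjF w * shellP k‖ ≤
      5 * ‖shellP i * conjF (diff (1 / 2 ^ (max i k + 1)) w) * shellP k‖ := by
  set q := max i k with hq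
  set h : ℝ := 1 / 2 ^ (q + 1) with hh
  set X := shellP i * conjF w * shellP k with hX
  set Y := shellP i * conjF (diff h w) * shellP k with hY
  have hid : X * modU h = modU h * X - Y * modU h := shell_comm_identity hw
  obtain ⟨N, hN, hN1, hN2⟩ := exists_inverse_modU_sub_one (q := q) (by omega)
  have hYU : ‖Y * modU h‖ ≤ ‖Y‖ := (norm_mul_le _ _).trans
    ((mul_le_mul_of_nonneg_left (norm_modU_le h) (norm_nonneg _)).trans (mul_one _).le)
  rcases hik with hik | hik
  · have hqk : q = k := by omega
    have e1 : X = (((modU h - 1) * shellP i) * X - Y * modU h) * N := by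
      have e2 : X = X * (modU h - 1) * N := by
        rw [mul_assoc, hN1, hqk, hX, mul_assoc _ (shellP k), shellP_mul_shellP]
      have e3 : shellP i * X = X := by
        rw [hX, ← mul_assoc, ← mul_assoc, shellP_mul_shellP]
      have e4 : X * (modU h - 1) = (modU h - 1) * shellP i * X - Y * modU h := by
        rw [mul_assoc _ (shellP i) X, e3, mul_sub, hid, sub_mul, mul_one, one_mul]
        abel
      rw [← e4]
      exact e2
    have h1 := norm_modU_sub_one_mul_shellP_le (i := i) (q := q) (by omega)
    have h2 : ‖((modU h - 1) * shellP i) * X - Y * modU h‖ ≤ 4 / 5 * ‖X‖ + ‖Y‖ :=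
      (norm_sub_le _ _).trans (add_le_add ((norm_mul_le _ _).trans
        (mul_le_mul_of_nonneg_right h1 (norm_nonneg _))) hYU)
    have h3 : ‖X‖ ≤ (4 / 5 * ‖X‖ + ‖Y‖) * 1 := by
      conv_lhs => rw [e1]
      exact (norm_mul_le _ _).trans (mul_le_mul h2 hN (norm_nonneg _) (by positivity))
    linarith
  · have hqk : q = i := by omega
    have e1 : X = N * (X * ((modU h - 1) * shellP k) + Y * modU h) := by
      have e2 : X = N * ((modU h - 1) * X) := by
        rw [← mul_assoc, hN2, hqk, hX, ← mul_assoc, ← mul_assoc, shellP_mul_shellP]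
      have e3 : X * shellP k = X := by
        rw [hX, mul_assoc _ (shellP k), shellP_mul_shellP]
      have e4 : (modU h - 1) * X = X * ((modU h - 1) * shellP k) + Y * modU h := by
        have : (modU h - 1) * shellP k = shellP k * (modU h - 1) := by
          rw [sub_mul, mul_sub, modU_shellP, one_mul, mul_one]
        rw [this, ← mul_assoc X, e3, mul_sub, hid, sub_mul, mul_one, one_mul]
        abel
      rw [← e4]
      exact e2
    have h1 := norm_modU_sub_one_mul_shellP_le (i := k) (q := q) (by omega)
    have h2 : ‖X * ((modU h - 1) * shellP k) + Y * modU h‖ ≤ ‖X‖ * (4 / 5) + ‖Y‖ :=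
      (norm_add_le _ _).trans (add_le_add ((norm_mul_le _ _).trans
        (mul_le_mul_of_nonneg_left h1 (norm_nonneg _))) hYU)
    have h3 : ‖X‖ ≤ 1 * (‖X‖ * (4 / 5) + ‖Y‖) := by
      conv_lhs => rw [e1]
      exact (norm_mul_le _ _).trans (mul_le_mul hN h2 (norm_nonneg _) zero_le_one)
    linarith

theorem norm_block_le_diff_iterate (hw : Bdd w) (hik : i + 2 ≤ k ∨ k + 2 ≤ i) (n : ℕ) :
    ‖shellP i * conjF w * shellP k‖ ≤
      5 ^ n * ‖shellP i * conjF ((diff (1 / 2 ^ (max i k + 1)))^[n] w) * shellP k‖ := by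
  induction n with
  | zero => simp
  | succ n ih =>
    refine (ih.trans (mul_le_mul_of_nonneg_left
      (norm_block_le_diff (bdd_diff_iterate hw _ n) hik)
      (pow_nonneg (by norm_num : (0 : ℝ) ≤ 5) n))).trans_eq ?_
    rw [pow_succ (5 : ℝ) n, Function.iterate_succ_apply']
    ring

end separation

/-- An operator on the frequency side which is bounded, Lipschitz under modulation, and has
off-diagonal decay of order `M + 1` with respect to the dyadic shells. -/
structure RegOp (M : ℕ) (K : ℝ) (T : L2 →L[ℂ] L2) : Prop where
  norm_le : ‖T‖ ≤ K
  lip : ∀ h, 0 < h → h ≤ 1 → ‖modU h * T - T * modU h‖ ≤ K * h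
  off : ∀ i k : ℕ, i + 2 ≤ k ∨ k + 2 ≤ i →
    ‖shellP i * T * shellP k‖ ≤ K * 2 ^ min i k * (1 / 2) ^ ((M + 1) * max i k)

/-- The norm `diffNorm` of `u` at the scale `s / h` is at most `κ` for all steps and shells once `s`
is small. Submultiplicativity gives `κ ^ l` for `u ^ l`, and the three properties are read off from
the terms of that norm. The room between `ρ` and `κ` is what pays for the differences. -/
theorem exists_regOp_pow {M : ℕ} (hM : 1 ≤ M) {u : ℝ → ℂ} (hu : Bdd u) {ρ κ D : ℝ} (hρ : 0 ≤ ρ)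
    (hρκ : ρ < κ) (hD : 0 ≤ D) (h0 : ‖conjF u‖ ≤ ρ)
    (h1 : ∀ h, 0 < h → h ≤ 1 → ∀ j, 1 ≤ j → j ≤ M → ‖conjF ((diff h)^[j] u)‖ ≤ D * h ^ j)
    (h2 : ∀ h, 0 < h → h ≤ 1 → ∀ i, shellSize i ((diff h)^[M + 1] u) ≤ D * h ^ (M + 1)) :
    ∃ K, 0 < K ∧ ∀ l : ℕ, RegOp M (K * κ ^ l) (conjF u ^ l) := by
  set S : ℝ := ∑ j ∈ Finset.range (M + 1), 2 ^ j with hS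
  have hS0 : 0 ≤ S := Finset.sum_nonneg fun j _ ↦ by positivity
  -- The factor `2 * D` appears because `shellSize` is at most twice the operator norm for
  -- differences of order at most `M`.
  obtain ⟨s, hs0, hs1, hsκ⟩ : ∃ s : ℝ, 0 < s ∧ s ≤ 1 ∧ ρ + s * (2 * D) * S ≤ κ := by
    refine ⟨min 1 ((κ - ρ) / (2 * D * S + 1)), ?_, min_le_left _ _, ?_⟩
    · exact lt_min one_pos (div_pos (by linarith) (by positivity))
    · have h3 : min 1 ((κ - ρ) / (2 * D * S + 1)) * (2 * D * S + 1) ≤ κ - ρ := by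
        rw [← le_div_iff₀ (by positivity)]; exact min_le_right _ _
      have h4 : 0 ≤ min 1 ((κ - ρ) / (2 * D * S + 1)) :=
        le_min zero_le_one (div_nonneg (by linarith) (by positivity))
      nlinarith
  have hκ : 0 < κ := by linarith
  have key : ∀ h, 0 < h → h ≤ 1 → ∀ i, diffNorm i h (s / h) M u ≤ κ := by
    intro h hh hh1 i
    refine (diffNorm_le_of_bounds (D := 2 * D) hh hs0.le hs1 (by positivity) h0 ?_ ?_).trans hsκ
    · intro j hj hjM
      have := h1 h hh hh1 j hj hjM
      have h3 : 0 ≤ D * h ^ j := by positivity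
      linarith
    · intro j hj hjM
      rcases Nat.lt_or_ge M j with h4 | h4
      · have : j = M + 1 := by omega
        subst this
        have h3 : 0 ≤ D * h ^ (M + 1) := by positivity
        have := h2 h hh hh1 i
        linarith
      · have := h1 h hh hh1 j hj h4
        have := shellSize_le i ((diff h)^[j] u)
        linarith
  -- The three summands serve the norm, the Lipschitz bound, and the off-diagonal decay, in this
  -- order.
  refine ⟨1 + 1 / s + (5 / s) ^ (M + 1), by positivity, fun l ↦ ?_⟩
  rw [← conjF_pow hu]
  have hul := hu.pow l
  have hκl : 0 < κ ^ l := by positivity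
  have key2 : ∀ h, 0 < h → h ≤ 1 → ∀ i, diffNorm i h (s / h) M (fun x ↦ u x ^ l) ≤ κ ^ l :=
    fun h hh hh1 i ↦ diffNorm_pow_le (by positivity) M hu (key h hh hh1 i) l
  have hs5 : 0 < (5 / s) ^ (M + 1) := by positivity
  have hs' : 0 < 1 / s := by positivity
  refine ⟨?_, ?_, ?_⟩
  · have := (norm_conjF_le_diffNorm (i := 0) (h := 1) (σ := s / 1) (by positivity) M _).trans
      (key2 1 one_pos le_rfl 0)
    nlinarith
  · intro h hh hh1
    obtain ⟨M', rfl⟩ : ∃ M', M = M' + 1 := ⟨M - 1, by omega⟩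
    have h3 := (norm_conjF_diff_le_diffNorm (i := 0) (h := h) (σ := s / h) (by positivity) M' _).trans
      (key2 h hh hh1 0)
    have e : modU h * conjF (fun x ↦ u x ^ l) - conjF (fun x ↦ u x ^ l) * modU h =
        conjF (diff h fun x ↦ u x ^ l) * modU h := by
      rw [modU_conjF h hul, conjF_diff hul, sub_mul]; rfl
    rw [e]
    have h4 : ‖conjF (diff h fun x ↦ u x ^ l) * modU h‖ ≤ ‖conjF (diff h fun x ↦ u x ^ l)‖ :=
      (norm_mul_le _ _).trans
        ((mul_le_mul_of_nonneg_left (norm_modU_le h) (norm_nonneg _)).trans (mul_one _).le)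
    refine h4.trans ?_
    have h5 : ‖conjF (diff h fun x ↦ u x ^ l)‖ ≤ 1 / s * κ ^ l * h := by
      rw [div_mul_eq_mul_div, div_le_iff₀ hh] at h3
      rw [div_mul_eq_mul_div, div_mul_eq_mul_div, le_div_iff₀ hs0]
      linarith
    refine h5.trans ?_
    gcongr
    linarith
  · intro i k hik
    set q := max i k with hq
    set h : ℝ := 1 / 2 ^ (q + 1) with hh
    have hhpos : 0 < h := by positivity
    have hh1 : h ≤ 1 := by
      rw [hh, div_le_one (by positivity)]
      exact one_le_pow₀ (by norm_num)
    have h3 := norm_block_le_diff_iterate hul hik (M + 1)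
    set y := (diff h)^[M + 1] (fun x ↦ u x ^ l) with hy
    -- Only the projection to the lower shell is kept, because the bound by `shellSize` loses a
    -- power of two of the shell index.
    have h4 : ‖shellP i * conjF y * shellP k‖ ≤ 2 ^ min i k * shellSize (min i k) y := by
      have e : (2 : ℝ) ^ min i k * shellSize (min i k) y =
          ‖conjF y * shellP (min i k)‖ + ‖shellP (min i k) * conjF y‖ := by
        rw [shellSize, ← mul_assoc, ← mul_pow]; norm_num
      rw [e]
      rcases le_total i k with hle | hle
      · rw [min_eq_left hle]
        exact (norm_mul_shellP_le _ _).trans (le_add_of_nonneg_left (norm_nonneg _))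
      · rw [min_eq_right hle, mul_assoc]
        exact (norm_shellP_mul_le _ _).trans (le_add_of_nonneg_right (norm_nonneg _))
    have h5 := (shellSize_le_diffNorm (i := min i k) (h := h) (σ := s / h) (by positivity) M
      (fun x ↦ u x ^ l)).trans (key2 h hhpos hh1 _)
    have h6 : shellSize (min i k) y ≤ (1 / s) ^ (M + 1) * h ^ (M + 1) * κ ^ l := by
      rw [div_pow, div_mul_eq_mul_div, div_le_iff₀ (by positivity)] at h5
      rw [div_pow, one_pow, mul_assoc, div_mul_eq_mul_div, one_mul, le_div_iff₀ (by positivity)]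
      linarith
    have h7 : h ^ (M + 1) ≤ (1 / 2) ^ ((M + 1) * q) := by
      rw [mul_comm, pow_mul, hh]
      gcongr
      rw [div_pow, one_pow]
      gcongr
      · norm_num
      · omega
    calc ‖shellP i * conjF (fun x ↦ u x ^ l) * shellP k‖
        ≤ 5 ^ (M + 1) * (2 ^ min i k * ((1 / s) ^ (M + 1) * (1 / 2) ^ ((M + 1) * q) * κ ^ l)) := by
          refine h3.trans ?_
          gcongr
          refine h4.trans ?_
          gcongr
          refine h6.trans ?_
          gcongr
      _ = (5 / s) ^ (M + 1) * κ ^ l * 2 ^ min i k * (1 / 2) ^ ((M + 1) * q) := by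
          rw [div_pow, div_pow, one_pow]; ring
      _ ≤ _ := by
          gcongr
          linarith

end

/-! ### Frequency-localized commutators with Fourier multipliers. -/

section

open scoped ENNReal

/-! ### Commutators with Fourier multipliers between two frequency sets -/

/-- The commutator of the Fourier multiplier `a` with `T`, from the frequencies in `J` to those
in `I`. -/
def commBlock (T : L2 →L[ℂ] L2) (I J : Set ℝ) (a : ℝ → ℂ) : L2 →L[ℂ] L2 :=
  mulL (cut I a) * T * proj J - proj I * T * mulL (cut J a)

section commBlock

variable {T : L2 →L[ℂ] L2} {I J : Set ℝ} {a b : ℝ → ℂ} {K : ℝ}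

theorem commBlock_eq (hI : MeasurableSet I) (hJ : MeasurableSet J) (hIa : Bdd (cut I a))
    (hJa : Bdd (cut J a)) : commBlock T I J a =
      mulL (cut I a) * (proj I * T * proj J) - (proj I * T * proj J) * mulL (cut J a) := by
  rw [commBlock]
  congr 1
  · rw [← mul_assoc, ← mul_assoc, mulL_cut_mul_proj hI hIa]
  · rw [mul_assoc _ (proj J), proj_mul_mulL_cut hJ hJa]

theorem norm_commBlock_le (hI : MeasurableSet I) (hJ : MeasurableSet J) {B : ℝ} (hB : 0 ≤ B)
    (ham : AEStronglyMeasurable a volume) (hIa : ∀ ξ ∈ I, ‖a ξ‖ ≤ B) (hJa : ∀ ξ ∈ J, ‖a ξ‖ ≤ B) :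
    ‖commBlock T I J a‖ ≤ 2 * B * ‖proj I * T * proj J‖ := by
  rw [commBlock_eq hI hJ (bdd_cut hI ham hIa) (bdd_cut hJ ham hJa)]
  have h1 := norm_mulL_cut_le hB hIa
  have h2 := norm_mulL_cut_le hB hJa
  have h3 := norm_mul_le (mulL (cut I a)) (proj I * T * proj J)
  have h4 := norm_mul_le (proj I * T * proj J) (mulL (cut J a))
  have h5 := norm_sub_le (mulL (cut I a) * (proj I * T * proj J))
    ((proj I * T * proj J) * mulL (cut J a))
  nlinarith [norm_nonneg (proj I * T * proj J)]

theorem norm_proj_mul_mul_proj_le (T : L2 →L[ℂ] L2) (I J : Set ℝ) : ‖proj I * T * proj J‖ ≤ ‖T‖ := by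
  have h1 := norm_mul_le (proj I * T) (proj J)
  have h2 := norm_mul_le (proj I) T
  have h3 := norm_proj_le I
  have h4 := norm_proj_le J
  nlinarith [norm_nonneg (proj I * T), norm_nonneg T, norm_nonneg (proj I)]

theorem norm_commBlock_le' (hI : MeasurableSet I) (hJ : MeasurableSet J) {B : ℝ} (hB : 0 ≤ B)
    (ham : AEStronglyMeasurable a volume) (hIa : ∀ ξ ∈ I, ‖a ξ‖ ≤ B) (hJa : ∀ ξ ∈ J, ‖a ξ‖ ≤ B)
    (hT : ‖T‖ ≤ K) : ‖commBlock T I J a‖ ≤ 2 * B * K :=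
  (norm_commBlock_le hI hJ hB ham hIa hJa).trans
    (mul_le_mul_of_nonneg_left ((norm_proj_mul_mul_proj_le T I J).trans hT) (by positivity))

theorem commBlock_sub (hIa : Bdd (cut I a)) (hJa : Bdd (cut J a)) (hIb : Bdd (cut I b))
    (hJb : Bdd (cut J b)) : commBlock T I J (fun ξ ↦ a ξ - b ξ) =
      commBlock T I J a - commBlock T I J b := by
  have e : ∀ s : Set ℝ, cut s (fun ξ ↦ a ξ - b ξ) = fun ξ ↦ cut s a ξ - cut s b ξ := by
    intro s; funext ξ; by_cases h : ξ ∈ s <;> simp [cut, h]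
  simp only [commBlock, e, mulL_sub hIa hIb, mulL_sub hJa hJb, sub_mul, mul_sub]
  abel

theorem commBlock_add (hIa : Bdd (cut I a)) (hJa : Bdd (cut J a)) (hIb : Bdd (cut I b))
    (hJb : Bdd (cut J b)) : commBlock T I J (fun ξ ↦ a ξ + b ξ) =
      commBlock T I J a + commBlock T I J b := by
  have e : ∀ s : Set ℝ, cut s (fun ξ ↦ a ξ + b ξ) = fun ξ ↦ cut s a ξ + cut s b ξ := by
    intro s; funext ξ; by_cases h : ξ ∈ s <;> simp [cut, h]
  simp only [commBlock, e, mulL_add hIa hIb, mulL_add hJa hJb, add_mul, mul_add]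
  abel

theorem mulL_cut_const (hI : MeasurableSet I) (k : ℂ) : mulL (cut I fun _ ↦ k) = k • proj I := by
  rw [mulL_cut_eq hI (bdd_const k), mulL_const, mul_smul_comm, mul_one]

theorem commBlock_const (hI : MeasurableSet I) (hJ : MeasurableSet J) (k : ℂ) :
    commBlock T I J (fun _ ↦ k) = 0 := by
  rw [commBlock, mulL_cut_const hI, mulL_cut_const hJ]
  simp

theorem bdd_cut_const (hI : MeasurableSet I) (k : ℂ) : Bdd (cut I fun _ ↦ k) :=
  bdd_cut hI aestronglyMeasurable_const (K := ‖k‖) (by simp)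

theorem commBlock_sub_const (hI : MeasurableSet I) (hJ : MeasurableSet J) (hIa : Bdd (cut I a))
    (hJa : Bdd (cut J a)) (k : ℂ) : commBlock T I J (fun ξ ↦ a ξ - k) = commBlock T I J a := by
  rw [commBlock_sub hIa hJa (bdd_cut_const hI k) (bdd_cut_const hJ k), commBlock_const hI hJ, sub_zero]

/-- The commutator is a derivation; the projections in the middle are absorbed by the cut-off
multipliers next to them. -/
theorem commBlock_mul (hI : MeasurableSet I) (hJ : MeasurableSet J) (hIa : Bdd (cut I a))
    (hJa : Bdd (cut J a)) (hIb : Bdd (cut I b)) (hJb : Bdd (cut J b)) :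
    commBlock T I J (fun ξ ↦ a ξ * b ξ) =
      mulL (cut I a) * commBlock T I J b + commBlock T I J a * mulL (cut J b) := by
  have e : ∀ s : Set ℝ, cut s (fun ξ ↦ a ξ * b ξ) = fun ξ ↦ cut s a ξ * cut s b ξ := by
    intro s; funext ξ; by_cases h : ξ ∈ s <;> simp [cut, h]
  simp only [commBlock, e, mulL_mul hIa hIb, mulL_mul hJa hJb, sub_mul, mul_sub]
  have h1 : mulL (cut I a) * (proj I * T * mulL (cut J b)) =
      mulL (cut I a) * T * proj J * mulL (cut J b) := by
    rw [← mul_assoc, ← mul_assoc, mulL_cut_mul_proj hI hIa, mul_assoc _ (proj J),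
      proj_mul_mulL_cut hJ hJb]
  rw [h1]
  simp only [mul_assoc]
  abel

/-- The Lipschitz bound of an operator under modulations. -/
def LipOp (K : ℝ) (T : L2 →L[ℂ] L2) : Prop :=
  ∀ h, 0 < h → h ≤ 1 → ‖modU h * T - T * modU h‖ ≤ K * h

theorem norm_freq_sub_le {h ξ : ℝ} (hh : 0 < h) (h1 : 2 * Real.pi * h * |ξ| ≤ 1) :
    ‖(ξ : ℂ) - (modE h ξ - 1) / (2 * Real.pi * Complex.I * h)‖ ≤ 2 * Real.pi * h * |ξ| ^ 2 := by
  set z : ℂ := 2 * Real.pi * Complex.I * h * ξ with hz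
  have hzn : ‖z‖ = 2 * Real.pi * h * |ξ| := by
    rw [hz]
    simp [abs_of_pos hh, abs_of_pos Real.pi_pos]
  have h2 := Complex.norm_exp_sub_one_sub_id_le (x := z) (by rw [hzn]; exact h1)
  have hne : (2 * Real.pi * Complex.I * h : ℂ) ≠ 0 := by
    simp [Real.pi_ne_zero, hh.ne']
  have e : (ξ : ℂ) - (modE h ξ - 1) / (2 * Real.pi * Complex.I * h) =
      -(cexp z - 1 - z) / (2 * Real.pi * Complex.I * h) := by
    rw [eq_div_iff hne, sub_mul, div_mul_cancel₀ _ hne, modE, ← hz]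
    rw [hz]; ring
  have hn : ‖(2 * Real.pi * Complex.I * h : ℂ)‖ = 2 * Real.pi * h := by
    simp [abs_of_pos hh, abs_of_pos Real.pi_pos]
  rw [e, norm_div, norm_neg, hn, div_le_iff₀ (by positivity)]
  refine h2.trans (le_of_eq ?_)
  rw [hzn]; ring

/-- On bounded frequencies `ξ` is the uniform limit of `(e^{2πihξ} - 1) / (2πih)`, whose commutator
with `T` is controlled by the Lipschitz bound divided by `2πh`. The bound `B` on the frequencies
only makes `ξ` a bounded multiplier and does not enter the result. -/
theorem norm_commBlock_id_le (hI : MeasurableSet I) (hJ : MeasurableSet J) {B : ℝ}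
    (hIB : ∀ ξ ∈ I, |ξ| ≤ B) (hJB : ∀ ξ ∈ J, |ξ| ≤ B) (hK : 0 ≤ K) (hT : LipOp K T) :
    ‖commBlock T I J (fun ξ ↦ (ξ : ℂ))‖ ≤ K := by
  wlog hB : 0 ≤ B generalizing B
  · exact this (B := |B|) (fun ξ hξ ↦ (hIB ξ hξ).trans (le_abs_self B))
      (fun ξ hξ ↦ (hJB ξ hξ).trans (le_abs_self B)) (abs_nonneg B)
  have hidm : AEStronglyMeasurable (fun ξ : ℝ ↦ (ξ : ℂ)) volume :=
    Complex.continuous_ofReal.aestronglyMeasurable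
  have hidI : Bdd (cut I fun ξ ↦ (ξ : ℂ)) := bdd_cut hI hidm (K := B) fun ξ hξ ↦ by
    simpa using hIB ξ hξ
  have hidJ : Bdd (cut J fun ξ ↦ (ξ : ℂ)) := bdd_cut hJ hidm (K := B) fun ξ hξ ↦ by
    simpa using hJB ξ hξ
  -- `C * h` is the error of replacing `ξ` by its difference quotient; it disappears as `h` tends to
  -- `0`.
  set C : ℝ := 2 * (2 * Real.pi * B ^ 2) * ‖T‖ with hC
  have key : ∀ h, 0 < h → h ≤ 1 → 2 * Real.pi * h * B ≤ 1 →
      ‖commBlock T I J (fun ξ ↦ (ξ : ℂ))‖ ≤ K + C * h := by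
    intro h hh hh1 hhB
    set k : ℂ := (2 * Real.pi * Complex.I * h)⁻¹ with hk
    set b : ℝ → ℂ := fun ξ ↦ (modE h ξ - 1) / (2 * Real.pi * Complex.I * h) with hb
    have hbb : Bdd b := by
      have := ((bdd_modE h).sub (bdd_const 1)).mul (bdd_const k)
      simpa only [hb, hk, div_eq_mul_inv] using this
    have hbm : mulL b = k • (modU h - 1) := by
      rw [modU_sub_one]
      have : b = fun ξ ↦ k * (modE h ξ - 1) := by
        funext ξ; simp only [hb, hk, div_eq_mul_inv, mul_comm]
      rw [this, mulL_mul (bdd_const k) ((bdd_modE h).sub (bdd_const 1)), mulL_const,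
        smul_mul_assoc, one_mul]
    have hbI : Bdd (cut I b) := hbb.indicator hI
    have hbJ : Bdd (cut J b) := hbb.indicator hJ
    have e1 : commBlock T I J b = k • (proj I * (modU h * T - T * modU h) * proj J) := by
      rw [commBlock, mulL_cut_eq hI hbb, mulL_cut_eq hJ hbb, hbm]
      have c : proj J * modU h = modU h * proj J := mulL_comm _ _
      simp only [mul_sub, sub_mul, mul_smul_comm, smul_mul_assoc, mul_one, mul_assoc, c]
      rw [← smul_sub]
      congr 1
      abel
    have hkn : ‖k‖ = (2 * Real.pi * h)⁻¹ := by
      rw [hk, norm_inv]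
      simp [abs_of_pos hh, abs_of_pos Real.pi_pos]
    have e2 : ‖commBlock T I J b‖ ≤ K := by
      rw [e1, norm_smul, hkn]
      have h3 := (norm_proj_mul_mul_proj_le (modU h * T - T * modU h) I J).trans (hT h hh hh1)
      rw [inv_mul_le_iff₀ (by positivity)]
      have : K * h ≤ 2 * Real.pi * h * K := by
        have := Real.pi_gt_three
        have : 0 ≤ K * h := by positivity
        nlinarith
      linarith
    have e3 : ‖commBlock T I J (fun ξ ↦ (ξ : ℂ) - b ξ)‖ ≤ C * h := by
      have hsmall : ∀ ξ, |ξ| ≤ B → ‖(ξ : ℂ) - b ξ‖ ≤ 2 * Real.pi * h * B ^ 2 := by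
        intro ξ hξ
        refine (norm_freq_sub_le hh ?_).trans ?_
        · exact (mul_le_mul_of_nonneg_left hξ (by positivity)).trans hhB
        · gcongr
      have := norm_commBlock_le' (T := T) hI hJ (B := 2 * Real.pi * h * B ^ 2) (by positivity)
        (hidm.sub hbb.1) (fun ξ hξ ↦ hsmall ξ (hIB ξ hξ)) (fun ξ hξ ↦ hsmall ξ (hJB ξ hξ)) le_rfl
      refine this.trans (le_of_eq ?_)
      rw [hC]; ring
    rw [commBlock_sub hidI hidJ hbI hbJ] at e3
    have := norm_le_norm_add_norm_sub' (commBlock T I J fun ξ ↦ (ξ : ℂ)) (commBlock T I J b)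
    linarith
  refine le_of_forall_pos_le_add fun ε hε ↦ ?_
  have hC0 : 0 ≤ C := by positivity
  set h := min 1 (min (1 / (2 * Real.pi * B + 1)) (ε / (C + 1))) with hh
  have h1 : 0 < h := by positivity
  have h2 : h ≤ 1 / (2 * Real.pi * B + 1) := (min_le_right _ _).trans (min_le_left _ _)
  have h3 : h ≤ ε / (C + 1) := (min_le_right _ _).trans (min_le_right _ _)
  rw [le_div_iff₀ (by positivity)] at h2 h3
  refine (key h h1 (min_le_left _ _) (by linarith)).trans ?_
  linarith

/-- Let `X` be the block and `x = ξ - ξ₀`. The commutator bound says that `X x` and `x X` differ by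
at most `K`; `x` is at most `r` on the left, and its inverse at most `1 / r'` on the right. So `‖X‖
≤ (r ‖X‖ + K) / r'`. -/
theorem norm_proj_mul_proj_le_of_separated (hI : MeasurableSet I) (hJ : MeasurableSet J)
    {B r r' ξ₀ : ℝ} (hr : 0 ≤ r) (hrr' : r < r') (hIB : ∀ ξ ∈ I, |ξ| ≤ B) (hJB : ∀ ξ ∈ J, |ξ| ≤ B)
    (hIr : ∀ ξ ∈ I, |ξ - ξ₀| ≤ r) (hJr : ∀ ξ ∈ J, r' ≤ |ξ - ξ₀|) (hK : 0 ≤ K) (hT : LipOp K T) :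
    ‖proj I * T * proj J‖ ≤ K / (r' - r) := by
  have hr' : 0 < r' := by linarith
  set x : ℝ → ℂ := fun ξ ↦ (ξ : ℂ) - ξ₀ with hx
  have hidm : AEStronglyMeasurable (fun ξ : ℝ ↦ (ξ : ℂ)) volume :=
    Complex.continuous_ofReal.aestronglyMeasurable
  have hxm : Measurable x := by rw [hx]; fun_prop
  have hxn : ∀ ξ, ‖x ξ‖ = |ξ - ξ₀| := fun ξ ↦ by
    simp only [hx]; rw [← ofReal_sub, norm_real, Real.norm_eq_abs]
  have hidI : Bdd (cut I fun ξ ↦ (ξ : ℂ)) := bdd_cut hI hidm (K := B) fun ξ hξ ↦ by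
    simpa using hIB ξ hξ
  have hidJ : Bdd (cut J fun ξ ↦ (ξ : ℂ)) := bdd_cut hJ hidm (K := B) fun ξ hξ ↦ by
    simpa using hJB ξ hξ
  have hxI : Bdd (cut I x) := bdd_cut hI hxm.aestronglyMeasurable (K := r)
    fun ξ hξ ↦ by rw [hxn]; exact hIr ξ hξ
  have hxJ : Bdd (cut J x) := bdd_cut hJ hxm.aestronglyMeasurable (K := B + |ξ₀|) fun ξ hξ ↦ by
    rw [hxn]; exact (abs_sub _ _).trans (by gcongr; exact hJB ξ hξ)
  have hcomm : ‖commBlock T I J x‖ ≤ K := by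
    rw [hx, commBlock_sub_const hI hJ hidI hidJ]
    exact norm_commBlock_id_le hI hJ hIB hJB hK hT
  rw [commBlock_eq hI hJ hxI hxJ] at hcomm
  set X := proj I * T * proj J with hX
  have hn : ∀ ξ ∈ J, ‖(x ξ)⁻¹‖ ≤ 1 / r' := fun ξ hξ ↦ by
    rw [norm_inv, hxn, one_div]
    exact inv_anti₀ hr' (hJr ξ hξ)
  have hNb : Bdd (cut J fun ξ ↦ (x ξ)⁻¹) := bdd_cut hJ hxm.inv.aestronglyMeasurable hn
  have hXN : X = X * mulL (cut J x) * mulL (cut J fun ξ ↦ (x ξ)⁻¹) := by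
    rw [mul_assoc, ← mulL_mul hxJ hNb]
    have : (fun ξ ↦ cut J x ξ * cut J (fun ξ ↦ (x ξ)⁻¹) ξ) = cut J fun _ ↦ 1 := by
      funext ξ
      by_cases h : ξ ∈ J
      · have : x ξ ≠ 0 := norm_pos_iff.1 (by rw [hxn]; exact hr'.trans_le (hJr ξ h))
        simp [cut, h, this]
      · simp [cut, h]
    rw [this, ← proj, hX, mul_assoc _ (proj J), proj_mul_proj hJ]
  have h1 : ‖X * mulL (cut J x)‖ ≤ r * ‖X‖ + K := by
    have h2 : ‖mulL (cut I x) * X‖ ≤ r * ‖X‖ := (norm_mul_le _ _).trans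
      (mul_le_mul_of_nonneg_right (norm_mulL_cut_le hr fun ξ hξ ↦ by rw [hxn]; exact hIr ξ hξ)
        (norm_nonneg _))
    have h3 := norm_sub_norm_le (X * mulL (cut J x)) (mulL (cut I x) * X)
    rw [norm_sub_rev] at h3
    linarith
  have h2 : ‖X‖ ≤ (r * ‖X‖ + K) * (1 / r') := by
    conv_lhs => rw [hXN]
    exact (norm_mul_le _ _).trans (mul_le_mul h1 (norm_mulL_cut_le (by positivity) hn)
      (norm_nonneg _) (by positivity))
  rw [mul_one_div, le_div_iff₀ hr'] at h2
  rw [le_div_iff₀ (by linarith)]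
  linarith

/-- Leibniz rule: `j` terms, each with one commutator of `ξ` and `j - 1` factors of size at most
`r`. -/
theorem norm_commBlock_pow_le (hI : MeasurableSet I) (hJ : MeasurableSet J) {B r ξ₀ : ℝ}
    (hr : 0 ≤ r) (hIB : ∀ ξ ∈ I, |ξ| ≤ B) (hJB : ∀ ξ ∈ J, |ξ| ≤ B)
    (hIr : ∀ ξ ∈ I, |ξ - ξ₀| ≤ r) (hJr : ∀ ξ ∈ J, |ξ - ξ₀| ≤ r) (hK : 0 ≤ K) (hT : LipOp K T)
    (j : ℕ) : ‖commBlock T I J (fun ξ ↦ ((ξ : ℂ) - ξ₀) ^ j)‖ ≤ K * (j * r ^ (j - 1)) := by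
  set x : ℝ → ℂ := fun ξ ↦ (ξ : ℂ) - ξ₀ with hx
  have hidm : AEStronglyMeasurable (fun ξ : ℝ ↦ (ξ : ℂ)) volume :=
    Complex.continuous_ofReal.aestronglyMeasurable
  have hxm : Measurable x := by rw [hx]; fun_prop
  have hxn : ∀ ξ, ‖x ξ‖ = |ξ - ξ₀| := fun ξ ↦ by
    simp only [hx]; rw [← ofReal_sub, norm_real, Real.norm_eq_abs]
  have hidI : Bdd (cut I fun ξ ↦ (ξ : ℂ)) := bdd_cut hI hidm (K := B) fun ξ hξ ↦ by
    simpa using hIB ξ hξ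
  have hidJ : Bdd (cut J fun ξ ↦ (ξ : ℂ)) := bdd_cut hJ hidm (K := B) fun ξ hξ ↦ by
    simpa using hJB ξ hξ
  have hnI : ∀ j : ℕ, ∀ ξ ∈ I, ‖x ξ ^ j‖ ≤ r ^ j := fun j ξ hξ ↦ by
    rw [norm_pow, hxn]; gcongr; exact hIr ξ hξ
  have hnJ : ∀ j : ℕ, ∀ ξ ∈ J, ‖x ξ ^ j‖ ≤ r ^ j := fun j ξ hξ ↦ by
    rw [norm_pow, hxn]; gcongr; exact hJr ξ hξ
  have hbI : ∀ j : ℕ, Bdd (cut I fun ξ ↦ x ξ ^ j) := fun j ↦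
    bdd_cut hI (hxm.pow_const j).aestronglyMeasurable (hnI j)
  have hbJ : ∀ j : ℕ, Bdd (cut J fun ξ ↦ x ξ ^ j) := fun j ↦
    bdd_cut hJ (hxm.pow_const j).aestronglyMeasurable (hnJ j)
  have hxI : Bdd (cut I x) := by simpa using hbI 1
  have hxJ : Bdd (cut J x) := by simpa using hbJ 1
  have hcomm : ‖commBlock T I J x‖ ≤ K := by
    rw [hx, commBlock_sub_const hI hJ hidI hidJ]
    exact norm_commBlock_id_le hI hJ hIB hJB hK hT
  induction j with
  | zero => simp [commBlock_const hI hJ]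
  | succ j ih =>
    have e : (fun ξ ↦ x ξ ^ (j + 1)) = fun ξ ↦ x ξ * x ξ ^ j := by funext ξ; rw [pow_succ']
    rw [e, commBlock_mul hI hJ hxI hxJ (hbI j) (hbJ j)]
    have h1 : ‖mulL (cut I x)‖ ≤ r := norm_mulL_cut_le hr fun ξ hξ ↦ by
      rw [hxn]; exact hIr ξ hξ
    have h2 : ‖mulL (cut J fun ξ ↦ x ξ ^ j)‖ ≤ r ^ j := norm_mulL_cut_le (by positivity) (hnJ j)
    have h3 := (norm_mul_le (mulL (cut I x)) (commBlock T I J fun ξ ↦ x ξ ^ j)).trans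
      (mul_le_mul h1 ih (norm_nonneg _) hr)
    have h4 := (norm_mul_le (commBlock T I J x) (mulL (cut J fun ξ ↦ x ξ ^ j))).trans
      (mul_le_mul hcomm h2 (norm_nonneg _) hK)
    refine (norm_add_le _ _).trans ((add_le_add h3 h4).trans (le_of_eq ?_))
    rcases j with - | j
    · simp
    · simp only [Nat.add_sub_cancel]
      push_cast
      ring

/-- An absolute constant. -/
def geomConst : ℝ := ∑' j : ℕ, (j : ℝ) * (6 / 7 : ℝ) ^ (j - 1)

theorem summable_geomConst : Summable fun j : ℕ ↦ (j : ℝ) * (6 / 7 : ℝ) ^ (j - 1) := by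
  have h := (summable_pow_mul_geometric_of_norm_lt_one (R := ℝ) 1 (r := 6 / 7)
    (by norm_num)).mul_left (7 / 6)
  refine h.congr fun j ↦ ?_
  rcases j with - | j
  · simp
  · simp only [Nat.add_sub_cancel, pow_succ]
    ring

theorem geomConst_nonneg : 0 ≤ geomConst := tsum_nonneg fun j ↦ by positivity

/-- The symbol is expanded in its Taylor series about `ξ₀`. Cauchy's estimate `A / ρ ^ j` meets `K j
(6ρ/7)^{j-1}` from the commutator with the `j`-th power, and the sum is `geomConst * K * A / ρ`. -/
theorem norm_commBlock_analytic_le (hI : MeasurableSet I) (hJ : MeasurableSet J) {B A ρ ξ₀ : ℝ}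
    (hρ : 0 < ρ) (hIB : ∀ ξ ∈ I, |ξ| ≤ B) (hJB : ∀ ξ ∈ J, |ξ| ≤ B)
    (hIr : ∀ ξ ∈ I, |ξ - ξ₀| ≤ 6 / 7 * ρ) (hJr : ∀ ξ ∈ J, |ξ - ξ₀| ≤ 6 / 7 * ρ)
    (hK : 0 ≤ K) (hT : LipOp K T) (ham : AEStronglyMeasurable a volume) {φ : ℂ → ℂ}
    (hφ : DiffContOnCl ℂ φ (Metric.ball (ξ₀ : ℂ) ρ)) (hA : 0 ≤ A)
    (hφA : ∀ z ∈ Metric.sphere (ξ₀ : ℂ) ρ, ‖φ z‖ ≤ A)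
    (haI : ∀ ξ ∈ I, a ξ = φ ξ) (haJ : ∀ ξ ∈ J, a ξ = φ ξ) :
    ‖commBlock T I J a‖ ≤ geomConst * (K * A / ρ) := by
  set co : ℕ → ℂ := fun j ↦ (j.factorial : ℂ)⁻¹ * iteratedDeriv j φ ξ₀ with hco
  have hcob : ∀ j, ‖co j‖ ≤ A / ρ ^ j := by
    intro j
    have h1 := Complex.norm_iteratedDeriv_le_of_forall_mem_sphere_norm_le j hρ hφ hφA
    rw [hco]
    simp only [norm_mul, norm_inv, norm_natCast]
    rw [inv_mul_le_iff₀ (by positivity)]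
    rw [mul_div_assoc] at h1
    exact h1
  set X : ℝ → ℂ := fun ξ ↦ (ξ : ℂ) - ξ₀ with hX
  have hXn : ∀ ξ, ‖X ξ‖ = |ξ - ξ₀| := fun ξ ↦ by
    simp only [hX]; rw [← ofReal_sub, norm_real, Real.norm_eq_abs]
  have hXm : Measurable X := by rw [hX]; fun_prop
  have hsum : ∀ ξ : ℝ, |ξ - ξ₀| ≤ 6 / 7 * ρ → HasSum (fun j ↦ co j * X ξ ^ j) (φ ξ) := by
    intro ξ hξ
    have h1 : (ξ : ℂ) ∈ Metric.ball (ξ₀ : ℂ) ρ := by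
      rw [Metric.mem_ball, dist_eq_norm]
      have := hXn ξ
      simp only [hX] at this
      rw [this]; linarith
    have h2 := Complex.hasSum_taylorSeries_on_ball hφ.differentiableOn h1
    refine h2.congr_fun fun j ↦ ?_
    simp only [smul_eq_mul, hco, hX]; ring
  set s : ℕ → ℝ → ℂ := fun N ξ ↦ ∑ j ∈ Finset.range N, co j * X ξ ^ j with hs
  have hterm : ∀ ξ : ℝ, |ξ - ξ₀| ≤ 6 / 7 * ρ → ∀ j, ‖co j * X ξ ^ j‖ ≤ A * (6 / 7) ^ j := by
    intro ξ hξ j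
    rw [norm_mul, norm_pow, hXn]
    calc ‖co j‖ * |ξ - ξ₀| ^ j ≤ A / ρ ^ j * (6 / 7 * ρ) ^ j := by
          gcongr; exact hcob j
      _ = A * (6 / 7) ^ j := by
          rw [mul_pow]; field_simp
  have htail : ∀ ξ : ℝ, |ξ - ξ₀| ≤ 6 / 7 * ρ → ∀ N, ‖φ ξ - s N ξ‖ ≤ 7 * A * (6 / 7) ^ N := by
    intro ξ hξ N
    have h1 := (hasSum_nat_add_iff' N).2 (hsum ξ hξ)
    have h2 : HasSum (fun j : ℕ ↦ A * (6 / 7 : ℝ) ^ N * (6 / 7) ^ j) (A * (6 / 7 : ℝ) ^ N * 7) := by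
      have h3 := hasSum_geometric_of_lt_one (r := (6 / 7 : ℝ)) (by norm_num) (by norm_num)
      norm_num at h3
      exact h3.mul_left _
    have h4 := h1.norm_le_of_bounded h2 fun j ↦ by
      refine (hterm ξ hξ (j + N)).trans (le_of_eq ?_)
      rw [pow_add]; ring
    refine h4.trans (le_of_eq ?_)
    ring
  have hXb : ∀ S : Set ℝ, MeasurableSet S → (∀ ξ ∈ S, |ξ - ξ₀| ≤ 6 / 7 * ρ) → ∀ j : ℕ,
      Bdd (cut S fun ξ ↦ co j * X ξ ^ j) := fun S hS hSr j ↦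
    bdd_cut hS ((hXm.pow_const j).const_mul _).aestronglyMeasurable fun ξ hξ ↦ hterm ξ (hSr ξ hξ) j
  have hsm : ∀ N, Measurable (s N) := fun N ↦
    Finset.measurable_fun_sum _ fun j _ ↦ (hXm.pow_const j).const_mul _
  have hsb : ∀ S : Set ℝ, MeasurableSet S → (∀ ξ ∈ S, |ξ - ξ₀| ≤ 6 / 7 * ρ) → ∀ N : ℕ,
      Bdd (cut S (s N)) := fun S hS hSr N ↦
    bdd_cut hS (hsm N).aestronglyMeasurable (K := ∑ j ∈ Finset.range N, A * (6 / 7) ^ j)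
      fun ξ hξ ↦ norm_sum_le_of_le _ fun j _ ↦ hterm ξ (hSr ξ hξ) j
  have hone : ∀ j, ‖commBlock T I J (fun ξ ↦ co j * X ξ ^ j)‖ ≤
      K * A / ρ * (j * (6 / 7 : ℝ) ^ (j - 1)) := by
    intro j
    have hpI : Bdd (cut I fun ξ ↦ X ξ ^ j) := bdd_cut hI (hXm.pow_const j).aestronglyMeasurable
      (K := (6 / 7 * ρ) ^ j) fun ξ hξ ↦ by rw [norm_pow, hXn]; gcongr; exact hIr ξ hξ
    have hpJ : Bdd (cut J fun ξ ↦ X ξ ^ j) := bdd_cut hJ (hXm.pow_const j).aestronglyMeasurable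
      (K := (6 / 7 * ρ) ^ j) fun ξ hξ ↦ by rw [norm_pow, hXn]; gcongr; exact hJr ξ hξ
    rw [commBlock_mul hI hJ (bdd_cut_const hI (co j)) (bdd_cut_const hJ (co j)) hpI hpJ,
      commBlock_const hI hJ, zero_mul, add_zero]
    have h1 := norm_commBlock_pow_le hI hJ (by positivity : 0 ≤ 6 / 7 * ρ) hIB hJB hIr hJr hK hT j
    have h2 : ‖mulL (cut I fun _ ↦ co j)‖ ≤ A / ρ ^ j :=
      norm_mulL_cut_le (by positivity) fun _ _ ↦ hcob j
    refine (norm_mul_le _ _).trans ((mul_le_mul h2 h1 (norm_nonneg _) (by positivity)).trans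
      (le_of_eq ?_))
    rcases j with - | j
    · simp
    · simp only [Nat.add_sub_cancel]
      rw [mul_pow, pow_succ ρ]
      field_simp
  have hpart : ∀ N, ‖commBlock T I J (s N)‖ ≤
      ∑ j ∈ Finset.range N, K * A / ρ * (j * (6 / 7 : ℝ) ^ (j - 1)) := by
    intro N
    induction N with
    | zero => simp [hs, commBlock_const hI hJ]
    | succ N ih =>
      have e : s (N + 1) = fun ξ ↦ s N ξ + co N * X ξ ^ N := by
        funext ξ; simp only [hs, Finset.sum_range_succ]
      rw [e, commBlock_add (hsb I hI hIr N) (hsb J hJ hJr N) (hXb I hI hIr N) (hXb J hJ hJr N),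
        Finset.sum_range_succ]
      exact (norm_add_le _ _).trans (add_le_add ih (hone N))
  have hpart' : ∀ N, ‖commBlock T I J (s N)‖ ≤ geomConst * (K * A / ρ) := by
    intro N
    refine (hpart N).trans ?_
    rw [← Finset.mul_sum, mul_comm]
    gcongr
    exact summable_geomConst.sum_le_tsum _ fun j _ ↦ by positivity
  have hnorm : ∀ ξ : ℝ, |ξ - ξ₀| ≤ 6 / 7 * ρ → ‖φ ξ‖ ≤ 7 * A := by
    intro ξ hξ
    have := htail ξ hξ 0
    simpa [hs] using this
  have haIb : Bdd (cut I a) := bdd_cut hI ham (K := 7 * A) fun ξ hξ ↦ by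
    rw [haI ξ hξ]; exact hnorm ξ (hIr ξ hξ)
  have haJb : Bdd (cut J a) := bdd_cut hJ ham (K := 7 * A) fun ξ hξ ↦ by
    rw [haJ ξ hξ]; exact hnorm ξ (hJr ξ hξ)
  -- The Taylor polynomials converge uniformly on both frequency sets, so the truncation error costs
  -- `‖T‖` times a geometric factor and vanishes in the limit.
  have hfin : ∀ N, ‖commBlock T I J a‖ ≤
      geomConst * (K * A / ρ) + 2 * (7 * A) * ‖T‖ * (6 / 7 : ℝ) ^ N := by
    intro N
    have h1 := norm_commBlock_le' (T := T) hI hJ (B := 7 * A * (6 / 7) ^ N) (by positivity)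
      (ham.sub (hsm N).aestronglyMeasurable)
      (fun ξ hξ ↦ by rw [Pi.sub_apply, haI ξ hξ]; exact htail ξ (hIr ξ hξ) N)
      (fun ξ hξ ↦ by rw [Pi.sub_apply, haJ ξ hξ]; exact htail ξ (hJr ξ hξ) N) le_rfl
    have h2 : commBlock T I J (a - s N) = commBlock T I J a - commBlock T I J (s N) :=
      commBlock_sub haIb haJb (hsb I hI hIr N) (hsb J hJ hJr N)
    rw [h2] at h1
    have h3 := norm_le_norm_add_norm_sub' (commBlock T I J a) (commBlock T I J (s N))
    have h4 := hpart' N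
    linarith
  have hlim : Filter.Tendsto
      (fun N : ℕ ↦ geomConst * (K * A / ρ) + 2 * (7 * A) * ‖T‖ * (6 / 7 : ℝ) ^ N) Filter.atTop
      (nhds (geomConst * (K * A / ρ) + 2 * (7 * A) * ‖T‖ * 0)) :=
    ((tendsto_pow_atTop_nhds_zero_of_lt_one (by norm_num) (by norm_num)).const_mul _).const_add _
  rw [mul_zero, add_zero] at hlim
  exact ge_of_tendsto' hlim hfin

theorem proj_union {I' : Set ℝ} (hd : Disjoint I I') (hI : MeasurableSet I)
    (hI' : MeasurableSet I') : proj (I ∪ I') = proj I + proj I' := by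
  have e : cut (I ∪ I') (fun _ ↦ 1) = fun ξ ↦ cut I (fun _ ↦ 1) ξ + cut I' (fun _ ↦ 1) ξ :=
    Set.indicator_union_of_disjoint hd _
  rw [proj, e, mulL_add (bdd_cut_one hI) (bdd_cut_one hI')]
  rfl

theorem commBlock_union_left {I' : Set ℝ} (hd : Disjoint I I') (hI : MeasurableSet I)
    (hI' : MeasurableSet I') (hIa : Bdd (cut I a)) (hI'a : Bdd (cut I' a)) :
    commBlock T (I ∪ I') J a = commBlock T I J a + commBlock T I' J a := by
  have e : ∀ b : ℝ → ℂ, cut (I ∪ I') b = fun ξ ↦ cut I b ξ + cut I' b ξ := fun b ↦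
    Set.indicator_union_of_disjoint hd b
  rw [commBlock, proj_union hd hI hI', e, mulL_add hIa hI'a, commBlock, commBlock]
  simp only [add_mul]
  abel

theorem commBlock_union_right {J' : Set ℝ} (hd : Disjoint J J') (hJ : MeasurableSet J)
    (hJ' : MeasurableSet J') (hJa : Bdd (cut J a)) (hJ'a : Bdd (cut J' a)) :
    commBlock T I (J ∪ J') a = commBlock T I J a + commBlock T I J' a := by
  have e : ∀ b : ℝ → ℂ, cut (J ∪ J') b = fun ξ ↦ cut J b ξ + cut J' b ξ := fun b ↦
    Set.indicator_union_of_disjoint hd b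
  rw [commBlock, proj_union hd hJ hJ', e, mulL_add hJa hJ'a, commBlock, commBlock]
  simp only [mul_add]
  abel

end commBlock

/-- With `Q = 2 ^ max i k`, the frequencies satisfy `Q/4 ≤ |ξ| ≤ Q`. The positive ones lie within
`3Q/8` of the centre `5Q/8`, which is `6/7` of the radius `7Q/16`; the disc of that radius stays in
the sector since `7/10 < 1/√2`. Equal signs are treated by Taylor expansion, opposite signs by
separation. -/
theorem norm_commBlock_shell_le {T : L2 →L[ℂ] L2} {K A : ℝ} {i k : ℕ} (hi : i ≤ k + 1)
    (hk : k ≤ i + 1) (hq : 2 ≤ max i k) (hK : 0 ≤ K) (hT : LipOp K T) {a : ℝ → ℂ}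
    (ham : AEStronglyMeasurable a volume) {φ : ℂ → ℂ}
    (hφ : DifferentiableOn ℂ φ {z | 0 < z.re ∧ |z.im| ≤ z.re}) (hA : 0 ≤ A)
    (hφA : ∀ z : ℂ, 0 < z.re → |z.im| ≤ z.re → ‖z‖ ≤ 2 * 2 ^ max i k → ‖φ z‖ ≤ A)
    (ha : ∀ ξ : ℝ, ξ ≠ 0 → a ξ = φ (|ξ| : ℝ)) :
    ‖commBlock T (shell i) (shell k) a‖ ≤ (5 * geomConst + 8) * (K * A / 2 ^ max i k) := by
  set q := max i k with hqdef
  have hQ : (0 : ℝ) < 2 ^ q := by positivity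
  have hrange : ∀ j, 1 ≤ j → q ≤ j + 1 → j ≤ q → ∀ ξ ∈ shell j,
      2 ^ q / 4 ≤ |ξ| ∧ |ξ| ≤ 2 ^ q := by
    intro j hj1 hj2 hj3 ξ hξ
    have h1 : (2 : ℝ) ^ q ≤ 2 ^ (j + 1) := pow_le_pow_right₀ (by norm_num) hj2
    have h2 : (2 : ℝ) ^ j ≤ 2 ^ q := pow_le_pow_right₀ (by norm_num) hj3
    have h3 := hξ.2.resolve_left (by omega)
    have h4 := hξ.1
    rw [pow_succ] at h1
    constructor <;> linarith
  have hri := hrange i (by omega) (by omega) (by omega)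
  have hrk := hrange k (by omega) (by omega) (by omega)
  set pos : ℕ → Set ℝ := fun j ↦ shell j ∩ Set.Ioi 0 with hpos
  set neg : ℕ → Set ℝ := fun j ↦ shell j ∩ Set.Iic 0 with hneg
  have hposm : ∀ j, MeasurableSet (pos j) := fun j ↦ (measurableSet_shell j).inter measurableSet_Ioi
  have hnegm : ∀ j, MeasurableSet (neg j) := fun j ↦ (measurableSet_shell j).inter measurableSet_Iic
  have hunion : ∀ j, shell j = pos j ∪ neg j := fun j ↦ by
    rw [hpos, hneg, ← Set.inter_union_distrib_left, Set.Ioi_union_Iic, Set.inter_univ]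
  have hdisj : ∀ j, Disjoint (pos j) (neg j) := fun j ↦ by
    rw [Set.disjoint_left]
    rintro ξ ⟨-, h1⟩ ⟨-, h2⟩
    exact absurd (Set.mem_Ioi.1 h1) (not_lt.2 (Set.mem_Iic.1 h2))
  have hbound : ∀ ξ : ℝ, 2 ^ q / 4 ≤ |ξ| ∧ |ξ| ≤ 2 ^ q → ‖a ξ‖ ≤ A := by
    rintro ξ ⟨h1, h2⟩
    have h3 : 0 < |ξ| := by linarith
    rw [ha ξ (abs_pos.1 h3)]
    refine hφA _ (by simpa using h3) (by simp) ?_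
    rw [norm_real, Real.norm_eq_abs, abs_abs]
    linarith
  have hbs : ∀ j, (∀ ξ ∈ shell j, 2 ^ q / 4 ≤ |ξ| ∧ |ξ| ≤ 2 ^ q) → ∀ S, MeasurableSet S →
      S ⊆ shell j → Bdd (cut S a) := fun j hj S hS hSj ↦
    bdd_cut hS ham fun ξ hξ ↦ hbound ξ (hj ξ (hSj hξ))
  have hsub1 : ∀ j, pos j ⊆ shell j := fun j ↦ Set.inter_subset_left
  have hsub2 : ∀ j, neg j ⊆ shell j := fun j ↦ Set.inter_subset_left
  -- the ball around the middle of the positive frequencies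
  set ρ : ℝ := 7 / 16 * 2 ^ q with hρ
  set ξ₀ : ℝ := 5 / 8 * 2 ^ q with hξ₀
  have hball : ∀ z ∈ Metric.closedBall (ξ₀ : ℂ) ρ, 0 < z.re ∧ |z.im| ≤ z.re ∧ ‖z‖ ≤ 2 * 2 ^ q := by
    intro z hz
    rw [mem_closedBall_iff_norm] at hz
    have h1 : |z.re - ξ₀| ≤ ρ := by
      have := Complex.abs_re_le_norm (z - ξ₀)
      simp only [sub_re, ofReal_re] at this
      linarith
    have h2 : (z.re - ξ₀) ^ 2 + z.im ^ 2 ≤ ρ ^ 2 := by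
      have h3 : ‖z - ξ₀‖ ^ 2 ≤ ρ ^ 2 := by gcongr
      rw [← Complex.normSq_eq_norm_sq, Complex.normSq_apply] at h3
      simp only [sub_re, sub_im, ofReal_re, ofReal_im, sub_zero] at h3
      nlinarith
    have h4 : 0 < z.re := by
      have := (abs_le.1 h1).1
      rw [hξ₀, hρ] at this
      linarith
    refine ⟨h4, ?_, ?_⟩
    · apply abs_le_of_sq_le_sq _ h4.le
      rw [hξ₀, hρ] at h2
      nlinarith [sq_nonneg (z.re - 5 / 16 * 2 ^ q)]
    · have h5 : ‖z‖ ≤ ‖z - ξ₀‖ + ‖(ξ₀ : ℂ)‖ := by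
        simpa using norm_add_le (z - ξ₀) (ξ₀ : ℂ)
      rw [norm_real, Real.norm_eq_abs, abs_of_pos (by positivity)] at h5
      rw [hξ₀, hρ] at *
      linarith
  have hdiff : DiffContOnCl ℂ φ (Metric.ball (ξ₀ : ℂ) ρ) := by
    have hsubset : closure (Metric.ball (ξ₀ : ℂ) ρ) ⊆ {z | 0 < z.re ∧ |z.im| ≤ z.re} :=
      fun z hz ↦ ⟨(hball z (Metric.closure_ball_subset_closedBall hz)).1,
        (hball z (Metric.closure_ball_subset_closedBall hz)).2.1⟩
    exact (hφ.mono hsubset).diffContOnCl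
  have hdiff' : DiffContOnCl ℂ (fun z ↦ φ (-z)) (Metric.ball ((-ξ₀ : ℝ) : ℂ) ρ) := by
    refine hdiff.comp (g := fun z ↦ -z) (f := φ) differentiable_neg.diffContOnCl ?_
    intro z hz
    rw [Metric.mem_ball, dist_eq_norm] at hz ⊢
    have e : -z - (ξ₀ : ℂ) = -(z - ((-ξ₀ : ℝ) : ℂ)) := by push_cast; ring
    rwa [e, norm_neg]
  have hsph : ∀ z ∈ Metric.sphere (ξ₀ : ℂ) ρ, ‖φ z‖ ≤ A := fun z hz ↦ by
    obtain ⟨h1, h2, h3⟩ := hball z (Metric.sphere_subset_closedBall hz)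
    exact hφA z h1 h2 h3
  have hsph' : ∀ z ∈ Metric.sphere ((-ξ₀ : ℝ) : ℂ) ρ, ‖φ (-z)‖ ≤ A := fun z hz ↦ by
    refine hsph _ ?_
    rw [mem_sphere_iff_norm] at hz ⊢
    rw [← norm_neg, ← hz]
    congr 1
    push_cast
    ring
  have hLB : ∀ j, (∀ ξ ∈ shell j, 2 ^ q / 4 ≤ |ξ| ∧ |ξ| ≤ 2 ^ q) → ∀ ξ ∈ pos j,
      |ξ| ≤ 2 ^ q ∧ |ξ - ξ₀| ≤ 6 / 7 * ρ ∧ 7 / 8 * 2 ^ q ≤ |ξ - (-ξ₀)| := by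
    rintro j hj ξ ⟨h1, h2⟩
    have h3 := hj ξ h1
    have h2' : 0 < ξ := h2
    rw [abs_of_pos h2'] at h3 ⊢
    refine ⟨h3.2, ?_, ?_⟩
    · rw [abs_le, hξ₀, hρ]; constructor <;> linarith
    · rw [abs_of_pos (by rw [hξ₀]; linarith), hξ₀]; linarith
  have hLB' : ∀ j, (∀ ξ ∈ shell j, 2 ^ q / 4 ≤ |ξ| ∧ |ξ| ≤ 2 ^ q) → ∀ ξ ∈ neg j,
      |ξ| ≤ 2 ^ q ∧ |ξ - (-ξ₀ : ℝ)| ≤ 6 / 7 * ρ ∧ 7 / 8 * 2 ^ q ≤ |ξ - ξ₀| := by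
    rintro j hj ξ ⟨h1, h2⟩
    have h3 := hj ξ h1
    have h2' : ξ ≤ 0 := h2
    rw [abs_of_nonpos h2'] at h3 ⊢
    refine ⟨h3.2, ?_, ?_⟩
    · rw [abs_le, hξ₀, hρ]; constructor <;> linarith
    · rw [abs_of_nonpos (by rw [hξ₀]; linarith), hξ₀]; linarith
  have hapos : ∀ j, ∀ ξ ∈ pos j, a ξ = φ ξ := by
    rintro j ξ ⟨-, h⟩
    have h' : 0 < ξ := h
    rw [ha ξ h'.ne', abs_of_pos h']
  have haneg : ∀ j, (∀ ξ ∈ shell j, 2 ^ q / 4 ≤ |ξ| ∧ |ξ| ≤ 2 ^ q) → ∀ ξ ∈ neg j,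
      a ξ = φ (-ξ) := by
    rintro j hj ξ ⟨h1, h⟩
    have h' : ξ ≤ 0 := h
    have h3 : ξ ≠ 0 := by
      rintro rfl
      have := (hj 0 h1).1
      rw [abs_zero] at this
      linarith
    rw [ha ξ h3, abs_of_nonpos h']
    push_cast
    rfl
  have hKA : 0 ≤ K * A / 2 ^ q := by positivity
  have hpp : ‖commBlock T (pos i) (pos k) a‖ ≤ geomConst * (K * A / ρ) :=
    norm_commBlock_analytic_le (hposm i) (hposm k) (by positivity)
      (fun ξ hξ ↦ (hLB i hri ξ hξ).1) (fun ξ hξ ↦ (hLB k hrk ξ hξ).1)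
      (fun ξ hξ ↦ (hLB i hri ξ hξ).2.1) (fun ξ hξ ↦ (hLB k hrk ξ hξ).2.1) hK hT ham hdiff hA hsph
      (hapos i) (hapos k)
  have hnn : ‖commBlock T (neg i) (neg k) a‖ ≤ geomConst * (K * A / ρ) :=
    norm_commBlock_analytic_le (ξ₀ := -ξ₀) (hnegm i) (hnegm k) (by positivity)
      (fun ξ hξ ↦ (hLB' i hri ξ hξ).1) (fun ξ hξ ↦ (hLB' k hrk ξ hξ).1)
      (fun ξ hξ ↦ (hLB' i hri ξ hξ).2.1) (fun ξ hξ ↦ (hLB' k hrk ξ hξ).2.1) hK hT ham hdiff' hA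
      hsph' (haneg i hri) (haneg k hrk)
  have hr67 : 6 / 7 * ρ < 7 / 8 * 2 ^ q := by rw [hρ]; linarith
  have hdenom : K / (7 / 8 * 2 ^ q - 6 / 7 * ρ) = 2 * (K / 2 ^ q) := by
    rw [hρ]; field_simp; ring
  -- Frequencies of opposite sign: the relevant distances to the centre are at most `3/8` and at
  -- least `7/8` of `2 ^ q`, so the block itself is `O(K / 2 ^ q)` and no cancellation in the
  -- commutator is needed.
  have hpn : ‖commBlock T (pos i) (neg k) a‖ ≤ 2 * A * (2 * (K / 2 ^ q)) := by
    refine (norm_commBlock_le (hposm i) (hnegm k) hA ham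
      (fun ξ hξ ↦ hbound ξ (hri ξ (hsub1 i hξ))) (fun ξ hξ ↦ hbound ξ (hrk ξ (hsub2 k hξ)))).trans ?_
    refine mul_le_mul_of_nonneg_left ?_ (by positivity)
    rw [← hdenom]
    exact norm_proj_mul_proj_le_of_separated (hposm i) (hnegm k) (by positivity) hr67
      (fun ξ hξ ↦ (hLB i hri ξ hξ).1) (fun ξ hξ ↦ (hLB' k hrk ξ hξ).1)
      (fun ξ hξ ↦ (hLB i hri ξ hξ).2.1) (fun ξ hξ ↦ (hLB' k hrk ξ hξ).2.2) hK hT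
  have hnp : ‖commBlock T (neg i) (pos k) a‖ ≤ 2 * A * (2 * (K / 2 ^ q)) := by
    refine (norm_commBlock_le (hnegm i) (hposm k) hA ham
      (fun ξ hξ ↦ hbound ξ (hri ξ (hsub2 i hξ))) (fun ξ hξ ↦ hbound ξ (hrk ξ (hsub1 k hξ)))).trans ?_
    refine mul_le_mul_of_nonneg_left ?_ (by positivity)
    rw [← hdenom]
    exact norm_proj_mul_proj_le_of_separated (ξ₀ := -ξ₀) (hnegm i) (hposm k) (by positivity) hr67
      (fun ξ hξ ↦ (hLB' i hri ξ hξ).1) (fun ξ hξ ↦ (hLB k hrk ξ hξ).1)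
      (fun ξ hξ ↦ (hLB' i hri ξ hξ).2.1) (fun ξ hξ ↦ (hLB k hrk ξ hξ).2.2) hK hT
  have hbi := hbs i hri
  have hbk := hbs k hrk
  rw [hunion i, commBlock_union_left (hdisj i) (hposm i) (hnegm i) (hbi _ (hposm i) (hsub1 i))
    (hbi _ (hnegm i) (hsub2 i)), hunion k,
    commBlock_union_right (hdisj k) (hposm k) (hnegm k) (hbk _ (hposm k) (hsub1 k))
      (hbk _ (hnegm k) (hsub2 k)),
    commBlock_union_right (hdisj k) (hposm k) (hnegm k) (hbk _ (hposm k) (hsub1 k))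
      (hbk _ (hnegm k) (hsub2 k))]
  refine (norm_add_le _ _).trans ((add_le_add ((norm_add_le _ _).trans (add_le_add hpp hpn))
    ((norm_add_le _ _).trans (add_le_add hnp hnn))).trans ?_)
  -- Two Taylor terms give `32/7 ≤ 5` times `geomConst`, two separated terms give `4 + 4`.
  have e1 : geomConst * (K * A / ρ) = 16 / 7 * geomConst * (K * A / 2 ^ q) := by
    rw [hρ]; field_simp
  have e2 : 2 * A * (2 * (K / 2 ^ q)) = 4 * (K * A / 2 ^ q) := by ring
  rw [e1, e2]
  have := mul_nonneg geomConst_nonneg hKA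
  nlinarith

end

/-! ### Schur test, dyadic weights, and weighted commutator bounds. -/

section

open scoped ENNReal

/-! ### A Schur test for kernels with geometric off-diagonal decay -/

/-- With truncated subtraction the exponent is `|i - j|`, and at most two `j` lie at any given
distance from `i`. -/
theorem tsum_geometric_dist_le {r : ℝ≥0∞} (i : ℕ) :
    ∑' j : ℕ, r ^ ((i - j) + (j - i)) ≤ 2 * (1 - r)⁻¹ := by
  have h1 : ∀ j : ℕ, r ^ ((i - j) + (j - i)) ≤
      ∑' n : ℕ, r ^ n * ((if j = i - n then 1 else 0) + if j = i + n then 1 else 0) := by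
    intro j
    refine le_trans ?_ (ENNReal.le_tsum ((i - j) + (j - i)))
    have : (1 : ℝ≥0∞) ≤ (if j = i - ((i - j) + (j - i)) then 1 else 0) +
        if j = i + ((i - j) + (j - i)) then 1 else 0 := by
      rcases le_total j i with h | h
      · rw [if_pos (by omega)]; exact le_self_add
      · rw [if_pos (c := j = i + _) (by omega)]; exact le_add_self
    calc r ^ ((i - j) + (j - i)) = r ^ ((i - j) + (j - i)) * 1 := (mul_one _).symm
      _ ≤ _ := by gcongr
  refine (ENNReal.tsum_le_tsum h1).trans ?_
  rw [ENNReal.tsum_comm]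
  have h2 : ∀ n : ℕ, ∑' j : ℕ, r ^ n * ((if j = i - n then (1 : ℝ≥0∞) else 0) +
      if j = i + n then 1 else 0) = r ^ n * 2 := by
    intro n
    rw [ENNReal.tsum_mul_left, ENNReal.tsum_add, tsum_ite_eq, tsum_ite_eq]
    norm_num
  simp_rw [h2]
  rw [ENNReal.tsum_mul_right, ENNReal.tsum_geometric, mul_comm]

theorem two_mul_mul_le_sq_add_sq (a b : ℝ≥0∞) : 2 * (a * b) ≤ a ^ 2 + b ^ 2 := by
  rcases eq_or_ne a ⊤ with rfl | ha
  · simp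
  rcases eq_or_ne b ⊤ with rfl | hb
  · simp
  lift a to NNReal using ha
  lift b to NNReal using hb
  exact_mod_cast (by
    have := two_mul_le_add_sq (a : ℝ) b
    rw [← NNReal.coe_le_coe]; push_cast; linarith : 2 * (a * b) ≤ a ^ 2 + b ^ 2)

/-- Weighted Cauchy–Schwarz: expand the square as a double sum and use `2 f_j f_k ≤ f_j² + f_k²`. -/
theorem tsum_mul_sq_le {ι : Type*} (w f : ι → ℝ≥0∞) :
    (∑' j, w j * f j) ^ 2 ≤ (∑' j, w j) * ∑' j, w j * f j ^ 2 := by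
  have e : (∑' j, w j * f j) ^ 2 = ∑' j, ∑' k, w j * w k * (f j * f k) := by
    rw [sq, ← ENNReal.tsum_mul_right]
    congr 1; funext j
    rw [← ENNReal.tsum_mul_left]
    congr 1; funext k; ring
  have e1 : (∑' j, w j) * ∑' j, w j * f j ^ 2 = ∑' j, ∑' k, w j * w k * f k ^ 2 := by
    rw [← ENNReal.tsum_mul_right]
    congr 1; funext j
    rw [← ENNReal.tsum_mul_left]
    congr 1; funext k; ring
  have e2 : (∑' j, w j) * ∑' j, w j * f j ^ 2 = ∑' j, ∑' k, w j * w k * f j ^ 2 := by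
    rw [e1, ENNReal.tsum_comm]
    congr 1; funext j; congr 1; funext k; ring
  have h : 2 * (∑' j, w j * f j) ^ 2 ≤ 2 * ((∑' j, w j) * ∑' j, w j * f j ^ 2) := by
    calc 2 * (∑' j, w j * f j) ^ 2 = ∑' j, ∑' k, w j * w k * (2 * (f j * f k)) := by
          rw [e, ← ENNReal.tsum_mul_left]
          congr 1; funext j
          rw [← ENNReal.tsum_mul_left]
          congr 1; funext k; ring
      _ ≤ ∑' j, ∑' k, (w j * w k * f j ^ 2 + w j * w k * f k ^ 2) := by
          refine ENNReal.tsum_le_tsum fun j ↦ ENNReal.tsum_le_tsum fun k ↦ ?_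
          rw [← mul_add]
          gcongr
          exact two_mul_mul_le_sq_add_sq _ _
      _ = _ := by
          simp_rw [ENNReal.tsum_add]
          rw [← e1, ← e2, two_mul]
  exact (ENNReal.mul_le_mul_iff_right (by norm_num) (by norm_num)).1 h

/-- Schur test: Cauchy–Schwarz uses the row sums, the exchange of summations uses the column sums,
and both are bounded by `2 / (1 - r)`. -/
theorem tsum_sq_le_of_geometric_kernel {f g : ℕ → ℝ≥0∞} {C r : ℝ≥0∞}
    (h : ∀ i, g i ≤ ∑' j, C * r ^ ((i - j) + (j - i)) * f j) :
    ∑' i, g i ^ 2 ≤ (C * (2 * (1 - r)⁻¹)) ^ 2 * ∑' j, f j ^ 2 := by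
  set S : ℝ≥0∞ := 2 * (1 - r)⁻¹ with hS
  have h1 : ∀ i, g i ^ 2 ≤ C ^ 2 * (S * ∑' j, r ^ ((i - j) + (j - i)) * f j ^ 2) := by
    intro i
    have e : ∑' j, C * r ^ ((i - j) + (j - i)) * f j =
        C * ∑' j, r ^ ((i - j) + (j - i)) * f j := by
      rw [← ENNReal.tsum_mul_left]; congr 1; funext j; ring
    calc g i ^ 2 ≤ (C * ∑' j, r ^ ((i - j) + (j - i)) * f j) ^ 2 := by
          rw [← e]; gcongr; exact h i
      _ = C ^ 2 * (∑' j, r ^ ((i - j) + (j - i)) * f j) ^ 2 := by ring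
      _ ≤ _ := by
          gcongr
          refine (tsum_mul_sq_le _ _).trans ?_
          gcongr
          exact tsum_geometric_dist_le i
  calc ∑' i, g i ^ 2 ≤ ∑' i, C ^ 2 * (S * ∑' j, r ^ ((i - j) + (j - i)) * f j ^ 2) :=
        ENNReal.tsum_le_tsum h1
    _ = C ^ 2 * (S * ∑' j, ∑' i, r ^ ((i - j) + (j - i)) * f j ^ 2) := by
        rw [ENNReal.tsum_mul_left, ENNReal.tsum_mul_left, ENNReal.tsum_comm]
    _ ≤ C ^ 2 * (S * ∑' j, S * f j ^ 2) := by
        gcongr with j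
        rw [ENNReal.tsum_mul_right]
        gcongr
        refine le_trans (le_of_eq ?_) (tsum_geometric_dist_le j)
        congr 1; funext i; rw [add_comm]
    _ = _ := by rw [ENNReal.tsum_mul_left]; ring

theorem enorm_apply_le_tsum_shellP {S : ℕ → L2 →L[ℂ] L2} {F G : L2}
    (h : HasSum (fun j ↦ S j F) G) (hS : ∀ j, S j * shellP j = S j) :
    ‖G‖ₑ ≤ ∑' j, ‖S j‖ₑ * ‖shellP j F‖ₑ := by
  rw [← h.tsum_eq]
  refine (enorm_tsum_le_tsum_enorm (f := fun j ↦ S j F)).trans (ENNReal.tsum_le_tsum fun j ↦ ?_)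
  conv_lhs => rw [← hS j]
  exact ContinuousLinearMap.le_opENorm _ _

/-! ### Dyadic weights -/

/-- The size of `1 + t |ξ|` on the `i`-th shell. -/
def theta (t : ℝ) (i : ℕ) : ℝ := 1 + t * 2 ^ i

theorem one_le_theta {t : ℝ} (ht : 0 < t) (i : ℕ) : 1 ≤ theta t i := by
  have : 0 < t * 2 ^ i := by positivity
  rw [theta]; linarith

theorem theta_pos {t : ℝ} (ht : 0 < t) (i : ℕ) : 0 < theta t i :=
  zero_lt_one.trans_le (one_le_theta ht i)

theorem theta_mono {t : ℝ} (ht : 0 < t) {i j : ℕ} (h : i ≤ j) : theta t i ≤ theta t j := by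
  have : (2 : ℝ) ^ i ≤ 2 ^ j := pow_le_pow_right₀ (by norm_num) h
  rw [theta, theta]; gcongr

theorem theta_add_le {t : ℝ} (i d : ℕ) : theta t (i + d) ≤ 2 ^ d * theta t i := by
  have : (1 : ℝ) ≤ 2 ^ d := one_le_pow₀ (by norm_num)
  rw [theta, theta, pow_add]
  nlinarith [pow_pos (show (0 : ℝ) < 2 by norm_num) i]

theorem two_rpow_natCast_mul (d : ℕ) (s : ℝ) : ((2 : ℝ) ^ d) ^ s = (2 ^ s) ^ d := by
  rw [← Real.rpow_natCast, ← Real.rpow_mul (by norm_num), mul_comm, Real.rpow_mul (by norm_num),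
    Real.rpow_natCast]

/-- Weights of adjacent shells differ by at most a factor `2`, so up to a constant the product is a
power of `theta t j` with exponent `α - 1 - β ≤ 0`. -/
theorem theta_weight_near {t : ℝ} (ht : 0 < t) {M : ℕ} {m α β : ℝ} (hm : 0 ≤ m) (hmM : m ≤ M)
    (hα : 1 ≤ α) (hαM : α ≤ M) (hβ : α - 1 - β ≤ 0) {i j : ℕ} (hi : i ≤ j + 1) (hj : j ≤ i + 1) :
    theta t i ^ (-m) * (theta t (max i j) ^ (α - 1) * (theta t j ^ (-β) * theta t j ^ m)) ≤
      4 ^ M := by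
  have hx := theta_pos ht i
  have hy := theta_pos ht j
  have hy1 := one_le_theta ht j
  have h1 : theta t j ≤ 2 * theta t i := by
    refine (theta_mono ht hj).trans ?_
    simpa using theta_add_le (t := t) i 1
  have h2 : theta t (max i j) ≤ 2 * theta t j := by
    refine (theta_mono ht (by omega : max i j ≤ j + 1)).trans ?_
    simpa using theta_add_le (t := t) j 1
  have h3 : theta t i ^ (-m) * theta t j ^ m ≤ 2 ^ m := by
    rw [Real.rpow_neg hx.le, inv_mul_le_iff₀ (by positivity), mul_comm,
      ← Real.mul_rpow (by norm_num) hx.le]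
    exact Real.rpow_le_rpow hy.le h1 hm
  have h4 : theta t (max i j) ^ (α - 1) * theta t j ^ (-β) ≤ 2 ^ (α - 1) := by
    calc theta t (max i j) ^ (α - 1) * theta t j ^ (-β)
        ≤ (2 * theta t j) ^ (α - 1) * theta t j ^ (-β) := by
          gcongr
          exact (theta_pos ht _).le
      _ = 2 ^ (α - 1) * theta t j ^ (α - 1 - β) := by
          rw [Real.mul_rpow (by norm_num) hy.le, mul_assoc, ← Real.rpow_add hy]; rfl
      _ ≤ 2 ^ (α - 1) * 1 := by
          gcongr
          exact Real.rpow_le_one_of_one_le_of_nonpos hy1 hβ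
      _ = _ := mul_one _
  calc _ = (theta t i ^ (-m) * theta t j ^ m) *
        (theta t (max i j) ^ (α - 1) * theta t j ^ (-β)) := by ring
    _ ≤ 2 ^ m * 2 ^ (α - 1) := by
        gcongr
        exact mul_nonneg (Real.rpow_nonneg (theta_pos ht _).le _) (Real.rpow_nonneg hy.le _)
    _ = 2 ^ (m + (α - 1)) := (Real.rpow_add (by norm_num) _ _).symm
    _ ≤ 2 ^ ((2 * M : ℕ) : ℝ) := by
        refine Real.rpow_le_rpow_of_exponent_le (by norm_num) ?_
        push_cast; linarith
    _ = 4 ^ M := by rw [Real.rpow_natCast, pow_mul]; norm_num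

/-- This is where the conditions on the orders meet. With `d = |i - j|`, from low to high frequency
(`j ≤ i`) the negative weights help, and the decay `2^{-Md}` exceeds the growth `2^{(M-1)d}` of the
symbol. From high to low (`i ≤ j`) the weights may cost all of `2^{Md}`; what remains is the gain `1
- α + β` of the composed symbols, measured by `η`. -/
theorem theta_weight_far {t : ℝ} (ht : 0 < t) {M : ℕ} {m α β η : ℝ} (hm : 0 ≤ m) (hmM : m ≤ M)
    (hα : 1 ≤ α) (hαM : α ≤ M) (hη0 : 0 ≤ η) (hη1 : η ≤ 1) (hη : η ≤ 1 - α + β) (i j : ℕ) :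
    theta t i ^ (-m) * (theta t (max i j) ^ (α - 1) * (theta t j ^ (-β) * theta t j ^ m)) *
      (2 ^ min i j * (1 / 2) ^ (M * max i j)) ≤ ((2 : ℝ) ^ (-η)) ^ ((i - j) + (j - i)) := by
  have hx := theta_pos ht i
  have hy := theta_pos ht j
  have hx1 := one_le_theta ht i
  have hy1 := one_le_theta ht j
  have hM : (1 : ℝ) ≤ M := hα.trans hαM
  rcases le_total j i with h | h
  · obtain ⟨d, rfl⟩ := Nat.exists_eq_add_of_le h
    rw [max_eq_left h, min_eq_right h, Nat.sub_eq_zero_of_le h, Nat.add_sub_cancel_left, add_zero]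
    set x := theta t (j + d)
    set y := theta t j
    have hyx : y ≤ x := theta_mono ht h
    have h1 : x ^ (-m) * y ^ m ≤ 1 := by
      rw [Real.rpow_neg hx.le, inv_mul_le_iff₀ (by positivity), mul_one]
      exact Real.rpow_le_rpow hy.le hyx hm
    have h2 : x ^ (α - 1) * y ^ (-β) ≤ (2 ^ d) ^ (M - 1 : ℝ) := by
      calc x ^ (α - 1) * y ^ (-β) ≤ (2 ^ d * y) ^ (α - 1) * y ^ (-β) := by
            gcongr
            exact theta_add_le j d
        _ = (2 ^ d) ^ (α - 1) * y ^ (α - 1 - β) := by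
            rw [Real.mul_rpow (by positivity) hy.le, mul_assoc, ← Real.rpow_add hy]; rfl
        _ ≤ (2 ^ d) ^ (α - 1) * 1 := by
            gcongr
            exact Real.rpow_le_one_of_one_le_of_nonpos hy1 (by linarith)
        _ ≤ (2 ^ d) ^ (M - 1 : ℝ) := by
            rw [mul_one]
            exact Real.rpow_le_rpow_of_exponent_le (one_le_pow₀ (by norm_num)) (by linarith)
    obtain ⟨M, rfl⟩ : ∃ M', M = M' + 1 := ⟨M - 1, by
      have : 1 ≤ M := by exact_mod_cast hM
      omega⟩
    rw [Nat.cast_add_one, add_sub_cancel_right, Real.rpow_natCast] at h2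
    have hhalf : ((1 : ℝ) / 2) ≤ 2 ^ (-η) := by
      rw [one_div, ← Real.rpow_neg_one]
      exact Real.rpow_le_rpow_of_exponent_le (by norm_num) (by linarith)
    calc _ = (x ^ (-m) * y ^ m) * (x ^ (α - 1) * y ^ (-β)) *
          (2 ^ j * (1 / 2) ^ ((M + 1) * (j + d))) := by ring
      _ ≤ 1 * (2 ^ d) ^ M * (2 ^ j * (1 / 2) ^ ((M + 1) * (j + d))) := by
          gcongr
      _ = (1 / 2) ^ (M * j) * (1 / 2) ^ d := by
          rw [one_mul, ← pow_mul]
          have e : (M + 1) * (j + d) = M * j + d + d * M + j := by ring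
          rw [e]
          simp only [pow_add, one_div, inv_pow]
          field_simp
      _ ≤ 1 * (2 ^ (-η)) ^ d := by
          gcongr
          exact pow_le_one₀ (by norm_num) (by norm_num)
      _ = _ := one_mul _
  · obtain ⟨d, rfl⟩ := Nat.exists_eq_add_of_le h
    rw [max_eq_right h, min_eq_left h, Nat.sub_eq_zero_of_le h, Nat.add_sub_cancel_left, zero_add]
    set y := theta t (i + d)
    set x := theta t i
    have hxy : x ≤ y := theta_mono ht h
    have hq : 1 ≤ y / x := by rwa [le_div_iff₀ hx, one_mul]
    have hqy : y / x ≤ y := div_le_self hy.le hx1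
    have hqd : y / x ≤ 2 ^ d := by rw [div_le_iff₀ hx]; exact theta_add_le i d
    have h1 : x ^ (-m) * y ^ m ≤ (y / x) ^ (M : ℝ) := by
      have : x ^ (-m) * y ^ m = (y / x) ^ m := by
        rw [Real.div_rpow hy.le hx.le, Real.rpow_neg hx.le]; field_simp
      rw [this]
      exact Real.rpow_le_rpow_of_exponent_le hq hmM
    have h2 : y ^ (α - 1) * y ^ (-β) ≤ (y / x) ^ (-η) := by
      rw [← Real.rpow_add hy]
      calc y ^ (α - 1 + -β) ≤ y ^ (-η) :=
            Real.rpow_le_rpow_of_exponent_le hy1 (by linarith)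
        _ ≤ (y / x) ^ (-η) :=
            Real.rpow_le_rpow_of_nonpos (by linarith) hqy (by linarith)
    -- The two powers are combined before `y / x ≤ 2 ^ d` is used: the total exponent `M - η` is
    -- nonnegative, whereas the factor with exponent `-η` alone could not be bounded from this
    -- inequality.
    have h3 : (y / x) ^ (M : ℝ) * (y / x) ^ (-η) ≤ (2 ^ d) ^ M * (2 ^ (-η)) ^ d := by
      rw [← Real.rpow_add (by linarith)]
      calc (y / x) ^ ((M : ℝ) + -η) ≤ (2 ^ d) ^ ((M : ℝ) + -η) :=
            Real.rpow_le_rpow (by linarith) hqd (by linarith)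
        _ = _ := by
            rw [Real.rpow_add (by positivity), Real.rpow_natCast, two_rpow_natCast_mul]
    have hM1 : 1 ≤ M := by exact_mod_cast hM
    calc _ = (x ^ (-m) * y ^ m) * (y ^ (α - 1) * y ^ (-β)) *
          (2 ^ i * (1 / 2) ^ (M * (i + d))) := by ring
      _ ≤ (y / x) ^ (M : ℝ) * (y / x) ^ (-η) * (2 ^ i * (1 / 2) ^ (M * (i + d))) := by
          gcongr
      _ ≤ (2 ^ d) ^ M * (2 ^ (-η)) ^ d * (2 ^ i * (1 / 2) ^ (M * (i + d))) := by
          gcongr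
      _ = (2 ^ i * (1 / 2) ^ (M * i)) * (2 ^ (-η)) ^ d := by
          rw [← pow_mul]
          have e : M * (i + d) = M * i + d * M := by ring
          rw [e]
          simp only [pow_add, one_div, inv_pow]
          field_simp
      _ ≤ 1 * (2 ^ (-η)) ^ d := by
          gcongr
          rw [one_div, inv_pow, mul_inv_le_iff₀ (by positivity), one_mul]
          exact pow_le_pow_right₀ (by norm_num) (Nat.le_mul_of_pos_left i hM1)
      _ = _ := one_mul _

/-! ### Commutators with symbols of finite order -/

/-- Constants commute with every operator, so the value at `0` may be subtracted from a symbol. The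
difference vanishes to first order at zero frequency, and this is the source of the factor `t`. -/
theorem norm_symbol_sub_le {t Ka α : ℝ} (ht : 0 < t) (hKa : 0 ≤ Ka) (hα : 1 ≤ α) {A : ℂ → ℂ}
    (hAb : ∀ z : ℂ, 0 < z.re → |z.im| ≤ z.re → ‖A z - A 0‖ ≤ Ka * (‖z‖ * (1 + ‖z‖) ^ (α - 1)))
    {ξ : ℝ} {q : ℕ} (hξ : |ξ| ≤ 2 ^ q) :
    ‖A (t * |ξ| : ℝ) - A 0‖ ≤ Ka * (t * 2 ^ q * theta t q ^ (α - 1)) := by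
  have hθ := theta_pos ht q
  rcases (abs_nonneg ξ).eq_or_lt with h | h
  · rw [← h, mul_zero, ofReal_zero, sub_self, norm_zero]
    have := Real.rpow_nonneg hθ.le (α - 1)
    positivity
  · have hpos : 0 < t * |ξ| := by positivity
    refine (hAb _ (by simpa using hpos) (by simpa using hpos.le)).trans ?_
    rw [norm_real, Real.norm_of_nonneg hpos.le, theta]
    gcongr

theorem abs_le_of_mem_shell {i q : ℕ} (h : i ≤ q) {ξ : ℝ} (hξ : ξ ∈ shell i) : |ξ| ≤ 2 ^ q :=
  hξ.1.le.trans (pow_le_pow_right₀ (by norm_num) h)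

theorem norm_commBlock_symbol_le_mul {t Ka α : ℝ} {T : L2 →L[ℂ] L2} (ht : 0 < t) (hKa : 0 ≤ Ka)
    (hα : 1 ≤ α) {A : ℂ → ℂ}
    (hAb : ∀ z : ℂ, 0 < z.re → |z.im| ≤ z.re → ‖A z - A 0‖ ≤ Ka * (‖z‖ * (1 + ‖z‖) ^ (α - 1)))
    (hAm : Measurable fun ξ : ℝ ↦ A (t * |ξ| : ℝ)) (i j : ℕ) :
    ‖commBlock T (shell i) (shell j) (fun ξ ↦ A (t * |ξ| : ℝ) - A 0)‖ ≤
      2 * (Ka * (t * 2 ^ max i j * theta t (max i j) ^ (α - 1))) * ‖shellP i * T * shellP j‖ := by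
  have := Real.rpow_nonneg (theta_pos ht (max i j)).le (α - 1)
  refine norm_commBlock_le (measurableSet_shell i) (measurableSet_shell j) (by positivity)
    (hAm.sub_const _).aestronglyMeasurable
    (fun ξ hξ ↦ ?_) (fun ξ hξ ↦ ?_)
  · exact norm_symbol_sub_le ht hKa hα hAb (abs_le_of_mem_shell (le_max_left _ _) hξ)
  · exact norm_symbol_sub_le ht hKa hα hAb (abs_le_of_mem_shell (le_max_right _ _) hξ)

theorem bdd_cut_symbol {t Ka α : ℝ} (ht : 0 < t) (hKa : 0 ≤ Ka)
    (hα : 1 ≤ α) {A : ℂ → ℂ}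
    (hAb : ∀ z : ℂ, 0 < z.re → |z.im| ≤ z.re → ‖A z - A 0‖ ≤ Ka * (‖z‖ * (1 + ‖z‖) ^ (α - 1)))
    (hAm : Measurable fun ξ : ℝ ↦ A (t * |ξ| : ℝ)) (i : ℕ) :
    Bdd (cut (shell i) fun ξ ↦ A (t * |ξ| : ℝ)) := by
  refine bdd_cut (measurableSet_shell i) hAm.aestronglyMeasurable
    (K := ‖A 0‖ + Ka * (t * 2 ^ i * theta t i ^ (α - 1))) fun ξ hξ ↦ ?_
  have h1 := norm_symbol_sub_le ht hKa hα hAb (abs_le_of_mem_shell le_rfl hξ)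
  have h2 := norm_le_norm_add_norm_sub' (A (t * |ξ| : ℝ)) (A 0)
  linarith

/-- One of the `M + 1` powers of `2^{-max i j}` in the off-diagonal decay cancels the factor `2^{max
i j}` of the symbol; `M` of them are left. -/
theorem norm_commBlock_symbol_le_of_far {M : ℕ} {K t Ka α : ℝ} {T : L2 →L[ℂ] L2}
    (hT : RegOp M K T) (ht : 0 < t) (hKa : 0 ≤ Ka) (hα : 1 ≤ α) {A : ℂ → ℂ}
    (hAb : ∀ z : ℂ, 0 < z.re → |z.im| ≤ z.re → ‖A z - A 0‖ ≤ Ka * (‖z‖ * (1 + ‖z‖) ^ (α - 1)))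
    (hAm : Measurable fun ξ : ℝ ↦ A (t * |ξ| : ℝ)) {i j : ℕ} (hij : i + 2 ≤ j ∨ j + 2 ≤ i) :
    ‖commBlock T (shell i) (shell j) (fun ξ ↦ A (t * |ξ| : ℝ))‖ ≤
      2 * (K * Ka * t * theta t (max i j) ^ (α - 1)) *
        (2 ^ min i j * (1 / 2) ^ (M * max i j)) := by
  have h0 := Real.rpow_nonneg (theta_pos ht (max i j)).le (α - 1)
  rw [← commBlock_sub_const (measurableSet_shell i) (measurableSet_shell j)
    (bdd_cut_symbol ht hKa hα hAb hAm i) (bdd_cut_symbol ht hKa hα hAb hAm j) (A 0)]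
  refine (norm_commBlock_symbol_le_mul ht hKa hα hAb hAm i j).trans ?_
  refine (mul_le_mul_of_nonneg_left (hT.off i j hij) (by positivity)).trans (le_of_eq ?_)
  rw [add_mul, one_mul, pow_add]
  have e : (2 : ℝ) ^ max i j * (1 / 2) ^ max i j = 1 := by rw [← mul_pow]; norm_num
  linear_combination (2 * Ka * t * theta t (max i j) ^ (α - 1) * K * 2 ^ min i j *
    (1 / 2) ^ (M * max i j)) * e

/-- The factor `2^{max i j}` of the symbol is cancelled by the gain of one order in the commutator
with a holomorphic symbol. -/
theorem norm_commBlock_symbol_le_of_near {M : ℕ} {K t Ka α : ℝ} {T : L2 →L[ℂ] L2}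
    (hT : RegOp M K T) (hK : 0 ≤ K) (ht : 0 < t) (hKa : 0 ≤ Ka) (hα : 1 ≤ α) {A : ℂ → ℂ}
    (hA : DifferentiableOn ℂ A {z | 0 < z.re ∧ |z.im| ≤ z.re})
    (hAb : ∀ z : ℂ, 0 < z.re → |z.im| ≤ z.re → ‖A z - A 0‖ ≤ Ka * (‖z‖ * (1 + ‖z‖) ^ (α - 1)))
    (hAm : Measurable fun ξ : ℝ ↦ A (t * |ξ| : ℝ)) {i j : ℕ} (hi : i ≤ j + 1) (hj : j ≤ i + 1) :
    ‖commBlock T (shell i) (shell j) (fun ξ ↦ A (t * |ξ| : ℝ))‖ ≤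
      (2 ^ α * (5 * geomConst + 8)) * (K * Ka * t * theta t (max i j) ^ (α - 1)) := by
  have hθ := theta_pos ht (max i j)
  have h0 := Real.rpow_nonneg hθ.le (α - 1)
  rw [← commBlock_sub_const (measurableSet_shell i) (measurableSet_shell j)
    (bdd_cut_symbol ht hKa hα hAb hAm i) (bdd_cut_symbol ht hKa hα hAb hAm j) (A 0)]
  have h2α : (2 : ℝ) ≤ 2 ^ α := by
    simpa using Real.rpow_le_rpow_of_exponent_le (by norm_num : (1 : ℝ) ≤ 2) hα
  by_cases hq : 2 ≤ max i j
  · set q := max i j with hqdef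
    -- The symbol is bounded up to `‖z‖ ≤ 2 * 2 ^ q`, the range required on the disc; doubling the
    -- argument costs the factor `2 ^ α`.
    refine (norm_commBlock_shell_le hi hj hq hK hT.lip (hAm.sub_const _).aestronglyMeasurable
      (φ := fun z ↦ A (t * z) - A 0) (A := Ka * (t * (2 * 2 ^ q) * (2 * theta t q) ^ (α - 1)))
      ?_ (by positivity) ?_ ?_).trans (le_of_eq ?_)
    · refine (hA.comp (differentiable_id.const_mul (t : ℂ)).differentiableOn ?_).sub_const _
      rintro z ⟨h1, h2⟩
      simp only [Set.mem_ofPred_eq, re_ofReal_mul, im_ofReal_mul]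
      rw [abs_mul, abs_of_pos ht]
      exact ⟨by positivity, by gcongr⟩
    · intro z h1 h2 h3
      have e1 : ‖(t : ℂ) * z‖ = t * ‖z‖ := by rw [norm_mul, norm_real, Real.norm_of_nonneg ht.le]
      refine (hAb _ (by rw [re_ofReal_mul]; positivity) ?_).trans ?_
      · rw [re_ofReal_mul, im_ofReal_mul, abs_mul, abs_of_pos ht]; gcongr
      · rw [e1]
        gcongr
        rw [theta]
        nlinarith
    · intro ξ _
      push_cast
      rfl
    · rw [Real.mul_rpow (by norm_num) hθ.le, Real.rpow_sub_one (by norm_num : (2 : ℝ) ≠ 0)]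
      field_simp
      ring
  -- At the lowest shells `2 ^ max i j ≤ 2`, so the trivial bound suffices.
  · have h1 := norm_commBlock_symbol_le_mul (T := T) ht hKa hα hAb hAm i j
    have h2 := (norm_proj_mul_mul_proj_le T (shell i) (shell j)).trans hT.norm_le
    have h3 : (2 : ℝ) ^ max i j ≤ 2 ^ 1 := pow_le_pow_right₀ (by norm_num) (by omega)
    have h4 : 8 ≤ 2 ^ α * (5 * geomConst + 8) := by nlinarith [geomConst_nonneg]
    refine h1.trans ?_
    calc 2 * (Ka * (t * 2 ^ max i j * theta t (max i j) ^ (α - 1))) * ‖shellP i * T * shellP j‖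
        ≤ 2 * (Ka * (t * 2 ^ 1 * theta t (max i j) ^ (α - 1))) * K := by
          gcongr
          exact h2
      _ = 4 * (K * Ka * t * theta t (max i j) ^ (α - 1)) := by ring
      _ ≤ _ := by gcongr; linarith

/-! ### Weighted square sums over the shells -/

/-- The square of a dyadic version of the norm `‖(1 + i t ξ)^{-m} F‖`. -/
def dyadSq (t m : ℝ) (F : L2) : ℝ≥0∞ :=
  ∑' i, (ENNReal.ofReal (theta t i ^ (-m)) * ‖shellP i F‖ₑ) ^ 2

/-- The factor `theta t j ^ m * theta t j ^ (-m)` is inserted in each block; the hypothesis on the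
blocks then becomes the geometric kernel of the Schur test. -/
theorem dyadSq_le_of_blocks {t m C r : ℝ} (ht : 0 < t) (hC : 0 ≤ C) (hr0 : 0 ≤ r)
    {F G H : L2} {w : ℕ → ℝ} (hw : ∀ j, 0 ≤ w j) (hH : ∀ j, ‖shellP j H‖ ≤ w j * ‖shellP j F‖)
    {S : ℕ → ℕ → L2 →L[ℂ] L2} (hG : ∀ i, HasSum (fun j ↦ S i j H) (shellP i G))
    (hS : ∀ i j, S i j * shellP j = S i j)
    (hb : ∀ i j, theta t i ^ (-m) * (‖S i j‖ * w j * theta t j ^ m) ≤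
      C * r ^ ((i - j) + (j - i))) :
    dyadSq t m G ≤
      (ENNReal.ofReal C * (2 * (1 - ENNReal.ofReal r)⁻¹)) ^ 2 * dyadSq t m F := by
  refine tsum_sq_le_of_geometric_kernel fun i ↦ ?_
  calc ENNReal.ofReal (theta t i ^ (-m)) * ‖shellP i G‖ₑ
      ≤ ENNReal.ofReal (theta t i ^ (-m)) * ∑' j, ‖S i j‖ₑ * ‖shellP j H‖ₑ := by
        gcongr
        exact enorm_apply_le_tsum_shellP (hG i) (hS i)
    _ = ∑' j, ENNReal.ofReal (theta t i ^ (-m)) * (‖S i j‖ₑ * ‖shellP j H‖ₑ) :=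
        ENNReal.tsum_mul_left.symm
    _ ≤ _ := by
        refine ENNReal.tsum_le_tsum fun j ↦ ?_
        have hx := Real.rpow_nonneg (theta_pos ht i).le (-m)
        have hy := theta_pos ht j
        have hwj := hw j
        have e0 : ‖shellP j H‖ₑ ≤ ENNReal.ofReal (w j) * ‖shellP j F‖ₑ := by
          rw [← ofReal_norm, ← ofReal_norm, ← ENNReal.ofReal_mul hwj]
          exact ENNReal.ofReal_le_ofReal (hH j)
        have e1 : ENNReal.ofReal (theta t i ^ (-m)) * (‖S i j‖ₑ * ENNReal.ofReal (w j)) =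
            ENNReal.ofReal (theta t i ^ (-m) * (‖S i j‖ * w j * theta t j ^ m)) *
              ENNReal.ofReal (theta t j ^ (-m)) := by
          rw [← ENNReal.ofReal_mul (by positivity), mul_assoc, mul_assoc _ (theta t j ^ m),
            ← Real.rpow_add hy, add_neg_cancel, Real.rpow_zero, mul_one,
            ENNReal.ofReal_mul hx, ENNReal.ofReal_mul (norm_nonneg _), ofReal_norm]
        calc ENNReal.ofReal (theta t i ^ (-m)) * (‖S i j‖ₑ * ‖shellP j H‖ₑ)
            ≤ ENNReal.ofReal (theta t i ^ (-m)) *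
                (‖S i j‖ₑ * (ENNReal.ofReal (w j) * ‖shellP j F‖ₑ)) := by gcongr
          _ = ENNReal.ofReal (theta t i ^ (-m) * (‖S i j‖ * w j * theta t j ^ m)) *
              ENNReal.ofReal (theta t j ^ (-m)) * ‖shellP j F‖ₑ := by rw [← e1]; ring
          _ ≤ _ := by
            rw [mul_assoc]
            gcongr
            refine (ENNReal.ofReal_le_ofReal (hb i j)).trans (le_of_eq ?_)
            rw [ENNReal.ofReal_mul hC, ENNReal.ofReal_pow hr0]

/-- Needed for the powers of `T` standing to the left of the commutators. -/
theorem dyadSq_map_le {M : ℕ} {K t m : ℝ} {T : L2 →L[ℂ] L2} (hT : RegOp M K T) (hK : 0 ≤ K)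
    (ht : 0 < t) (hM : 1 ≤ M) (hm : 0 ≤ m) (hmM : m ≤ M) (F : L2) :
    dyadSq t m (T F) ≤ (ENNReal.ofReal (4 ^ M * 2 * K) * 4) ^ 2 * dyadSq t m F := by
  have hM1 : (1 : ℝ) ≤ M := by exact_mod_cast hM
  have h := dyadSq_le_of_blocks (t := t) (m := m) (C := 4 ^ M * 2 * K) (r := 1 / 2) ht
    (by positivity) (by norm_num) (F := F) (G := T F) (H := F) (w := fun _ ↦ 1)
    (fun _ ↦ zero_le_one) (fun _ ↦ (one_mul _).ge) (S := fun i j ↦ shellP i * T * shellP j)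
    (fun i ↦ ?_) (fun i j ↦ ?_) (fun i j ↦ ?_)
  · refine h.trans (le_of_eq ?_)
    congr 3
    rw [← ENNReal.ofReal_one, ← ENNReal.ofReal_sub _ (by norm_num), ← ENNReal.ofReal_inv_of_pos
      (by norm_num), ← ENNReal.ofReal_ofNat 2, ← ENNReal.ofReal_mul (by norm_num)]
    norm_num
  · exact ((hasSum_shellP F).mapL (shellP i * T))
  · rw [mul_assoc, shellP_mul_shellP]
  · have hx := Real.rpow_nonneg (theta_pos ht i).le (-m)
    have hy := theta_pos ht j
    rw [mul_one, ← mul_assoc]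
    by_cases hij : i + 2 ≤ j ∨ j + 2 ≤ i
    -- With `η = 0` the weights leave no decay; it comes from the power of `2^{-max i j}` that is
    -- not spent on a symbol here.
    · have h1 := theta_weight_far ht hm hmM (α := 1) (β := 0) (η := 0) le_rfl hM1 le_rfl
        zero_le_one (by norm_num) i j
      simp only [sub_self, Real.rpow_zero, neg_zero, one_mul, one_pow] at h1
      have h2 := hT.off i j hij
      calc theta t i ^ (-m) * ‖shellP i * T * shellP j‖ * theta t j ^ m
          ≤ theta t i ^ (-m) * (K * 2 ^ min i j * (1 / 2) ^ ((M + 1) * max i j)) *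
              theta t j ^ m := by gcongr
        _ = theta t i ^ (-m) * theta t j ^ m * (2 ^ min i j * (1 / 2) ^ (M * max i j)) *
              (K * (1 / 2) ^ max i j) := by
            rw [add_mul, one_mul, pow_add]; ring
        _ ≤ 1 * (K * (1 / 2) ^ ((i - j) + (j - i))) := by
            gcongr ?_ * (K * ?_)
            exact pow_le_pow_of_le_one (by norm_num) (by norm_num) (by omega)
        _ ≤ 4 ^ M * 2 * K * (1 / 2) ^ ((i - j) + (j - i)) := by
            rw [one_mul]
            gcongr
            have : (1 : ℝ) ≤ 4 ^ M := one_le_pow₀ (by norm_num)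
            nlinarith
    · have h1 := theta_weight_near ht hm hmM (α := 1) (β := 0) le_rfl hM1 (by norm_num)
        (by omega : i ≤ j + 1) (by omega : j ≤ i + 1)
      simp only [sub_self, Real.rpow_zero, neg_zero, one_mul] at h1
      have h2 := (norm_proj_mul_mul_proj_le T (shell i) (shell j)).trans hT.norm_le
      have h3 : (1 / 2 : ℝ) ^ 1 ≤ (1 / 2) ^ ((i - j) + (j - i)) :=
        pow_le_pow_of_le_one (by norm_num) (by norm_num) (by omega)
      calc theta t i ^ (-m) * ‖shellP i * T * shellP j‖ * theta t j ^ m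
          ≤ theta t i ^ (-m) * K * theta t j ^ m := by gcongr; exact h2
        _ = theta t i ^ (-m) * theta t j ^ m * K := by ring
        _ ≤ 4 ^ M * K := by gcongr
        _ = 4 ^ M * 2 * K * (1 / 2) ^ 1 := by ring
        _ ≤ _ := by gcongr

/-- The difference `X - T Y` is the commutator of `A` with `T` applied to `H`. The `β` orders of
decay of `H` relative to `F` compensate the `α - 1` orders that are left of `A` after the commutator
has gained one. -/
theorem dyadSq_comm_le {M : ℕ} {K t m Ka Kb α β η : ℝ} {T : L2 →L[ℂ] L2} (hT : RegOp M K T)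
    (hK : 0 ≤ K) (ht : 0 < t) (hm : 0 ≤ m) (hmM : m ≤ M) (hKa : 0 ≤ Ka) (hKb : 0 ≤ Kb)
    (hα : 1 ≤ α) (hαM : α ≤ M) (hη0 : 0 < η) (hη1 : η ≤ 1) (hη : η ≤ 1 - α + β) {A : ℂ → ℂ}
    (hA : DifferentiableOn ℂ A {z | 0 < z.re ∧ |z.im| ≤ z.re})
    (hAb : ∀ z : ℂ, 0 < z.re → |z.im| ≤ z.re → ‖A z - A 0‖ ≤ Ka * (‖z‖ * (1 + ‖z‖) ^ (α - 1)))
    (hAm : Measurable fun ξ : ℝ ↦ A (t * |ξ| : ℝ)) {F H X Y : L2}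
    (hH : ∀ j, ‖shellP j H‖ ≤ Kb * theta t j ^ (-β) * ‖shellP j F‖)
    (hX : (X : ℝ → ℂ) =ᵐ[volume] fun ξ ↦ A (t * |ξ| : ℝ) * (T H : ℝ → ℂ) ξ)
    (hY : (Y : ℝ → ℂ) =ᵐ[volume] fun ξ ↦ A (t * |ξ| : ℝ) * (H : ℝ → ℂ) ξ) :
    dyadSq t m (X - T Y) ≤ (ENNReal.ofReal
      (2 * 4 ^ M * (2 ^ α * (5 * geomConst + 8)) * Kb * (K * Ka * t)) *
        (2 * (1 - ENNReal.ofReal (2 ^ (-η)))⁻¹)) ^ 2 * dyadSq t m F := by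
  set a : ℝ → ℂ := fun ξ ↦ A (t * |ξ| : ℝ) with ha
  have hab : ∀ i, Bdd (cut (shell i) a) := bdd_cut_symbol ht hKa hα hAb hAm
  have hproj : ∀ {Z Z' : L2}, (Z : ℝ → ℂ) =ᵐ[volume] (fun ξ ↦ a ξ * (Z' : ℝ → ℂ) ξ) → ∀ i,
      shellP i Z = mulL (cut (shell i) a) Z' := by
    intro Z Z' h i
    refine mulL_eq_of_ae (bdd_cut_one (measurableSet_shell i)) ?_
    filter_upwards [h, coeFn_mulL (hab i) Z'] with ξ h1 h2
    rw [h2, h1]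
    by_cases hξ : ξ ∈ shell i <;> simp [cut, hξ]
  have hg := geomConst_nonneg
  have h2α : 1 ≤ (2 : ℝ) ^ α := Real.one_le_rpow (by norm_num) (by linarith)
  have h8 : 8 ≤ 2 ^ α * (5 * geomConst + 8) := by nlinarith
  refine dyadSq_le_of_blocks ht (by positivity) (by positivity) (H := H)
    (w := fun j ↦ Kb * theta t j ^ (-β))
    (fun j ↦ mul_nonneg hKb (Real.rpow_nonneg (theta_pos ht j).le _)) hH
    (S := fun i j ↦ commBlock T (shell i) (shell j) a) (fun i ↦ ?_) (fun i j ↦ ?_) (fun i j ↦ ?_)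
  · rw [map_sub, hproj hX]
    refine HasSum.sub ?_ ?_
    · exact (hasSum_shellP H).mapL (mulL (cut (shell i) a) * T)
    · have := (hasSum_shellP Y).mapL (shellP i * T)
      refine this.congr_fun fun j ↦ ?_
      rw [hproj hY j]
      rfl
  · simp only [commBlock, sub_mul, mul_assoc]
    rw [← shellP, shellP_mul_shellP, shellP, proj, mulL_comm, ← proj,
      proj_mul_mulL_cut (measurableSet_shell j) (hab j)]
  · have hx := Real.rpow_nonneg (theta_pos ht i).le (-m)
    have hy := theta_pos ht j
    have hq := theta_pos ht (max i j)
    by_cases hij : i + 2 ≤ j ∨ j + 2 ≤ i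
    · have h1 := theta_weight_far ht hm hmM hα hαM hη0.le hη1 hη i j
      have h2 := norm_commBlock_symbol_le_of_far hT ht hKa hα hAb hAm hij
      calc theta t i ^ (-m) * (‖commBlock T (shell i) (shell j) a‖ * (Kb * theta t j ^ (-β)) *
            theta t j ^ m)
          ≤ theta t i ^ (-m) * (2 * (K * Ka * t * theta t (max i j) ^ (α - 1)) *
              (2 ^ min i j * (1 / 2) ^ (M * max i j)) * (Kb * theta t j ^ (-β)) *
              theta t j ^ m) := by gcongr
        _ = 2 * Kb * (K * Ka * t) * (theta t i ^ (-m) * (theta t (max i j) ^ (α - 1) *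
              (theta t j ^ (-β) * theta t j ^ m)) * (2 ^ min i j * (1 / 2) ^ (M * max i j))) := by
            ring
        _ ≤ 2 * Kb * (K * Ka * t) * ((2 : ℝ) ^ (-η)) ^ ((i - j) + (j - i)) := by gcongr
        _ ≤ 2 * 4 ^ M * (2 ^ α * (5 * geomConst + 8)) * Kb * (K * Ka * t) *
              ((2 : ℝ) ^ (-η)) ^ ((i - j) + (j - i)) := by
            gcongr
            have : (1 : ℝ) ≤ 4 ^ M := one_le_pow₀ (by norm_num)
            nlinarith
    · have h1 := theta_weight_near ht hm hmM hα hαM (β := β) (by linarith)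
        (by omega : i ≤ j + 1) (by omega : j ≤ i + 1)
      have h2 := norm_commBlock_symbol_le_of_near hT hK ht hKa hα hA hAb hAm
        (by omega : i ≤ j + 1) (by omega : j ≤ i + 1)
      have hr : (1 / 2 : ℝ) ≤ 2 ^ (-η) := by
        rw [one_div, ← Real.rpow_neg_one]
        exact Real.rpow_le_rpow_of_exponent_le (by norm_num) (by linarith)
      have hr1 : (2 : ℝ) ^ (-η) ≤ 1 :=
        Real.rpow_le_one_of_one_le_of_nonpos (by norm_num) (by linarith)
      have h3 : (1 / 2 : ℝ) ≤ (2 ^ (-η)) ^ ((i - j) + (j - i)) := by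
        refine hr.trans ?_
        conv_lhs => rw [← pow_one ((2 : ℝ) ^ (-η))]
        exact pow_le_pow_of_le_one (by positivity) hr1 (by omega)
      calc theta t i ^ (-m) * (‖commBlock T (shell i) (shell j) a‖ * (Kb * theta t j ^ (-β)) *
            theta t j ^ m)
          ≤ theta t i ^ (-m) * ((2 ^ α * (5 * geomConst + 8)) *
              (K * Ka * t * theta t (max i j) ^ (α - 1)) * (Kb * theta t j ^ (-β)) *
              theta t j ^ m) := by gcongr
        _ = (2 ^ α * (5 * geomConst + 8)) * Kb * (K * Ka * t) * (theta t i ^ (-m) *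
              (theta t (max i j) ^ (α - 1) * (theta t j ^ (-β) * theta t j ^ m))) := by ring
        _ ≤ (2 ^ α * (5 * geomConst + 8)) * Kb * (K * Ka * t) * 4 ^ M := by gcongr
        _ = 2 * 4 ^ M * (2 ^ α * (5 * geomConst + 8)) * Kb * (K * Ka * t) * (1 / 2) := by ring
        _ ≤ _ := by gcongr

theorem norm_scWeight_bounds {t m ξ : ℝ} (ht : 0 < t) (ht1 : t ≤ 1) (hm : 0 ≤ m) {i : ℕ}
    (hξ : ξ ∈ shell i) : theta t i ^ (-m) ≤ ‖scWeight t (-m) ξ‖ ∧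
      ‖scWeight t (-m) ξ‖ ≤ 5 ^ (m / 2) * theta t i ^ (-m) := by
  have hθ := theta_pos ht i
  have e : ∀ x : ℝ, 0 < x → x ^ (-m) = (x ^ 2) ^ (-m / 2) := fun x hx ↦ by
    rw [← Real.rpow_natCast, ← Real.rpow_mul hx.le]; congr 1; push_cast; ring
  have hp : 0 < t * 2 ^ i := by positivity
  have ha : |t * ξ| = t * |ξ| := by rw [abs_mul, abs_of_pos ht]
  rw [norm_scWeight, e _ hθ, Real.norm_eq_abs, ha]
  have hpow : 0 < t * 2 ^ i := by positivity
  have h0 : 0 ≤ t * |ξ| := by positivity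
  constructor
  · refine Real.rpow_le_rpow_of_nonpos (by positivity) ?_ (by linarith)
    have : t * |ξ| ≤ t * 2 ^ i := by gcongr; exact hξ.1.le
    rw [theta]
    nlinarith
  -- With `r = t * 2 ^ i`, away from the first shell `5 (1 + r²/4) - (1 + r)² = (r - 4)²/4`. On the
  -- first shell `theta t 0 ≤ 2` because `t ≤ 1`.
  · have h1 : theta t i ^ 2 / 5 ≤ 1 + (t * |ξ|) ^ 2 := by
      rcases hξ.2 with rfl | h
      · rw [theta, pow_zero, mul_one]; nlinarith
      · have : t * 2 ^ i ≤ 2 * (t * |ξ|) := by nlinarith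
        rw [theta]
        nlinarith [sq_nonneg (t * 2 ^ i - 4)]
    refine (Real.rpow_le_rpow_of_nonpos (by positivity) h1 (by linarith)).trans (le_of_eq ?_)
    rw [div_eq_mul_inv, Real.mul_rpow (by positivity) (by norm_num), mul_comm,
      Real.inv_rpow (by norm_num), ← Real.rpow_neg (by norm_num)]
    congr 2
    ring

theorem bdd_scWeight {m : ℝ} (t : ℝ) (hm : 0 ≤ m) : Bdd (scWeight t (-m)) := by
  refine bdd_of_bound (measurable_scWeight t _).aestronglyMeasurable (K := 1)
    (Filter.Eventually.of_forall fun ξ ↦ ?_)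
  rw [norm_scWeight]
  exact Real.rpow_le_one_of_one_le_of_nonpos (by nlinarith [sq_nonneg ‖t * ξ‖]) (by linarith)

theorem enorm_shellP_scWeight {t m : ℝ} (ht : 0 < t) (ht1 : t ≤ 1) (hm : 0 ≤ m) (F : L2) (i : ℕ) :
    theta t i ^ (-m) * ‖shellP i F‖ ≤ ‖shellP i (mulL (scWeight t (-m)) F)‖ ∧
      ‖shellP i (mulL (scWeight t (-m)) F)‖ ≤
        5 ^ (m / 2) * theta t i ^ (-m) * ‖shellP i F‖ := by
  have hθ := Real.rpow_pos_of_pos (theta_pos ht i) (-m)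
  have h1 := coeFn_mulL (bdd_cut_one (measurableSet_shell i)) F
  have h2 := coeFn_mulL (bdd_cut_one (measurableSet_shell i)) (mulL (scWeight t (-m)) F)
  have h3 := coeFn_mulL (bdd_scWeight t hm) F
  constructor
  · rw [← le_inv_mul_iff₀ hθ]
    refine norm_le_of_ae_le ?_
    filter_upwards [h1, h2, h3] with ξ h1 h2 h3
    rw [shellP, proj, h1, h2, h3]
    by_cases hξ : ξ ∈ shell i
    · have := (norm_scWeight_bounds ht ht1 hm hξ).1
      simp only [cut, hξ, Set.indicator_of_mem, one_mul, norm_mul]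
      rw [le_inv_mul_iff₀ hθ]
      gcongr
    · simp [cut, hξ]
  · refine norm_le_of_ae_le ?_
    filter_upwards [h1, h2, h3] with ξ h1 h2 h3
    rw [shellP, proj, h1, h2, h3]
    by_cases hξ : ξ ∈ shell i
    · have := (norm_scWeight_bounds ht ht1 hm hξ).2
      simp only [cut, hξ, Set.indicator_of_mem, one_mul, norm_mul]
      gcongr
    · simp [cut, hξ]

theorem dyadSq_le_enorm_sq {t m : ℝ} (ht : 0 < t) (ht1 : t ≤ 1) (hm : 0 ≤ m) (F : L2) :
    dyadSq t m F ≤ ‖mulL (scWeight t (-m)) F‖ₑ ^ 2 := by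
  rw [enorm_sq_eq_tsum_shellP]
  refine ENNReal.tsum_le_tsum fun i ↦ ?_
  gcongr
  rw [← ofReal_norm, ← ofReal_norm,
    ← ENNReal.ofReal_mul (Real.rpow_nonneg (theta_pos ht i).le _)]
  exact ENNReal.ofReal_le_ofReal (enorm_shellP_scWeight ht ht1 hm F i).1

theorem enorm_sq_le_dyadSq {t m : ℝ} (ht : 0 < t) (ht1 : t ≤ 1) (hm : 0 ≤ m) (F : L2) :
    ‖mulL (scWeight t (-m)) F‖ₑ ^ 2 ≤ ENNReal.ofReal (5 ^ (m / 2)) ^ 2 * dyadSq t m F := by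
  rw [enorm_sq_eq_tsum_shellP, dyadSq, ← ENNReal.tsum_mul_left]
  refine ENNReal.tsum_le_tsum fun i ↦ ?_
  rw [← mul_pow]
  gcongr
  rw [← ofReal_norm, ← ofReal_norm, ← mul_assoc, ← ENNReal.ofReal_mul (by positivity),
    ← ENNReal.ofReal_mul (mul_nonneg (by positivity) (Real.rpow_nonneg (theta_pos ht i).le _))]
  exact ENNReal.ofReal_le_ofReal (enorm_shellP_scWeight ht ht1 hm F i).2

end

/-! ### Bounds in the weighted norm, and integrability from decay over the shells. -/

section

open scoped ENNReal

/-! ### Weighted operator bounds -/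

theorem norm_le_mul_of_enorm_sq_le {F G : L2} {a b : ℝ} (ha : 0 ≤ a) (hb : 0 ≤ b)
    {x y : ℝ≥0∞} (h1 : ‖F‖ₑ ^ 2 ≤ ENNReal.ofReal a ^ 2 * x) (h2 : x ≤ ENNReal.ofReal b ^ 2 * y)
    (h3 : y ≤ ‖G‖ₑ ^ 2) : ‖F‖ ≤ a * b * ‖G‖ := by
  have h : ‖F‖ₑ ^ 2 ≤ (ENNReal.ofReal (a * b * ‖G‖)) ^ 2 := by
    rw [ENNReal.ofReal_mul (by positivity), ENNReal.ofReal_mul ha, ofReal_norm, mul_pow, mul_pow,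
      mul_assoc]
    exact h1.trans (mul_le_mul_right (h2.trans (mul_le_mul_right h3 _)) _)
  have h' := (ENNReal.pow_le_pow_left_iff (by norm_num)).1 h
  rwa [← ofReal_norm, ENNReal.ofReal_le_ofReal_iff (by positivity)] at h'

theorem five_rpow_le {M : ℕ} {m : ℝ} (hmM : m ≤ M) : (5 : ℝ) ^ (m / 2) ≤ 5 ^ M := by
  rw [← Real.rpow_natCast]
  exact Real.rpow_le_rpow_of_exponent_le (by norm_num) (by linarith [(Nat.cast_nonneg M : (0 : ℝ) ≤ M)])

theorem norm_scWeight_map_le {M : ℕ} {K t m : ℝ} {T : L2 →L[ℂ] L2} (hT : RegOp M K T) (hK : 0 ≤ K)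
    (ht : 0 < t) (ht1 : t ≤ 1) (hM : 1 ≤ M) (hm : 0 ≤ m) (hmM : m ≤ M) (F : L2) :
    ‖mulL (scWeight t (-m)) (T F)‖ ≤ 5 ^ M * (4 ^ M * 8) * K * ‖mulL (scWeight t (-m)) F‖ := by
  have h2 := dyadSq_map_le hT hK ht hM hm hmM F
  have e : ENNReal.ofReal (4 ^ M * 2 * K) * 4 = ENNReal.ofReal (4 ^ M * 8 * K) := by
    rw [← ENNReal.ofReal_ofNat 4, ← ENNReal.ofReal_mul (by positivity)]; congr 1; ring
  rw [e] at h2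
  refine (norm_le_mul_of_enorm_sq_le (by positivity) (by positivity) (enorm_sq_le_dyadSq ht ht1 hm _)
    h2 (dyadSq_le_enorm_sq ht ht1 hm F)).trans ?_
  calc _ ≤ 5 ^ M * (4 ^ M * 8 * K) * ‖mulL (scWeight t (-m)) F‖ := by
        gcongr; exact five_rpow_le hmM
    _ = _ := by ring

/-- The constant in the commutator estimate. -/
def commConst (M : ℕ) (α η : ℝ) : ℝ :=
  5 ^ M * (2 * 4 ^ M * (2 ^ α * (5 * geomConst + 8)) * (2 * (1 - 2 ^ (-η))⁻¹))

theorem norm_scWeight_comm_le {M : ℕ} {K t m Ka Kb α β η : ℝ} {T : L2 →L[ℂ] L2} (hT : RegOp M K T)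
    (hK : 0 ≤ K) (ht : 0 < t) (ht1 : t ≤ 1) (hm : 0 ≤ m) (hmM : m ≤ M) (hKa : 0 ≤ Ka) (hKb : 0 ≤ Kb)
    (hα : 1 ≤ α) (hαM : α ≤ M) (hη0 : 0 < η) (hη1 : η ≤ 1) (hη : η ≤ 1 - α + β) {A : ℂ → ℂ}
    (hA : DifferentiableOn ℂ A {z | 0 < z.re ∧ |z.im| ≤ z.re})
    (hAb : ∀ z : ℂ, 0 < z.re → |z.im| ≤ z.re → ‖A z - A 0‖ ≤ Ka * (‖z‖ * (1 + ‖z‖) ^ (α - 1)))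
    (hAm : Measurable fun ξ : ℝ ↦ A (t * |ξ| : ℝ)) {F H X Y : L2}
    (hH : ∀ j, ‖shellP j H‖ ≤ Kb * theta t j ^ (-β) * ‖shellP j F‖)
    (hX : (X : ℝ → ℂ) =ᵐ[volume] fun ξ ↦ A (t * |ξ| : ℝ) * (T H : ℝ → ℂ) ξ)
    (hY : (Y : ℝ → ℂ) =ᵐ[volume] fun ξ ↦ A (t * |ξ| : ℝ) * (H : ℝ → ℂ) ξ) :
    ‖mulL (scWeight t (-m)) (X - T Y)‖ ≤
      commConst M α η * (Kb * K * Ka) * t * ‖mulL (scWeight t (-m)) F‖ := by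
  have h2 := dyadSq_comm_le hT hK ht hm hmM hKa hKb hα hαM hη0 hη1 hη hA hAb hAm hH hX hY
  have hr : (2 : ℝ) ^ (-η) < 1 := Real.rpow_lt_one_of_one_lt_of_neg (by norm_num) (by linarith)
  have hg := geomConst_nonneg
  have hr' : 0 < (1 - (2 : ℝ) ^ (-η))⁻¹ := inv_pos.2 (by linarith)
  have e : ENNReal.ofReal (2 * 4 ^ M * (2 ^ α * (5 * geomConst + 8)) * Kb * (K * Ka * t)) *
      (2 * (1 - ENNReal.ofReal (2 ^ (-η)))⁻¹) = ENNReal.ofReal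
      (2 * 4 ^ M * (2 ^ α * (5 * geomConst + 8)) * Kb * (K * Ka * t) *
        (2 * (1 - 2 ^ (-η))⁻¹)) := by
    rw [← ENNReal.ofReal_one, ← ENNReal.ofReal_sub _ (by positivity),
      ← ENNReal.ofReal_inv_of_pos (by linarith), ← ENNReal.ofReal_ofNat 2,
      ← ENNReal.ofReal_mul (by norm_num), ← ENNReal.ofReal_mul (by positivity)]
  rw [e] at h2
  refine (norm_le_mul_of_enorm_sq_le (by positivity) (by positivity) (enorm_sq_le_dyadSq ht ht1 hm _)
    h2 (dyadSq_le_enorm_sq ht ht1 hm F)).trans ?_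
  calc _ ≤ 5 ^ M * (2 * 4 ^ M * (2 ^ α * (5 * geomConst + 8)) * Kb * (K * Ka * t) *
        (2 * (1 - 2 ^ (-η))⁻¹)) * ‖mulL (scWeight t (-m)) F‖ := by
        gcongr; exact five_rpow_le hmM
    _ = _ := by rw [commConst]; ring

/-! ### Decay in frequency -/

/-- A weighted `ℓ¹` norm of the sizes of `G` on the frequency shells. -/
def dyadDecay (n : ℕ) (G : L2) : ℝ≥0∞ := ∑' j, 2 ^ (n * j) * ‖shellP j G‖ₑ

/-- One bound for all pairs of shells: decay of order `M + 1` in the output, paid for by growth in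
the input. It is meant for inputs that decay rapidly. -/
theorem norm_block_le {M : ℕ} {K : ℝ} {T : L2 →L[ℂ] L2} (hT : RegOp M K T) (hK : 0 ≤ K) (i j : ℕ) :
    ‖shellP i * T * shellP j‖ ≤
      K * 2 ^ (M + 1) * (1 / 2) ^ ((M + 1) * i) * 2 ^ ((M + 1) * j) := by
  by_cases hij : j + 2 ≤ i
  · refine (hT.off i j (Or.inr hij)).trans ?_
    rw [max_eq_left (by omega), min_eq_right (by omega)]
    have h1 : (2 : ℝ) ^ j ≤ 2 ^ ((M + 1) * j) :=
      pow_le_pow_right₀ (by norm_num) (Nat.le_mul_of_pos_left _ (by omega))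
    have h2 : (1 : ℝ) ≤ 2 ^ (M + 1) := one_le_pow₀ (by norm_num)
    calc K * 2 ^ j * (1 / 2) ^ ((M + 1) * i)
        ≤ K * 2 ^ ((M + 1) * j) * (1 / 2) ^ ((M + 1) * i) := by gcongr
      _ = K * 1 * (1 / 2) ^ ((M + 1) * i) * 2 ^ ((M + 1) * j) := by ring
      _ ≤ _ := by gcongr
  · refine ((norm_proj_mul_mul_proj_le T _ _).trans hT.norm_le).trans ?_
    have h1 : (2 : ℝ) ^ ((M + 1) * i) ≤ 2 ^ (M + 1) * 2 ^ ((M + 1) * j) := by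
      rw [← pow_add]
      refine pow_le_pow_right₀ (by norm_num) ?_
      have : i ≤ j + 1 := by omega
      calc (M + 1) * i ≤ (M + 1) * (j + 1) := Nat.mul_le_mul_left _ this
        _ = _ := by ring
    calc K = K * ((1 / 2) ^ ((M + 1) * i) * 2 ^ ((M + 1) * i)) := by
          rw [← mul_pow]; norm_num
      _ ≤ K * ((1 / 2) ^ ((M + 1) * i) * (2 ^ (M + 1) * 2 ^ ((M + 1) * j))) := by gcongr
      _ = _ := by ring

theorem two_pow_eq_ofReal (k : ℕ) : (2 : ℝ≥0∞) ^ k = ENNReal.ofReal (2 ^ k) := by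
  rw [ENNReal.ofReal_pow (by norm_num), ENNReal.ofReal_ofNat]

theorem enorm_shellP_map_le {M : ℕ} {K : ℝ} {T : L2 →L[ℂ] L2} (hT : RegOp M K T) (hK : 0 ≤ K)
    (G : L2) (i : ℕ) : ‖shellP i (T G)‖ₑ ≤
      ENNReal.ofReal (K * 2 ^ (M + 1) * (1 / 2) ^ ((M + 1) * i)) * dyadDecay (M + 1) G := by
  have h1 : HasSum (fun j ↦ (shellP i * T * shellP j) G) (shellP i (T G)) :=
    (hasSum_shellP G).mapL (shellP i * T)
  refine (enorm_apply_le_tsum_shellP h1 fun j ↦ by rw [mul_assoc, shellP_mul_shellP]).trans ?_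
  rw [dyadDecay, ← ENNReal.tsum_mul_left]
  refine ENNReal.tsum_le_tsum fun j ↦ ?_
  rw [← mul_assoc]
  gcongr
  rw [← ofReal_norm, two_pow_eq_ofReal,
    ← ENNReal.ofReal_mul (by positivity)]
  exact ENNReal.ofReal_le_ofReal (norm_block_le hT hK i j)

theorem volume_shell_le (i : ℕ) : volume (shell i) ≤ ENNReal.ofReal (2 * 2 ^ i) := by
  refine (measure_mono (t := Set.Icc (-2 ^ i) (2 ^ i)) fun ξ hξ ↦ ?_).trans ?_
  · exact abs_le.1 hξ.1.le
  · rw [Real.volume_Icc]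
    exact ENNReal.ofReal_le_ofReal (by linarith)

theorem tsum_ofReal_geometric {r : ℝ} (c : ℝ) (hc : 0 ≤ c) (hr0 : 0 ≤ r) (hr1 : r < 1) :
    ∑' i : ℕ, ENNReal.ofReal (c * r ^ i) = ENNReal.ofReal (c * (1 - r)⁻¹) := by
  rw [← ENNReal.ofReal_tsum_of_nonneg (fun i ↦ by positivity)
    ((summable_geometric_of_lt_one hr0 hr1).mul_left c), tsum_mul_left,
    tsum_geometric_of_lt_one hr0 hr1]

/-- A shell has measure `O(2 ^ i)`, so `L²` norms of size `2^{-i}` give summable `L¹` norms of size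
`2^{-i/2}`. The proof replaces Cauchy–Schwarz by `x ≤ x² / s + s`. -/
theorem enorm_le_of_shell_decay {g : ℝ → ℂ} {B : ℝ} (hB : 0 < B)
    (h : ∀ i, ∫⁻ ξ in shell i, ‖g ξ‖ₑ ^ 2 ≤ ENNReal.ofReal (B * (1 / 2) ^ i) ^ 2) :
    ∫⁻ ξ, ‖g ξ‖ₑ ≤ ENNReal.ofReal (11 * B) ∧
      ∫⁻ ξ, ‖g ξ‖ₑ ^ 2 ≤ ENNReal.ofReal (2 * B) ^ 2 := by
  constructor
  · rw [lintegral_eq_tsum_shell]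
    have key : ∀ i, ∫⁻ ξ in shell i, ‖g ξ‖ₑ ≤
        ENNReal.ofReal (B * (2 / 3) ^ i) + ENNReal.ofReal (2 * B * (3 / 4) ^ i) := by
      intro i
      -- Any ratio strictly between `1/4` and `1/2` makes both terms summable. With `3/8` they are
      -- `B (2/3)^i` and `2 B (3/4)^i`, of sums `3 B` and `8 B`.
      set s : ℝ := B * (3 / 8) ^ i with hs
      have hs0 : 0 < s := by positivity
      have hpt : ∀ ξ, ‖g ξ‖ₑ ≤ ENNReal.ofReal s⁻¹ * ‖g ξ‖ₑ ^ 2 + ENNReal.ofReal s := by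
        intro ξ
        rw [← ofReal_norm, ← ENNReal.ofReal_pow (norm_nonneg _),
          ← ENNReal.ofReal_mul (by positivity), ← ENNReal.ofReal_add (by positivity) hs0.le]
        refine ENNReal.ofReal_le_ofReal ?_
        set x := ‖g ξ‖
        have : x * s ≤ x ^ 2 + s ^ 2 := by nlinarith [sq_nonneg (x - s), sq_nonneg x, sq_nonneg s]
        calc x = s⁻¹ * (x * s) := by field_simp
          _ ≤ s⁻¹ * (x ^ 2 + s ^ 2) := by gcongr
          _ = _ := by field_simp
      calc ∫⁻ ξ in shell i, ‖g ξ‖ₑ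
          ≤ ∫⁻ ξ in shell i, (ENNReal.ofReal s⁻¹ * ‖g ξ‖ₑ ^ 2 + ENNReal.ofReal s) :=
            lintegral_mono hpt
        _ = ENNReal.ofReal s⁻¹ * (∫⁻ ξ in shell i, ‖g ξ‖ₑ ^ 2) +
              ENNReal.ofReal s * volume (shell i) := by
            rw [lintegral_add_right _ measurable_const, lintegral_const_mul' _ _ (by simp),
              setLIntegral_const]
        _ ≤ ENNReal.ofReal s⁻¹ * ENNReal.ofReal (B * (1 / 2) ^ i) ^ 2 +
              ENNReal.ofReal s * ENNReal.ofReal (2 * 2 ^ i) := by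
            gcongr
            · exact h i
            · exact volume_shell_le i
        _ = _ := by
            rw [← ENNReal.ofReal_pow (by positivity), ← ENNReal.ofReal_mul (by positivity),
              ← ENNReal.ofReal_mul (by positivity)]
            congr 2
            · rw [hs, mul_inv, mul_pow, ← pow_mul, mul_comm i 2, pow_mul, ← inv_pow]
              have : (2 / 3 : ℝ) = (3 / 8)⁻¹ * (1 / 2) ^ 2 := by norm_num
              rw [this, mul_pow]
              field_simp
            · have : (3 / 4 : ℝ) = 3 / 8 * 2 := by norm_num
              rw [hs, this, mul_pow]
              ring
    refine (ENNReal.tsum_le_tsum key).trans (le_of_eq ?_)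
    rw [ENNReal.tsum_add, tsum_ofReal_geometric _ hB.le (by norm_num) (by norm_num),
      tsum_ofReal_geometric _ (by positivity) (by norm_num) (by norm_num),
      ← ENNReal.ofReal_add (by norm_num; positivity) (by norm_num; positivity)]
    congr 1
    norm_num
    ring
  · rw [lintegral_eq_tsum_shell]
    refine (ENNReal.tsum_le_tsum h).trans ?_
    have e : ∀ i : ℕ, ENNReal.ofReal (B * (1 / 2) ^ i) ^ 2 =
        ENNReal.ofReal (B ^ 2 * (1 / 4) ^ i) := by
      intro i
      rw [← ENNReal.ofReal_pow (by positivity), mul_pow, ← pow_mul, mul_comm i 2, pow_mul]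
      norm_num
    simp_rw [e]
    rw [tsum_ofReal_geometric _ (by positivity) (by norm_num) (by norm_num),
      ← ENNReal.ofReal_pow (by positivity)]
    refine ENNReal.ofReal_le_ofReal ?_
    norm_num
    nlinarith [sq_nonneg B]

theorem integrable_memLp_of_shell_decay {g : ℝ → ℂ} (hg : AEStronglyMeasurable g volume) {B : ℝ}
    (hB : 0 < B)
    (h : ∀ i, ∫⁻ ξ in shell i, ‖g ξ‖ₑ ^ 2 ≤ ENNReal.ofReal (B * (1 / 2) ^ i) ^ 2) :
    Integrable g ∧ ∫ ξ, ‖g ξ‖ ≤ 11 * B ∧ ∃ h2 : MemLp g 2, ‖h2.toLp g‖ ≤ 2 * B := by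
  obtain ⟨h1, h2⟩ := enorm_le_of_shell_decay hB h
  have i1 : Integrable g := ⟨hg, h1.trans_lt ENNReal.ofReal_lt_top⟩
  refine ⟨i1, ?_, ?_⟩
  · rw [integral_norm_eq_lintegral_enorm hg]
    exact ENNReal.toReal_le_of_le_ofReal (by positivity) h1
  · have e : eLpNorm g 2 volume ^ 2 = ∫⁻ ξ, ‖g ξ‖ₑ ^ 2 := by
      rw [eLpNorm_eq_lintegral_rpow_enorm_toReal (by norm_num) (by norm_num)]
      simp only [ENNReal.toReal_ofNat, one_div]
      rw [← ENNReal.rpow_natCast, ← ENNReal.rpow_mul]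
      norm_num
    rw [← e, ENNReal.pow_le_pow_left_iff (by norm_num)] at h2
    have hm : MemLp g 2 := ⟨hg, h2.trans_lt ENNReal.ofReal_lt_top⟩
    refine ⟨hm, ?_⟩
    rw [Lp.norm_toLp]
    exact ENNReal.toReal_le_of_le_ofReal (by positivity) h2

/-- The symbol grows like `2 ^ (M * i)` and the output of `T` decays like `2^{-(M+1) i}`. The
remaining factor `2^{-i}` is enough for integrability as well as square integrability. -/
theorem symbol_map_integrable {M : ℕ} {K Ka Q : ℝ} {T : L2 →L[ℂ] L2} (hT : RegOp M K T) (hK : 0 < K)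
    {a : ℝ → ℂ} (ham : Measurable a) (hKa : 0 < Ka)
    (ha : ∀ i, ∀ ξ ∈ shell i, ‖a ξ‖ ≤ Ka * 2 ^ (M * i)) {G : L2} (hQ : 0 < Q)
    (hG : dyadDecay (M + 1) G ≤ ENNReal.ofReal Q) :
    Integrable (fun ξ ↦ a ξ * (T G : ℝ → ℂ) ξ) ∧
      ∫ ξ, ‖a ξ * (T G : ℝ → ℂ) ξ‖ ≤ 11 * (K * Ka * (2 ^ (M + 1) * Q)) ∧
      ∃ h2 : MemLp (fun ξ ↦ a ξ * (T G : ℝ → ℂ) ξ) 2,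
        ‖h2.toLp _‖ ≤ 2 * (K * Ka * (2 ^ (M + 1) * Q)) := by
  refine integrable_memLp_of_shell_decay
    (ham.aestronglyMeasurable.mul (Lp.aestronglyMeasurable (T G))) (by positivity) fun i ↦ ?_
  calc ∫⁻ ξ in shell i, ‖a ξ * (T G : ℝ → ℂ) ξ‖ₑ ^ 2
      ≤ ∫⁻ ξ in shell i, ENNReal.ofReal (Ka * 2 ^ (M * i)) ^ 2 * ‖(T G : ℝ → ℂ) ξ‖ₑ ^ 2 := by
        refine setLIntegral_mono' (measurableSet_shell i) fun ξ hξ ↦ ?_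
        rw [enorm_mul, mul_pow]
        gcongr
        rw [← ofReal_norm]
        exact ENNReal.ofReal_le_ofReal (ha i ξ hξ)
    _ = (ENNReal.ofReal (Ka * 2 ^ (M * i)) * ‖shellP i (T G)‖ₑ) ^ 2 := by
        rw [lintegral_const_mul' _ _ (by simp), mul_pow,
          enorm_shellP_sq (T G) (Filter.EventuallyEq.refl _ _)]
    _ ≤ (ENNReal.ofReal (Ka * 2 ^ (M * i)) *
          (ENNReal.ofReal (K * 2 ^ (M + 1) * (1 / 2) ^ ((M + 1) * i)) * ENNReal.ofReal Q)) ^ 2 := by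
        gcongr
        exact (enorm_shellP_map_le hT hK.le G i).trans (mul_le_mul_right hG _)
    _ = _ := by
        rw [← ENNReal.ofReal_mul (by positivity), ← ENNReal.ofReal_mul (by positivity)]
        congr 2
        rw [add_mul, one_mul, pow_add (1 / 2 : ℝ)]
        have e : (2 : ℝ) ^ (M * i) * (1 / 2) ^ (M * i) = 1 := by rw [← mul_pow]; norm_num
        linear_combination (Ka * K * 2 ^ (M + 1) * (1 / 2) ^ i * Q) * e

theorem dyadDecay_le_of_ae {n : ℕ} {F G : L2} (hn : 1 ≤ n)
    (h : (G : ℝ → ℂ) =ᵐ[volume] fun ξ ↦ ((1 + ξ ^ 2 : ℝ) : ℂ) ^ n * (F : ℝ → ℂ) ξ) :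
    dyadDecay n F ≤ ENNReal.ofReal (4 ^ n * 2 * ‖G‖) := by
  have key : ∀ j, ‖shellP j F‖ ≤ 4 ^ n * (1 / 4) ^ (n * j) * ‖G‖ := by
    intro j
    refine norm_le_of_ae_le ?_
    filter_upwards [coeFn_mulL (bdd_cut_one (measurableSet_shell j)) F, h] with ξ h1 h2
    rw [shellP, proj, h1, h2]
    by_cases hξ : ξ ∈ shell j
    · have h3 : (4 : ℝ) ^ j ≤ 4 * (1 + ξ ^ 2) := by
        have e : (4 : ℝ) ^ j = (2 ^ j) ^ 2 := by rw [← pow_mul, mul_comm, pow_mul]; norm_num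
        rw [e]
        rcases hξ.2 with rfl | h
        · nlinarith [sq_nonneg ξ]
        · have := pow_le_pow_left₀ (by positivity) h 2
          rw [mul_pow, sq_abs] at this
          linarith
      simp only [cut, hξ, Set.indicator_of_mem, one_mul, norm_mul, norm_pow, norm_real]
      rw [Real.norm_of_nonneg (by positivity), ← mul_assoc]
      refine le_mul_of_one_le_left (norm_nonneg _) ?_
      have h4 := pow_le_pow_left₀ (by positivity) h3 n
      rw [mul_pow, ← pow_mul, mul_comm j n] at h4
      rw [one_div, inv_pow, mul_right_comm, le_mul_inv_iff₀ (by positivity), one_mul]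
      exact h4
    · simp only [cut, hξ, not_false_eq_true, Set.indicator_of_notMem, zero_mul, norm_zero]
      positivity
  calc dyadDecay n F ≤ ∑' j, ENNReal.ofReal (4 ^ n * ‖G‖ * (1 / 2) ^ j) := by
        refine ENNReal.tsum_le_tsum fun j ↦ ?_
        rw [← ofReal_norm, two_pow_eq_ofReal,
          ← ENNReal.ofReal_mul (by positivity)]
        refine ENNReal.ofReal_le_ofReal ?_
        calc (2 : ℝ) ^ (n * j) * ‖shellP j F‖
            ≤ 2 ^ (n * j) * (4 ^ n * (1 / 4) ^ (n * j) * ‖G‖) := by gcongr; exact key j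
          _ = 4 ^ n * ‖G‖ * (1 / 2) ^ (n * j) := by
              have : (1 / 2 : ℝ) ^ (n * j) = 2 ^ (n * j) * (1 / 4) ^ (n * j) := by
                rw [← mul_pow]; norm_num
              rw [this]; ring
          _ ≤ _ := by
              gcongr ?_ * ?_
              exact pow_le_pow_of_le_one (by norm_num) (by norm_num)
                (Nat.le_mul_of_pos_left _ hn)
    _ = _ := by
        rw [tsum_ofReal_geometric _ (by positivity) (by norm_num) (by norm_num)]
        congr 1
        norm_num
        ring

end

/-! ### Power series of the symbols in the speed. -/

section

open scoped ENNReal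

/-! ### Taylor coefficients as circle integrals -/

/-- The `k`-th Taylor coefficient at `z₀`, as an integral over the circle of radius `R`. -/
def coef (z₀ R : ℝ) (k : ℕ) (f : ℂ → ℂ) : ℂ :=
  (2 * Real.pi * Complex.I : ℂ)⁻¹ • ∮ z in C((z₀ : ℂ), R), ((z - z₀) ^ (k + 1))⁻¹ * f z

theorem hasSum_coef {z₀ R : ℝ} {f : ℂ → ℂ} (hf : DiffContOnCl ℂ f (Metric.ball (z₀ : ℂ) R)) {u : ℂ}
    (hu : ‖u‖ < R) : HasSum (fun k ↦ u ^ k * coef z₀ R k f) (f (z₀ + u)) := by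
  have hR : 0 < R := (norm_nonneg u).trans_lt hu
  have hc : ContinuousOn f (Metric.sphere (z₀ : ℂ) R) := by
    refine hf.continuousOn.mono ?_
    rw [closure_ball _ hR.ne']
    exact Metric.sphere_subset_closedBall
  have h1 := (hasSum_two_pi_I_cauchyPowerSeries_integral (hc.circleIntegrable hR.le) hu).const_smul
    (2 * Real.pi * Complex.I : ℂ)⁻¹
  rw [hf.two_pi_i_inv_smul_circleIntegral_sub_inv_smul (by simpa using hu)] at h1
  refine h1.congr_fun fun k ↦ ?_
  rw [coef, mul_smul_comm, ← circleIntegral.integral_const_mul]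
  congr 2
  funext z
  simp only [smul_eq_mul, div_pow, pow_succ, mul_inv]
  ring

/-- With coefficients written as circle integrals, every bound in `λ` that is uniform over the
circle passes to the `k`-th coefficient at the price of `R⁻¹ ^ k`; differences and derivatives in
`λ` are handled likewise. -/
theorem norm_coef_le {z₀ R A : ℝ} (hR : 0 < R) {f : ℂ → ℂ}
    (hf : ∀ z ∈ Metric.sphere (z₀ : ℂ) R, ‖f z‖ ≤ A) (k : ℕ) : ‖coef z₀ R k f‖ ≤ A * R⁻¹ ^ k := by
  have h := circleIntegral.norm_two_pi_i_inv_smul_integral_le_of_norm_le_const (c := (z₀ : ℂ))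
    (f := fun z ↦ ((z - z₀) ^ (k + 1))⁻¹ * f z) (C := (R ^ (k + 1))⁻¹ * A) hR.le fun z hz ↦ by
      rw [mem_sphere_iff_norm] at hz
      have hfz := hf z (by rwa [mem_sphere_iff_norm])
      rw [norm_mul, norm_inv, norm_pow, hz]
      gcongr
  refine h.trans (le_of_eq ?_)
  rw [pow_succ, inv_pow]
  field_simp

theorem circleIntegrable_coef {z₀ R : ℝ} (hR : 0 < R) {f : ℂ → ℂ}
    (hf : ContinuousOn f (Metric.sphere (z₀ : ℂ) R)) (k : ℕ) :
    CircleIntegrable (fun z ↦ ((z - z₀) ^ (k + 1))⁻¹ * f z) z₀ R := by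
  refine ContinuousOn.circleIntegrable hR.le (ContinuousOn.mul ?_ hf)
  refine ContinuousOn.inv₀ (by fun_prop) fun z hz ↦ pow_ne_zero _ fun h ↦ ?_
  rw [mem_sphere_iff_norm, h, norm_zero] at hz
  exact hR.ne hz

theorem coef_sub {z₀ R : ℝ} (hR : 0 < R) {f g : ℂ → ℂ}
    (hf : ContinuousOn f (Metric.sphere (z₀ : ℂ) R))
    (hg : ContinuousOn g (Metric.sphere (z₀ : ℂ) R)) (k : ℕ) :
    coef z₀ R k f - coef z₀ R k g = coef z₀ R k (fun z ↦ f z - g z) := by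
  rw [coef, coef, coef, ← smul_sub, ← circleIntegral.integral_sub (circleIntegrable_coef hR hf k)
    (circleIntegrable_coef hR hg k)]
  simp_rw [mul_sub]

theorem norm_coef_sub_le {z₀ R A : ℝ} (hR : 0 < R) {f g : ℂ → ℂ}
    (hf : ContinuousOn f (Metric.sphere (z₀ : ℂ) R))
    (hg : ContinuousOn g (Metric.sphere (z₀ : ℂ) R))
    (h : ∀ z ∈ Metric.sphere (z₀ : ℂ) R, ‖f z - g z‖ ≤ A) (k : ℕ) :
    ‖coef z₀ R k f - coef z₀ R k g‖ ≤ A * R⁻¹ ^ k := by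
  rw [coef_sub hR hf hg]
  exact norm_coef_le hR h k

/-- Differentiation under the integral sign; the dominating constant exists because the sphere and
the closed ball are compact. -/
theorem differentiableAt_coef {z₀ R ε : ℝ} (hR : 0 < R) (hε : 0 < ε) {f f' : ℂ → ℂ → ℂ} {lam : ℂ}
    (hf : ∀ μ ∈ Metric.closedBall lam ε, ContinuousOn (fun z ↦ f z μ) (Metric.sphere (z₀ : ℂ) R))
    (hf' : ContinuousOn (fun p : ℂ × ℂ ↦ f' p.1 p.2)
      (Metric.sphere (z₀ : ℂ) R ×ˢ Metric.closedBall lam ε))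
    (hd : ∀ z ∈ Metric.sphere (z₀ : ℂ) R, ∀ μ ∈ Metric.closedBall lam ε,
      HasDerivAt (f z) (f' z μ) μ) (k : ℕ) :
    DifferentiableAt ℂ (fun μ ↦ coef z₀ R k fun z ↦ f z μ) lam := by
  obtain ⟨B, hB⟩ := ((isCompact_sphere (z₀ : ℂ) R).prod
    (isCompact_closedBall lam ε)).exists_bound_of_continuousOn hf'
  set w : ℂ → ℂ := fun z ↦ ((z - z₀) ^ (k + 1))⁻¹ with hw
  have hmem : ∀ θ, circleMap z₀ R θ ∈ Metric.sphere (z₀ : ℂ) R := fun θ ↦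
    circleMap_mem_sphere _ hR.le θ
  have hlam : lam ∈ Metric.closedBall lam ε := Metric.mem_closedBall_self hε.le
  have hcont : ∀ {g : ℂ → ℂ}, ContinuousOn g (Metric.sphere (z₀ : ℂ) R) →
      Continuous fun θ ↦ deriv (circleMap z₀ R) θ • (w (circleMap z₀ R θ) * g (circleMap z₀ R θ)) := by
    intro g hg
    have h1 : ContinuousOn (fun z ↦ w z * g z) (Metric.sphere (z₀ : ℂ) R) := by
      refine ContinuousOn.mul (ContinuousOn.inv₀ (by fun_prop) fun z hz ↦ pow_ne_zero _ fun h ↦ ?_) hg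
      rw [mem_sphere_iff_norm, h, norm_zero] at hz
      exact hR.ne hz
    have h2 : Continuous fun θ ↦ w (circleMap z₀ R θ) * g (circleMap z₀ R θ) :=
      h1.comp_continuous (continuous_circleMap _ _) hmem
    have h3 : Continuous fun θ ↦ deriv (circleMap z₀ R) θ := by
      simp only [deriv_circleMap]
      fun_prop
    exact h3.smul h2
  have hf'c : ContinuousOn (fun z ↦ f' z lam) (Metric.sphere (z₀ : ℂ) R) :=
    hf'.comp (f := fun z ↦ (z, lam)) (by fun_prop) fun z hz ↦ ⟨hz, hlam⟩
  have hcw : ∀ θ, ‖deriv (circleMap z₀ R) θ • w (circleMap z₀ R θ)‖ ≤ R * (R ^ (k + 1))⁻¹ := by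
    intro θ
    have h := hmem θ
    rw [mem_sphere_iff_norm] at h
    rw [norm_smul, hw, norm_inv, norm_pow, h, deriv_circleMap]
    simp [abs_of_pos hR]
  have hB0 : 0 ≤ B := (norm_nonneg _).trans (hB (circleMap z₀ R 0, lam) ⟨hmem 0, hlam⟩)
  have h := intervalIntegral.hasDerivAt_integral_of_dominated_loc_of_deriv_le (𝕜 := ℂ)
    (μ := volume) (a := 0) (b := 2 * Real.pi) (x₀ := lam) (s := Metric.closedBall lam ε)
    (F := fun μ θ ↦ deriv (circleMap z₀ R) θ • (w (circleMap z₀ R θ) * f (circleMap z₀ R θ) μ))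
    (F' := fun μ θ ↦ deriv (circleMap z₀ R) θ • (w (circleMap z₀ R θ) * f' (circleMap z₀ R θ) μ))
    (bound := fun _ ↦ R * (R ^ (k + 1))⁻¹ * B) (Metric.closedBall_mem_nhds lam hε)
    (by
      filter_upwards [Metric.closedBall_mem_nhds lam hε] with μ hμ
      exact (hcont (hf μ hμ)).aestronglyMeasurable)
    ((hcont (hf lam hlam)).intervalIntegrable _ _) (hcont hf'c).aestronglyMeasurable
    (Filter.Eventually.of_forall fun θ _ μ hμ ↦ by
      rw [smul_eq_mul, ← mul_assoc, norm_mul]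
      exact mul_le_mul (hcw θ) (hB (circleMap z₀ R θ, μ) ⟨hmem θ, hμ⟩) (norm_nonneg _)
        (by positivity))
    (by simp)
    (Filter.Eventually.of_forall fun θ _ μ hμ ↦
      HasDerivAt.fun_const_smul (deriv (circleMap z₀ R) θ)
        (HasDerivAt.const_mul (w (circleMap z₀ R θ)) (hd _ (hmem θ) μ hμ)))
  exact h.2.differentiableAt.const_smul (2 * Real.pi * Complex.I : ℂ)⁻¹

/-! ### The analytic continuation of the symbol -/

/-- The function `(1 + z λ)^{s / z}`. -/
def symE (s z lam : ℂ) : ℂ := exp (s * log (1 + z * lam) / z)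

/-- Two arguments of size at most `π / 4` add up to at most `π / 2`. Thus `1 + zλ` stays in the
right half plane, where the logarithm is holomorphic. -/
theorem re_mul_nonneg {z lam : ℂ} (hz : |z.im| ≤ z.re) (hl : |lam.im| ≤ lam.re) :
    0 ≤ (z * lam).re := by
  rw [mul_re, sub_nonneg]
  calc z.im * lam.im ≤ |z.im * lam.im| := le_abs_self _
    _ = |z.im| * |lam.im| := abs_mul _ _
    _ ≤ z.re * lam.re := mul_le_mul hz hl (abs_nonneg _) ((abs_nonneg _).trans hz)

theorem one_le_norm_of_re {w : ℂ} (hw : 0 ≤ w.re) : 1 ≤ ‖1 + w‖ := by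
  have := Complex.re_le_norm (1 + w)
  simp only [add_re, one_re] at this
  linarith

theorem hasDerivAt_symE (s : ℂ) {z lam : ℂ} (hz : z ≠ 0) (h : 0 < (1 + z * lam).re) :
    HasDerivAt (symE s z) (s * symE s z lam / (1 + z * lam)) lam := by
  have h1 : HasDerivAt (fun μ ↦ 1 + z * μ) z lam := by
    simpa using ((hasDerivAt_id lam).const_mul z).const_add 1
  have h2 := (((h1.clog (Or.inl h)).const_mul s).div_const z).cexp
  refine h2.congr_deriv ?_
  rw [symE]
  field_simp

section disc

variable {z₀ R : ℝ}

/-- The condition `R ≤ z₀ / 2` puts the disc inside the sector. Inversion sends it to the disc with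
diameter from `(z₀ + R)⁻¹` to `(z₀ - R)⁻¹`; these end points become the orders of the two symbols.
-/
theorem disc_bounds (hR : 0 < R) (hRz : R ≤ z₀ / 2) {z : ℂ}
    (hz : z ∈ Metric.closedBall (z₀ : ℂ) R) :
    |z.im| ≤ z.re ∧ z₀ - R ≤ z.re ∧ z₀ - R ≤ ‖z‖ ∧ ‖z‖ ≤ z₀ + R ∧
      (z₀ + R)⁻¹ ≤ (z⁻¹).re ∧ ‖z⁻¹‖ ≤ (z₀ - R)⁻¹ := by
  rw [mem_closedBall_iff_norm] at hz
  have h1 : |z.re - z₀| ≤ R := by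
    have := Complex.abs_re_le_norm (z - z₀)
    simp only [sub_re, ofReal_re] at this
    linarith
  have h2 : (z.re - z₀) ^ 2 + z.im ^ 2 ≤ R ^ 2 := by
    have h3 : ‖z - z₀‖ ^ 2 ≤ R ^ 2 := by gcongr
    rw [← Complex.normSq_eq_norm_sq, Complex.normSq_apply] at h3
    simp only [sub_re, sub_im, ofReal_re, ofReal_im, sub_zero] at h3
    nlinarith
  have h4 := abs_le.1 h1
  have hre : z₀ - R ≤ z.re := by linarith
  have hn : z₀ - R ≤ ‖z‖ := hre.trans (Complex.re_le_norm z)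
  have hpos : 0 < z₀ - R := by linarith
  refine ⟨?_, hre, hn, ?_, ?_, ?_⟩
  · apply abs_le_of_sq_le_sq _ (by linarith)
    nlinarith [sq_nonneg (z.re - z₀ / 2)]
  · have h5 : ‖z‖ ≤ ‖z - z₀‖ + ‖(z₀ : ℂ)‖ := by simpa using norm_add_le (z - z₀) (z₀ : ℂ)
    rw [norm_real, Real.norm_of_nonneg (by linarith)] at h5
    linarith
  · rw [Complex.inv_re, inv_le_comm₀ (by linarith) (by
      refine div_pos (by linarith) (Complex.normSq_pos.2 ?_)
      intro h; rw [h, norm_zero] at hn; linarith), inv_div, div_le_iff₀ (by linarith),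
      Complex.normSq_apply]
    nlinarith
  · rw [norm_inv]
    exact inv_anti₀ hpos hn

/-- With `w = 1 + zλ`, the real part of `log w / z` is `log ‖w‖ * Re z⁻¹ - arg w * Im z⁻¹`. The
second term is at most `π / (z₀ - R)` in absolute value, and `log ‖w‖ ≥ 0` lets the extreme values
of `Re z⁻¹` be used. -/
theorem norm_symE_le (hR : 0 < R) (hRz : R ≤ z₀ / 2) {z lam : ℂ}
    (hz : z ∈ Metric.closedBall (z₀ : ℂ) R) (hl : |lam.im| ≤ lam.re) :
    ‖symE 1 z lam‖ ≤ Real.exp (Real.pi * (z₀ - R)⁻¹) * ‖1 + z * lam‖ ^ (z₀ - R)⁻¹ ∧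
      ‖symE (-1) z lam‖ ≤ Real.exp (Real.pi * (z₀ - R)⁻¹) * ‖1 + z * lam‖ ^ (-(z₀ + R)⁻¹) := by
  obtain ⟨h1, h2, h3, h4, h5, h6⟩ := disc_bounds hR hRz hz
  have hw := one_le_norm_of_re (re_mul_nonneg h1 hl)
  set w := 1 + z * lam with hwdef
  have hL : 0 ≤ Real.log ‖w‖ := Real.log_nonneg hw
  have hre : (log w / z).re = Real.log ‖w‖ * (z⁻¹).re - arg w * (z⁻¹).im := by
    rw [div_eq_mul_inv, mul_re, log_re, log_im]
  have h7 : |arg w * (z⁻¹).im| ≤ Real.pi * (z₀ - R)⁻¹ := by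
    rw [abs_mul]
    exact mul_le_mul (Complex.abs_arg_le_pi w) ((Complex.abs_im_le_norm _).trans h6) (abs_nonneg _)
      Real.pi_pos.le
  have h8 := abs_le.1 h7
  have h9 : (z⁻¹).re ≤ (z₀ - R)⁻¹ := (Complex.re_le_norm _).trans h6
  have hwpos : 0 < ‖w‖ := by linarith
  constructor
  · rw [symE, norm_exp, one_mul, hre, Real.rpow_def_of_pos hwpos, ← Real.exp_add]
    refine Real.exp_le_exp.2 ?_
    nlinarith [mul_le_mul_of_nonneg_left h9 hL]
  · have e : ((-1) * log w / z).re = -(log w / z).re := by rw [neg_one_mul, neg_div, neg_re]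
    rw [symE, norm_exp, e, hre, Real.rpow_def_of_pos hwpos, ← Real.exp_add]
    refine Real.exp_le_exp.2 ?_
    nlinarith [mul_le_mul_of_nonneg_left h5 hL]

theorem norm_one_add_mul_le (hR : 0 < R) (hRz : R ≤ z₀ / 2) (h2 : z₀ + R ≤ 2) {z : ℂ}
    (hz : z ∈ Metric.closedBall (z₀ : ℂ) R) (lam : ℂ) : ‖1 + z * lam‖ ≤ 2 * (1 + ‖lam‖) := by
  obtain ⟨-, -, -, h4, -⟩ := disc_bounds hR hRz hz
  refine (norm_add_le _ _).trans ?_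
  rw [norm_one, norm_mul]
  nlinarith [norm_nonneg lam]

theorem continuousOn_symE (hR : 0 < R) (hRz : R ≤ z₀ / 2) (s : ℂ) {lam : ℂ}
    (hl : |lam.im| ≤ lam.re) :
    ContinuousOn (fun z ↦ symE s z lam) (Metric.closedBall (z₀ : ℂ) R) := by
  intro z hz
  obtain ⟨h1, h2, -⟩ := disc_bounds hR hRz hz
  have hz0 : z ≠ 0 := by rintro rfl; simp at h2; linarith
  have h3 : 1 + z * lam ∈ slitPlane := Or.inl (by
    have := re_mul_nonneg h1 hl
    rw [add_re, one_re]; linarith)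
  refine ContinuousAt.continuousWithinAt ?_
  unfold symE
  refine ContinuousAt.cexp (ContinuousAt.div (ContinuousAt.mul continuousAt_const
    (ContinuousAt.clog (by fun_prop) h3)) continuousAt_id hz0)

theorem diffContOnCl_symE (hR : 0 < R) (hRz : R ≤ z₀ / 2) (s : ℂ) {lam : ℂ}
    (hl : |lam.im| ≤ lam.re) :
    DiffContOnCl ℂ (fun z ↦ symE s z lam) (Metric.ball (z₀ : ℂ) R) := by
  refine ⟨fun z hz ↦ ?_, ?_⟩
  · obtain ⟨h1, h2, -⟩ := disc_bounds hR hRz (Metric.ball_subset_closedBall hz)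
    have hz0 : z ≠ 0 := by rintro rfl; simp at h2; linarith
    have h3 : 1 + z * lam ∈ slitPlane := Or.inl (by
      have := re_mul_nonneg h1 hl
      rw [add_re, one_re]; linarith)
    refine DifferentiableAt.differentiableWithinAt ?_
    unfold symE
    have h4 : DifferentiableAt ℂ (fun z ↦ log (1 + z * lam)) z :=
      DifferentiableAt.clog (by fun_prop) h3
    exact ((h4.const_mul s).div differentiableAt_id hz0).cexp
  · rw [closure_ball _ hR.ne']
    exact continuousOn_symE hR hRz s hl

theorem symE_zero_right (s z : ℂ) : symE s z 0 = 1 := by simp [symE]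

theorem symE_ofReal (s : ℝ) {c x : ℝ} (hc : 0 < c) (hx : 0 ≤ x) :
    symE s c x = (((1 + c * x) ^ (s / c) : ℝ) : ℂ) := by
  have h : 0 < 1 + c * x := by positivity
  rw [symE, Real.rpow_def_of_pos h]
  push_cast
  rw [ofReal_log h.le]
  push_cast
  congr 1
  ring

theorem isConvexSector : Convex ℝ {z : ℂ | |z.im| ≤ z.re} := by
  intro x hx y hy a b ha hb _
  simp only [Set.mem_ofPred_eq, add_im, add_re, real_smul, im_ofReal_mul, re_ofReal_mul] at *
  calc |a * x.im + b * y.im| ≤ |a * x.im| + |b * y.im| := abs_add_le _ _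
    _ = a * |x.im| + b * |y.im| := by rw [abs_mul, abs_mul, abs_of_nonneg ha, abs_of_nonneg hb]
    _ ≤ _ := by gcongr

/-- Mean value inequality on the convex set formed by the sector and a ball. The derivative `symE /
(1 + zλ)` is at most of order `α - 1 ≥ 0`, so its bound increases with the modulus and may be taken
at the end point. -/
theorem norm_symE_sub_one_le (hR : 0 < R) (hRz : R ≤ z₀ / 2) (h2 : z₀ + R ≤ 2) {α : ℝ}
    (hα : 1 ≤ α) (hα' : (z₀ - R)⁻¹ ≤ α) {z lam : ℂ} (hz : z ∈ Metric.closedBall (z₀ : ℂ) R)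
    (hl : |lam.im| ≤ lam.re) : ‖symE 1 z lam - 1‖ ≤
      Real.exp (Real.pi * (z₀ - R)⁻¹) * 2 ^ (α - 1) * (‖lam‖ * (1 + ‖lam‖) ^ (α - 1)) := by
  obtain ⟨b1, b2, -⟩ := disc_bounds hR hRz hz
  have hz0 : z ≠ 0 := by rintro rfl; simp at b2; linarith
  set s : Set ℂ := {μ | |μ.im| ≤ μ.re} ∩ Metric.closedBall 0 ‖lam‖ with hs
  have hconv : Convex ℝ s := isConvexSector.inter (convex_closedBall _ _)
  have h := hconv.norm_image_sub_le_of_norm_hasDerivWithin_le (f := symE 1 z)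
    (f' := fun μ ↦ 1 * symE 1 z μ / (1 + z * μ)) (x := 0) (y := lam)
    (C := Real.exp (Real.pi * (z₀ - R)⁻¹) * (2 * (1 + ‖lam‖)) ^ (α - 1))
    (fun μ hμ ↦ (hasDerivAt_symE 1 hz0 (by
      have := re_mul_nonneg b1 hμ.1
      rw [add_re, one_re]; linarith)).hasDerivWithinAt)
    (fun μ hμ ↦ by
      have h3 := (norm_symE_le hR hRz hz hμ.1).1
      have h4 := one_le_norm_of_re (re_mul_nonneg b1 hμ.1)
      have h5 := norm_one_add_mul_le hR hRz h2 hz μ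
      have h6 : ‖μ‖ ≤ ‖lam‖ := by simpa using hμ.2
      rw [one_mul, norm_div, div_le_iff₀ (by linarith)]
      refine h3.trans ?_
      rw [mul_assoc]
      refine mul_le_mul_of_nonneg_left ?_ (Real.exp_pos _).le
      calc ‖1 + z * μ‖ ^ (z₀ - R)⁻¹ ≤ ‖1 + z * μ‖ ^ α :=
            Real.rpow_le_rpow_of_exponent_le h4 hα'
        _ = ‖1 + z * μ‖ ^ (α - 1) * ‖1 + z * μ‖ := by
            rw [Real.rpow_sub_one (by linarith)]; field_simp
        _ ≤ _ := by
            refine mul_le_mul_of_nonneg_right ?_ (norm_nonneg _)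
            refine Real.rpow_le_rpow (norm_nonneg _) ?_ (by linarith)
            linarith)
    ⟨by simp, by simp⟩ ⟨hl, by simp⟩
  rw [symE_zero_right, sub_zero] at h
  refine h.trans (le_of_eq ?_)
  rw [Real.mul_rpow (by norm_num) (by positivity)]
  ring

/-- Here the derivative has negative order, so it is bounded and the inverse symbol is Lipschitz. -/
theorem norm_symE_neg_sub_le (hR : 0 < R) (hRz : R ≤ z₀ / 2) {z : ℂ}
    (hz : z ∈ Metric.closedBall (z₀ : ℂ) R) {x y : ℝ} (hx : 0 ≤ x) (hy : 0 ≤ y) :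
    ‖symE (-1) z x - symE (-1) z y‖ ≤ Real.exp (Real.pi * (z₀ - R)⁻¹) * |x - y| := by
  obtain ⟨b1, b2, -⟩ := disc_bounds hR hRz hz
  have hz0 : z ≠ 0 := by rintro rfl; simp at b2; linarith
  have h := isConvexSector.norm_image_sub_le_of_norm_hasDerivWithin_le (f := symE (-1) z)
    (f' := fun μ ↦ (-1) * symE (-1) z μ / (1 + z * μ)) (x := (y : ℂ)) (y := (x : ℂ))
    (C := Real.exp (Real.pi * (z₀ - R)⁻¹))
    (fun μ hμ ↦ (hasDerivAt_symE (-1) hz0 (by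
      have := re_mul_nonneg b1 hμ
      rw [add_re, one_re]; linarith)).hasDerivWithinAt)
    (fun μ hμ ↦ by
      have h3 := (norm_symE_le hR hRz hz hμ).2
      have h4 := one_le_norm_of_re (re_mul_nonneg b1 hμ)
      rw [neg_one_mul, norm_div, norm_neg, div_le_iff₀ (by linarith)]
      refine h3.trans ?_
      refine mul_le_mul_of_nonneg_left ?_ (Real.exp_pos _).le
      refine (Real.rpow_le_one_of_one_le_of_nonpos h4 ?_).trans h4
      have : 0 < (z₀ + R)⁻¹ := inv_pos.2 (by linarith)
      linarith)
    (by simpa using hy) (by simpa using hx)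
  refine h.trans (le_of_eq ?_)
  rw [← ofReal_sub, norm_real, Real.norm_eq_abs]

theorem differentiableAt_coef_symE (hR : 0 < R) (hRz : R ≤ z₀ / 2) (h2 : z₀ + R ≤ 2) {lam : ℂ}
    (hl : |lam.im| ≤ lam.re) (k : ℕ) :
    DifferentiableAt ℂ (fun μ ↦ coef z₀ R k fun z ↦ symE 1 z μ) lam := by
  -- Since `‖z‖ ≤ 2`, moving `λ` by `1/4` changes `zλ` by at most `1/2`, and `1 + zμ` keeps positive
  -- real part. This gives differentiability at the boundary of the sector as well.
  have hpos : ∀ z ∈ Metric.sphere (z₀ : ℂ) R, ∀ μ ∈ Metric.closedBall lam (1 / 4),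
      z ≠ 0 ∧ 0 < (1 + z * μ).re := by
    intro z hz μ hμ
    obtain ⟨b1, b2, -, b4, -⟩ := disc_bounds hR hRz (Metric.sphere_subset_closedBall hz)
    refine ⟨by rintro rfl; simp at b2; linarith, ?_⟩
    rw [mem_closedBall_iff_norm] at hμ
    have h3 := re_mul_nonneg b1 hl
    have h4 : ‖z * (μ - lam)‖ ≤ 2 * (1 / 4) := by
      rw [norm_mul]
      exact mul_le_mul (b4.trans h2) hμ (norm_nonneg _) (by norm_num)
    have h5 := neg_le_of_abs_le (Complex.abs_re_le_norm (z * (μ - lam)))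
    have e : (1 + z * μ).re = 1 + (z * lam).re + (z * (μ - lam)).re := by
      rw [mul_sub, sub_re, add_re, one_re]; ring
    rw [e]
    linarith
  refine differentiableAt_coef (f := symE 1) (f' := fun z μ ↦ 1 * symE 1 z μ / (1 + z * μ)) hR
    (by norm_num : (0 : ℝ) < 1 / 4) (fun μ hμ z hz ↦ ?_) ?_
    (fun z hz μ hμ ↦ hasDerivAt_symE 1 (hpos z hz μ hμ).1 (hpos z hz μ hμ).2) k
  · obtain ⟨hz0, h3⟩ := hpos z hz μ hμ
    refine ContinuousAt.continuousWithinAt ?_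
    unfold symE
    exact ContinuousAt.cexp (ContinuousAt.div (ContinuousAt.mul continuousAt_const
      (ContinuousAt.clog (by fun_prop) (Or.inl h3))) continuousAt_id hz0)
  · rintro ⟨z, μ⟩ ⟨hz, hμ⟩
    obtain ⟨hz0, h3⟩ := hpos z hz μ hμ
    refine ContinuousAt.continuousWithinAt ?_
    unfold symE
    have hne : 1 + z * μ ≠ 0 := fun h ↦ by rw [h] at h3; simp at h3
    refine ContinuousAt.div (ContinuousAt.mul continuousAt_const (ContinuousAt.cexp
      (ContinuousAt.div (ContinuousAt.mul continuousAt_const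
      (ContinuousAt.clog (by fun_prop) (Or.inl h3))) (by fun_prop) hz0))) (by fun_prop) hne

/-- The expansions of `(1 + c λ)^{1 / c}` and of its inverse in powers of `c - z₀`. -/
structure SymbolExpansion (z₀ R α β C : ℝ) (a b : ℕ → ℂ → ℂ) : Prop where
  pos : 0 < C
  diff_a : ∀ k, DifferentiableOn ℂ (a k) {z | 0 < z.re ∧ |z.im| ≤ z.re}
  sub_a : ∀ k z, 0 < z.re → |z.im| ≤ z.re →
    ‖a k z - a k 0‖ ≤ C * R⁻¹ ^ k * (‖z‖ * (1 + ‖z‖) ^ (α - 1))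
  bound_a : ∀ k (x : ℝ), 0 ≤ x → ‖a k x‖ ≤ C * R⁻¹ ^ k * (1 + x) ^ α
  bound_b : ∀ k (x : ℝ), 0 ≤ x → ‖b k x‖ ≤ C * R⁻¹ ^ k * (1 + x) ^ (-β)
  lip_b : ∀ k (x y : ℝ), 0 ≤ x → 0 ≤ y → ‖b k x - b k y‖ ≤ C * R⁻¹ ^ k * |x - y|
  sum_a : ∀ c x : ℝ, |c - z₀| < R → 0 ≤ x →
    HasSum (fun k ↦ ((c - z₀ : ℝ) : ℂ) ^ k * a k x) (((1 + c * x) ^ (1 / c) : ℝ) : ℂ)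
  sum_b : ∀ c x : ℝ, |c - z₀| < R → 0 ≤ x →
    HasSum (fun k ↦ ((c - z₀ : ℝ) : ℂ) ^ k * b k x) (((1 + c * x) ^ (1 / c) : ℝ) : ℂ)⁻¹

theorem exists_symbolExpansion (hR : 0 < R) (hRz : R ≤ z₀ / 2) (h2 : z₀ + R ≤ 2) {α : ℝ}
    (hα : 1 ≤ α) (hα' : (z₀ - R)⁻¹ ≤ α) :
    ∃ C a b, SymbolExpansion z₀ R α (z₀ + R)⁻¹ C a b := by
  set E := Real.exp (Real.pi * (z₀ - R)⁻¹) with hE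
  have hE0 : 0 < E := Real.exp_pos _
  -- `δ (1 + x) ≤ ‖1 + z x‖` for `x ≥ 0` on the disc; a lower bound is needed for the negative
  -- power.
  set δ : ℝ := min 1 (z₀ - R) with hδ
  have hzR : 0 < z₀ - R := by linarith
  have hδ0 : 0 < δ := lt_min one_pos hzR
  set β : ℝ := (z₀ + R)⁻¹ with hβ
  have hβ0 : 0 < β := inv_pos.2 (by linarith)
  have h2α : (1 : ℝ) ≤ 2 ^ α := Real.one_le_rpow (by norm_num) (by linarith)
  have h2α' : (2 : ℝ) ^ (α - 1) ≤ 2 ^ α :=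
    Real.rpow_le_rpow_of_exponent_le (by norm_num) (by linarith)
  have hδβ : 0 < δ ^ (-β) := Real.rpow_pos_of_pos hδ0 _
  set C := E * (2 ^ α + δ ^ (-β)) with hC
  have hreal : ∀ x : ℝ, 0 ≤ x → |(x : ℂ).im| ≤ (x : ℂ).re := fun x hx ↦ by simpa using hx
  have hcc : ∀ s lam, |lam.im| ≤ lam.re →
      ContinuousOn (fun z ↦ symE s z lam) (Metric.sphere (z₀ : ℂ) R) := fun s lam hl ↦
    (continuousOn_symE hR hRz s hl).mono Metric.sphere_subset_closedBall
  have hRi : ∀ k : ℕ, 0 ≤ R⁻¹ ^ k := fun k ↦ by positivity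
  refine ⟨C, fun k μ ↦ coef z₀ R k fun z ↦ symE 1 z μ, fun k μ ↦ coef z₀ R k fun z ↦ symE (-1) z μ,
    by positivity, ?_, ?_, ?_, ?_, ?_, ?_, ?_⟩
  · exact fun k z hz ↦ (differentiableAt_coef_symE hR hRz h2 hz.2 k).differentiableWithinAt
  · intro k z _ hz
    refine (norm_coef_sub_le hR (hcc 1 z hz) (hcc 1 0 (by simp))
      (A := E * 2 ^ (α - 1) * (‖z‖ * (1 + ‖z‖) ^ (α - 1))) (fun w hw ↦ ?_) k).trans ?_
    · rw [symE_zero_right]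
      exact norm_symE_sub_one_le hR hRz h2 hα hα' (Metric.sphere_subset_closedBall hw) hz
    · have h3 : 0 ≤ ‖z‖ * (1 + ‖z‖) ^ (α - 1) := by positivity
      calc E * 2 ^ (α - 1) * (‖z‖ * (1 + ‖z‖) ^ (α - 1)) * R⁻¹ ^ k
          ≤ C * (‖z‖ * (1 + ‖z‖) ^ (α - 1)) * R⁻¹ ^ k := by
            gcongr
            rw [hC]
            exact mul_le_mul_of_nonneg_left (by linarith) hE0.le
        _ = _ := by ring
  · intro k x hx
    refine (norm_coef_le hR (A := C * (1 + x) ^ α) (fun z hz ↦ ?_) k).trans (le_of_eq (by ring))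
    have hz' := Metric.sphere_subset_closedBall hz
    have b1 := (disc_bounds hR hRz hz').1
    refine (norm_symE_le hR hRz hz' (hreal x hx)).1.trans ?_
    rw [hC, mul_assoc]
    refine mul_le_mul_of_nonneg_left ?_ hE0.le
    have h3 := norm_one_add_mul_le hR hRz h2 hz' x
    rw [norm_real, Real.norm_of_nonneg hx] at h3
    have h4 := one_le_norm_of_re (re_mul_nonneg b1 (hreal x hx))
    calc ‖1 + z * x‖ ^ (z₀ - R)⁻¹ ≤ ‖1 + z * x‖ ^ α := Real.rpow_le_rpow_of_exponent_le h4 hα'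
      _ ≤ (2 * (1 + x)) ^ α := Real.rpow_le_rpow (norm_nonneg _) h3 (by linarith)
      _ = 2 ^ α * (1 + x) ^ α := Real.mul_rpow (by norm_num) (by linarith)
      _ ≤ _ := by gcongr; linarith
  · intro k x hx
    refine (norm_coef_le hR (A := C * (1 + x) ^ (-β)) (fun z hz ↦ ?_) k).trans (le_of_eq (by ring))
    have hz' := Metric.sphere_subset_closedBall hz
    obtain ⟨b1, b2, -⟩ := disc_bounds hR hRz hz'
    refine (norm_symE_le hR hRz hz' (hreal x hx)).2.trans ?_
    rw [hC, mul_assoc]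
    refine mul_le_mul_of_nonneg_left ?_ hE0.le
    have h3 : δ * (1 + x) ≤ ‖1 + z * x‖ := by
      refine le_trans ?_ (Complex.re_le_norm _)
      rw [add_re, one_re, re_mul_ofReal]
      have h5 : δ ≤ 1 := min_le_left _ _
      have h6 : δ ≤ z.re := (min_le_right _ _).trans b2
      nlinarith
    calc ‖1 + z * x‖ ^ (-β) ≤ (δ * (1 + x)) ^ (-β) :=
          Real.rpow_le_rpow_of_nonpos (by positivity) h3 (by linarith)
      _ = δ ^ (-β) * (1 + x) ^ (-β) := Real.mul_rpow hδ0.le (by linarith)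
      _ ≤ _ := by gcongr; linarith
  · intro k x y hx hy
    refine (norm_coef_sub_le hR (hcc (-1) x (hreal x hx)) (hcc (-1) y (hreal y hy))
      (A := C * |x - y|) (fun z hz ↦ ?_) k).trans (le_of_eq (by ring))
    refine (norm_symE_neg_sub_le hR hRz (Metric.sphere_subset_closedBall hz) hx hy).trans ?_
    gcongr
    rw [hC]
    nlinarith
  · intro c x hc hx
    have hc0 : 0 < c := by have := (abs_lt.1 hc).1; linarith
    have h := hasSum_coef (diffContOnCl_symE hR hRz 1 (hreal x hx)) (u := ((c - z₀ : ℝ) : ℂ))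
      (by rwa [norm_real, Real.norm_eq_abs])
    have e := symE_ofReal 1 hc0 hx
    rw [ofReal_one] at e
    rw [← e]
    convert h using 2
    push_cast; ring
  · intro c x hc hx
    have hc0 : 0 < c := by have := (abs_lt.1 hc).1; linarith
    have h := hasSum_coef (diffContOnCl_symE hR hRz (-1) (hreal x hx)) (u := ((c - z₀ : ℝ) : ℂ))
      (by rwa [norm_real, Real.norm_eq_abs])
    have e := symE_ofReal (-1) hc0 hx
    rw [neg_div, Real.rpow_neg (by positivity), ofReal_neg, ofReal_one, ofReal_inv] at e
    rw [← e]
    convert h using 2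
    push_cast; ring

end disc

end

/-! ### Finite differences under `W^{N,∞}` regularity. -/

section

open scoped ENNReal Convolution

/-! ### Finite differences of functions with bounded weak derivatives -/

/-- The derivative of a mollification of `g` is the mollification of its weak derivative, an average
of values bounded by `D`. -/
theorem norm_convolution_deriv_le {g g' : ℝ → ℝ} (h : IsWeakDeriv g g') {D : ℝ}
    (hD : ∀ᵐ x, |g' x| ≤ D) (φ : ContDiffBump (0 : ℝ)) (x : ℝ) :
    ‖(deriv (φ.normed volume) ⋆[ContinuousLinearMap.lsmul ℝ ℝ, volume] g) x‖ ≤ D := by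
  set ψ : ℝ → ℝ := φ.normed volume with hψ
  have hψd : ContDiff ℝ ∞ ψ := φ.contDiff_normed
  have hψc : HasCompactSupport ψ := φ.hasCompactSupport_normed
  have h1 := h (fun y ↦ ψ (x - y)) (hψd.comp (by fun_prop))
    (hψc.comp_homeomorph (Homeomorph.subLeft x))
  have e1 : ∀ y, deriv (fun y ↦ ψ (x - y)) y = -deriv ψ (x - y) := fun y ↦
    deriv_comp_const_sub ψ x y
  rw [convolution_eq_swap]
  simp only [ContinuousLinearMap.lsmul_apply, smul_eq_mul]
  simp_rw [e1] at h1
  have e2 : ∫ y, deriv ψ (x - y) * g y = ∫ y, g' y * ψ (x - y) := by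
    have : ∫ y, g y * -deriv ψ (x - y) = -∫ y, deriv ψ (x - y) * g y := by
      rw [← integral_neg]
      congr 1; funext y; ring
    rw [this, neg_inj] at h1
    exact h1
  rw [e2]
  have hψi : Integrable ψ := hψd.continuous.integrable_of_hasCompactSupport hψc
  have hi : Integrable fun y ↦ D * ψ (x - y) := (hψi.comp_sub_left x).const_mul D
  refine (norm_integral_le_of_norm_le hi ?_).trans (le_of_eq ?_)
  · filter_upwards [hD] with y hy
    rw [norm_mul, Real.norm_of_nonneg (φ.nonneg_normed _)]
    exact mul_le_mul_of_nonneg_right hy (φ.nonneg_normed _)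
  · rw [integral_const_mul, integral_sub_left_eq_self ψ, hψ, φ.integral_normed, mul_one]

/-- The mollifications are Lipschitz with constant `D` by the mean value inequality, and they
converge to `g` almost everywhere. -/
theorem ae_abs_sub_le_of_isWeakDeriv {g g' : ℝ → ℝ} (hg : LocallyIntegrable g volume)
    (h : IsWeakDeriv g g') {D : ℝ} (hD : ∀ᵐ x, |g' x| ≤ D) (k : ℝ) :
    ∀ᵐ x, |g (x + k) - g x| ≤ D * |k| := by
  set φ : ℕ → ContDiffBump (0 : ℝ) := fun n ↦ ⟨1 / (n + 1 : ℝ), 2 * (1 / (n + 1 : ℝ)),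
    by positivity, by linarith [show (0 : ℝ) < 1 / (n + 1 : ℝ) by positivity]⟩ with hφ
  have h1 : Filter.Tendsto (fun n ↦ (φ n).rOut) Filter.atTop (nhds 0) := by
    have := (tendsto_one_div_add_atTop_nhds_zero_nat (𝕜 := ℝ)).const_mul 2
    rw [mul_zero] at this
    exact this
  have h2 := ContDiffBump.ae_convolution_tendsto_right_of_locallyIntegrable (K := 2) h1
    (Filter.Eventually.of_forall fun n ↦ le_rfl) hg
  filter_upwards [h2, (measurePreserving_add_right volume k).quasiMeasurePreserving.ae h2]
    with x h3 h4
  refine le_of_tendsto' ((h4.sub h3).abs) fun n ↦ ?_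
  have h5 := Convex.norm_image_sub_le_of_norm_hasDerivWithin_le (𝕜 := ℝ)
    (f := ((φ n).normed volume ⋆[ContinuousLinearMap.lsmul ℝ ℝ, volume] g)) (s := Set.univ)
    (x := x) (y := x + k)
    (fun y _ ↦ (HasCompactSupport.hasDerivAt_convolution_left (ContinuousLinearMap.lsmul ℝ ℝ)
      (φ n).hasCompactSupport_normed (φ n).contDiff_normed hg y).hasDerivWithinAt)
    (fun y _ ↦ norm_convolution_deriv_le h hD (φ n) y) convex_univ trivial trivial
  rw [add_sub_cancel_left] at h5
  exact h5

/-- The difference `g (x + h) - g x` of a real function. -/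
def diffR (h : ℝ) (g : ℝ → ℝ) : ℝ → ℝ := fun x ↦ g (x + h) - g x

theorem memLp_diffR {g : ℝ → ℝ} (hg : MemLp g ⊤ volume) (h : ℝ) : MemLp (diffR h g) ⊤ volume :=
  (hg.comp_measurePreserving (measurePreserving_add_right volume h)).sub hg

theorem isWeakDeriv_diffR {g g' : ℝ → ℝ} (hg : LocallyIntegrable g volume)
    (hg' : LocallyIntegrable g' volume) (hd : IsWeakDeriv g g') (h : ℝ) :
    IsWeakDeriv (diffR h g) (diffR h g') := by
  intro φ hφ hφc
  have hφ' : Continuous (deriv φ) := hφ.continuous_deriv (by simp)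
  set ψ : ℝ → ℝ := fun x ↦ φ (x - h) with hψ
  have hψd : ContDiff ℝ ∞ ψ := hφ.comp (by fun_prop)
  have hψc : HasCompactSupport ψ := hφc.comp_homeomorph (Homeomorph.subRight h)
  have eψ : ∀ x, deriv ψ x = deriv φ (x - h) := fun x ↦ deriv_comp_sub_const φ h x
  have key : ∀ {k η : ℝ → ℝ}, LocallyIntegrable k volume → Continuous η → HasCompactSupport η →
      Integrable fun x ↦ k x * η x := by
    intro k η hk hη hηc
    have := hk.integrable_smul_left_of_hasCompactSupport hη hηc
    refine this.congr (Filter.Eventually.of_forall fun x ↦ ?_)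
    simp [mul_comm]
  have key2 : ∀ {k η : ℝ → ℝ}, LocallyIntegrable k volume → Continuous η → HasCompactSupport η →
      ∫ x, diffR h k x * η x = (∫ x, k x * η (x - h)) - ∫ x, k x * η x := by
    intro k η hk hη hηc
    have hη2 : Continuous fun x ↦ η (x - h) := by fun_prop
    have i1 := key hk hη2 (hηc.comp_homeomorph (Homeomorph.subRight h))
    have e1 : ∀ x, k (x + h) * η x = (fun y ↦ k y * η (y - h)) (x + h) := fun x ↦ by simp
    have i2 : Integrable fun x ↦ k (x + h) * η x := by
      simp_rw [e1]; exact i1.comp_add_right h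
    simp only [diffR, sub_mul]
    rw [integral_sub i2 (key hk hη hηc)]
    simp_rw [e1]
    rw [integral_add_right_eq_self (fun y ↦ k y * η (y - h)) h]
  rw [key2 hg hφ' hφc.deriv, key2 hg' hφ.continuous hφc, hd φ hφ hφc]
  have := hd ψ hψd hψc
  simp_rw [eψ] at this
  rw [this]
  ring

/-- Taking one difference of every function in the chain of weak derivatives gives again such a
chain, shorter by one, whose last member is bounded by `D * h`. -/
theorem ae_abs_diffR_iterate_le {h : ℝ} (hh : 0 < h) (j : ℕ) {g : ℕ → ℝ → ℝ}
    (hg : ∀ k ≤ j, MemLp (g k) ⊤ volume) (hd : ∀ k < j, IsWeakDeriv (g k) (g (k + 1))) {D : ℝ}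
    (hD : ∀ᵐ x, |g j x| ≤ D) : ∀ᵐ x, |(diffR h)^[j] (g 0) x| ≤ D * h ^ j := by
  induction j generalizing g D with
  | zero => simpa using hD
  | succ j ih =>
    have hl : ∀ k ≤ j + 1, LocallyIntegrable (g k) volume := fun k hk ↦
      (hg k hk).locallyIntegrable le_top
    have h1 := ih (g := fun k ↦ diffR h (g k)) (D := D * h)
      (fun k hk ↦ memLp_diffR (hg k (by omega)) h)
      (fun k hk ↦ isWeakDeriv_diffR (hl k (by omega)) (hl (k + 1) (by omega)) (hd k (by omega)) h)
      (by
        filter_upwards [ae_abs_sub_le_of_isWeakDeriv (hl j (by omega)) (hd j (by omega)) hD h]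
          with x hx
        rwa [abs_of_pos hh] at hx)
    rw [Function.iterate_succ_apply]
    filter_upwards [h1] with x hx
    rw [pow_succ']
    linarith

theorem diff_iterate_ofReal (h : ℝ) (j : ℕ) (g : ℝ → ℝ) :
    (diff h)^[j] (fun x ↦ (g x : ℂ)) = fun x ↦ ((diffR h)^[j] g x : ℂ) := by
  induction j generalizing g with
  | zero => rfl
  | succ j ih =>
    have e : diff h (fun x ↦ (g x : ℂ)) = fun x ↦ (diffR h g x : ℂ) := by
      funext x; simp [diff, diffR]
    rw [Function.iterate_succ_apply, Function.iterate_succ_apply, e, ih]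

theorem diff_sub_const (h : ℝ) (w : ℝ → ℂ) (k : ℂ) : diff h (fun x ↦ w x - k) = diff h w := by
  funext x; simp [diff]

theorem diff_iterate_sub_const (h : ℝ) (w : ℝ → ℂ) (k : ℂ) {j : ℕ} (hj : 1 ≤ j) :
    (diff h)^[j] (fun x ↦ w x - k) = (diff h)^[j] w := by
  obtain ⟨j, rfl⟩ := Nat.exists_eq_add_of_le' hj
  rw [Function.iterate_succ_apply, Function.iterate_succ_apply, diff_sub_const]

/-- The finite differences of `w` up to order `M + 1` have the expected size. -/
def DiffBounds (M : ℕ) (w : ℝ → ℂ) : Prop :=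
  ∃ D, 0 ≤ D ∧ (∀ h, 0 < h → h ≤ 1 → ∀ j, 1 ≤ j → j ≤ M → ‖conjF ((diff h)^[j] w)‖ ≤ D * h ^ j) ∧
    ∀ h, 0 < h → h ≤ 1 → ∀ i, shellSize i ((diff h)^[M + 1] w) ≤ D * h ^ (M + 1)

theorem diffBounds_sub_const {M : ℕ} {w : ℝ → ℂ} (hw : DiffBounds M w) (k : ℂ) :
    DiffBounds M (fun x ↦ w x - k) := by
  obtain ⟨D, hD, h1, h2⟩ := hw
  refine ⟨D, hD, fun h hh hh1 j hj hjM ↦ ?_, fun h hh hh1 i ↦ ?_⟩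
  · rw [diff_iterate_sub_const h w k hj]; exact h1 h hh hh1 j hj hjM
  · rw [diff_iterate_sub_const h w k (by omega)]; exact h2 h hh hh1 i

theorem diffBounds_of_memSobolevInfty {N M : ℕ} (hN : M + 1 ≤ N) {c : ℝ → ℝ}
    (hc : MemSobolevInfty N c) : DiffBounds M (fun x ↦ (c x : ℂ)) := by
  obtain ⟨g, rfl, hg, hd⟩ := hc
  have hb : ∀ k ≤ N, ∃ D, 0 ≤ D ∧ ∀ᵐ x, |g k x| ≤ D := fun k hk ↦ by
    have h1 := (hg k hk).2
    refine ⟨(eLpNorm (g k) ⊤ volume).toReal, ENNReal.toReal_nonneg, ?_⟩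
    filter_upwards [ae_le_eLpNormEssSup (f := g k) (μ := volume)] with x hx
    rw [← eLpNorm_exponent_top] at hx
    have := ENNReal.toReal_mono h1.ne hx
    simpa using this
  choose! D hD0 hD using hb
  set B := ∑ k ∈ Finset.range (N + 1), D k with hB
  have hDB : ∀ k ≤ N, D k ≤ B := fun k hk ↦
    Finset.single_le_sum (f := D) (fun j hj ↦ hD0 j (by simpa [Nat.lt_succ_iff] using hj))
      (by simpa [Nat.lt_succ_iff] using hk)
  have hB0 : 0 ≤ B := (hD0 0 (by omega)).trans (hDB 0 (by omega))
  have key : ∀ h, 0 < h → ∀ j ≤ N, ‖conjF ((diff h)^[j] (fun x ↦ (g 0 x : ℂ)))‖ ≤ B * h ^ j := by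
    intro h hh j hj
    refine norm_conjF_le (by positivity) ?_
    filter_upwards [ae_abs_diffR_iterate_le hh j (fun k hk ↦ hg k (by omega))
      (fun k hk ↦ hd k (by omega)) (hD j hj)] with x hx
    rw [diff_iterate_ofReal, norm_real, Real.norm_eq_abs]
    exact hx.trans (by gcongr; exact hDB j hj)
  refine ⟨2 * B, by positivity, fun h hh _ j _ hjM ↦ ?_, fun h hh _ i ↦ ?_⟩
  · refine (key h hh j (by omega)).trans ?_
    gcongr
    linarith
  · refine (shellSize_le i _).trans ?_
    linarith [key h hh (M + 1) hN]

end

/-! ### Finite differences under `H^s` regularity. -/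

section

open scoped ENNReal ComplexConjugate

/-! ### Adjoints -/

theorem Bdd.conj {a : ℝ → ℂ} (ha : Bdd a) : Bdd (fun x ↦ conj (a x)) := ha.star

theorem star_mulL {a : ℝ → ℂ} (ha : Bdd a) : star (mulL a) = mulL (fun x ↦ conj (a x)) := by
  symm
  rw [ContinuousLinearMap.star_eq_adjoint, ContinuousLinearMap.eq_adjoint_iff]
  intro f g
  rw [L2.inner_def, L2.inner_def]
  refine integral_congr_ae ?_
  filter_upwards [coeFn_mulL ha.conj f, coeFn_mulL ha g] with x h1 h2
  rw [h1, h2]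
  simp only [RCLike.inner_apply, map_mul, conj_conj]
  ring

theorem star_conjF {a : ℝ → ℂ} (ha : Bdd a) : star (conjF a) = conjF (fun x ↦ conj (a x)) := by
  symm
  rw [ContinuousLinearMap.star_eq_adjoint, ContinuousLinearMap.eq_adjoint_iff]
  intro f g
  have h1 : ∀ f g : L2, inner ℂ (𝓕 f : L2) g = inner ℂ f (𝓕⁻ g : L2) := fun f g ↦ by
    have := (Lp.fourierTransformₗᵢ ℝ ℂ : L2 ≃ₗᵢ[ℂ] L2).inner_map_map f (𝓕⁻ g : L2)
    rw [← this]
    change inner ℂ (𝓕 f : L2) g = inner ℂ (𝓕 f : L2) (𝓕 (𝓕⁻ g : L2) : L2)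
    rw [fourier_fourierInv_eq]
  rw [conjF_apply, h1, conjF_apply, ← fourier_fourierInv_eq (F := L2) f, h1,
    fourierInv_fourier_eq, fourierInv_fourier_eq, ← star_mulL ha,
    ContinuousLinearMap.star_eq_adjoint, ContinuousLinearMap.adjoint_inner_left]

theorem star_shellP (i : ℕ) : star (shellP i) = shellP i := by
  rw [shellP, proj, star_mulL (bdd_cut_one (measurableSet_shell i))]
  congr 1
  funext ξ
  by_cases h : ξ ∈ shell i <;> simp [cut, h]

/-! ### Multiplication by square integrable functions -/

theorem norm_fourierInv_le (f : ℝ → ℂ) (x : ℝ) : ‖𝓕⁻ f x‖ ≤ ∫ ξ, ‖f ξ‖ :=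
  VectorFourier.norm_fourierIntegral_le_integral_norm _ _ _ _ _

/-- Cauchy–Schwarz on the shell. The square root of the measure bound is replaced by `2 * 2 ^ i`
itself, which is at least `1`. -/
theorem integral_norm_cut_le (f : L2) (i : ℕ) :
    Integrable (cut (shell i) (f : ℝ → ℂ)) ∧
      ∫ ξ, ‖cut (shell i) (f : ℝ → ℂ) ξ‖ ≤ 2 * 2 ^ i * ‖f‖ := by
  have hm : AEStronglyMeasurable (cut (shell i) (f : ℝ → ℂ)) volume :=
    (Lp.aestronglyMeasurable f).indicator (measurableSet_shell i)
  have h1 : ∫⁻ ξ, ‖cut (shell i) (f : ℝ → ℂ) ξ‖ₑ ≤ ENNReal.ofReal (2 * 2 ^ i * ‖f‖) := by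
    have e : eLpNorm (cut (shell i) (f : ℝ → ℂ)) 1 volume =
        eLpNorm (f : ℝ → ℂ) 1 (volume.restrict (shell i)) :=
      eLpNorm_indicator_eq_eLpNorm_restrict (measurableSet_shell i)
    rw [← eLpNorm_one_eq_lintegral_enorm, e]
    refine (eLpNorm_le_eLpNorm_mul_rpow_measure_univ (q := 2) (by norm_num)
      (Lp.aestronglyMeasurable f).restrict).trans ?_
    rw [Measure.restrict_apply_univ, mul_comm, ENNReal.ofReal_mul (by positivity)]
    gcongr
    · refine (ENNReal.rpow_le_rpow (volume_shell_le i) (by norm_num)).trans ?_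
      rw [ENNReal.ofReal_rpow_of_nonneg (by positivity) (by norm_num)]
      refine ENNReal.ofReal_le_ofReal ?_
      have h2 : (1 : ℝ) ≤ 2 * 2 ^ i := by
        have : (1 : ℝ) ≤ 2 ^ i := one_le_pow₀ (by norm_num)
        linarith
      calc (2 * 2 ^ i : ℝ) ^ (1 / ENNReal.toReal 1 - 1 / ENNReal.toReal 2)
          ≤ (2 * 2 ^ i : ℝ) ^ (1 : ℝ) :=
            Real.rpow_le_rpow_of_exponent_le h2 (by norm_num)
        _ = _ := Real.rpow_one _
    · rw [ofReal_norm, Lp.enorm_def]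
      exact eLpNorm_mono_measure _ Measure.restrict_le_self
  refine ⟨⟨hm, h1.trans_lt ENNReal.ofReal_lt_top⟩, ?_⟩
  rw [integral_norm_eq_lintegral_enorm hm]
  exact ENNReal.toReal_le_of_le_ofReal (by positivity) h1

/-- Bernstein's inequality: a function with frequencies in the shell `i` is bounded by `2 * 2 ^ i`
times its `L²` norm, so its product with a square integrable function is controlled in `L²`. -/
theorem norm_conjF_mul_shellP_le {w : ℝ → ℂ} (hw : Bdd w) {W : L2}
    (h : ∀ᵐ x, ‖w x‖ ≤ ‖(W : ℝ → ℂ) x‖) (i : ℕ) : ‖conjF w * shellP i‖ ≤ 2 * 2 ^ i * ‖W‖ := by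
  refine ContinuousLinearMap.opNorm_le_bound _ (by positivity) fun f ↦ ?_
  rw [mul_apply_eq_comp, conjF_apply, Lp.norm_fourier_eq]
  obtain ⟨i1, i2⟩ := integral_norm_cut_le f i
  have i3 : MemLp (cut (shell i) (f : ℝ → ℂ)) 2 := (Lp.memLp f).indicator (measurableSet_shell i)
  have e : shellP i f = i3.toLp _ := by
    refine mulL_eq_of_ae (bdd_cut_one (measurableSet_shell i)) ?_
    filter_upwards [i3.coeFn_toLp] with ξ h1
    rw [h1]
    by_cases hξ : ξ ∈ shell i <;> simp [cut, hξ]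
  have h2 : ‖mulL w (𝓕⁻ (shellP i f) : L2)‖ ≤ (2 * 2 ^ i * ‖f‖) * ‖W‖ := by
    refine norm_le_of_ae_le ?_
    filter_upwards [coeFn_mulL hw (𝓕⁻ (shellP i f) : L2), h, fourierInv_toLp i1 i3] with x h1 h2 h3
    rw [h1, e, h3, norm_mul, mul_comm]
    gcongr
    exact (norm_fourierInv_le _ x).trans i2
  linarith

/-- The projection on the left is treated by taking adjoints. The factor `(1 / 2) ^ i` in
`shellSize` is there to offset the loss in Bernstein's inequality. -/
theorem shellSize_le_of_memLp {w : ℝ → ℂ} (hw : Bdd w) {W : L2}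
    (h : (w : ℝ → ℂ) =ᵐ[volume] (W : ℝ → ℂ)) (i : ℕ) : shellSize i w ≤ 4 * ‖W‖ := by
  have h1 := norm_conjF_mul_shellP_le hw (W := W) (by
    filter_upwards [h] with x hx
    rw [hx]) i
  have h2 : ‖shellP i * conjF w‖ ≤ 2 * 2 ^ i * ‖W‖ := by
    rw [← norm_star, star_mul, star_shellP, star_conjF hw]
    refine norm_conjF_mul_shellP_le hw.conj ?_ i
    filter_upwards [h] with x hx
    rw [hx, RCLike.norm_conj]
  rw [shellSize]
  calc (1 / 2) ^ i * (‖conjF w * shellP i‖ + ‖shellP i * conjF w‖)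
      ≤ (1 / 2) ^ i * (2 * 2 ^ i * ‖W‖ + 2 * 2 ^ i * ‖W‖) := by gcongr
    _ = 4 * ‖W‖ * ((1 / 2) ^ i * 2 ^ i) := by ring
    _ = 4 * ‖W‖ := by rw [← mul_pow]; norm_num

/-! ### Finite differences of Sobolev functions -/

theorem isRepresentedBy_toTemperedDistribution (f : L2) :
    IsRepresentedBy (Lp.toTemperedDistribution f) (f : ℝ → ℂ) := by
  refine ⟨fun φ ↦ ?_, fun φ ↦ ?_⟩
  · exact (φ.memLp 2 volume).integrable_mul (Lp.memLp f)
  · rw [Lp.toTemperedDistribution_apply]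
    simp

theorem eq_toTemperedDistribution_of_isRepresentedBy {u : 𝓢'(ℝ, ℂ)} {F : ℝ → ℂ}
    (hu : IsRepresentedBy u F) (hF : MemLp F 2 volume) :
    u = Lp.toTemperedDistribution (hF.toLp F) := by
  ext φ
  rw [hu.2, Lp.toTemperedDistribution_apply]
  refine integral_congr_ae ?_
  filter_upwards [hF.coeFn_toLp] with x hx
  rw [hx, smul_eq_mul]

theorem ae_eq_fourierInv_of_isRepresentedBy {u : 𝓢'(ℝ, ℂ)} {v F : ℝ → ℂ} (hu : IsRepresentedBy u v)
    (hF : IsRepresentedBy (𝓕 u) F) (hF2 : MemLp F 2 volume) :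
    v =ᵐ[volume] ((𝓕⁻ (hF2.toLp F) : L2) : ℝ → ℂ) := by
  have h1 := eq_toTemperedDistribution_of_isRepresentedBy hF hF2
  have h2 : u = Lp.toTemperedDistribution (𝓕⁻ (hF2.toLp F) : L2) := by
    rw [← fourierInv_fourier_eq (F := 𝓢'(ℝ, ℂ)) u, h1, Lp.fourierInv_toTemperedDistribution_eq]
  have h3 := isRepresentedBy_toTemperedDistribution (𝓕⁻ (hF2.toLp F) : L2)
  rw [← h2] at h3
  exact hu.ae_unique h3

theorem diff_ae_eq_fourierInv {w : ℝ → ℂ} {V : L2}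
    (h : w =ᵐ[volume] ((𝓕⁻ V : L2) : ℝ → ℂ)) (k : ℝ) :
    diff k w =ᵐ[volume] ((𝓕⁻ ((modU k - 1) V) : L2) : ℝ → ℂ) := by
  have e : (𝓕⁻ ((modU k - 1) V) : L2) = transL k (𝓕⁻ V : L2) - (𝓕⁻ V : L2) := by
    rw [← fourierInv_modU, sub_apply, one_apply_eq_self]
    exact map_sub (Lp.fourierTransformₗᵢ ℝ ℂ : L2 ≃ₗᵢ[ℂ] L2).symm _ _
  rw [e]
  filter_upwards [Lp.coeFn_sub (transL k (𝓕⁻ V : L2)) (𝓕⁻ V : L2), coeFn_transL k (𝓕⁻ V : L2), h,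
    ae_comp_add h k] with x h1 h2 h3 h4
  rw [h1, Pi.sub_apply, h2, diff, h3, h4]

theorem diff_iterate_ae_eq_fourierInv {w : ℝ → ℂ} {V : L2}
    (h : w =ᵐ[volume] ((𝓕⁻ V : L2) : ℝ → ℂ)) (k : ℝ) (j : ℕ) :
    (diff k)^[j] w =ᵐ[volume] ((𝓕⁻ (((modU k - 1) ^ j) V) : L2) : ℝ → ℂ) := by
  induction j with
  | zero => exact h
  | succ j ih =>
    rw [Function.iterate_succ_apply', pow_succ', mul_apply_eq_comp]
    exact diff_ae_eq_fourierInv ih k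

theorem coeFn_modU_sub_one_pow (k : ℝ) (j : ℕ) (V : L2) :
    ((((modU k - 1) ^ j) V : L2) : ℝ → ℂ) =ᵐ[volume]
      fun ξ ↦ (modE k ξ - 1) ^ j * (V : ℝ → ℂ) ξ := by
  have hb : Bdd (fun ξ ↦ modE k ξ - 1) := (bdd_modE k).sub (bdd_const 1)
  have e : (modU k - 1) ^ j = mulL (fun ξ ↦ (modE k ξ - 1) ^ j) := by
    rw [modU_sub_one]
    induction j with
    | zero => simp [mulL_one]
    | succ j ih => rw [pow_succ, ih, ← mulL_mul (hb.pow j) hb]; simp_rw [pow_succ]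
  rw [e]
  exact coeFn_mulL (hb.pow j) V

/-- A difference multiplies the transform by `e^{2πikξ} - 1`, of size at most `2πk|ξ|`. Up to order
`M` this bounds the sup norm by an `L¹` norm; the order `M + 1` is only square integrable and is
measured by `shellSize`, which is why `s ≥ M + 1` suffices. -/
theorem diffBounds_of_fourier {M : ℕ} {w F : ℝ → ℂ} (hw : Bdd w) (hF : MemLp F 2 volume)
    (h : w =ᵐ[volume] ((𝓕⁻ (hF.toLp F) : L2) : ℝ → ℂ))
    (hF1 : ∀ j ≤ M, Integrable fun ξ ↦ ((|ξ| ^ j : ℝ) : ℂ) * F ξ)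
    (hF2 : MemLp (fun ξ ↦ ((|ξ| ^ (M + 1) : ℝ) : ℂ) * F ξ) 2 volume) : DiffBounds M w := by
  set V : L2 := hF.toLp F with hV
  have hE : ∀ k ξ : ℝ, 0 < k → ∀ j : ℕ, ‖(modE k ξ - 1) ^ j * F ξ‖ ≤
      (2 * Real.pi * k) ^ j * ‖((|ξ| ^ j : ℝ) : ℂ) * F ξ‖ := by
    intro k ξ hk j
    have h1 := norm_modE_sub_one_le k ξ
    rw [abs_mul, abs_of_pos hk, ← mul_assoc] at h1
    rw [norm_mul, norm_pow, norm_mul, norm_real, norm_pow, Real.norm_eq_abs, abs_abs, ← mul_assoc,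
      ← mul_pow]
    gcongr
  have hFm : AEStronglyMeasurable F volume := hF.1
  have hmE : ∀ (k : ℝ) (j : ℕ), AEStronglyMeasurable (fun ξ ↦ (modE k ξ - 1) ^ j * F ξ) volume :=
    fun k j ↦ (((continuous_modE k).sub continuous_const).pow j).aestronglyMeasurable.mul hFm
  have hcoe : ∀ (k : ℝ) (j : ℕ), ((((modU k - 1) ^ j) V : L2) : ℝ → ℂ) =ᵐ[volume]
      fun ξ ↦ (modE k ξ - 1) ^ j * F ξ := by
    intro k j
    filter_upwards [coeFn_modU_sub_one_pow k j V, hF.coeFn_toLp] with ξ h1 h2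
    rw [h1, h2]
  set B : ℝ := ∑ j ∈ Finset.range (M + 1), (2 * Real.pi) ^ j * ∫ ξ, ‖((|ξ| ^ j : ℝ) : ℂ) * F ξ‖
    with hB
  have hBterm : ∀ j, 0 ≤ (2 * Real.pi) ^ j * ∫ ξ, ‖((|ξ| ^ j : ℝ) : ℂ) * F ξ‖ := fun j ↦
    mul_nonneg (by positivity) (integral_nonneg fun _ ↦ norm_nonneg _)
  have hB0 : 0 ≤ B := Finset.sum_nonneg fun j _ ↦ hBterm j
  set B2 : ℝ := 4 * ((2 * Real.pi) ^ (M + 1) * ‖hF2.toLp _‖) with hB2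
  have hB20 : 0 ≤ B2 := by positivity
  refine ⟨B + B2, by positivity, fun k hk _ j _ hjM ↦ ?_, fun k hk _ i ↦ ?_⟩
  · have i1 : Integrable fun ξ ↦ (modE k ξ - 1) ^ j * F ξ :=
      ((hF1 j hjM).norm.const_mul _).mono' (hmE k j)
        (Filter.Eventually.of_forall fun ξ ↦ hE k ξ hk j)
    have i2 : MemLp (fun ξ ↦ (modE k ξ - 1) ^ j * F ξ) 2 :=
      (memLp_congr_ae (hcoe k j)).1 (Lp.memLp _)
    have e1 : ((modU k - 1) ^ j) V = i2.toLp _ :=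
      Lp.ext ((hcoe k j).trans i2.coeFn_toLp.symm)
    have h3 : ‖conjF ((diff k)^[j] w)‖ ≤ B * k ^ j := by
      refine norm_conjF_le (by positivity) ?_
      filter_upwards [diff_iterate_ae_eq_fourierInv h k j, fourierInv_toLp i1 i2] with x h1 h2
      rw [h1, e1, h2]
      refine (norm_fourierInv_le _ x).trans ?_
      calc ∫ ξ, ‖(modE k ξ - 1) ^ j * F ξ‖
          ≤ ∫ ξ, (2 * Real.pi * k) ^ j * ‖((|ξ| ^ j : ℝ) : ℂ) * F ξ‖ :=
            integral_mono i1.norm ((hF1 j hjM).norm.const_mul _) fun ξ ↦ hE k ξ hk j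
        _ = ((2 * Real.pi) ^ j * ∫ ξ, ‖((|ξ| ^ j : ℝ) : ℂ) * F ξ‖) * k ^ j := by
            rw [integral_const_mul, mul_pow]; ring
        _ ≤ B * k ^ j := by
            gcongr
            exact Finset.single_le_sum
              (f := fun j ↦ (2 * Real.pi) ^ j * ∫ ξ, ‖((|ξ| ^ j : ℝ) : ℂ) * F ξ‖)
              (fun j _ ↦ hBterm j) (Finset.mem_range.2 (by omega))
    refine h3.trans ?_
    gcongr
    linarith
  · have h3 := shellSize_le_of_memLp (bdd_diff_iterate hw k (M + 1))
      (diff_iterate_ae_eq_fourierInv h k (M + 1)) i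
    rw [norm_fourierInv] at h3
    have h4 : ‖((modU k - 1) ^ (M + 1)) V‖ ≤ (2 * Real.pi * k) ^ (M + 1) * ‖hF2.toLp _‖ := by
      refine norm_le_of_ae_le ?_
      filter_upwards [hcoe k (M + 1), hF2.coeFn_toLp] with ξ h1 h2
      rw [h1, h2]
      exact hE k ξ hk (M + 1)
    calc shellSize i ((diff k)^[M + 1] w)
        ≤ 4 * ((2 * Real.pi * k) ^ (M + 1) * ‖hF2.toLp _‖) := by linarith
      _ = B2 * k ^ (M + 1) := by rw [hB2, mul_pow]; ring
      _ ≤ (B + B2) * k ^ (M + 1) := by gcongr; linarith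

theorem diffBounds_of_memSobolevTwo {M : ℕ} {s : ℝ} (hs : (M : ℝ) + 1 ≤ s) {v : ℝ → ℝ}
    (hv : MemSobolevTwo s v) (hvb : Bdd fun x ↦ (v x : ℂ)) : DiffBounds M (fun x ↦ (v x : ℂ)) := by
  obtain ⟨u, hu, F, hF, hF2⟩ := hv
  have hFm : AEStronglyMeasurable F volume := by
    have h1 : AEStronglyMeasurable (fun ξ ↦ (scWeight 1 s ξ)⁻¹ * (scWeight 1 s ξ * F ξ)) volume :=
      (measurable_scWeight 1 s).inv.aestronglyMeasurable.mul hF2.1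
    refine h1.congr (Filter.Eventually.of_forall fun ξ ↦ ?_)
    simp only
    rw [inv_mul_cancel_left₀ (scWeight_ne_zero 1 s ξ)]
  -- For `j ≤ M` at least one factor `(1 + ξ²)^{-1/2}` is left over. It is square integrable, so
  -- Cauchy–Schwarz gives the `L¹` bounds.
  have hwt : ∀ ξ : ℝ, ∀ j ≤ M + 1, |ξ| ^ j ≤ ((1 + ξ ^ 2) ^ (-(1 : ℝ) / 2)) ^ (M + 1 - j) *
      ‖scWeight 1 s ξ‖ := by
    intro ξ j hj
    have h1 : 1 ≤ 1 + ξ ^ 2 := by nlinarith [sq_nonneg ξ]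
    have h2 : |ξ| ≤ (1 + ξ ^ 2) ^ ((1 : ℝ) / 2) := by
      rw [← Real.sqrt_eq_rpow]
      exact Real.abs_le_sqrt (by linarith)
    rw [norm_scWeight, one_mul, Real.norm_eq_abs, sq_abs, ← Real.rpow_natCast ((1 + ξ ^ 2) ^ _),
      ← Real.rpow_mul (by linarith), ← Real.rpow_add (by linarith)]
    calc |ξ| ^ j ≤ ((1 + ξ ^ 2) ^ ((1 : ℝ) / 2)) ^ j := by gcongr
      _ = (1 + ξ ^ 2) ^ ((1 : ℝ) / 2 * j) := by
          rw [← Real.rpow_natCast, ← Real.rpow_mul (by linarith)]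
      _ ≤ _ := by
          refine Real.rpow_le_rpow_of_exponent_le h1 ?_
          rw [Nat.cast_sub hj]
          push_cast
          linarith
  have hone : ∀ ξ : ℝ, (1 + ξ ^ 2) ^ (-(1 : ℝ) / 2) ≤ 1 := fun ξ ↦
    Real.rpow_le_one_of_one_le_of_nonpos (by nlinarith [sq_nonneg ξ]) (by norm_num)
  have hnn : ∀ ξ : ℝ, 0 ≤ (1 + ξ ^ 2) ^ (-(1 : ℝ) / 2) := fun ξ ↦ by positivity
  have hmF : ∀ j : ℕ, AEStronglyMeasurable (fun ξ ↦ ((|ξ| ^ j : ℝ) : ℂ) * F ξ) volume := fun j ↦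
    (by fun_prop : Continuous fun ξ : ℝ ↦ ((|ξ| ^ j : ℝ) : ℂ)).aestronglyMeasurable.mul hFm
  have hnorm : ∀ (j : ℕ) ξ, ‖((|ξ| ^ j : ℝ) : ℂ) * F ξ‖ = |ξ| ^ j * ‖F ξ‖ := fun j ξ ↦ by
    rw [norm_mul, norm_real, Real.norm_of_nonneg (by positivity)]
  have hL2 : ∀ j ≤ M + 1, MemLp (fun ξ ↦ ((|ξ| ^ j : ℝ) : ℂ) * F ξ) 2 volume := fun j hj ↦ by
    refine hF2.of_le (hmF j) (Filter.Eventually.of_forall fun ξ ↦ ?_)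
    rw [hnorm, norm_mul]
    gcongr
    refine (hwt ξ j hj).trans ?_
    exact mul_le_of_le_one_left (norm_nonneg _) (pow_le_one₀ (hnn ξ) (hone ξ))
  have hF0 : MemLp F 2 volume := by simpa using hL2 0 (by omega)
  have hq : MemLp (fun ξ : ℝ ↦ (1 + ξ ^ 2) ^ (-(1 : ℝ) / 2)) 2 volume := by
    have hc : Continuous fun ξ : ℝ ↦ (1 + ξ ^ 2) ^ (-(1 : ℝ) / 2) :=
      Continuous.rpow_const (by fun_prop) fun ξ ↦ Or.inl (by positivity)
    rw [memLp_two_iff_integrable_sq hc.aestronglyMeasurable]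
    refine integrable_inv_one_add_sq.congr (Filter.Eventually.of_forall fun ξ ↦ ?_)
    simp only
    rw [← Real.rpow_natCast (_ ^ _), ← Real.rpow_mul (by positivity), ← Real.rpow_neg_one]
    norm_num
  refine diffBounds_of_fourier hvb hF0 (ae_eq_fourierInv_of_isRepresentedBy hu hF hF0)
    (fun j hj ↦ ?_) (hL2 (M + 1) le_rfl)
  refine (hq.integrable_mul hF2.norm).mono' (hmF j) (Filter.Eventually.of_forall fun ξ ↦ ?_)
  rw [hnorm, Pi.mul_apply, norm_mul, ← mul_assoc]
  gcongr
  refine (hwt ξ j (by omega)).trans ?_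
  gcongr
  exact pow_le_of_le_one (hnn ξ) (hone ξ) (by omega)

end

/-! ### Series of inverse transforms, and integrability from first moments. -/

section

open scoped ENNReal

/-! ### Series of multiples of inverse Fourier transforms -/

theorem fourierInv_eq_modE (H : ℝ → ℂ) (x : ℝ) : 𝓕⁻ H x = ∫ ξ, modE x ξ * H ξ := by
  rw [Real.fourierInv_eq']
  refine integral_congr_ae (Filter.Eventually.of_forall fun ξ ↦ ?_)
  simp only [smul_eq_mul, modE]
  congr 2
  simp
  ring

theorem summable_enorm_ne_top {ι E : Type*} [SeminormedAddCommGroup E] {f : ι → E} {b : ι → ℝ}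
    (hb : Summable b) (h : ∀ i, ‖f i‖ ≤ b i) : ∑' i, ‖f i‖ₑ ≠ ⊤ := by
  have hs : Summable fun i ↦ ‖f i‖ := hb.of_nonneg_of_le (fun i ↦ norm_nonneg _) h
  have e : ∑' i, ‖f i‖ₑ = ∑' i, ENNReal.ofReal ‖f i‖ := by
    congr 1; funext i; rw [ofReal_norm]
  rw [e]
  exact hs.tsum_ofReal_ne_top

/-- The bounds `B i` allow the sum and the integral to be exchanged. The integrand is integrable as
the sum of an absolutely convergent series in `L¹`. -/
theorem integrable_and_hasSum_fourierInv {ι : Type*} [Countable ι] {w : ι → ℂ} {H : ι → ℝ → ℂ}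
    {B : ι → ℝ} {x : ℝ} (hB : ∀ i, ‖w i‖ ≤ B i) (h1 : ∀ i, Integrable (H i))
    (hs : Summable fun i ↦ B i * ∫ ξ, ‖H i ξ‖) {Φ : ℝ → ℂ}
    (hΦ : ∀ᵐ ξ, HasSum (fun i ↦ w i * H i ξ) (Φ ξ)) :
    Integrable (fun ξ ↦ modE x ξ * Φ ξ) ∧
      HasSum (fun i ↦ w i * 𝓕⁻ (H i) x) (∫ ξ, modE x ξ * Φ ξ) := by
  have hm : ∀ i, Integrable (fun ξ ↦ modE x ξ * (w i * H i ξ)) := fun i ↦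
    ((h1 i).const_mul (w i)).bdd_mul (continuous_modE x).aestronglyMeasurable (c := 1)
      (Filter.Eventually.of_forall fun ξ ↦ (norm_modE x ξ).le)
  have hn : ∀ i, ∫ ξ, ‖modE x ξ * (w i * H i ξ)‖ = ‖w i‖ * ∫ ξ, ‖H i ξ‖ := by
    intro i
    rw [← integral_const_mul]
    simp [norm_modE]
  have hs' : Summable fun i ↦ ∫ ξ, ‖modE x ξ * (w i * H i ξ)‖ := by
    refine hs.of_nonneg_of_le (fun i ↦ integral_nonneg fun _ ↦ norm_nonneg _) fun i ↦ ?_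
    rw [hn]
    exact mul_le_mul_of_nonneg_right (hB i) (integral_nonneg fun _ ↦ norm_nonneg _)
  have hsum := hasSum_integral_of_summable_integral_norm hm hs'
  have hae : (fun ξ ↦ ∑' i, modE x ξ * (w i * H i ξ)) =ᵐ[volume] fun ξ ↦ modE x ξ * Φ ξ := by
    filter_upwards [hΦ] with ξ hξ
    exact (hξ.mul_left _).tsum_eq
  have hL : ∑' i, ‖(hm i).toL1 _‖ₑ ≠ ⊤ :=
    summable_enorm_ne_top hs' fun i ↦ (L1.norm_of_fun_eq_integral_norm (hm i)).le
  refine ⟨?_, ?_⟩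
  · refine (L1.integrable_coeFn (∑' i, (hm i).toL1 _)).congr ?_
    filter_upwards [Lp.coeFn_tsum hL, hae, ae_all_iff.2 fun i ↦ (hm i).coeFn_toL1] with ξ a1 a2 a3
    rw [a1, ← a2]
    exact tsum_congr a3
  · rw [integral_congr_ae hae] at hsum
    have e : (fun i ↦ ∫ ξ, modE x ξ * (w i * H i ξ)) = fun i ↦ w i * 𝓕⁻ (H i) x := by
      funext i
      rw [fourierInv_eq_modE, ← integral_const_mul]
      congr 1; funext ξ; ring
    rwa [e] at hsum

/-- The same kind of series as an absolutely convergent one in `L²`; such a series also converges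
almost everywhere to its sum, which identifies the pointwise sum with an `L²` function. -/
theorem fourierInv_tsum_conjF_ae {ι : Type*} [Countable ι] {w H : ι → ℝ → ℂ} {B : ι → ℝ}
    (hw : ∀ i, Bdd (w i)) (hB0 : ∀ i, 0 ≤ B i) (hB : ∀ i x, ‖w i x‖ ≤ B i)
    (h1 : ∀ i, Integrable (H i)) (h2 : ∀ i, MemLp (H i) 2)
    (hs : Summable fun i ↦ B i * ‖(h2 i).toLp _‖) :
    Summable (fun i ↦ conjF (w i) ((h2 i).toLp _)) ∧
      ∀ᵐ x, HasSum (fun i ↦ w i x * 𝓕⁻ (H i) x)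
        ((𝓕⁻ (∑' i, conjF (w i) ((h2 i).toLp _)) : L2) x) := by
  have hb : ∀ i, ‖conjF (w i) ((h2 i).toLp _)‖ ≤ B i * ‖(h2 i).toLp _‖ := fun i ↦
    (conjF (w i)).le_of_opNorm_le (norm_conjF_le (hB0 i) (Filter.Eventually.of_forall (hB i))) _
  have hsum : Summable fun i ↦ conjF (w i) ((h2 i).toLp _) := Summable.of_norm_bounded hs hb
  refine ⟨hsum, ?_⟩
  have e : (𝓕⁻ (∑' i, conjF (w i) ((h2 i).toLp _)) : L2) =
      ∑' i, (𝓕⁻ (conjF (w i) ((h2 i).toLp _)) : L2) :=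
    (Lp.fourierTransformₗᵢ ℝ ℂ : L2 ≃ₗᵢ[ℂ] L2).symm.toContinuousLinearEquiv.map_tsum
  rw [e]
  have hL : ∑' i, ‖(𝓕⁻ (conjF (w i) ((h2 i).toLp _)) : L2)‖ₑ ≠ ⊤ :=
    summable_enorm_ne_top hs fun i ↦ by rw [norm_fourierInv]; exact hb i
  have h3 : ∀ i, ((𝓕⁻ (conjF (w i) ((h2 i).toLp _)) : L2) : ℝ → ℂ) =ᵐ[volume]
      fun x ↦ w i x * 𝓕⁻ (H i) x := by
    intro i
    rw [fourierInv_conjF]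
    filter_upwards [coeFn_mulL (hw i) (𝓕⁻ ((h2 i).toLp _) : L2), fourierInv_toLp (h1 i) (h2 i)]
      with x a1 a2
    rw [a1, a2]
  filter_upwards [Lp.hasSum_coeFn_tsum hL, ae_all_iff.2 h3] with x a1 a2
  rwa [funext a2] at a1

/-! ### First moments -/

theorem eLpNorm_fourierInv {G : ℝ → ℂ} (h1 : Integrable G) (h2 : MemLp G 2) :
    eLpNorm (𝓕⁻ G) 2 = eLpNorm G 2 := by
  rw [← eLpNorm_congr_ae (fourierInv_toLp h1 h2), ← eLpNorm_congr_ae h2.coeFn_toLp,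
    ← Lp.enorm_def, ← Lp.enorm_def, ← ofReal_norm, ← ofReal_norm, norm_fourierInv]

theorem eLpNorm_fourier {G : ℝ → ℂ} (h1 : Integrable G) (h2 : MemLp G 2) :
    eLpNorm (𝓕 G) 2 = eLpNorm G 2 := by
  rw [← eLpNorm_congr_ae (fourier_toLp h1 h2), ← eLpNorm_congr_ae h2.coeFn_toLp,
    ← Lp.enorm_def, ← Lp.enorm_def, ← ofReal_norm, ← ofReal_norm, Lp.norm_fourier_eq]

theorem fourierInv_sub_shift {G : ℝ → ℂ} (h1 : Integrable G) (h x : ℝ) :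
    𝓕⁻ (fun ξ ↦ G (ξ - h) - G ξ) x = (modE h x - 1) * 𝓕⁻ G x := by
  have i1 : Integrable fun ξ ↦ modE x ξ * G (ξ - h) :=
    (h1.comp_sub_right h).bdd_mul (continuous_modE x).aestronglyMeasurable (c := 1)
      (Filter.Eventually.of_forall fun ξ ↦ (norm_modE x ξ).le)
  have i2 : Integrable fun ξ ↦ modE x ξ * G ξ :=
    h1.bdd_mul (continuous_modE x).aestronglyMeasurable (c := 1)
      (Filter.Eventually.of_forall fun ξ ↦ (norm_modE x ξ).le)
  rw [fourierInv_eq_modE, fourierInv_eq_modE]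
  simp_rw [mul_sub]
  rw [integral_sub i1 i2, sub_mul, one_mul,
    ← integral_sub_right_eq_self (μ := volume) (fun ξ ↦ modE x ξ * G (ξ - h)) (-h),
    ← integral_const_mul]
  congr 2
  funext ξ
  rw [sub_neg_eq_add, add_sub_cancel_right, modE_add_right]
  have : modE x h = modE h x := by unfold modE; congr 1; ring
  rw [this]; ring

theorem hasDerivAt_modE_zero (x : ℝ) :
    HasDerivAt (fun h : ℝ ↦ modE h x) (2 * Real.pi * Complex.I * x) 0 := by
  have h0 : HasDerivAt (fun h : ℝ ↦ (h : ℂ)) 1 0 := Complex.ofRealCLM.hasDerivAt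
  have h1 := ((h0.const_mul (2 * Real.pi * Complex.I : ℂ)).mul_const (x : ℂ)).cexp
  simpa [modE] using h1

/-- Multiplication by `2πix` is the limit of the difference quotients of modulations, which
correspond to shifts of `G`. Plancherel and Fatou pass the bound to the limit. -/
theorem eLpNorm_id_mul_fourierInv_le {G : ℝ → ℂ} (h1 : Integrable G) (h2 : MemLp G 2) {L : ℝ}
    (hL : ∀ h : ℝ, 0 < h → h ≤ 1 →
      eLpNorm (fun ξ ↦ G (ξ - h) - G ξ) 2 ≤ ENNReal.ofReal (L * h)) :
    eLpNorm (fun x ↦ (2 * Real.pi * Complex.I * x) * 𝓕⁻ G x) 2 ≤ ENNReal.ofReal L := by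
  have hG : AEStronglyMeasurable (𝓕⁻ G) volume :=
    (Lp.aestronglyMeasurable (𝓕⁻ (h2.toLp G) : L2)).congr (fourierInv_toLp h1 h2)
  set ε : ℕ → ℝ := fun n ↦ ((n : ℝ) + 1)⁻¹ with hε
  have ε0 : ∀ n, 0 < ε n := fun n ↦ by positivity
  have ε1 : ∀ n, ε n ≤ 1 := fun n ↦ inv_le_one_of_one_le₀ (by linarith [n.cast_nonneg (α := ℝ)])
  set f : ℕ → ℝ → ℂ := fun n x ↦ ((ε n)⁻¹ : ℝ) • ((modE (ε n) x - 1) * 𝓕⁻ G x) with hf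
  have hfm : ∀ n, AEStronglyMeasurable (f n) volume := fun n ↦
    AEStronglyMeasurable.const_smul (f := fun x ↦ (modE (ε n) x - 1) * 𝓕⁻ G x)
      (AEStronglyMeasurable.mul (f := fun x ↦ modE (ε n) x - 1)
      (((continuous_modE (ε n)).sub continuous_const).aestronglyMeasurable) hG) (ε n)⁻¹
  have hlim : ∀ᵐ x, Filter.Tendsto (fun n ↦ f n x) Filter.atTop
      (nhds ((2 * Real.pi * Complex.I * x) * 𝓕⁻ G x)) := by
    refine Filter.Eventually.of_forall fun x ↦ ?_
    have hs := (hasDerivAt_iff_tendsto_slope_zero.1 (hasDerivAt_modE_zero x))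
    have ht : Filter.Tendsto ε Filter.atTop (nhdsWithin 0 {0}ᶜ) := by
      refine tendsto_nhdsWithin_iff.2 ⟨?_, Filter.Eventually.of_forall fun n ↦ (ε0 n).ne'⟩
      exact tendsto_inv_atTop_zero.comp
        (Filter.tendsto_atTop_add_const_right _ _ tendsto_natCast_atTop_atTop)
    have := (hs.comp ht).mul_const (𝓕⁻ G x)
    refine this.congr fun n ↦ ?_
    simp only [Function.comp_apply, hf, zero_add, modE_zero, smul_mul_assoc]
  have hbound : ∀ n, eLpNorm (f n) 2 ≤ ENNReal.ofReal L := by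
    intro n
    have e : f n = ((ε n)⁻¹ : ℝ) • 𝓕⁻ (fun ξ ↦ G (ξ - ε n) - G ξ) := by
      funext x
      rw [Pi.smul_apply, fourierInv_sub_shift h1]
    have m2 : MemLp (fun ξ ↦ G (ξ - ε n) - G ξ) 2 :=
      (h2.comp_measurePreserving (measurePreserving_sub_right volume (ε n))).sub h2
    have m1 : Integrable (fun ξ ↦ G (ξ - ε n) - G ξ) := (h1.comp_sub_right _).sub h1
    rw [e, eLpNorm_const_smul, eLpNorm_fourierInv m1 m2]
    refine (mul_le_mul_right (hL _ (ε0 n) (ε1 n)) _).trans ?_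
    rw [Real.enorm_of_nonneg (inv_nonneg.2 (ε0 n).le), ← ENNReal.ofReal_mul (inv_nonneg.2 (ε0 n).le)]
    refine ENNReal.ofReal_le_ofReal (le_of_eq ?_)
    field_simp [(ε0 n).ne']
  refine (Lp.eLpNorm_lim_le_liminf_eLpNorm hfm _ hlim).trans ?_
  exact Filter.liminf_le_of_frequently_le' (Filter.Frequently.of_forall hbound)

/-- Write `g` as `(1 + 2πix)⁻¹` times `(1 + 2πix) g`, a product of two square integrable functions.
-/
theorem integrable_of_memLp_two_id_mul {g : ℝ → ℂ} (h2 : MemLp g 2)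
    (hx : MemLp (fun x ↦ (2 * Real.pi * Complex.I * x) * g x) 2) : Integrable g := by
  have hi : MemLp (fun x : ℝ ↦ (1 + 2 * Real.pi * Complex.I * x : ℂ)⁻¹) 2 := by
    have hc : Continuous fun x : ℝ ↦ (1 + 2 * Real.pi * Complex.I * x : ℂ)⁻¹ := by
      refine Continuous.inv₀ (by fun_prop) fun x h ↦ ?_
      simpa using congrArg Complex.re h
    rw [memLp_two_iff_integrable_sq_norm hc.aestronglyMeasurable]
    refine integrable_inv_one_add_sq.mono' (hc.norm.pow 2).aestronglyMeasurable
      (Filter.Eventually.of_forall fun x ↦ ?_)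
    have e : ‖(1 + 2 * Real.pi * Complex.I * x : ℂ)‖ ^ 2 = 1 + (2 * Real.pi * x) ^ 2 := by
      rw [Complex.sq_norm, Complex.normSq_apply]
      simp
      ring
    rw [Real.norm_of_nonneg (by positivity), norm_inv, inv_pow, e]
    refine inv_anti₀ (by positivity) ?_
    have : 1 ≤ (2 * Real.pi) ^ 2 := by nlinarith [Real.pi_gt_three]
    nlinarith [sq_nonneg x, mul_pow (2 * Real.pi) x 2]
  have := hi.integrable_mul (h2.add hx)
  refine this.congr (Filter.Eventually.of_forall fun x ↦ ?_)
  have hne : (1 + 2 * Real.pi * Complex.I * x : ℂ) ≠ 0 := by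
    intro h
    simpa using congrArg Complex.re h
  simp only [Pi.mul_apply, Pi.add_apply]
  field_simp

/-- The shifted difference is the transform of `(e^{2πihx} - 1) f`, which is at most `2πh |x f|`. -/
theorem exists_eLpNorm_fourier_shift_le (f : 𝓢(ℝ, ℂ)) : ∃ L : ℝ, 0 ≤ L ∧ ∀ h : ℝ, 0 ≤ h →
    eLpNorm (fun ξ ↦ 𝓕 (f : ℝ → ℂ) (ξ - h) - 𝓕 (f : ℝ → ℂ) ξ) 2 ≤ ENNReal.ofReal (L * h) := by
  set g : 𝓢(ℝ, ℂ) := SchwartzMap.smulLeftCLM ℂ (fun x : ℝ ↦ x) f with hg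
  have hgx : ∀ x, g x = x * f x := fun x ↦ by
    rw [hg, SchwartzMap.smulLeftCLM_apply_apply (by fun_prop)]; simp
  have hgm := g.memLp 2 volume
  refine ⟨2 * Real.pi * (eLpNorm g 2 volume).toReal, by positivity, fun h hh ↦ ?_⟩
  have i1 : Integrable fun x ↦ (modE h x - 1) * f x :=
    f.integrable.bdd_mul ((continuous_modE h).sub continuous_const).aestronglyMeasurable (c := 2)
      (Filter.Eventually.of_forall fun x ↦ (norm_sub_le _ _).trans (by simp [norm_modE]; norm_num))
  have i2 : MemLp (fun x ↦ (modE h x - 1) * f x) 2 := by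
    refine ((f.memLp 2 volume).norm.const_mul 2).of_le i1.1 (Filter.Eventually.of_forall fun x ↦ ?_)
    rw [norm_mul, norm_mul, norm_norm]
    refine mul_le_mul_of_nonneg_right ((norm_sub_le _ _).trans ?_) (norm_nonneg _)
    simp [norm_modE]; norm_num
  have e : (fun ξ ↦ 𝓕 (f : ℝ → ℂ) (ξ - h) - 𝓕 (f : ℝ → ℂ) ξ) =
      𝓕 (fun x ↦ (modE h x - 1) * f x) := by
    funext ξ
    have j1 : Integrable fun x ↦ cexp (((-2 * Real.pi * (x * (ξ - h)) : ℝ) : ℂ) * Complex.I) * f x :=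
      f.integrable.bdd_mul (by fun_prop : Continuous _).aestronglyMeasurable (c := 1)
        (Filter.Eventually.of_forall fun x ↦ (Complex.norm_exp_ofReal_mul_I _).le)
    have j2 : Integrable fun x ↦ cexp (((-2 * Real.pi * (x * ξ) : ℝ) : ℂ) * Complex.I) * f x :=
      f.integrable.bdd_mul (by fun_prop : Continuous _).aestronglyMeasurable (c := 1)
        (Filter.Eventually.of_forall fun x ↦ (Complex.norm_exp_ofReal_mul_I _).le)
    rw [Real.fourier_eq', Real.fourier_eq', Real.fourier_eq']
    simp only [RCLike.inner_apply, conj_trivial, smul_eq_mul]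
    simp only [mul_comm _ ξ, mul_comm _ (ξ - h)] at j1 j2 ⊢
    rw [← integral_sub (by simpa [mul_comm] using j1) (by simpa [mul_comm] using j2)]
    congr 1; funext x
    have em : cexp (((-2 * Real.pi * ((ξ - h) * x) : ℝ) : ℂ) * Complex.I) =
        cexp (((-2 * Real.pi * (ξ * x) : ℝ) : ℂ) * Complex.I) * modE h x := by
      rw [modE, ← Complex.exp_add]
      congr 1
      push_cast; ring
    rw [em]; ring
  rw [e, eLpNorm_fourier i1 i2]
  have hb : ∀ᵐ x, ‖(modE h x - 1) * f x‖ ≤ (2 * Real.pi * h) * ‖g x‖ := by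
    refine Filter.Eventually.of_forall fun x ↦ ?_
    rw [norm_mul, hgx, norm_mul, Complex.norm_real, Real.norm_eq_abs]
    refine (mul_le_mul_of_nonneg_right (norm_modE_sub_one_le h x) (norm_nonneg _)).trans (le_of_eq ?_)
    rw [abs_mul, abs_of_nonneg hh]; ring
  refine (eLpNorm_le_mul_eLpNorm_of_ae_le_mul hb 2).trans ?_
  rw [mul_right_comm (2 * Real.pi) _ h, ENNReal.ofReal_mul (by positivity : 0 ≤ 2 * Real.pi * h),
    ENNReal.ofReal_toReal hgm.2.ne]

end

/-! ### From an admissible speed to the symbol expansion and the operator bounds. -/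

section

open scoped ENNReal

/-! ### The expansion of the symbols of an admissible speed -/

/-- The deviation of the speed `c` from the constant `z₀`. -/
abbrev deviation (c : ℝ → ℝ) (z₀ : ℝ) : ℝ → ℂ := fun x ↦ ((c x - z₀ : ℝ) : ℂ)

/-- The speed `c` is regular enough and close enough to the constant `z₀` for the symbols to be
expanded in powers of `c - z₀`. -/
structure SpeedExpansion (c : ℝ → ℝ) (M : ℕ) (z₀ ρ κ R α β C K : ℝ) (a b : ℕ → ℂ → ℂ) : Prop where
  symb : SymbolExpansion z₀ R α β C a b
  one_le_M : 1 ≤ M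
  ρ_nonneg : 0 ≤ ρ
  ρ_lt : ρ < κ
  κ_lt : κ < R
  one_le_α : 1 ≤ α
  α_le : α ≤ M
  β_nonneg : 0 ≤ β
  gap : 0 < 1 - α + β
  bdd : Bdd (deviation c z₀)
  abs_le : ∀ x, |c x - z₀| ≤ ρ
  K_pos : 0 < K
  reg : ∀ l, RegOp M (K * κ ^ l) (conjF (deviation c z₀) ^ l)

theorem aestronglyMeasurable_of_memSobolevTwo {s : ℝ} (hs : 0 ≤ s) {v : ℝ → ℝ}
    (hv : MemSobolevTwo s v) : AEStronglyMeasurable (fun x ↦ (v x : ℂ)) volume := by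
  obtain ⟨u, hu, F, hF, hF2⟩ := hv
  have hFm : AEStronglyMeasurable F volume := by
    have h := ((measurable_scWeight 1 s).inv.aestronglyMeasurable (μ := volume)).mul hF2.1
    refine h.congr (Filter.Eventually.of_forall fun ξ ↦ ?_)
    simp [scWeight_ne_zero]
  have hF3 : MemLp F 2 volume := by
    refine hF2.of_le hFm (Filter.Eventually.of_forall fun ξ ↦ ?_)
    rw [norm_mul, norm_scWeight]
    refine le_mul_of_one_le_left (norm_nonneg _) (Real.one_le_rpow ?_ (by linarith))
    nlinarith [sq_nonneg ‖(1 : ℝ) * ξ‖]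
  exact (Lp.aestronglyMeasurable _).congr (ae_eq_fourierInv_of_isRepresentedBy hu hF hF3).symm

theorem exists_speedExpansion {c₁ c₂ : ℝ} (hpair : AdmissiblePair c₁ c₂) {c : ℝ → ℝ}
    (hc : Admissible c₁ c₂ c) :
    ∃ z₀ ρ κ R α β C K a b, SpeedExpansion c ⌈c₁⁻¹⌉₊ z₀ ρ κ R α β C K a b := by
  obtain ⟨h1, h12, h2, hd⟩ := hpair
  obtain ⟨⟨hb, hB, hinf, hsup⟩, hreg⟩ := hc
  have hM : 1 ≤ ⌈c₁⁻¹⌉₊ := Nat.one_le_ceil_iff.2 (inv_pos.2 h1)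
  set M := ⌈c₁⁻¹⌉₊ with hMdef
  have hcM : c₁⁻¹ ≤ M := Nat.le_ceil _
  set z₀ := (c₁ + c₂) / 2 with hz
  set ρ := max ((⨆ x, c x) - z₀) (z₀ - ⨅ x, c x) with hρ
  have hρlt : ρ < (c₂ - c₁) / 2 := max_lt (by linarith) (by linarith)
  have habs : ∀ x, |c x - z₀| ≤ ρ := fun x ↦ by
    have e1 := ciInf_le hb x
    have e2 := le_ciSup hB x
    have e3 := le_max_left ((⨆ x, c x) - z₀) (z₀ - ⨅ x, c x)
    have e4 := le_max_right ((⨆ x, c x) - z₀) (z₀ - ⨅ x, c x)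
    exact abs_le.2 ⟨by linarith, by linarith⟩
  have hρ0 : 0 ≤ ρ := (abs_nonneg _).trans (habs 0)
  -- `κ` and `R` divide the interval from `ρ` to `(c₂ - c₁) / 2` into three equal parts.
  set κ := (2 * ρ + (c₂ - c₁) / 2) / 3 with hκ
  set R := (ρ + 2 * ((c₂ - c₁) / 2)) / 3 with hR
  -- Multiplying `c₁⁻¹ ≤ 1 + c₂⁻¹` by `c₁ c₂` gives `c₂ ≤ c₁ c₂ + c₁`, and `c₂ ≤ 2`. This is what
  -- yields `R ≤ z₀ / 2`, the condition that keeps the disc in the sector.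
  have h3 : c₂ ≤ 3 * c₁ := by
    have h20 : 0 < c₂ := h1.trans h12
    have e1 : c₁⁻¹ ≤ 1 + c₂⁻¹ := by linarith
    have e2 := mul_le_mul_of_nonneg_left e1 (mul_pos h1 h20).le
    have e3 : c₁ * c₂ * c₁⁻¹ = c₂ := by field_simp
    have e4 : c₁ * c₂ * (1 + c₂⁻¹) = c₁ * c₂ + c₁ := by field_simp
    rw [e3, e4] at e2
    nlinarith
  have hz1 : c₁ < z₀ - R := by linarith
  have hz2 : z₀ + R < c₂ := by linarith
  have hi1 : (z₀ - R)⁻¹ < c₁⁻¹ := inv_strictAnti₀ h1 hz1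
  have hi2 : c₂⁻¹ < (z₀ + R)⁻¹ := inv_strictAnti₀ (by linarith) hz2
  -- The order is raised to at least `1`, so that `α - 1 ≥ 0` in the symbol bounds.
  obtain ⟨C, a, b, hsymb⟩ := exists_symbolExpansion (z₀ := z₀) (R := R) (by linarith)
    (by linarith) (by linarith) (α := max 1 (z₀ - R)⁻¹) (le_max_left _ _) (le_max_right _ _)
  have hβ : 0 < (z₀ + R)⁻¹ := inv_pos.2 (by linarith)
  have hDB : AEStronglyMeasurable (fun x ↦ (c x : ℂ)) volume ∧ DiffBounds M (fun x ↦ (c x : ℂ)) := by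
    have hbd : ∀ x, ‖(c x : ℂ)‖ ≤ ρ + |z₀| := fun x ↦ by
      rw [Complex.norm_real, Real.norm_eq_abs]
      have := abs_add_le (c x - z₀) z₀
      rw [sub_add_cancel] at this
      linarith [habs x]
    rcases hreg with ⟨N, -, hN, hW⟩ | ⟨c₀, s, -, -, -, hs, hv, -⟩
    · refine ⟨?_, diffBounds_of_memSobolevInfty (by omega) hW⟩
      obtain ⟨g, rfl, hg, -⟩ := hW
      exact Complex.continuous_ofReal.comp_aestronglyMeasurable (hg 0 (by omega)).1
    · have hm := aestronglyMeasurable_of_memSobolevTwo (by linarith [M.cast_nonneg (α := ℝ)]) hv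
      have hvb : Bdd (fun x ↦ ((c x - c₀ : ℝ) : ℂ)) :=
        bdd_of_bound hm (K := ρ + |z₀| + |c₀|) (Filter.Eventually.of_forall fun x ↦ by
          push_cast
          refine (norm_sub_le _ _).trans (add_le_add (hbd x) ?_)
          simp)
      have hD := diffBounds_sub_const (diffBounds_of_memSobolevTwo (M := M) (by linarith) hv hvb)
        (-(c₀ : ℂ))
      have e : (fun x ↦ ((c x - c₀ : ℝ) : ℂ) - -(c₀ : ℂ)) = fun x ↦ (c x : ℂ) := by
        funext x; push_cast; ring
      rw [e] at hD
      refine ⟨?_, hD⟩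
      have := hm.add (aestronglyMeasurable_const (b := (c₀ : ℂ)))
      refine this.congr (Filter.Eventually.of_forall fun x ↦ ?_)
      simp
  obtain ⟨hcm, hD⟩ := hDB
  have hub : Bdd (fun x ↦ ((c x - z₀ : ℝ) : ℂ)) := by
    refine bdd_of_bound (K := ρ) ?_ (Filter.Eventually.of_forall fun x ↦ by
      rw [Complex.norm_real]; exact habs x)
    refine (hcm.sub (aestronglyMeasurable_const (b := (z₀ : ℂ)))).congr
      (Filter.Eventually.of_forall fun x ↦ ?_)
    simp
  have hD' := diffBounds_sub_const hD (z₀ : ℂ)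
  have e : (fun x ↦ (c x : ℂ) - (z₀ : ℂ)) = fun x ↦ ((c x - z₀ : ℝ) : ℂ) := by
    funext x; push_cast; ring
  rw [e] at hD'
  obtain ⟨D, hD0, hD1, hD2⟩ := hD'
  have hρκ : ρ < κ := by linarith
  obtain ⟨K, hK, hreg⟩ := exists_regOp_pow hM hub hρ0 hρκ hD0
    (norm_conjF_le hρ0 (Filter.Eventually.of_forall fun x ↦ by
      rw [Complex.norm_real]; exact habs x)) hD1 hD2
  exact ⟨z₀, ρ, κ, R, max 1 (z₀ - R)⁻¹, (z₀ + R)⁻¹, C, K, a, b, hsymb, hM, hρ0, hρκ, by linarith,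
    le_max_left _ _, max_le (by exact_mod_cast hM) (by linarith), hβ.le,
    -- If `α = 1` the gap is `β > 0`. Otherwise `α < c₁⁻¹` and `β > c₂⁻¹`, and the gap is positive
    -- because `c₁⁻¹ - c₂⁻¹ ≤ 1`.
    by rcases max_choice 1 (z₀ - R)⁻¹ with h | h <;> rw [h] <;> linarith, hub, habs, hK, hreg⟩

end

/-! ### Quantization of the expanded symbols on Schwartz functions. -/

section

open scoped ENNReal

/-! ### Quantization of the expanded symbols -/

/-- The symbol `ξ ↦ a_k(t|ξ|)`. -/
def absSym (a : ℕ → ℂ → ℂ) (t : ℝ) (k : ℕ) (ξ : ℝ) : ℂ := a k (t * |ξ| : ℝ)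

/-- The Fourier transform of a Schwartz function as an element of `L²`. -/
def fhat (f : 𝓢(ℝ, ℂ)) : L2 := (𝓕 f).toLp 2 volume

theorem coeFn_fhat (f : 𝓢(ℝ, ℂ)) : (fhat f : ℝ → ℂ) =ᵐ[volume] 𝓕 (f : ℝ → ℂ) := by
  rw [← SchwartzMap.fourier_coe]
  exact (𝓕 f).coeFn_toLp 2 volume

/-- The function `b_l(t|ξ|) f̂(ξ)`. -/
def symFhat (b : ℕ → ℂ → ℂ) (t : ℝ) (f : 𝓢(ℝ, ℂ)) (l : ℕ) : L2 := mulL (absSym b t l) (fhat f)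

variable {c : ℝ → ℝ} {M : ℕ} {z₀ ρ κ R α β C K t : ℝ} {a b : ℕ → ℂ → ℂ}

theorem SpeedExpansion.κ_pos (hS : SpeedExpansion c M z₀ ρ κ R α β C K a b) : 0 < κ :=
  hS.ρ_nonneg.trans_lt hS.ρ_lt

theorem SpeedExpansion.R_pos (hS : SpeedExpansion c M z₀ ρ κ R α β C K a b) : 0 < R :=
  hS.κ_pos.trans hS.κ_lt

theorem SpeedExpansion.norm_deviation_pow_le (hS : SpeedExpansion c M z₀ ρ κ R α β C K a b) (k : ℕ)
    (x : ℝ) : ‖deviation c z₀ x ^ k‖ ≤ ρ ^ k := by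
  rw [norm_pow, Complex.norm_real]
  exact pow_le_pow_left₀ (norm_nonneg _) (hS.abs_le x) k

theorem SpeedExpansion.measurable_absSym (hS : SpeedExpansion c M z₀ ρ κ R α β C K a b) (ht : 0 < t)
    (k : ℕ) : Measurable (absSym a t k) := by
  refine measurable_of_continuousOn_compl_singleton 0 ?_
  refine (hS.symb.diff_a k).continuousOn.comp (by fun_prop) fun ξ hξ ↦ ?_
  have h : 0 < t * |ξ| := mul_pos ht (abs_pos.2 hξ)
  refine ⟨by simpa using h, ?_⟩
  rw [ofReal_im, ofReal_re, abs_zero]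
  exact h.le

theorem SpeedExpansion.norm_absSym_le (hS : SpeedExpansion c M z₀ ρ κ R α β C K a b) (ht : 0 < t)
    (ht1 : t ≤ 1) (k i : ℕ) {ξ : ℝ} (hξ : ξ ∈ shell i) :
    ‖absSym a t k ξ‖ ≤ C * R⁻¹ ^ k * 2 ^ M * 2 ^ (M * i) := by
  have hR := hS.R_pos
  have hC := hS.symb.pos
  refine (hS.symb.bound_a k _ (by positivity)).trans ?_
  have h1 : 1 + t * |ξ| ≤ 2 * 2 ^ i := by
    have h2 : t * |ξ| ≤ 1 * 2 ^ i := by gcongr; exact hξ.1.le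
    have h3 : (1 : ℝ) ≤ 2 ^ i := one_le_pow₀ (by norm_num)
    linarith
  have h4 : (1 + t * |ξ|) ^ α ≤ 2 ^ M * 2 ^ (M * i) := by
    calc (1 + t * |ξ|) ^ α ≤ (1 + t * |ξ|) ^ (M : ℝ) :=
          Real.rpow_le_rpow_of_exponent_le (by
            have : 0 ≤ t * |ξ| := by positivity
            linarith) hS.α_le
      _ = (1 + t * |ξ|) ^ M := Real.rpow_natCast _ _
      _ ≤ (2 * 2 ^ i) ^ M := pow_le_pow_left₀ (by positivity) h1 M
      _ = _ := by rw [mul_pow, ← pow_mul, mul_comm i]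
  calc _ ≤ C * R⁻¹ ^ k * (2 ^ M * 2 ^ (M * i)) := by gcongr
    _ = _ := by ring

theorem SpeedExpansion.norm_absSym_inv_le (hS : SpeedExpansion c M z₀ ρ κ R α β C K a b)
    (ht : 0 < t) (l : ℕ) (ξ : ℝ) : ‖absSym b t l ξ‖ ≤ C * R⁻¹ ^ l := by
  have hR := hS.R_pos
  have hC := hS.symb.pos
  refine (hS.symb.bound_b l _ (by positivity)).trans ?_
  refine mul_le_of_le_one_right (by positivity) ?_
  exact Real.rpow_le_one_of_one_le_of_nonpos (by
    have : 0 ≤ t * |ξ| := by positivity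
    linarith) (by linarith [hS.β_nonneg])

theorem SpeedExpansion.norm_absSym_inv_sub_le (hS : SpeedExpansion c M z₀ ρ κ R α β C K a b)
    (ht : 0 < t) (ht1 : t ≤ 1) (l : ℕ) (ξ η : ℝ) :
    ‖absSym b t l ξ - absSym b t l η‖ ≤ C * R⁻¹ ^ l * |ξ - η| := by
  have hR := hS.R_pos
  have hC := hS.symb.pos
  refine (hS.symb.lip_b l _ _ (by positivity) (by positivity)).trans ?_
  refine mul_le_mul_of_nonneg_left ?_ (by positivity)
  rw [← mul_sub, abs_mul, abs_of_pos ht]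
  exact (mul_le_of_le_one_left (abs_nonneg _) ht1).trans (abs_abs_sub_abs_le _ _)

theorem SpeedExpansion.continuous_absSym_inv (hS : SpeedExpansion c M z₀ ρ κ R α β C K a b)
    (ht : 0 < t) (ht1 : t ≤ 1) (l : ℕ) : Continuous (absSym b t l) := by
  have hR := hS.R_pos
  have hC := hS.symb.pos
  refine LipschitzWith.continuous (K := (C * R⁻¹ ^ l).toNNReal) ?_
  refine LipschitzWith.of_dist_le_mul fun ξ η ↦ ?_
  rw [dist_eq_norm, dist_eq_norm, Real.coe_toNNReal _ (by positivity)]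
  exact hS.norm_absSym_inv_sub_le ht ht1 l ξ η

theorem SpeedExpansion.bdd_absSym_inv (hS : SpeedExpansion c M z₀ ρ κ R α β C K a b)
    (ht : 0 < t) (ht1 : t ≤ 1) (l : ℕ) : Bdd (absSym b t l) :=
  bdd_of_bound (hS.continuous_absSym_inv ht ht1 l).aestronglyMeasurable
    (Filter.Eventually.of_forall (hS.norm_absSym_inv_le ht l))

theorem SpeedExpansion.coeFn_symFhat (hS : SpeedExpansion c M z₀ ρ κ R α β C K a b)
    (ht : 0 < t) (ht1 : t ≤ 1) (f : 𝓢(ℝ, ℂ)) (l : ℕ) :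
    (symFhat b t f l : ℝ → ℂ) =ᵐ[volume] fun ξ ↦ absSym b t l ξ * 𝓕 (f : ℝ → ℂ) ξ := by
  filter_upwards [coeFn_mulL (hS.bdd_absSym_inv ht ht1 l) (fhat f), coeFn_fhat f] with ξ h1 h2
  rw [symFhat, h1, h2]

theorem SpeedExpansion.norm_mulL_absSym_inv_le (hS : SpeedExpansion c M z₀ ρ κ R α β C K a b)
    (ht : 0 < t) (l : ℕ) : ‖mulL (absSym b t l)‖ ≤ C * R⁻¹ ^ l := by
  have hR := hS.R_pos
  have hC := hS.symb.pos
  exact norm_mulL_le (by positivity) (Filter.Eventually.of_forall (hS.norm_absSym_inv_le ht l))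

theorem SpeedExpansion.norm_symFhat_le (hS : SpeedExpansion c M z₀ ρ κ R α β C K a b)
    (ht : 0 < t) (f : 𝓢(ℝ, ℂ)) (l : ℕ) : ‖symFhat b t f l‖ ≤ C * R⁻¹ ^ l * ‖fhat f‖ :=
  (mulL _).le_of_opNorm_le (hS.norm_mulL_absSym_inv_le ht l) _

/-- The transform of a Schwartz function absorbs the weight `(1 + ξ²)^{M+1}`, and the multipliers
`b_l` are bounded by a multiple of `R⁻¹ ^ l`. -/
theorem SpeedExpansion.exists_dyadDecay_symFhat_le (hS : SpeedExpansion c M z₀ ρ κ R α β C K a b)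
    (ht : 0 < t) (ht1 : t ≤ 1) (f : 𝓢(ℝ, ℂ)) : ∃ Q : ℝ, 0 < Q ∧ ∀ l,
      dyadDecay (M + 1) (symFhat b t f l) ≤ ENNReal.ofReal (R⁻¹ ^ l * Q) := by
  have hR := hS.R_pos
  have hC := hS.symb.pos
  set w : ℝ → ℂ := fun ξ ↦ ((1 + ξ ^ 2 : ℝ) : ℂ) ^ (M + 1) with hw
  have hwt : Function.HasTemperateGrowth w := by
    have : Function.HasTemperateGrowth fun ξ : ℝ ↦ ((1 + ξ ^ 2 : ℝ) : ℂ) := by fun_prop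
    fun_prop
  set g : 𝓢(ℝ, ℂ) := SchwartzMap.smulLeftCLM ℂ w (𝓕 f) with hg
  set G : L2 := g.toLp 2 volume with hG
  refine ⟨4 ^ (M + 1) * 2 * (C * ‖G‖) + 1, by positivity, fun l ↦ ?_⟩
  have h := dyadDecay_le_of_ae (n := M + 1) (F := symFhat b t f l) (G := mulL (absSym b t l) G)
    (by omega) (by
      filter_upwards [hS.coeFn_symFhat ht ht1 f l, coeFn_mulL (hS.bdd_absSym_inv ht ht1 l) G,
        g.coeFn_toLp 2 volume] with ξ h1 h2 h3
      rw [h1, h2, hG, h3, hg, SchwartzMap.smulLeftCLM_apply_apply hwt, SchwartzMap.fourier_coe]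
      simp only [smul_eq_mul, hw]
      ring)
  refine h.trans (ENNReal.ofReal_le_ofReal ?_)
  have h2 : ‖mulL (absSym b t l) G‖ ≤ C * R⁻¹ ^ l * ‖G‖ :=
    (mulL _).le_of_opNorm_le (hS.norm_mulL_absSym_inv_le ht l) _
  have h3 : 0 ≤ R⁻¹ ^ l := by positivity
  calc 4 ^ (M + 1) * 2 * ‖mulL (absSym b t l) G‖
      ≤ 4 ^ (M + 1) * 2 * (C * R⁻¹ ^ l * ‖G‖) := by gcongr
    _ = R⁻¹ ^ l * (4 ^ (M + 1) * 2 * (C * ‖G‖)) := by ring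
    _ ≤ _ := by gcongr; linarith

theorem SpeedExpansion.exists_symbol_map_bounds (hS : SpeedExpansion c M z₀ ρ κ R α β C K a b)
    (ht : 0 < t) (ht1 : t ≤ 1) (f : 𝓢(ℝ, ℂ)) : ∃ A : ℝ, 0 < A ∧ ∀ k i l,
      Integrable (fun ξ ↦ absSym a t k ξ *
        ((conjF (deviation c z₀) ^ i) (symFhat b t f l) : ℝ → ℂ) ξ) ∧
      ∫ ξ, ‖absSym a t k ξ * ((conjF (deviation c z₀) ^ i) (symFhat b t f l) : ℝ → ℂ) ξ‖ ≤
        A * (R⁻¹ ^ k * (κ ^ i * R⁻¹ ^ l)) ∧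
      ∃ h2 : MemLp (fun ξ ↦ absSym a t k ξ *
        ((conjF (deviation c z₀) ^ i) (symFhat b t f l) : ℝ → ℂ) ξ) 2,
        ‖h2.toLp _‖ ≤ A * (R⁻¹ ^ k * (κ ^ i * R⁻¹ ^ l)) := by
  have hR := hS.R_pos
  have hC := hS.symb.pos
  have hκ := hS.κ_pos
  have hK := hS.K_pos
  obtain ⟨Q, hQ, hQd⟩ := hS.exists_dyadDecay_symFhat_le ht ht1 f
  refine ⟨11 * (K * (C * 2 ^ M) * (2 ^ (M + 1) * Q)), by positivity, fun k i l ↦ ?_⟩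
  obtain ⟨h1, h2, h3, h4⟩ := symbol_map_integrable (hS.reg i) (by positivity)
    (hS.measurable_absSym ht k) (Ka := C * R⁻¹ ^ k * 2 ^ M) (by positivity)
    (fun j ξ hξ ↦ hS.norm_absSym_le ht ht1 k j hξ) (Q := R⁻¹ ^ l * Q) (by positivity) (hQd l)
  refine ⟨h1, h2.trans (le_of_eq (by ring)), h3, h4.trans ?_⟩
  calc 2 * (K * κ ^ i * (C * R⁻¹ ^ k * 2 ^ M) * (2 ^ (M + 1) * (R⁻¹ ^ l * Q)))
      ≤ 11 * (K * κ ^ i * (C * R⁻¹ ^ k * 2 ^ M) * (2 ^ (M + 1) * (R⁻¹ ^ l * Q))) := by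
        gcongr; norm_num
    _ = _ := by ring

theorem scQuantIntegrand_eq (p : ℝ → ℝ → ℂ) (t : ℝ) (f : ℝ → ℂ) (x ξ : ℝ) :
    scQuantIntegrand p t f x ξ = modE x ξ * (p x (t * ξ) * 𝓕 f ξ) := by
  rw [scQuantIntegrand, modE, mul_assoc]

theorem SpeedExpansion.hasSum_symbolP (hS : SpeedExpansion c M z₀ ρ κ R α β C K a b) (ht : 0 < t)
    (x ξ : ℝ) :
    HasSum (fun k ↦ deviation c z₀ x ^ k * absSym a t k ξ) (symbolP c x (t * ξ)) := by
  have h := hS.symb.sum_a (c x) (t * |ξ|) ((hS.abs_le x).trans_lt (hS.ρ_lt.trans hS.κ_lt))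
    (by positivity)
  rw [symbolP, abs_mul, abs_of_pos ht]
  exact h

theorem SpeedExpansion.hasSum_symbolPInv (hS : SpeedExpansion c M z₀ ρ κ R α β C K a b) (ht : 0 < t)
    (x ξ : ℝ) :
    HasSum (fun l ↦ deviation c z₀ x ^ l * absSym b t l ξ) (symbolPInv c x (t * ξ)) := by
  have h := hS.symb.sum_b (c x) (t * |ξ|) ((hS.abs_le x).trans_lt (hS.ρ_lt.trans hS.κ_lt))
    (by positivity)
  rw [symbolPInv, symbolP, abs_mul, abs_of_pos ht]
  exact h

theorem memLp_two_of_hasSum {ι : Type*} [Countable ι] {f : ι → ℝ → ℂ} {B : ι → ℝ}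
    (hf : ∀ i, AEStronglyMeasurable (f i) volume) (hB0 : ∀ i, 0 ≤ B i)
    (hB : ∀ i, eLpNorm (f i) 2 ≤ ENNReal.ofReal (B i)) (hs : Summable B) {g : ℝ → ℂ}
    (hg : ∀ᵐ x, HasSum (fun i ↦ f i x) (g x)) : MemLp g 2 := by
  have hm : ∀ i, MemLp (f i) 2 := fun i ↦ ⟨hf i, (hB i).trans_lt ENNReal.ofReal_lt_top⟩
  have hL : ∑' i, ‖(hm i).toLp _‖ₑ ≠ ⊤ := summable_enorm_ne_top hs fun i ↦ by
    rw [Lp.norm_toLp]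
    exact ENNReal.toReal_le_of_le_ofReal (hB0 i) (hB i)
  refine (memLp_congr_ae ?_).1 (Lp.memLp (∑' i, (hm i).toLp _))
  filter_upwards [Lp.coeFn_tsum hL, hg, ae_all_iff.2 fun i ↦ (hm i).coeFn_toLp] with x h1 h2 h3
  rw [h1, ← h2.tsum_eq]
  exact tsum_congr h3

/-- Discrete product rule: the symbol is bounded and Lipschitz, and the transform of a Schwartz
function is Lipschitz under shifts in `L²`. -/
theorem SpeedExpansion.eLpNorm_shift_le (hS : SpeedExpansion c M z₀ ρ κ R α β C K a b)
    (ht : 0 < t) (ht1 : t ≤ 1) (f : 𝓢(ℝ, ℂ)) : ∃ L : ℝ, 0 ≤ L ∧ ∀ l, ∀ h : ℝ, 0 < h → h ≤ 1 →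
      eLpNorm (fun ξ ↦ absSym b t l (ξ - h) * 𝓕 (f : ℝ → ℂ) (ξ - h) -
        absSym b t l ξ * 𝓕 (f : ℝ → ℂ) ξ) 2 ≤ ENNReal.ofReal (R⁻¹ ^ l * L * h) := by
  have hR := hS.R_pos
  have hC := hS.symb.pos
  obtain ⟨L, hL0, hL⟩ := exists_eLpNorm_fourier_shift_le f
  have hFm : MemLp (𝓕 (f : ℝ → ℂ)) 2 := by
    rw [← SchwartzMap.fourier_coe]; exact (𝓕 f).memLp 2 volume
  have hFc : Continuous (𝓕 (f : ℝ → ℂ)) := by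
    rw [← SchwartzMap.fourier_coe]; exact (𝓕 f).continuous
  set N : ℝ := (eLpNorm (𝓕 (f : ℝ → ℂ)) 2 volume).toReal with hN
  have hN' : eLpNorm (𝓕 (f : ℝ → ℂ)) 2 volume = ENNReal.ofReal N :=
    (ENNReal.ofReal_toReal hFm.2.ne).symm
  refine ⟨C * (L + N), by positivity, fun l h hh hh1 ↦ ?_⟩
  have hbc := hS.continuous_absSym_inv ht ht1 l
  have hs : Continuous fun ξ : ℝ ↦ ξ - h := by fun_prop
  have e : (fun ξ ↦ absSym b t l (ξ - h) * 𝓕 (f : ℝ → ℂ) (ξ - h) -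
        absSym b t l ξ * 𝓕 (f : ℝ → ℂ) ξ) =
      (fun ξ ↦ absSym b t l (ξ - h) * (𝓕 (f : ℝ → ℂ) (ξ - h) - 𝓕 (f : ℝ → ℂ) ξ)) +
      fun ξ ↦ (absSym b t l (ξ - h) - absSym b t l ξ) * 𝓕 (f : ℝ → ℂ) ξ := by
    funext ξ
    simp only [Pi.add_apply]
    ring
  rw [e]
  refine (eLpNorm_add_le
    ((hbc.comp hs).mul ((hFc.comp hs).sub hFc)).aestronglyMeasurable
    (((hbc.comp hs).sub hbc).mul hFc).aestronglyMeasurable (by norm_num)).trans ?_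
  have h1 : eLpNorm (fun ξ ↦ absSym b t l (ξ - h) *
      (𝓕 (f : ℝ → ℂ) (ξ - h) - 𝓕 (f : ℝ → ℂ) ξ)) 2 ≤
      ENNReal.ofReal (C * R⁻¹ ^ l) * ENNReal.ofReal (L * h) := by
    refine (eLpNorm_le_mul_eLpNorm_of_ae_le_mul (c := C * R⁻¹ ^ l)
      (g := fun ξ ↦ 𝓕 (f : ℝ → ℂ) (ξ - h) - 𝓕 (f : ℝ → ℂ) ξ)
      (Filter.Eventually.of_forall fun ξ ↦ ?_) 2).trans (mul_le_mul_right (hL h hh.le) _)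
    rw [norm_mul]
    gcongr
    exact hS.norm_absSym_inv_le ht l _
  have h2 : eLpNorm (fun ξ ↦ (absSym b t l (ξ - h) - absSym b t l ξ) * 𝓕 (f : ℝ → ℂ) ξ) 2 ≤
      ENNReal.ofReal (C * R⁻¹ ^ l * h) * ENNReal.ofReal N := by
    rw [← hN']
    refine eLpNorm_le_mul_eLpNorm_of_ae_le_mul (Filter.Eventually.of_forall fun ξ ↦ ?_) 2
    rw [norm_mul]
    gcongr
    refine (hS.norm_absSym_inv_sub_le ht ht1 l _ _).trans (le_of_eq ?_)
    rw [sub_sub_cancel_left, abs_neg, abs_of_pos hh]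
  refine (add_le_add h1 h2).trans ?_
  rw [← ENNReal.ofReal_mul (by positivity), ← ENNReal.ofReal_mul (by positivity),
    ← ENNReal.ofReal_add (by positivity) (by positivity)]
  exact ENNReal.ofReal_le_ofReal (le_of_eq (by ring))

/-- The function `g = p⁻¹(x, tD) f` has to be integrable before `p(x, tD)` can be applied to it. The
expansion gives `g` in `L²`, and the Lipschitz bound on the `b_l` gives `x g` in `L²`; together
these give integrability. Then the Fourier integral of `g` agrees almost everywhere with the series
on the frequency side. -/
theorem SpeedExpansion.scQuant_symbolPInv (hS : SpeedExpansion c M z₀ ρ κ R α β C K a b)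
    (ht : 0 < t) (ht1 : t ≤ 1) (f : 𝓢(ℝ, ℂ)) :
    ScQuantConverges (symbolPInv c) t f ∧ Integrable (scQuant (symbolPInv c) t f) ∧
      ∀ᵐ ξ, HasSum (fun l ↦ ((conjF (deviation c z₀) ^ l) (symFhat b t f l) : ℝ → ℂ) ξ)
        (𝓕 (scQuant (symbolPInv c) t f) ξ) := by
  have hR := hS.R_pos
  have hC := hS.symb.pos
  have hρ := hS.ρ_nonneg
  set u := deviation c z₀ with hu
  set g := scQuant (symbolPInv c) t f with hg
  set H : ℕ → ℝ → ℂ := fun l ξ ↦ absSym b t l ξ * 𝓕 (f : ℝ → ℂ) ξ with hH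
  have hFi : Integrable (𝓕 (f : ℝ → ℂ)) := by
    rw [← SchwartzMap.fourier_coe]; exact (𝓕 f).integrable
  have h1 : ∀ l, Integrable (H l) := fun l ↦
    hFi.bdd_mul (hS.continuous_absSym_inv ht ht1 l).aestronglyMeasurable
      (Filter.Eventually.of_forall (hS.norm_absSym_inv_le ht l))
  have h2 : ∀ l, MemLp (H l) 2 := fun l ↦
    (memLp_congr_ae (hS.coeFn_symFhat ht ht1 f l)).1 (Lp.memLp _)
  have hG : ∀ l, (h2 l).toLp _ = symFhat b t f l := fun l ↦
    Lp.ext ((h2 l).coeFn_toLp.trans (hS.coeFn_symFhat ht ht1 f l).symm)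
  have hgeo : Summable fun l : ℕ ↦ ρ ^ l * R⁻¹ ^ l := by
    simp_rw [← mul_pow]
    refine summable_geometric_of_lt_one (by positivity) ?_
    rw [← div_eq_mul_inv, div_lt_one hR]
    exact hS.ρ_lt.trans hS.κ_lt
  have s1 : Summable fun l ↦ ρ ^ l * ∫ ξ, ‖H l ξ‖ := by
    refine (hgeo.mul_right (C * ∫ ξ, ‖𝓕 (f : ℝ → ℂ) ξ‖)).of_nonneg_of_le
      (fun l ↦ mul_nonneg (by positivity) (integral_nonneg fun _ ↦ norm_nonneg _)) fun l ↦ ?_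
    have : ∫ ξ, ‖H l ξ‖ ≤ C * R⁻¹ ^ l * ∫ ξ, ‖𝓕 (f : ℝ → ℂ) ξ‖ := by
      rw [← integral_const_mul]
      refine integral_mono (h1 l).norm (hFi.norm.const_mul _) fun ξ ↦ ?_
      simp only [hH, norm_mul]
      gcongr
      exact hS.norm_absSym_inv_le ht l ξ
    calc ρ ^ l * ∫ ξ, ‖H l ξ‖ ≤ ρ ^ l * (C * R⁻¹ ^ l * ∫ ξ, ‖𝓕 (f : ℝ → ℂ) ξ‖) := by gcongr
      _ = _ := by ring
  have s2 : Summable fun l ↦ ρ ^ l * ‖(h2 l).toLp _‖ := by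
    refine (hgeo.mul_right (C * ‖fhat f‖)).of_nonneg_of_le (fun l ↦ by positivity) fun l ↦ ?_
    rw [hG]
    calc ρ ^ l * ‖symFhat b t f l‖ ≤ ρ ^ l * (C * R⁻¹ ^ l * ‖fhat f‖) := by
          gcongr; exact hS.norm_symFhat_le ht f l
      _ = _ := by ring
  have hpt : ∀ x, Integrable (scQuantIntegrand (symbolPInv c) t f x) ∧
      HasSum (fun l ↦ u x ^ l * 𝓕⁻ (H l) x) (g x) := by
    intro x
    have e : scQuantIntegrand (symbolPInv c) t f x =
        fun ξ ↦ modE x ξ * (symbolPInv c x (t * ξ) * 𝓕 (f : ℝ → ℂ) ξ) := by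
      funext ξ; exact scQuantIntegrand_eq _ _ _ _ _
    rw [hg, scQuant, e]
    refine integrable_and_hasSum_fourierInv (fun l ↦ hS.norm_deviation_pow_le l x) h1 s1
      (Filter.Eventually.of_forall fun ξ ↦ ?_)
    have := (hS.hasSum_symbolPInv ht x ξ).mul_right (𝓕 (f : ℝ → ℂ) ξ)
    simpa only [hH, mul_assoc] using this
  obtain ⟨-, hae⟩ := fourierInv_tsum_conjF_ae (w := fun l x ↦ u x ^ l) (fun l ↦ hS.bdd.pow l)
    (fun l ↦ pow_nonneg hρ l) (fun l x ↦ hS.norm_deviation_pow_le l x) h1 h2 s2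
  set Γ : L2 := ∑' l, conjF (fun x ↦ u x ^ l) ((h2 l).toLp _) with hΓ
  have hgΓ : g =ᵐ[volume] ((𝓕⁻ Γ : L2) : ℝ → ℂ) := by
    filter_upwards [hae] with x hx
    exact (hpt x).2.unique hx
  have hg2 : MemLp g 2 := (memLp_congr_ae hgΓ).2 (Lp.memLp _)
  obtain ⟨L, hL0, hL⟩ := hS.eLpNorm_shift_le ht ht1 f
  -- The moment is estimated term by term: the powers of the deviation are bounded by `ρ ^ l` and
  -- commute with multiplication by `x`, so only the moments of the inverse transforms of the terms
  -- matter.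
  have hxg : MemLp (fun x ↦ (2 * Real.pi * Complex.I * x) * g x) 2 := by
    have hm : ∀ l, AEStronglyMeasurable (fun x ↦ (2 * Real.pi * Complex.I * x) * 𝓕⁻ (H l) x)
        volume := fun l ↦
      (by fun_prop : Continuous fun x : ℝ ↦ (2 * Real.pi * Complex.I * x : ℂ)).aestronglyMeasurable.mul
        ((Lp.aestronglyMeasurable (𝓕⁻ ((h2 l).toLp _) : L2)).congr (fourierInv_toLp (h1 l) (h2 l)))
    refine memLp_two_of_hasSum (ι := ℕ)
      (f := fun l x ↦ u x ^ l * ((2 * Real.pi * Complex.I * x) * 𝓕⁻ (H l) x))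
      (B := fun l ↦ ρ ^ l * R⁻¹ ^ l * L) (fun l ↦ (hS.bdd.pow l).1.mul (hm l))
      (fun l ↦ by positivity) (fun l ↦ ?_) (hgeo.mul_right L)
      (Filter.Eventually.of_forall fun x ↦ ?_)
    · refine (eLpNorm_le_mul_eLpNorm_of_ae_le_mul (c := ρ ^ l)
        (g := fun x ↦ (2 * Real.pi * Complex.I * x) * 𝓕⁻ (H l) x)
        (Filter.Eventually.of_forall fun x ↦ ?_) 2).trans ?_
      · rw [norm_mul]
        gcongr
        exact hS.norm_deviation_pow_le l x
      · rw [mul_assoc (ρ ^ l), ENNReal.ofReal_mul (by positivity)]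
        exact mul_le_mul_right (eLpNorm_id_mul_fourierInv_le (h1 l) (h2 l) (hL l)) _
    · have := (hpt x).2.mul_left (2 * Real.pi * Complex.I * x : ℂ)
      refine this.congr_fun fun l ↦ ?_
      ring
  have hgi : Integrable g := integrable_of_memLp_two_id_mul hg2 hxg
  refine ⟨⟨f.integrable, fun x ↦ (hpt x).1⟩, hgi, ?_⟩
  have hgL : hg2.toLp g = (𝓕⁻ Γ : L2) := Lp.ext (hg2.coeFn_toLp.trans hgΓ)
  have hΓg : (Γ : ℝ → ℂ) =ᵐ[volume] 𝓕 g := by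
    have := fourier_toLp hgi hg2
    rwa [hgL, fourier_fourierInv_eq] at this
  have hsum : ∑' l, ‖conjF (fun x ↦ u x ^ l) ((h2 l).toLp _)‖ₑ ≠ ⊤ :=
    summable_enorm_ne_top s2 fun l ↦ (conjF _).le_of_opNorm_le
      (norm_conjF_le (pow_nonneg hρ l) (Filter.Eventually.of_forall (hS.norm_deviation_pow_le l))) _
  filter_upwards [Lp.hasSum_coeFn_tsum hsum, hΓg] with ξ x1 x2
  rw [← x2]
  have hT : ∀ l, conjF (fun x ↦ u x ^ l) ((h2 l).toLp _) = (conjF u ^ l) (symFhat b t f l) :=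
    fun l ↦ by rw [hG, conjF_pow hS.bdd]
  have x3 : HasSum (fun l ↦ (conjF (fun x ↦ u x ^ l) ((h2 l).toLp _) : ℝ → ℂ) ξ)
    ((Γ : ℝ → ℂ) ξ) := x1
  simpa only [hT] using x3

end

/-! ### The remainder as a double series of commutators. -/

section

open scoped ENNReal

/-! ### The composition remainder -/

variable {c : ℝ → ℝ} {M : ℕ} {z₀ ρ κ R α β C K t : ℝ} {a b : ℕ → ℂ → ℂ}

theorem SpeedExpansion.norm_shellP_symFhat_le (hS : SpeedExpansion c M z₀ ρ κ R α β C K a b)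
    (ht : 0 < t) (ht1 : t ≤ 1) (f : 𝓢(ℝ, ℂ)) (l j : ℕ) :
    ‖shellP j (symFhat b t f l)‖ ≤
      C * R⁻¹ ^ l * 2 ^ β * theta t j ^ (-β) * ‖shellP j (fhat f)‖ := by
  have hR := hS.R_pos
  have hC := hS.symb.pos
  refine norm_le_of_ae_le ?_
  filter_upwards [coeFn_mulL (bdd_cut_one (measurableSet_shell j)) (symFhat b t f l),
    coeFn_mulL (bdd_cut_one (measurableSet_shell j)) (fhat f),
    coeFn_mulL (hS.bdd_absSym_inv ht ht1 l) (fhat f)] with ξ h1 h2 h3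
  rw [shellP, proj, h1, h2, symFhat, h3]
  by_cases hξ : ξ ∈ shell j
  · simp only [cut, Set.indicator_of_mem hξ, one_mul, norm_mul]
    gcongr
    refine (hS.symb.bound_b l _ (by positivity)).trans ?_
    rw [mul_assoc (C * R⁻¹ ^ l)]
    refine mul_le_mul_of_nonneg_left ?_ (by positivity)
    have h4 : theta t j ≤ 2 * (1 + t * |ξ|) := by
      rw [theta]
      rcases hξ.2 with rfl | h
      · have : 0 ≤ t * |ξ| := by positivity
        rw [pow_zero]; linarith
      · have := mul_le_mul_of_nonneg_left h ht.le
        linarith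
    have h5 : 0 < 1 + t * |ξ| := by positivity
    have h6 := theta_pos ht j
    have h7 : theta t j ^ β ≤ 2 ^ β * (1 + t * |ξ|) ^ β := by
      rw [← Real.mul_rpow (by norm_num) h5.le]
      exact Real.rpow_le_rpow h6.le h4 hS.β_nonneg
    rw [Real.rpow_neg h5.le, Real.rpow_neg h6.le, ← div_eq_mul_inv,
      le_div_iff₀ (Real.rpow_pos_of_pos h6 _), inv_mul_le_iff₀ (Real.rpow_pos_of_pos h5 _), mul_comm]
    exact h7
  · simp [cut, hξ]

/-- The constant in the bound for the composition remainder. -/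
def remainderConst (M : ℕ) (κ R α β C K : ℝ) : ℝ :=
  5 ^ M * (4 ^ M * 8) * K * (commConst M α (min (1 - α + β) 1) * (C * 2 ^ β * K * C)) *
    ((1 - κ * R⁻¹)⁻¹ * (1 - κ * R⁻¹)⁻¹)

/-- The commutator contributes `κ ^ l R⁻¹ ^ k R⁻¹ ^ l`, including the inner symbol, and the outer
power contributes `κ ^ k`. The result is geometric in both indices. -/
theorem SpeedExpansion.norm_scWeight_term_le (hS : SpeedExpansion c M z₀ ρ κ R α β C K a b)
    (ht : 0 < t) (ht1 : t ≤ 1) (f : 𝓢(ℝ, ℂ)) {m : ℝ} (hm : 0 ≤ m) (hmM : m ≤ M) (k l : ℕ) {X Y : L2}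
    (hX : (X : ℝ → ℂ) =ᵐ[volume] fun ξ ↦ absSym a t k ξ *
      ((conjF (deviation c z₀) ^ l) (symFhat b t f l) : ℝ → ℂ) ξ)
    (hY : (Y : ℝ → ℂ) =ᵐ[volume] fun ξ ↦ absSym a t k ξ * (symFhat b t f l : ℝ → ℂ) ξ) :
    ‖mulL (scWeight t (-m)) ((conjF (deviation c z₀) ^ k) (X - (conjF (deviation c z₀) ^ l) Y))‖ ≤
      5 ^ M * (4 ^ M * 8) * K * (commConst M α (min (1 - α + β) 1) * (C * 2 ^ β * K * C)) *
        t * ‖mulL (scWeight t (-m)) (fhat f)‖ * ((κ * R⁻¹) ^ k * (κ * R⁻¹) ^ l) := by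
  have hR := hS.R_pos
  have hC := hS.symb.pos
  have hκ := hS.κ_pos
  have hK := hS.K_pos
  refine (norm_scWeight_map_le (hS.reg k) (by positivity) ht ht1 hS.one_le_M hm hmM _).trans ?_
  have h := norm_scWeight_comm_le (hS.reg l) (by positivity) ht ht1 hm hmM
    (Ka := C * R⁻¹ ^ k) (Kb := C * R⁻¹ ^ l * 2 ^ β) (by positivity) (by positivity) hS.one_le_α
    hS.α_le (lt_min hS.gap one_pos) (min_le_right _ _) (min_le_left _ _) (hS.symb.diff_a k)
    (hS.symb.sub_a k) (hS.measurable_absSym ht k) (hS.norm_shellP_symFhat_le ht ht1 f l) hX hY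
  calc 5 ^ M * (4 ^ M * 8) * (K * κ ^ k) *
        ‖mulL (scWeight t (-m)) (X - (conjF (deviation c z₀) ^ l) Y)‖
      ≤ 5 ^ M * (4 ^ M * 8) * (K * κ ^ k) * (commConst M α (min (1 - α + β) 1) *
        (C * R⁻¹ ^ l * 2 ^ β * (K * κ ^ l) * (C * R⁻¹ ^ k)) * t *
          ‖mulL (scWeight t (-m)) (fhat f)‖) := by gcongr
    _ = _ := by rw [mul_pow, mul_pow]; ring

theorem hasSum_mul_prod {f g : ℕ → ℂ} {r s : ℂ} (hf : HasSum f r) (hg : HasSum g s) :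
    HasSum (fun q : ℕ × ℕ ↦ f q.1 * g q.2) (r * s) :=
  HasSum.mul hf hg (summable_mul_of_summable_norm hf.summable.norm hg.summable.norm)

theorem SpeedExpansion.hasSum_scQuant_symbolP (hS : SpeedExpansion c M z₀ ρ κ R α β C K a b)
    (ht : 0 < t) {f : ℝ → ℂ} {G : ℕ → ℝ → ℂ} (hG : ∀ᵐ ξ, HasSum (fun l ↦ G l ξ) (𝓕 f ξ))
    (h1 : ∀ q : ℕ × ℕ, Integrable (fun ξ ↦ absSym a t q.1 ξ * G q.2 ξ))
    (hs : Summable fun q : ℕ × ℕ ↦ ρ ^ q.1 * ∫ ξ, ‖absSym a t q.1 ξ * G q.2 ξ‖) (x : ℝ) :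
    Integrable (scQuantIntegrand (symbolP c) t f x) ∧
      HasSum (fun q : ℕ × ℕ ↦ deviation c z₀ x ^ q.1 *
        𝓕⁻ (fun ξ ↦ absSym a t q.1 ξ * G q.2 ξ) x) (scQuant (symbolP c) t f x) := by
  have e : scQuantIntegrand (symbolP c) t f x =
      fun ξ ↦ modE x ξ * (symbolP c x (t * ξ) * 𝓕 f ξ) := by
    funext ξ; exact scQuantIntegrand_eq _ _ _ _ _
  rw [scQuant, e]
  refine integrable_and_hasSum_fourierInv (w := fun q : ℕ × ℕ ↦ deviation c z₀ x ^ q.1)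
    (H := fun q ξ ↦ absSym a t q.1 ξ * G q.2 ξ) (fun q ↦ hS.norm_deviation_pow_le q.1 x) h1 hs ?_
  filter_upwards [hG] with ξ hξ
  have h := hasSum_mul_prod (hS.hasSum_symbolP ht x ξ) hξ
  have e2 : (fun q : ℕ × ℕ ↦ deviation c z₀ x ^ q.1 * absSym a t q.1 ξ * G q.2 ξ) =
      fun q ↦ deviation c z₀ x ^ q.1 * (absSym a t q.1 ξ * G q.2 ξ) := by
    funext q; ring
  rwa [e2] at h

theorem SpeedExpansion.norm_deviation_pow_mul_le (hS : SpeedExpansion c M z₀ ρ κ R α β C K a b)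
    (q : ℕ × ℕ) (x : ℝ) :
    ‖deviation c z₀ x ^ q.1 * deviation c z₀ x ^ q.2‖ ≤ ρ ^ q.1 * ρ ^ q.2 := by
  rw [norm_mul]
  exact mul_le_mul (hS.norm_deviation_pow_le _ x) (hS.norm_deviation_pow_le _ x)
    (norm_nonneg _) (pow_nonneg hS.ρ_nonneg _)

theorem SpeedExpansion.hasSum_scQuant_mul (hS : SpeedExpansion c M z₀ ρ κ R α β C K a b)
    (ht : 0 < t) {f : ℝ → ℂ} {G : ℕ → ℝ → ℂ} (hG : ∀ᵐ ξ, ∀ l, G l ξ = absSym b t l ξ * 𝓕 f ξ)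
    (h1 : ∀ q : ℕ × ℕ, Integrable (fun ξ ↦ absSym a t q.1 ξ * G q.2 ξ))
    (hs : Summable fun q : ℕ × ℕ ↦ ρ ^ q.1 * ρ ^ q.2 * ∫ ξ, ‖absSym a t q.1 ξ * G q.2 ξ‖) (x : ℝ) :
    HasSum (fun q : ℕ × ℕ ↦ deviation c z₀ x ^ q.1 * deviation c z₀ x ^ q.2 *
        𝓕⁻ (fun ξ ↦ absSym a t q.1 ξ * G q.2 ξ) x)
      (scQuant (fun y ξ ↦ symbolP c y ξ * symbolPInv c y ξ) t f x) := by
  have e : scQuantIntegrand (fun y ξ ↦ symbolP c y ξ * symbolPInv c y ξ) t f x =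
      fun ξ ↦ modE x ξ * (symbolP c x (t * ξ) * symbolPInv c x (t * ξ) * 𝓕 f ξ) := by
    funext ξ; exact scQuantIntegrand_eq _ _ _ _ _
  rw [scQuant, e]
  refine (integrable_and_hasSum_fourierInv (fun q ↦ hS.norm_deviation_pow_mul_le q x) h1 hs ?_).2
  filter_upwards [hG] with ξ hξ
  have hp := hS.hasSum_symbolP ht x ξ
  have hq := hS.hasSum_symbolPInv ht x ξ
  have h := (hasSum_mul_prod hp hq).mul_right (𝓕 f ξ)
  have e2 : (fun q : ℕ × ℕ ↦ deviation c z₀ x ^ q.1 * absSym a t q.1 ξ *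
      (deviation c z₀ x ^ q.2 * absSym b t q.2 ξ) * 𝓕 f ξ) =
      fun q ↦ deviation c z₀ x ^ q.1 * deviation c z₀ x ^ q.2 *
        (absSym a t q.1 ξ * G q.2 ξ) := by
    funext q; rw [hξ]; ring
  rwa [e2] at h

/-- Both terms of the remainder are expanded as double series, pointwise in `x` and in `L²`. Their
difference is summed term by term on the frequency side, where each term is a power of `T` applied
to a commutator. The function `V` does not depend on `m`, so one representation serves all the
weighted norms. -/
theorem SpeedExpansion.compRemainder_ae (hS : SpeedExpansion c M z₀ ρ κ R α β C K a b)
    (ht : 0 < t) (ht1 : t ≤ 1) (f : 𝓢(ℝ, ℂ)) :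
    ScQuantConverges (symbolP c) t (scQuant (symbolPInv c) t f) ∧
      ∃ V : L2, compRemainder t (symbolP c) (symbolPInv c) f =ᵐ[volume] ((𝓕⁻ V : L2) : ℝ → ℂ) ∧
        ∀ m : ℝ, 0 ≤ m → m ≤ M → ‖mulL (scWeight t (-m)) V‖ ≤
          t * remainderConst M κ R α β C K * ‖mulL (scWeight t (-m)) (fhat f)‖ := by
  have hR := hS.R_pos
  have hκ := hS.κ_pos
  have hρ := hS.ρ_nonneg
  set u := deviation c z₀ with hu
  set g := scQuant (symbolPInv c) t f with hg
  obtain ⟨-, hgi, hgsum⟩ := hS.scQuant_symbolPInv ht ht1 f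
  obtain ⟨A, hA, hb⟩ := hS.exists_symbol_map_bounds ht ht1 f
  have hρR : ρ * R⁻¹ < 1 := by
    rw [← div_eq_mul_inv, div_lt_one hR]; exact hS.ρ_lt.trans hS.κ_lt
  have hκR : κ * R⁻¹ < 1 := by
    rw [← div_eq_mul_inv, div_lt_one hR]; exact hS.κ_lt
  have gρ : Summable fun k : ℕ ↦ (ρ * R⁻¹) ^ k := summable_geometric_of_lt_one (by positivity) hρR
  have gκ : HasSum (fun k : ℕ ↦ (κ * R⁻¹) ^ k) (1 - κ * R⁻¹)⁻¹ :=
    hasSum_geometric_of_lt_one (by positivity) hκR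
  -- The index `i` counts the powers of the multiplication applied before the symbol `a_k`: `i = l`
  -- for the composition, where the power stands inside, and `i = 0` for the quantized product,
  -- where it stands outside.
  set H : ℕ → ℕ × ℕ → ℝ → ℂ := fun i q ξ ↦
    absSym a t q.1 ξ * ((conjF u ^ i) (symFhat b t f q.2) : ℝ → ℂ) ξ with hH
  set X : ℕ × ℕ → ℝ → ℂ := fun q ↦ H q.2 q with hX
  set Y : ℕ × ℕ → ℝ → ℂ := fun q ↦ H 0 q with hY
  have h1 : ∀ i q, Integrable (H i q) := fun i q ↦ (hb q.1 i q.2).1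
  have h2 : ∀ i q, MemLp (H i q) 2 := fun i q ↦ (hb q.1 i q.2).2.2.1
  have hn1 : ∀ i q, ∫ ξ, ‖H i q ξ‖ ≤ A * (R⁻¹ ^ q.1 * (κ ^ i * R⁻¹ ^ q.2)) :=
    fun i q ↦ (hb q.1 i q.2).2.1
  have hn2 : ∀ i q, ‖(h2 i q).toLp _‖ ≤ A * (R⁻¹ ^ q.1 * (κ ^ i * R⁻¹ ^ q.2)) :=
    fun i q ↦ (hb q.1 i q.2).2.2.2
  have sX : Summable fun q : ℕ × ℕ ↦ ρ ^ q.1 * (A * (R⁻¹ ^ q.1 * (κ ^ q.2 * R⁻¹ ^ q.2))) := by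
    refine ((gρ.mul_of_nonneg gκ.summable (fun k ↦ by positivity) fun k ↦ by positivity).mul_left
      A).congr fun q ↦ ?_
    rw [mul_pow, mul_pow]; ring
  have sY : Summable fun q : ℕ × ℕ ↦ ρ ^ q.1 * ρ ^ q.2 * (A * (R⁻¹ ^ q.1 * (κ ^ 0 * R⁻¹ ^ q.2))) := by
    refine ((gρ.mul_of_nonneg gρ (fun k ↦ by positivity) fun k ↦ by positivity).mul_left
      A).congr fun q ↦ ?_
    rw [mul_pow, mul_pow]; ring
  have sX1 : Summable fun q : ℕ × ℕ ↦ ρ ^ q.1 * ∫ ξ, ‖X q ξ‖ :=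
    sX.of_nonneg_of_le
      (fun q ↦ mul_nonneg (by positivity) (integral_nonneg fun _ ↦ norm_nonneg _))
      fun q ↦ mul_le_mul_of_nonneg_left (hn1 q.2 q) (by positivity)
  have sX2 : Summable fun q : ℕ × ℕ ↦ ρ ^ q.1 * ‖(h2 q.2 q).toLp (X q)‖ :=
    sX.of_nonneg_of_le (fun q ↦ by positivity)
      fun q ↦ mul_le_mul_of_nonneg_left (hn2 q.2 q) (by positivity)
  have sY1 : Summable fun q : ℕ × ℕ ↦ ρ ^ q.1 * ρ ^ q.2 * ∫ ξ, ‖Y q ξ‖ :=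
    sY.of_nonneg_of_le
      (fun q ↦ mul_nonneg (by positivity) (integral_nonneg fun _ ↦ norm_nonneg _))
      fun q ↦ mul_le_mul_of_nonneg_left (hn1 0 q) (by positivity)
  have sY2 : Summable fun q : ℕ × ℕ ↦ ρ ^ q.1 * ρ ^ q.2 * ‖(h2 0 q).toLp (Y q)‖ :=
    sY.of_nonneg_of_le (fun q ↦ by positivity)
      fun q ↦ mul_le_mul_of_nonneg_left (hn2 0 q) (by positivity)
  have hwX : ∀ (q : ℕ × ℕ) x, ‖u x ^ q.1‖ ≤ ρ ^ q.1 := fun q x ↦ hS.norm_deviation_pow_le _ x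
  have hptX := hS.hasSum_scQuant_symbolP ht hgsum (fun q ↦ h1 q.2 q) sX1
  have hone : ∀ l, (conjF u ^ 0) (symFhat b t f l) = symFhat b t f l := fun l ↦ by
    rw [pow_zero, one_apply_eq_self]
  have hGY : ∀ᵐ ξ, ∀ l, ((conjF u ^ 0) (symFhat b t f l) : ℝ → ℂ) ξ =
      absSym b t l ξ * 𝓕 (f : ℝ → ℂ) ξ := by
    simp only [hone]
    exact ae_all_iff.2 fun l ↦ hS.coeFn_symFhat ht ht1 f l
  have hptY := hS.hasSum_scQuant_mul ht hGY (h1 0) sY1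
  obtain ⟨sumX, aeX⟩ := fourierInv_tsum_conjF_ae (w := fun q : ℕ × ℕ ↦ fun x ↦ u x ^ q.1)
    (fun q ↦ hS.bdd.pow _) (fun q ↦ by positivity) hwX (fun q ↦ h1 q.2 q) (fun q ↦ h2 q.2 q) sX2
  obtain ⟨sumY, aeY⟩ := fourierInv_tsum_conjF_ae
    (w := fun q : ℕ × ℕ ↦ fun x ↦ u x ^ q.1 * u x ^ q.2)
    (fun q ↦ (hS.bdd.pow _).mul (hS.bdd.pow _)) (fun q ↦ by positivity) hS.norm_deviation_pow_mul_le (fun q ↦ h1 0 q)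
    (fun q ↦ h2 0 q) sY2
  refine ⟨⟨hgi, fun x ↦ (hptX x).1⟩,
    (∑' q : ℕ × ℕ, conjF (fun x ↦ u x ^ q.1) ((h2 q.2 q).toLp (X q))) -
      ∑' q : ℕ × ℕ, conjF (fun x ↦ u x ^ q.1 * u x ^ q.2) ((h2 0 q).toLp (Y q)), ?_,
    fun m hm hmM ↦ ?_⟩
  · have e : ∀ Z W : L2, (𝓕⁻ (Z - W) : L2) = (𝓕⁻ Z : L2) - (𝓕⁻ W : L2) := fun Z W ↦
      map_sub (Lp.fourierTransformₗᵢ ℝ ℂ : L2 ≃ₗᵢ[ℂ] L2).symm Z W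
    rw [e]
    filter_upwards [aeX, aeY, Lp.coeFn_sub
      (𝓕⁻ (∑' q : ℕ × ℕ, conjF (fun x ↦ u x ^ q.1) ((h2 q.2 q).toLp (X q))) : L2)
      (𝓕⁻ (∑' q : ℕ × ℕ, conjF (fun x ↦ u x ^ q.1 * u x ^ q.2) ((h2 0 q).toLp (Y q))) : L2)]
      with x x1 x2 x3
    rw [x3, Pi.sub_apply, compRemainder, (hptX x).2.unique x1, (hptY x).unique x2]
  · rw [← sumX.tsum_sub sumY, (mulL (scWeight t (-m))).map_tsum (sumX.sub sumY)]
    have hg2 : HasSum (fun q : ℕ × ℕ ↦ (κ * R⁻¹) ^ q.1 * (κ * R⁻¹) ^ q.2)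
        ((1 - κ * R⁻¹)⁻¹ * (1 - κ * R⁻¹)⁻¹) :=
      gκ.mul gκ (gκ.summable.mul_of_nonneg gκ.summable (fun k ↦ by positivity)
        fun k ↦ by positivity)
    refine (tsum_of_norm_bounded (hg2.mul_left (5 ^ M * (4 ^ M * 8) * K *
      (commConst M α (min (1 - α + β) 1) * (C * 2 ^ β * K * C)) *
        t * ‖mulL (scWeight t (-m)) (fhat f)‖)) fun q ↦ ?_).trans (le_of_eq ?_)
    · have h := hS.norm_scWeight_term_le ht ht1 f hm hmM q.1 q.2 (X := (h2 q.2 q).toLp (X q))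
        (Y := (h2 0 q).toLp (Y q)) (h2 q.2 q).coeFn_toLp (by
          refine (h2 0 q).coeFn_toLp.trans (Filter.EventuallyEq.of_eq ?_)
          simp only [hH, hone])
      rw [conjF_mul (hS.bdd.pow _) (hS.bdd.pow _), conjF_pow hS.bdd, conjF_pow hS.bdd,
        mul_apply_eq_comp, ← map_sub]
      exact h
    · rw [remainderConst]; ring

end

/-! ### Completeness and density in `H^{-m}_t`, and extension by continuity. -/

section

open scoped ENNReal

/-! ### The semiclassical Sobolev spaces of negative order -/

theorem _root_.IsRepresentedBy.congr_ae {u : 𝓢'(ℝ, ℂ)} {g h : ℝ → ℂ} (hu : IsRepresentedBy u g)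
    (e : g =ᵐ[volume] h) : IsRepresentedBy u h := by
  refine ⟨fun φ ↦ (hu.1 φ).congr ?_, fun φ ↦ (hu.2 φ).trans (integral_congr_ae ?_)⟩ <;>
  · filter_upwards [e] with x hx
    rw [hx]

theorem fourier_toTD_fourierInv (Z : L2) :
    𝓕 (Lp.toTemperedDistribution (𝓕⁻ Z : L2)) = Lp.toTemperedDistribution Z := by
  rw [Lp.fourier_toTemperedDistribution_eq, fourier_fourierInv_eq]

theorem memScSobolev_fourierInv (t : ℝ) {m : ℝ} (hm : 0 ≤ m) (Z : L2) :
    MemScSobolev t (-m) (Lp.toTemperedDistribution (𝓕⁻ Z : L2)) := by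
  refine ⟨Z, ?_, ?_⟩
  · rw [fourier_toTD_fourierInv]
    exact isRepresentedBy_toTemperedDistribution Z
  · exact (memLp_congr_ae (coeFn_mulL (bdd_scWeight t hm) Z)).1 (Lp.memLp _)

/-- The element of `H^{-m}_t` whose Fourier transform is a given square integrable function. -/
def ofL2 (t : ℝ) {m : ℝ} (hm : 0 ≤ m) (Z : L2) : ScSobolev t (-m) :=
  ⟨Lp.toTemperedDistribution (𝓕⁻ Z : L2), memScSobolev_fourierInv t hm Z⟩

theorem toDistribution_ofL2 (t : ℝ) {m : ℝ} (hm : 0 ≤ m) (Z : L2) :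
    (ofL2 t hm Z).toDistribution = Lp.toTemperedDistribution (𝓕⁻ Z : L2) := rfl

theorem toL2_eq_of_isRepresentedBy {t s : ℝ} {f : ScSobolev t s} {F : ℝ → ℂ}
    (hF : IsRepresentedBy (𝓕 f.toDistribution) F) {Z : L2}
    (hZ : (Z : ℝ → ℂ) =ᵐ[volume] fun ξ ↦ scWeight t s ξ * F ξ) : ScSobolev.toL2 t s f = Z := by
  refine Lp.ext (f.hat_spec.2.coeFn_toLp.trans ?_)
  filter_upwards [f.hat_spec.1.ae_unique hF, hZ] with ξ h1 h2
  rw [h1, h2]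

theorem toL2_ofL2 (t : ℝ) {m : ℝ} (hm : 0 ≤ m) (Z : L2) :
    ScSobolev.toL2 t (-m) (ofL2 t hm Z) = mulL (scWeight t (-m)) Z := by
  refine toL2_eq_of_isRepresentedBy (F := Z) ?_ (coeFn_mulL (bdd_scWeight t hm) Z)
  rw [toDistribution_ofL2, fourier_toTD_fourierInv]
  exact isRepresentedBy_toTemperedDistribution Z

theorem norm_eq_norm_toL2 {t s : ℝ} (f : ScSobolev t s) : ‖f‖ = ‖ScSobolev.toL2 t s f‖ := rfl

theorem toL2_ofSchwartz (t : ℝ) {m : ℝ} (hm : 0 ≤ m) (f : 𝓢(ℝ, ℂ)) :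
    ScSobolev.toL2 t (-m) (ScSobolev.ofSchwartz t (-m) f) = mulL (scWeight t (-m)) (fhat f) := by
  refine toL2_eq_of_isRepresentedBy (F := ((𝓕 f : 𝓢(ℝ, ℂ)) : ℝ → ℂ)) ⟨fun φ ↦ ?_, fun φ ↦ ?_⟩ ?_
  · exact (SchwartzMap.pairing (ContinuousLinearMap.mul ℂ ℂ) φ (𝓕 f)).integrable
  · change (𝓕 (f : 𝓢'(ℝ, ℂ))) φ = _
    rw [TemperedDistribution.fourier_toTemperedDistributionCLM_eq, SchwartzMap.coe_apply]
    rfl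
  · filter_upwards [coeFn_mulL (bdd_scWeight t hm) (fhat f), coeFn_fhat f] with ξ h1 h2
    rw [h1, h2, SchwartzMap.fourier_coe]

/-- Makes `H^s_t` isometric to `L²`, hence complete, which the extension by density requires. -/
theorem toL2_surjective (t s : ℝ) : Function.Surjective (ScSobolev.toL2 t s) := by
  intro G
  -- The inverse weight is split into its modulus `r`, which has temperate growth and so acts on
  -- tempered distributions, and the phase `σ`, which acts on `L²`.
  set r : ℝ → ℂ := fun ξ ↦ (((1 + ‖t * ξ‖ ^ 2) ^ (-s / 2) : ℝ) : ℂ) with hr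
  have hrg : Function.HasTemperateGrowth r := by
    have h₁ : Function.HasTemperateGrowth fun ξ : ℝ ↦ (1 + ‖ξ‖ ^ 2) ^ (-s / 2) :=
      Function.hasTemperateGrowth_one_add_norm_sq_rpow ℝ (-s / 2)
    have h₂ : Function.HasTemperateGrowth fun ξ : ℝ ↦ t * ξ := by fun_prop
    have h₃ : Function.HasTemperateGrowth fun ξ : ℝ ↦ (1 + ‖t * ξ‖ ^ 2) ^ (-s / 2) := h₁.comp h₂
    fun_prop
  have hpos : ∀ ξ : ℝ, 0 < 1 + ‖t * ξ‖ ^ 2 := fun ξ ↦ by positivity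
  have hr0 : ∀ ξ, r ξ ≠ 0 := fun ξ ↦ by
    simp only [hr]
    exact_mod_cast (Real.rpow_pos_of_pos (hpos ξ) _).ne'
  have hrm : Measurable r := by fun_prop
  set σ : ℝ → ℂ := fun ξ ↦ (scWeight t s ξ * r ξ)⁻¹ with hσ
  have hσn : ∀ ξ, ‖σ ξ‖ = 1 := fun ξ ↦ by
    simp only [hσ, hr]
    rw [norm_inv, norm_mul, norm_scWeight, norm_real,
      Real.norm_of_nonneg (Real.rpow_nonneg (hpos ξ).le _), ← Real.rpow_add (hpos ξ)]
    rw [show s / 2 + -s / 2 = 0 by ring, Real.rpow_zero, inv_one]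
  have hσb : Bdd σ := bdd_of_bound ((measurable_scWeight t s).mul hrm).inv.aestronglyMeasurable
    (K := 1) (Filter.Eventually.of_forall fun ξ ↦ (hσn ξ).le)
  set u : 𝓢'(ℝ, ℂ) := TemperedDistribution.smulLeftCLM ℂ r
    (Lp.toTemperedDistribution (mulL σ G)) with hu
  have hrep : IsRepresentedBy u (fun ξ ↦ r ξ * (mulL σ G : ℝ → ℂ) ξ) := by
    have h0 := isRepresentedBy_toTemperedDistribution (mulL σ G)
    have e : ∀ φ : 𝓢(ℝ, ℂ), (fun ξ ↦ φ ξ * (r ξ * (mulL σ G : ℝ → ℂ) ξ)) =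
        fun ξ ↦ SchwartzMap.smulLeftCLM ℂ r φ ξ * (mulL σ G : ℝ → ℂ) ξ := fun φ ↦ by
      funext ξ
      rw [SchwartzMap.smulLeftCLM_apply_apply hrg, smul_eq_mul]; ring
    refine ⟨fun φ ↦ ?_, fun φ ↦ ?_⟩
    · rw [e]; exact h0.1 _
    · rw [e, hu, TemperedDistribution.smulLeftCLM_apply_apply]; exact h0.2 _
  have hae : (G : ℝ → ℂ) =ᵐ[volume] fun ξ ↦ scWeight t s ξ * (r ξ * (mulL σ G : ℝ → ℂ) ξ) := by
    filter_upwards [coeFn_mulL hσb G] with ξ h1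
    rw [h1, ← mul_assoc, ← mul_assoc]
    simp only [hσ]
    rw [mul_inv_cancel₀ (mul_ne_zero (scWeight_ne_zero t s ξ) (hr0 ξ)), one_mul]
  have hF : 𝓕 (𝓕⁻ u) = u := fourier_fourierInv_eq u
  refine ⟨⟨𝓕⁻ u, fun ξ ↦ r ξ * (mulL σ G : ℝ → ℂ) ξ, ?_, (memLp_congr_ae hae).1 (Lp.memLp G)⟩, ?_⟩
  · rw [hF]; exact hrep
  · refine toL2_eq_of_isRepresentedBy (F := fun ξ ↦ r ξ * (mulL σ G : ℝ → ℂ) ξ) ?_ hae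
    change IsRepresentedBy (𝓕 (𝓕⁻ u)) _
    rw [hF]; exact hrep

/-- The space `H^s_t` is isometric to `L²`. -/
def toL2Equiv (t s : ℝ) : ScSobolev t s ≃ₗᵢ[ℂ] L2 where
  toLinearEquiv := LinearEquiv.ofBijective (ScSobolev.toL2 t s)
    ⟨ScSobolev.toL2_injective t s, toL2_surjective t s⟩
  norm_map' _ := rfl

instance completeSpace_scSobolev (t s : ℝ) : CompleteSpace (ScSobolev t s) :=
  (toL2Equiv t s).toIsometryEquiv.completeSpace_iff.2 inferInstance

/-- On each shell the weight has a bounded inverse, so the range contains all finite sums of shell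
projections. -/
theorem denseRange_mulL_scWeight (t : ℝ) {m : ℝ} (hm : 0 ≤ m) :
    DenseRange (mulL (scWeight t (-m))) := by
  intro G
  refine mem_closure_of_tendsto (hasSum_shellP G) (Filter.Eventually.of_forall fun S ↦ ?_)
  have h1 : ∀ i, ∃ Z, mulL (scWeight t (-m)) Z = shellP i G := by
    intro i
    have hb : Bdd (cut (shell i) fun ξ ↦ (scWeight t (-m) ξ)⁻¹) := by
      refine bdd_cut (measurableSet_shell i) (measurable_scWeight t _).inv.aestronglyMeasurable
        (K := (1 + (t * 2 ^ i) ^ 2) ^ (m / 2)) fun ξ hξ ↦ ?_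
      rw [norm_inv, norm_scWeight, ← Real.rpow_neg (by positivity), neg_div, neg_neg]
      refine Real.rpow_le_rpow (by positivity) ?_ (by positivity)
      rw [Real.norm_eq_abs, sq_abs, mul_pow, mul_pow]
      have : ξ ^ 2 ≤ (2 ^ i) ^ 2 := by
        rw [← sq_abs ξ]; exact pow_le_pow_left₀ (abs_nonneg _) hξ.1.le 2
      gcongr
    refine ⟨mulL (cut (shell i) fun ξ ↦ (scWeight t (-m) ξ)⁻¹) G, mulL_eq_of_ae (bdd_scWeight t hm) ?_⟩
    filter_upwards [coeFn_mulL hb G, coeFn_mulL (bdd_cut_one (measurableSet_shell i)) G] with ξ h1 h2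
    rw [h1, shellP, proj, h2]
    by_cases hξ : ξ ∈ shell i
    · simp [cut, hξ, scWeight_ne_zero]
    · simp [cut, hξ]
  choose Z hZ using h1
  exact ⟨∑ i ∈ S, Z i, by rw [map_sum]; simp [hZ]⟩

theorem denseRange_fhat : DenseRange fhat := by
  have h := SchwartzMap.denseRange_toLpCLM (p := 2) (F := ℂ) (E := ℝ) (μ := volume)
    ENNReal.ofNat_ne_top
  refine h.mono ?_
  rintro _ ⟨g, rfl⟩
  refine ⟨𝓕⁻ g, ?_⟩
  rw [fhat, fourier_fourierInv_eq]
  rfl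

/-- The inclusion of the Schwartz functions as a linear map. -/
def ofSchwartzₗ (t s : ℝ) : 𝓢(ℝ, ℂ) →ₗ[ℂ] ScSobolev t s where
  toFun := ScSobolev.ofSchwartz t s
  map_add' f g := Subtype.ext (map_add (SchwartzMap.toTemperedDistributionCLM ℝ ℂ volume) f g)
  map_smul' k f := Subtype.ext (map_smul (SchwartzMap.toTemperedDistributionCLM ℝ ℂ volume) k f)

theorem denseRange_ofSchwartzₗ (t : ℝ) {m : ℝ} (hm : 0 ≤ m) :
    DenseRange (ofSchwartzₗ t (-m)) := by
  have h1 : DenseRange (mulL (scWeight t (-m)) ∘ fhat) :=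
    (denseRange_mulL_scWeight t hm).comp denseRange_fhat (mulL _).continuous
  have h2 : DenseRange ((toL2Equiv t (-m)).symm ∘ (mulL (scWeight t (-m)) ∘ fhat)) :=
    (toL2Equiv t (-m)).symm.surjective.denseRange.comp h1 (toL2Equiv t (-m)).symm.continuous
  convert h2 using 1
  funext f
  rw [Function.comp_apply, Function.comp_apply, ← toL2_ofSchwartz t hm f]
  exact ((toL2Equiv t (-m)).symm_apply_apply _).symm

/-! ### Linearity of the composition remainder -/

theorem fourier_add_of_integrable {f g : ℝ → ℂ} (hf : Integrable f) (hg : Integrable g) :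
    𝓕 (f + g) = 𝓕 f + 𝓕 g :=
  VectorFourier.fourierIntegral_add Real.continuous_fourierChar
    (by fun_prop : Continuous fun p : ℝ × ℝ ↦ (innerₗ ℝ) p.1 p.2) hf hg

theorem fourier_const_smul (k : ℂ) (f : ℝ → ℂ) : 𝓕 (k • f) = k • 𝓕 f :=
  VectorFourier.fourierIntegral_const_smul _ _ _ _ _

theorem scQuant_add {p : ℝ → ℝ → ℂ} {t : ℝ} {f g : ℝ → ℂ} (hf : ScQuantConverges p t f)
    (hg : ScQuantConverges p t g) : scQuant p t (f + g) = scQuant p t f + scQuant p t g := by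
  funext x
  rw [Pi.add_apply, scQuant, scQuant, scQuant, ← integral_add (hf.2 x) (hg.2 x)]
  congr 1; funext ξ
  rw [scQuantIntegrand_eq, scQuantIntegrand_eq, scQuantIntegrand_eq,
    fourier_add_of_integrable hf.1 hg.1, Pi.add_apply]
  ring

theorem scQuant_smul (p : ℝ → ℝ → ℂ) (t : ℝ) (k : ℂ) (f : ℝ → ℂ) :
    scQuant p t (k • f) = k • scQuant p t f := by
  funext x
  rw [Pi.smul_apply, scQuant, scQuant, smul_eq_mul, ← integral_const_mul]
  congr 1; funext ξ
  rw [scQuantIntegrand_eq, scQuantIntegrand_eq, fourier_const_smul, Pi.smul_apply, smul_eq_mul]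
  ring

/-- The functions `V f` are chosen separately for each `f`; linearity is recovered because `rem f`
determines the inverse transform of `V f` almost everywhere. -/
theorem exists_linearMap_ofL2 {t m : ℝ} (hm : 0 ≤ m) {rem : 𝓢(ℝ, ℂ) → ℝ → ℂ}
    (hadd : ∀ f g, rem (f + g) = rem f + rem g) (hsmul : ∀ (k : ℂ) f, rem (k • f) = k • rem f)
    {V : 𝓢(ℝ, ℂ) → L2} (hV : ∀ f, rem f =ᵐ[volume] ((𝓕⁻ (V f) : L2) : ℝ → ℂ)) :
    ∃ S : 𝓢(ℝ, ℂ) →ₗ[ℂ] ScSobolev t (-m), ∀ f, S f = ofL2 t hm (V f) := by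
  have h1 : ∀ f g, (𝓕⁻ (V (f + g)) : L2) = (𝓕⁻ (V f) : L2) + (𝓕⁻ (V g) : L2) := fun f g ↦ by
    refine Lp.ext ?_
    filter_upwards [hV f, hV g, hV (f + g), Lp.coeFn_add (𝓕⁻ (V f) : L2) (𝓕⁻ (V g) : L2)]
      with x x1 x2 x3 x4
    rw [← x3, x4, Pi.add_apply, ← x1, ← x2, hadd, Pi.add_apply]
  have h2 : ∀ (k : ℂ) f, (𝓕⁻ (V (k • f)) : L2) = k • (𝓕⁻ (V f) : L2) := fun k f ↦ by
    refine Lp.ext ?_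
    filter_upwards [hV f, hV (k • f), Lp.coeFn_smul k (𝓕⁻ (V f) : L2)] with x x1 x2 x3
    rw [← x2, x3, Pi.smul_apply, ← x1, hsmul, Pi.smul_apply]
  refine ⟨⟨⟨fun f ↦ ofL2 t hm (V f), fun f g ↦ Subtype.ext ?_⟩, fun k f ↦ Subtype.ext ?_⟩,
    fun f ↦ rfl⟩
  · change Lp.toTemperedDistribution (𝓕⁻ (V (f + g)) : L2) = Lp.toTemperedDistribution (𝓕⁻ (V f) : L2) +
      Lp.toTemperedDistribution (𝓕⁻ (V g) : L2)
    rw [h1]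
    exact map_add (Lp.toTemperedDistributionCLM ℂ volume 2) _ _
  · change Lp.toTemperedDistribution (𝓕⁻ (V (k • f)) : L2) = k • Lp.toTemperedDistribution (𝓕⁻ (V f) : L2)
    rw [h2]
    exact map_smul (Lp.toTemperedDistributionCLM ℂ volume 2) _ _

/-- Schwartz functions are dense in `H^{-m}_t`. Two continuous operators whose values on them are
represented by the same functions agree there, hence everywhere. -/
theorem existsUnique_extension {t m : ℝ} (hm : 0 ≤ m) {rem : 𝓢(ℝ, ℂ) → ℝ → ℂ}
    (hadd : ∀ f g, rem (f + g) = rem f + rem g) (hsmul : ∀ (k : ℂ) f, rem (k • f) = k • rem f)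
    {V : 𝓢(ℝ, ℂ) → L2} (hV : ∀ f, rem f =ᵐ[volume] ((𝓕⁻ (V f) : L2) : ℝ → ℂ)) {B : ℝ} (hB : 0 ≤ B)
    (hVB : ∀ f, ‖mulL (scWeight t (-m)) (V f)‖ ≤ B * ‖mulL (scWeight t (-m)) (fhat f)‖) :
    ∃! E : ScSobolev t (-m) →L[ℂ] ScSobolev t (-m),
      (∀ f : 𝓢(ℝ, ℂ), IsRepresentedBy (E (ScSobolev.ofSchwartz t (-m) f)).toDistribution (rem f)) ∧
        ‖E‖ ≤ B := by
  obtain ⟨S, hS⟩ := exists_linearMap_ofL2 (t := t) hm hadd hsmul hV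
  have hd := denseRange_ofSchwartzₗ t hm
  have hn : ∀ f, ‖S f‖ ≤ B * ‖ofSchwartzₗ t (-m) f‖ := fun f ↦ by
    rw [hS, norm_eq_norm_toL2, norm_eq_norm_toL2, toL2_ofL2]
    exact (hVB f).trans (le_of_eq (by rw [← toL2_ofSchwartz t hm f]; rfl))
  have hE : ∀ f, S.extendOfNorm (ofSchwartzₗ t (-m)) (ofSchwartzₗ t (-m) f) = S f :=
    S.extendOfNorm_eq hd ⟨B, hn⟩
  refine ⟨S.extendOfNorm (ofSchwartzₗ t (-m)), ⟨fun f ↦ ?_, S.opNorm_extendOfNorm_le hd hB hn⟩, ?_⟩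
  · change IsRepresentedBy (S.extendOfNorm (ofSchwartzₗ t (-m)) (ofSchwartzₗ t (-m) f)).toDistribution _
    rw [hE, hS, toDistribution_ofL2]
    exact (isRepresentedBy_toTemperedDistribution _).congr_ae (hV f).symm
  · rintro E' ⟨hE', -⟩
    refine DFunLike.coe_injective (hd.equalizer E'.continuous (ContinuousLinearMap.continuous _) ?_)
    funext f
    rw [Function.comp_apply, Function.comp_apply, hE, hS]
    refine Subtype.ext ?_
    ext φ
    have h1 := (hE' f).2 φ
    have h2 := ((isRepresentedBy_toTemperedDistribution (𝓕⁻ (V f) : L2)).congr_ae (hV f).symm).2 φ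
    exact h1.trans h2.symm

end

end ScComm

end

theorem mainTheorem5 (c₁ c₂ : ℝ) (hpair : AdmissiblePair c₁ c₂) (c : ℝ → ℝ)
    (hc : Admissible c₁ c₂ c) :
    ∃ C₁ : ℝ, 0 < C₁ ∧ ∀ m : ℝ, 0 ≤ m → m ≤ (⌈c₁⁻¹⌉₊ : ℝ) → ∀ t : ℝ, 0 < t → t ≤ 1 →
      (∀ f : 𝓢(ℝ, ℂ), ScQuantConverges (symbolPInv c) t f ∧
        ScQuantConverges (symbolP c) t (scQuant (symbolPInv c) t f)) ∧
      ∃! E : ScSobolev t (-m) →L[ℂ] ScSobolev t (-m),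
        (∀ f : 𝓢(ℝ, ℂ), IsRepresentedBy (E (ScSobolev.ofSchwartz t (-m) f)).toDistribution
          (compRemainder t (symbolP c) (symbolPInv c) f)) ∧
        ‖E‖ ≤ t * C₁ := by
  obtain ⟨z₀, ρ, κ, R, α, β, C, K, a, b, hS⟩ := ScComm.exists_speedExpansion hpair hc
  -- The absolute value and the added `1` only secure positivity; the constant involves neither `m`
  -- nor `t`.
  refine ⟨|ScComm.remainderConst ⌈c₁⁻¹⌉₊ κ R α β C K| + 1, by positivity,
    fun m hm hmM t ht ht1 ↦ ⟨fun f ↦ ⟨(hS.scQuant_symbolPInv ht ht1 f).1,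
      (hS.compRemainder_ae ht ht1 f).1⟩, ?_⟩⟩
  choose V hV hVB using fun f ↦ (hS.compRemainder_ae ht ht1 f).2
  -- In this form linearity in `f` needs the convergence of the two nested quantizations only, the
  -- product symbol having become the identity.
  have hrem : ∀ f : 𝓢(ℝ, ℂ), compRemainder t (symbolP c) (symbolPInv c) f =
      scQuant (symbolP c) t (scQuant (symbolPInv c) t f) - f := fun f ↦
    funext fun x ↦ compRemainder_symbolP hpair.1 hc.1 t f x
  refine ScComm.existsUnique_extension hm (fun f g ↦ ?_) (fun k f ↦ ?_) hV (by positivity)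
    fun f ↦ (hVB f m hm hmM).trans ?_
  · rw [hrem, hrem, hrem, show ((f + g : 𝓢(ℝ, ℂ)) : ℝ → ℂ) = f + g from rfl,
      ScComm.scQuant_add (hS.scQuant_symbolPInv ht ht1 f).1 (hS.scQuant_symbolPInv ht ht1 g).1,
      ScComm.scQuant_add (hS.compRemainder_ae ht ht1 f).1 (hS.compRemainder_ae ht ht1 g).1]
    abel
  · rw [hrem, hrem, show ((k • f : 𝓢(ℝ, ℂ)) : ℝ → ℂ) = k • ⇑f from rfl,
      ScComm.scQuant_smul, ScComm.scQuant_smul, smul_sub]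
  · gcongr
    exact (le_abs_self _).trans (le_add_of_nonneg_right zero_le_one)
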